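/- **The problem.** An instance of 2ULS-IB$_R$ consists of $T\ge 1$ periods and nonnegative reals: demands $d_t$, fixed ordering costs $f^R_t,f^S_t$, unit ordering costs $p^R_t,p^S_t$, unit holding costs $h^R_t,h^S_t$, and retailer inventory bounds $u_t$ ($1\le t\le T$). Minimize $$\sum_{t=1}^T\bigl(f^S_ty^S_t+p^S_tx^S_t+h^S_ts^S_t+f^R_ty^R_t+p^R_tx^R_t+h^R_ts^R_t\bigr)$$ subject to $s^R_0=s^S_0=0$ and, for $1\le t\le T$: $s^R_{t-1}+x^R_t=d_t+s^R_t$, $s^S_{t-1}+x^S_t=x^R_t+s^S_t$, $x^R_t\le M_ty^R_t$, $x^S_t\le M_ty^S_t$ with $M_t=\sum_{i=t}^Td_i$, $x^R_t,x^S_t,s^R_t,s^S_t\ge0$, $y^R_t,y^S_t\in\{0,1\}$, $s^R_t\le u_t$. Call the bounds *tight* if $u_{t-1}\le u_t+d_t$ for $2\le t\le T$. Put $u_0=0$. **The recursion.** Let $d_{ij}=\sum_{n=i}^jd_n$ ($0$ if $i>j$). The superscripts $\alpha,\gamma,\beta$ are labels "0" or "u" for the retailer inventory at the end of periods $i-1$,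 $l$, $j$; "0" has value $0$ and "u" has value $u_{i-1},u_l,u_j$ respectively (labels are kept distinct even if the values coincide). Let $X_{ij}=d_{ij}-\alpha+\beta$. All minima over empty sets are $+\infty$. *Blocks.* $\phi^{\alpha\beta}_{ij-}=\sum_{n=i}^jh^R_n(\alpha-d_{in})$ if $X_{ij}=0$, and $+\infty$ otherwise. If $X_{ij}=0$ then $\phi^{\alpha\beta}_{ijk}=\phi^{\alpha\beta}_{ij-}$ for all $k$. If $X_{ij}\ne0$: - $\phi^{0\beta}_{ijk}=f^R_i+p^R_iX_{ij}+\sum_{n=i}^jh^R_n(d_{n+1,j}+\beta)$ if $k=i$, $0<d_{ij}+\beta$ and $d_{i+1,j}+\beta\le u_i$; - $\phi^{u_{i-1}u_j}_{ijk}=f^R_k+p^R_kX_{ij}+\sum_{n=i}^{j-1}h^R_n(u_{i-1}-d_{in})+h^R_ju_j$ if $k=j$ and $d_{ij}+u_j>u_{i-1}>d_{i,j-1}$; - $\phi^{u_{i-1}0}_{ijk}=f^R_k+p^R_kX_{ij}+\sum_{n=i}^{k-1}h^R_n(u_{i-1}-d_{in})+\sum_{n=k}^{j-1}h^R_nd_{n+1,j}$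 if $i\le k\le j$, $d_{ij}>u_{i-1}>d_{i,k-1}$ and $u_k\ge d_{k+1,j}$; - $+\infty$ in all other cases. *Regular subplans.* Here $X_{ij}$ units are available at the supplier at period $t$. For $t\le k$ and $i\le k$, $$w^{\alpha\gamma\beta}_{tijk}=\min_{k\le l<j}\Bigl\{\phi^{\alpha\gamma}_{ilk}+G^{\gamma\beta}_{k,l+1,j}+\sum_{p=t}^{k-1}h^S_pX_{ij}\Bigr\},$$ and $w^{\alpha\gamma\beta}_{tijk}=+\infty$ if $k<t$ or $k<i$; $v^{\alpha\beta}_{tij}=\min_{i\le k<j,\ \gamma}w^{\alpha\gamma\beta}_{tijk}$. If $i\le j$ and $t\le j$, $$G^{\alpha\beta}_{tij}=\begin{cases}\min\Bigl\{\min\limits_{\max(i,t)\le k\le j}\bigl\{\phi^{\alpha\beta}_{ijk}+\sum_{p=t}^{k-1}h^S_pX_{ij}\bigr\},\ v^{\alpha\beta}_{tij}\Bigr\}&X_{ij}>0,\\ \phi^{\alpha\beta}_{ij-}&X_{ij}=0,\\ +\infty&X_{ij}<0,\end{cases}$$ and $G^{\alpha\beta}_{tij}=+\infty$ if $i>j$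 or $t>j$. With each finite value of $w,v,G$ one stores its last retailer ordering period $t^*$: it is $t$ for $G^{\alpha\beta}_{tij}$ with $X_{ij}=0$; it is $k$ for a single block ordered at $k$; it is the one of $G^{\gamma\beta}_{k,l+1,j}$ for a candidate in $w$. Among candidates of minimal cost the one with smallest $t^*$ is kept. *Supply chain.* $C^{\alpha\beta}_{tij}=+\infty$ if $i>j$ or $t>j$; otherwise $C^{\alpha\beta}_{tij}=G^{\alpha\beta}_{tij}$ if $X_{ij}\le0$, and if $X_{ij}>0$, $$C^{\alpha\beta}_{tij}=\min\Bigl\{C^{\alpha\beta}_{t+1,i,j},\ f^S_t+p^S_tX_{ij}+G^{\alpha\beta}_{tij},\ \min_{i\le l<j,\ \gamma}\bigl\{\min\bigl(f^S_t+p^S_tX_{il},\mathbb 1(X_{il})\bigr)+G^{\alpha\gamma}_{til}+C^{\gamma\beta}_{t^*+1,l+1,j}\bigr\}\Bigr\},$$ where $\mathbb 1(0)=0$, $\mathbb 1(x)=+\infty$ for $x\ne0$, $t^*$ is the period stored with $G^{\alpha\gamma}_{til}$, and a term with $G^{\alpha\gamma}_{til}=+\infty$ is $+\infty$. **Theorem.**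 (1) For every instance with tight bounds, $C^{00}_{11T}$ is finite and is the minimum cost of 2ULS-IB$_R$ (which is attained). (2) There are a single program for a unit-cost machine over the reals and a constant $K$ such that, on every instance (tight or not), the program stops after at most $K\,T^4$ steps with the optimal cost and an optimal solution as output. The solution satisfies the zero-inventory-ordering property at the supplier, $s^S_{t-1}x^S_t=0$ for $1\le t\le T$. If the bounds are tight, the retailer's plan moreover has at most one ordering period in every block (a block being an interval $[i,j]$ with $s^R_{i-1}\in\{0,u_{i-1}\}$, $s^R_j\in\{0,u_j\}$ and $0<s^R_t<u_t$ for $i\le t<j$), and the program has then computed and stored the tables $\phi^{\alpha\beta}_{ijk}$ ($1\le i\le k\le j\le T$), $w^{\alpha\gamma\beta}_{tijk}$ ($1\le t\le k$, $1\le i\le k<j\le T$), and $v^{\alpha\beta}_{tij},G^{\alpha\beta}_{tij},C^{\alpha\beta}_{tij}$ ($1\le i\le j\le T$, $1\le t\le j$), including the periods stored with $w,v,G$. The machine has arrays of reals and arrays of natural numbers, with entries addressed by tuples of natural numbers; the program is a fixed finite text made of assignments, conditionals and counted loops; reading an array element, adding, subtracting, multiplying or comparing two reals, incrementing, subtracting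 or comparing natural numbers, and each pass of a loop cost one step (an access also pays for evaluating its indices). -/

import Mathlib

/-! Two-level uncapacitated lot-sizing with inventory bounds at the retailer. -/

noncomputable section

namespace LotSizing

/-- The data of an instance with `T` periods; only the values at periods `1, …, T` matter.
Suffix `R` is the retailer, suffix `S` the supplier: fixed ordering cost `f`, unit ordering cost
`p`, unit holding cost `h`; `d` is the demand and `u` the retailer's inventory bound. -/
structure Data where
  T : ℕ
  d : ℕ → ℝ
  fR : ℕ → ℝ
  pR : ℕ → ℝ
  hR : ℕ → ℝ
  fS : ℕ → ℝ
  pS : ℕ → ℝ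
  hS : ℕ → ℝ
  u : ℕ → ℝ

/-- A pair of plans: ordered quantities `x`, inventory levels `s`, setup indicators `y`. -/
structure Plan where
  xR : ℕ → ℝ
  sR : ℕ → ℝ
  yR : ℕ → ℝ
  xS : ℕ → ℝ
  sS : ℕ → ℝ
  yS : ℕ → ℝ

namespace Data

/-- At least one period, and nonnegative demands, costs and inventory bounds. -/
def Valid (I : Data) : Prop :=
  1 ≤ I.T ∧ ∀ t, 1 ≤ t → t ≤ I.T →
    0 ≤ I.d t ∧ 0 ≤ I.fR t ∧ 0 ≤ I.pR t ∧ 0 ≤ I.hR t ∧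
    0 ≤ I.fS t ∧ 0 ≤ I.pS t ∧ 0 ≤ I.hS t ∧ 0 ≤ I.u t

/-- The normalization `u_{t-1} ≤ u_t + d_t` of the inventory bounds (trivial at `t = 1`, where
the initial inventory is zero). -/
def Tight (I : Data) : Prop :=
  ∀ t, 2 ≤ t → t ≤ I.T → I.u (t - 1) ≤ I.u t + I.d t

/-- Cumulative demand `d_{ij}` (zero if `i > j`). -/
def D (I : Data) (i j : ℕ) : ℝ := ∑ n ∈ Finset.Icc i j, I.d n

/-- The constraints of the mixed-integer program, with zero initial inventories. -/
def Feasible (I : Data) (P : Plan) : Prop :=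
  P.sR 0 = 0 ∧ P.sS 0 = 0 ∧ ∀ t, 1 ≤ t → t ≤ I.T →
    P.sR (t - 1) + P.xR t = I.d t + P.sR t ∧
    P.sS (t - 1) + P.xS t = P.xR t + P.sS t ∧
    P.xR t ≤ I.D t I.T * P.yR t ∧
    P.xS t ≤ I.D t I.T * P.yS t ∧
    0 ≤ P.xR t ∧ 0 ≤ P.xS t ∧ 0 ≤ P.sR t ∧ 0 ≤ P.sS t ∧
    (P.yR t = 0 ∨ P.yR t = 1) ∧ (P.yS t = 0 ∨ P.yS t = 1) ∧
    P.sR t ≤ I.u t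

/-- Total cost of the supply chain. -/
def cost (I : Data) (P : Plan) : ℝ :=
  ∑ t ∈ Finset.Icc 1 I.T,
    (I.fS t * P.yS t + I.pS t * P.xS t + I.hS t * P.sS t +
      I.fR t * P.yR t + I.pR t * P.xR t + I.hR t * P.sR t)

/-- The set of costs of all feasible plans. -/
def costs (I : Data) : Set ℝ := {c | ∃ P : Plan, I.Feasible P ∧ I.cost P = c}

/-- Inventory level coded by a label at the end of period `t`: `false` is `0`, `true` is `u_t`
(and `0` if `t = 0`). -/
def lev (I : Data) (b : Bool) (t : ℕ) : ℝ := if b = true ∧ 1 ≤ t then I.u t else 0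

/-- Order quantity `X_{ij} = d_{ij} - s_{i-1} + s_j` of a regular subplan `[i,j]`. -/
def X (I : Data) (α β : Bool) (i j : ℕ) : ℝ := I.D i j - I.lev α (i - 1) + I.lev β j

/-- Zero-inventory-ordering at the supplier level. -/
def ZeroInvOrdering (I : Data) (P : Plan) : Prop :=
  ∀ t, 1 ≤ t → t ≤ I.T → P.sS (t - 1) * P.xS t = 0

/-- `[i,j]` is a block of the retailer plan: the inventory is `0` or at its bound at the end of
the periods `i-1` and `j`, and strictly between `0` and its bound in between. -/
def IsBlock (I : Data) (P : Plan) (i j : ℕ) : Prop :=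
  (∃ α, P.sR (i - 1) = I.lev α (i - 1)) ∧ (∃ β, P.sR j = I.lev β j) ∧
    ∀ t, i ≤ t → t < j → 0 < P.sR t ∧ P.sR t < I.u t

/-- Every block of the retailer plan has at most one ordering period. -/
def OneOrderPerBlock (I : Data) (P : Plan) : Prop :=
  ∀ i j, 1 ≤ i → i ≤ j → j ≤ I.T → I.IsBlock P i j →
    ∀ k l, i ≤ k → k ≤ j → i ≤ l → l ≤ j → 0 < P.xR k → 0 < P.xR l → k = l

/-! ### The dynamic program -/

/-- Retailer cost of `[i,j]` without any order. -/
def phiNone (I : Data) (α β : Bool) (i j : ℕ) : WithTop ℝ :=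
  open Classical in
  if I.X α β i j = 0 then
    ((∑ n ∈ Finset.Icc i j, I.hR n * (I.lev α (i - 1) - I.D i n) : ℝ) : WithTop ℝ)
  else ⊤

/-- Retailer cost of the block `[i,j]` with positive order quantity, all ordered at period `k`. -/
def phiOrder (I : Data) (α β : Bool) (i j k : ℕ) : WithTop ℝ :=
  open Classical in
  match α, β with
  | false, β =>
      if k = i ∧ 0 < I.D i j + I.lev β j ∧ I.D (i + 1) j + I.lev β j ≤ I.u i then
        ((I.fR i + I.pR i * I.X false β i j +
          ∑ n ∈ Finset.Icc i j, I.hR n * (I.D (n + 1) j + I.lev β j) : ℝ) : WithTop ℝ)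
      else ⊤
  | true, true =>
      if k = j ∧ I.lev true (i - 1) < I.D i j + I.u j ∧
          I.D i (j - 1) < I.lev true (i - 1) then
        ((I.fR k + I.pR k * I.X true true i j +
          ∑ n ∈ Finset.Ico i j, I.hR n * (I.lev true (i - 1) - I.D i n) +
          I.hR j * I.u j : ℝ) : WithTop ℝ)
      else ⊤
  | true, false =>
      if i ≤ k ∧ k ≤ j ∧ I.lev true (i - 1) < I.D i j ∧
          I.D i (k - 1) < I.lev true (i - 1) ∧ I.D (k + 1) j ≤ I.u k then
        ((I.fR k + I.pR k * I.X true false i j +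
          ∑ n ∈ Finset.Ico i k, I.hR n * (I.lev true (i - 1) - I.D i n) +
          ∑ n ∈ Finset.Ico k j, I.hR n * I.D (n + 1) j : ℝ) : WithTop ℝ)
      else ⊤

/-- Block cost `φ^{αβ}_{ijk}`: if no order is needed, the period `k` plays no role. -/
def phi (I : Data) (α β : Bool) (i j k : ℕ) : WithTop ℝ :=
  open Classical in
  if I.X α β i j = 0 then I.phiNone α β i j else I.phiOrder α β i j k

/-- Supplier cost of holding `q` units from period `t` to period `k`. -/
def carry (I : Data) (t k : ℕ) (q : ℝ) : ℝ := (∑ p ∈ Finset.Ico t k, I.hS p) * q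

end Data

/-- A cost together with the last ordering period of a retailer subplan attaining it, or `⊤` if
there is no such subplan. The order is lexicographic, so that a minimum has minimal cost and,
among minimal costs, the smallest last ordering period. -/
abbrev Stage := WithTop (ℝ ×ₗ ℕ)

namespace Stage

/-- The stage value with cost `c` and last ordering period `k`. -/
def mk (c : WithTop ℝ) (k : ℕ) : Stage := WithTop.map (fun r => toLex (r, k)) c

/-- The cost of a stage value. -/
def cost (g : Stage) : WithTop ℝ := WithTop.map (fun q => (ofLex q).1) g

/-- Adding a cost to a stage value, keeping the last ordering period. -/
def addCost (c : WithTop ℝ) : Stage → Stage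
  | none => ⊤
  | some q => mk (c + ((ofLex q).1 : ℝ)) (ofLex q).2

end Stage

namespace Data

mutual

/-- Subplan `[i,j]` with `X_{ij}` units available at the supplier at period `t`, whose first block
`[i,l]` ends at level `γ` with `l < j` and has `k` as its ordering period. -/
def w (I : Data) (α γ β : Bool) (t i j k : ℕ) : Stage :=
  if _h : t ≤ k ∧ i ≤ k then
    (Finset.Ico k j).attach.inf fun l =>
      Stage.addCost (I.phi α γ i l.1 k + (I.carry t k (I.X α β i j) : ℝ))
        (G I γ β k (l.1 + 1) j)
  else ⊤
termination_by 3 * (j + 1 - i)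
decreasing_by
  have := Finset.mem_Ico.mp l.2
  omega

/-- Subplan `[i,j]` made of at least two blocks. -/
def v (I : Data) (α β : Bool) (t i j : ℕ) : Stage :=
  (Finset.Ico i j).inf fun k => (Finset.univ : Finset Bool).inf fun γ => w I α γ β t i j k
termination_by 3 * (j + 1 - i) + 1

/-- Regular subplan `[i,j]` with `X_{ij}` units available at the supplier at period `t`
(supplier ordering costs excluded). -/
def G (I : Data) (α β : Bool) (t i j : ℕ) : Stage :=
  open Classical in
  if i ≤ j ∧ t ≤ j then
    if 0 < I.X α β i j then
      min
        ((Finset.Icc (max i t) j).inf fun k =>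
          Stage.mk (I.phi α β i j k + (I.carry t k (I.X α β i j) : ℝ)) k)
        (v I α β t i j)
    else if I.X α β i j = 0 then Stage.mk (I.phiNone α β i j) t
    else ⊤
  else ⊤
termination_by 3 * (j + 1 - i) + 2

end

/-- Supply chain cost `C^{αβ}_{tij}` of the regular subplan `[i,j]`, supplier orders being placed
at `t` or later. If a quantity covering exactly `[i,l]` is ordered at `t`, the remaining supplier
orders come after the last retailer ordering period `t^*` recorded in `G^{αγ}_{til}`. -/
def C (I : Data) (α β : Bool) (t i j : ℕ) : WithTop ℝ :=
  open Classical in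
  if _h : i ≤ j ∧ t ≤ j then
    if 0 < I.X α β i j then
      min (C I α β (t + 1) i j)
        (min (((I.fS t + I.pS t * I.X α β i j : ℝ) : WithTop ℝ) + (I.G α β t i j).cost)
          ((Finset.Ico i j).attach.inf fun l =>
            (Finset.univ : Finset Bool).inf fun γ =>
              match I.G α γ t i l.1 with
              | none => ⊤
              | some q =>
                  min ((I.fS t + I.pS t * I.X α γ i l.1 : ℝ) : WithTop ℝ)
                      (if I.X α γ i l.1 = 0 then 0 else ⊤)
                    + ((ofLex q).1 : ℝ) + C I γ β ((ofLex q).2 + 1) (l.1 + 1) j))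
    else (I.G α β t i j).cost
  else ⊤
termination_by (j + 1 - i, j + 1 - t)
decreasing_by
  · exact Prod.Lex.right _ (by omega)
  · have := Finset.mem_Ico.mp l.2
    exact Prod.Lex.left _ _ (by omega)

end Data

/-! ### A unit-cost machine over the reals

Programs work on two memories of arrays, one with natural entries and one with real entries; a
cell is addressed by the number of its array and a tuple of indices. Scalar variable number `a`
is the cell of array `a` at the empty tuple. Every operation, comparison, memory access and loop
iteration costs one step; a program is a fixed finite text. Natural numbers can only be compared,
incremented and subtracted, so they stay small. -/

/-- Memory contents. -/
structure State where
  nat : ℕ → List ℕ → ℕ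
  real : ℕ → List ℕ → ℝ

namespace State

/-- Write to a cell of the natural memory. -/
def setNat (s : State) (a : ℕ) (ix : List ℕ) (n : ℕ) : State :=
  { s with nat := fun b jx => if b = a ∧ jx = ix then n else s.nat b jx }

/-- Write to a cell of the real memory. -/
def setReal (s : State) (a : ℕ) (ix : List ℕ) (r : ℝ) : State :=
  { s with real := fun b jx => if b = a ∧ jx = ix then r else s.real b jx }

end State

/-- Natural-number expressions; `cell a vs` reads array `a` at the values of the scalar
variables listed in `vs`. -/
inductive NExp where
  | const (n : ℕ)
  | cell (a : ℕ) (vs : List ℕ)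
  | succ (e : NExp)
  | sub (e e' : NExp)

namespace NExp

/-- Value of a natural expression; subtraction is truncated. -/
def eval (s : State) : NExp → ℕ
  | const n => n
  | cell a vs => s.nat a (vs.map fun x => s.nat x [])
  | succ e => e.eval s + 1
  | sub e e' => e.eval s - e'.eval s

/-- Number of steps of an evaluation. -/
def steps : NExp → ℕ
  | const _ => 1
  | cell _ vs => 1 + vs.length
  | succ e => 1 + e.steps
  | sub e e' => 1 + e.steps + e'.steps

end NExp

/-- Real expressions; no division, no rounding. -/
inductive RExp where
  | zero
  | one
  | cell (a : ℕ) (ix : List NExp)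
  | add (e e' : RExp)
  | sub (e e' : RExp)
  | mul (e e' : RExp)

namespace RExp

/-- Value of a real expression. -/
def eval (s : State) : RExp → ℝ
  | zero => 0
  | one => 1
  | cell a ix => s.real a (ix.map (NExp.eval s))
  | add e e' => e.eval s + e'.eval s
  | sub e e' => e.eval s - e'.eval s
  | mul e e' => e.eval s * e'.eval s

/-- Number of steps of an evaluation. -/
def steps : RExp → ℕ
  | zero => 1
  | one => 1
  | cell _ ix => 1 + (ix.map NExp.steps).sum
  | add e e' => 1 + e.steps + e'.steps
  | sub e e' => 1 + e.steps + e'.steps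
  | mul e e' => 1 + e.steps + e'.steps

end RExp

/-- Tests. -/
inductive Test where
  | natLe (e e' : NExp)
  | realLe (e e' : RExp)
  | not (b : Test)
  | and (b b' : Test)

namespace Test

/-- Truth of a test. -/
def holds (s : State) : Test → Prop
  | natLe e e' => e.eval s ≤ e'.eval s
  | realLe e e' => e.eval s ≤ e'.eval s
  | not b => ¬ b.holds s
  | and b b' => b.holds s ∧ b'.holds s

/-- Number of steps of an evaluation. -/
def steps : Test → ℕ
  | natLe e e' => 1 + e.steps + e'.steps
  | realLe e e' => 1 + e.steps + e'.steps
  | not b => 1 + b.steps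
  | and b b' => 1 + b.steps + b'.steps

end Test

/-- Programs. `loop x lo hi c` runs `c` for the values `lo, lo + 1, …, hi - 1` of the natural
scalar variable `x`; the bounds are evaluated once. -/
inductive Cmd where
  | skip
  | setNat (a : ℕ) (ix : List NExp) (e : NExp)
  | setReal (a : ℕ) (ix : List NExp) (e : RExp)
  | seq (c c' : Cmd)
  | ite (b : Test) (c c' : Cmd)
  | loop (x : ℕ) (lo hi : NExp) (c : Cmd)

/-- Final state and number of steps of a run. -/
def Cmd.run : Cmd → State → State × ℕ
  | skip, s => (s, 1)
  | setNat a ix e, s =>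
      (s.setNat a (ix.map (NExp.eval s)) (e.eval s), 1 + (ix.map NExp.steps).sum + e.steps)
  | setReal a ix e, s =>
      (s.setReal a (ix.map (NExp.eval s)) (e.eval s), 1 + (ix.map NExp.steps).sum + e.steps)
  | seq c c', s =>
      let r := c.run s
      let r' := c'.run r.1
      (r'.1, 1 + r.2 + r'.2)
  | ite b c c', s =>
      open Classical in
      let r := if b.holds s then c.run s else c'.run s
      (r.1, 1 + b.steps + r.2)
  | loop x lo hi c, s =>
      (List.range' (lo.eval s) (hi.eval s - lo.eval s)).foldl
        (fun q n =>
          let r := c.run (q.1.setNat x [] n)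
          (r.1, q.2 + 1 + r.2))
        (s, 1 + lo.steps + hi.steps)

namespace Data

/-- Input arrays. -/
def input (I : Data) : ℕ → ℕ → ℝ
  | 0 => I.d
  | 1 => I.fR
  | 2 => I.pR
  | 3 => I.hR
  | 4 => I.fS
  | 5 => I.pS
  | 6 => I.hS
  | 7 => I.u
  | _ => fun _ => 0

/-- Initial memory: natural scalar variable `0` holds `T`, the real arrays `0, …, 7` hold the
data at the periods `1, …, T`; everything else is zero. -/
def initial (I : Data) : State where
  nat a ix := if a = 0 ∧ ix = [] then I.T else 0
  real a ix :=
    match ix with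
    | [t] => if 1 ≤ t ∧ t ≤ I.T then I.input a t else 0
    | _ => 0

end Data

namespace State

/-- Output: the real scalar variable `8`. -/
def outCost (s : State) : ℝ := s.real 8 []

/-- Output: the real arrays `9, …, 14`. -/
def outPlan (s : State) : Plan where
  xR t := s.real 9 [t]
  sR t := s.real 10 [t]
  yR t := s.real 11 [t]
  xS t := s.real 12 [t]
  sS t := s.real 13 [t]
  yS t := s.real 14 [t]

/-- The table `a` holds the cost `c` at index `ix`: a flag tells whether `c` is finite. -/
def HoldsCost (s : State) (a : ℕ) (ix : List ℕ) (c : WithTop ℝ) : Prop :=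
  (c = ⊤ ∧ s.nat a (0 :: ix) = 0) ∨ (c = (s.real a ix : ℝ) ∧ s.nat a (0 :: ix) = 1)

/-- The table `a` holds the stage value `g` at index `ix`. -/
def HoldsStage (s : State) (a : ℕ) (ix : List ℕ) (g : Stage) : Prop :=
  (g = ⊤ ∧ s.nat a (0 :: ix) = 0) ∨
    (g = Stage.mk (s.real a ix : ℝ) (s.nat a (1 :: ix)) ∧ s.nat a (0 :: ix) = 1)

/-- The arrays `15, …, 19` hold the complete tables `φ`, `w`, `v`, `G`, `C`. -/
def Tabulates (s : State) (I : Data) : Prop :=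
  (∀ (α β : Bool) (i j k : ℕ), 1 ≤ i → i ≤ k → k ≤ j → j ≤ I.T →
    s.HoldsCost 15 [α.toNat, β.toNat, i, j, k] (I.phi α β i j k)) ∧
  (∀ (α γ β : Bool) (t i j k : ℕ), 1 ≤ t → t ≤ k → 1 ≤ i → i ≤ k → k < j → j ≤ I.T →
    s.HoldsStage 16 [α.toNat, γ.toNat, β.toNat, t, i, j, k] (I.w α γ β t i j k)) ∧
  (∀ (α β : Bool) (t i j : ℕ), 1 ≤ t → t ≤ j → 1 ≤ i → i ≤ j → j ≤ I.T →
    s.HoldsStage 17 [α.toNat, β.toNat, t, i, j] (I.v α β t i j) ∧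
    s.HoldsStage 18 [α.toNat, β.toNat, t, i, j] (I.G α β t i j) ∧
    s.HoldsCost 19 [α.toNat, β.toNat, t, i, j] (I.C α β t i j))

end State

end LotSizing

end

-- A plan is encoded by the cumulative orders `A` of the supplier and `B` of the retailer. Orders
-- beyond the total demand only add cost, so it suffices to consider plans that end without stock
-- (`Feasible.exists_cum_le`). They form a polyhedron, bounded in the coordinates up to `T`. The
-- cost is linear except for the setup costs, and a setup is paid exactly where a constraint `A (t -
-- 1) ≤ A t` or `B (t - 1) ≤ B t` is slack. A move that keeps the active constraints active creates
-- no new setup, hence the minimum is attained at a vertex (`exists_isVertex_min`). Shifting a level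
-- set of `A`, or equal level sets of `A` and `B` together, shows that at a vertex the supplier
-- orders only when its stock is empty and that between two retailer orders the retailer inventory
-- meets `0` or its bound (`exists_structured_optimum`).
--
-- The retailer plan of such an optimum is cut at these levels into blocks with at most one order.
-- With tight bounds, stock that is merely consumed cannot violate a later bound, so the few
-- inequalities in `φ` decide feasibility of a block (`realG_block`, `phi_inc`). Every finite value
-- of `G` or `C` is the cost of an actual plan (`G_realizable`, `C_realizable`), so the recursion
-- never undercuts the optimum.
--
-- The converse, `OptCum.C_le`, follows the supplier orders of a structured optimum. An order at `p`
-- is used up before the next one at `r`. If `τ` is the last retailer order before `r` and `l` the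
-- first level from `τ` on, then the order at `p` serves exactly `[i,l]`. The delicate point is that
-- `G` remembers only one plan of `[i,l]`, through its last ordering period `t*`. Optimality forbids
-- a cheaper way of serving the group (`OptCum.groupCost_le`), so the remembered plan ties in cost
-- with the optimal one; the tie-breaking rule gives `t* ≤ τ`; and `C` does not increase when the
-- supplier may start earlier (`C_anti`). Hence nothing is lost by continuing from `t* + 1`.
--
-- Arbitrary bounds are reduced to tight ones: since `s_t ≤ s_{t+1} + d_{t+1}` in every plan,
-- lowering `u_t` to `u_{t+1} + d_{t+1}`, backwards in time, keeps the feasible plans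
-- (`feasible_tighten`).
--
-- Evaluated literally, `w` needs five nested loops, over `t, i, j, k, l`. But `t` enters only
-- through the cost of holding `X_{ij}` units until `k`, which does not involve `l`. The minimum
-- over `l` is therefore tabulated without `t` (`tail`, `w_eq_tail`), and no part of the program
-- nests more than four loops over periods (`steps_le`, `steps_full`). For correctness, the arrays
-- and index positions that a command writes are read off its text and checked by `decide`; a table
-- entry has then only to be correct when it is written (`nest_table`, `desc_fill`).

noncomputable section

namespace LotSizing

/-! ### Vertices of polyhedra -/

section Vertex

variable {V ι : Type*} [AddCommGroup V] [Module ℝ V]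

/-- Every direction along which all active constraints stay active is trivial. -/
def IsVertex (g : ι → V →ₗ[ℝ] ℝ) (b : ι → ℝ) (x : V) : Prop :=
  ∀ δ, (∀ i, g i x = b i → g i δ = 0) → ∀ i, g i δ = 0

/-- A point that is not a vertex can be moved along a direction that keeps its active constraints
and does not raise `φ`. By `hrec` some constraint decreases along it, so the move can be continued
until a further constraint becomes active, and the number of inactive constraints drops. Directions
matter only through the values `g i δ`, since `V` will be a space of infinite sequences of which
finitely many coordinates are constrained. -/
theorem exists_isVertex_le [Finite ι] (g : ι → V →ₗ[ℝ] ℝ) (b : ι → ℝ) (φ : V →ₗ[ℝ] ℝ)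
    (hrec : ∀ δ, (∀ i, 0 ≤ g i δ) → ∀ i, g i δ = 0) (x : V) (hx : ∀ i, b i ≤ g i x) :
    ∃ x', (∀ i, b i ≤ g i x') ∧ (∀ i, g i x = b i → g i x' = b i) ∧ φ x' ≤ φ x ∧
      IsVertex g b x' := by
  induction h : Set.ncard {i | g i x ≠ b i} using Nat.strong_induction_on generalizing x with
  | _ N ih =>
    by_cases hv : IsVertex g b x
    · exact ⟨x, hx, fun i hi => hi, le_rfl, hv⟩
    have hv' : ∃ δ, (∀ i, g i x = b i → g i δ = 0) ∧ (∃ i, g i δ ≠ 0) ∧ φ δ ≤ 0 := by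
      unfold IsVertex at hv
      push Not at hv
      obtain ⟨δ, h1, i, h2⟩ := hv
      rcases le_total (φ δ) 0 with h3 | h3
      · exact ⟨δ, h1, ⟨i, h2⟩, h3⟩
      · refine ⟨-δ, fun i hi => by rw [map_neg, h1 i hi, neg_zero], ⟨i, ?_⟩, ?_⟩
        · rw [map_neg]; exact neg_ne_zero.mpr h2
        · rw [map_neg]; linarith
    obtain ⟨δ, h1, ⟨i, h2⟩, h3⟩ := hv'
    have hne : {j | g j δ < 0}.Nonempty := by
      by_contra hcon
      rw [Set.not_nonempty_iff_eq_empty] at hcon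
      refine h2 (hrec δ (fun j => ?_) i)
      by_contra hj
      have : j ∈ {j | g j δ < 0} := not_le.mp hj
      rw [hcon] at this
      exact this
    -- Ratio test: `j` is the decreasing constraint that is reached first, after the step length
    -- `ε`.
    obtain ⟨j, hj, hmin⟩ := Set.exists_min_image {j | g j δ < 0}
      (fun j => (g j x - b j) / (- g j δ)) (Set.toFinite _) hne
    have hj' : g j δ < 0 := hj
    set ε := (g j x - b j) / (- g j δ) with hε
    have hε0 : 0 ≤ ε := div_nonneg (sub_nonneg.mpr (hx j)) (by linarith)
    have hval : ∀ i, g i (x + ε • δ) = g i x + ε * g i δ := by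
      intro i; rw [map_add, map_smul, smul_eq_mul]
    have hfeas : ∀ i, b i ≤ g i (x + ε • δ) := by
      intro i
      rw [hval]
      by_cases hi : g i δ < 0
      · have := hmin i hi
        rw [le_div_iff₀ (by linarith)] at this
        linarith
      · have := mul_nonneg hε0 (not_lt.mp hi)
        linarith [hx i]
    have htight : ∀ i, g i x = b i → g i (x + ε • δ) = b i := by
      intro i hi; rw [hval, h1 i hi, hi]; ring
    have hjt : g j (x + ε • δ) = b j := by
      have := div_mul_cancel₀ (g j x - b j) (neg_ne_zero.mpr hj'.ne)
      rw [← hε] at this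
      rw [hval]
      linarith
    have hlt : Set.ncard {i | g i (x + ε • δ) ≠ b i} < N := by
      rw [← h]
      refine Set.ncard_lt_ncard ⟨fun i hi hi' => hi (htight i hi'), fun hsub => ?_⟩ (Set.toFinite _)
      have : j ∈ {i | g i x ≠ b i} := fun hjx => hj'.ne (h1 j hjx)
      exact hsub this hjt
    obtain ⟨x', a1, a2, a3, a4⟩ := ih _ hlt _ hfeas rfl
    refine ⟨x', a1, fun i hi => a2 i (htight i hi), a3.trans ?_, a4⟩
    rw [map_add, map_smul, smul_eq_mul]
    linarith [mul_nonpos_of_nonneg_of_nonpos hε0 h3]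

/-- `F` is not linear; `hF` only says that it does not grow when `φ` does not and no active
constraint is lost. Two vertices with the same active constraints have the same values of all `g i`,
hence of `φ`, hence of `F`. As there are finitely many active sets, some vertex is best among
vertices, and `exists_isVertex_le` compares it with any other point. -/
theorem exists_isVertex_min [Finite ι] (g : ι → V →ₗ[ℝ] ℝ) (b : ι → ℝ) (φ : V →ₗ[ℝ] ℝ)
    (F : V → ℝ) (hrec : ∀ δ, (∀ i, 0 ≤ g i δ) → ∀ i, g i δ = 0)
    (hφ : ∀ δ, (∀ i, g i δ = 0) → φ δ = 0)
    (hF : ∀ x x', (∀ i, b i ≤ g i x) → (∀ i, b i ≤ g i x') →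
      (∀ i, g i x = b i → g i x' = b i) → φ x' ≤ φ x → F x' ≤ F x)
    (x₀ : V) (hx₀ : ∀ i, b i ≤ g i x₀) :
    ∃ x, (∀ i, b i ≤ g i x) ∧ IsVertex g b x ∧ ∀ x', (∀ i, b i ≤ g i x') → F x ≤ F x' := by
  classical
  let S : Set V := {x | (∀ i, b i ≤ g i x) ∧ IsVertex g b x}
  let act : V → Set ι := fun x => {i | g i x = b i}
  have key : ∀ x ∈ S, ∀ x' ∈ S, act x = act x' → F x ≤ F x' := by
    intro x hx x' hx' hxx
    have hz : ∀ i, g i (x - x') = 0 := by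
      refine hx.2 _ fun i hi => ?_
      have : i ∈ act x' := hxx ▸ hi
      have h' : g i x' = b i := this
      rw [map_sub, hi, h', sub_self]
    have hφ0 := hφ _ hz
    rw [map_sub, sub_eq_zero] at hφ0
    refine hF x' x hx'.1 hx.1 (fun i hi => ?_) hφ0.le
    have : i ∈ act x := hxx ▸ hi
    exact this
  have hSne : S.Nonempty := by
    obtain ⟨x', a1, -, -, a4⟩ := exists_isVertex_le g b φ hrec x₀ hx₀
    exact ⟨x', a1, a4⟩
  -- One vertex is chosen for each active set; the default `x₀` is never used on active sets of
  -- vertices.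
  let rep : Set ι → V := fun τ => if h : ∃ x ∈ S, act x = τ then h.choose else x₀
  have hrep : ∀ x ∈ S, rep (act x) ∈ S ∧ act (rep (act x)) = act x := by
    intro x hx
    have h : ∃ y ∈ S, act y = act x := ⟨x, hx, rfl⟩
    simp only [rep, dif_pos h]
    exact h.choose_spec
  obtain ⟨τ, ⟨x, hx, rfl⟩, hmin⟩ := Set.exists_min_image (act '' S) (fun τ => F (rep τ))
    (Set.toFinite _) (hSne.image _)
  refine ⟨rep (act x), (hrep x hx).1.1, (hrep x hx).1.2, fun x' hx' => ?_⟩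
  obtain ⟨y, a1, a2, a3, a4⟩ := exists_isVertex_le g b φ hrec x' hx'
  have hy : y ∈ S := ⟨a1, a4⟩
  calc F (rep (act x)) ≤ F (rep (act y)) := hmin _ ⟨y, hy, rfl⟩
    _ ≤ F y := key _ (hrep y hy).1 _ hy (hrep y hy).2
    _ ≤ F x' := hF _ _ hx' a1 a2 a3

end Vertex

/-! ### Plans in cumulative form -/

namespace Data

variable (I : Data)

/-- `A` and `B` are the cumulative supplier and retailer orders of a feasible plan that ends
without stock. -/
structure Cum (A B : ℕ → ℝ) : Prop where
  A_zero : A 0 = 0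
  B_zero : B 0 = 0
  A_mono : ∀ t, 1 ≤ t → t ≤ I.T → A (t - 1) ≤ A t
  B_mono : ∀ t, 1 ≤ t → t ≤ I.T → B (t - 1) ≤ B t
  B_le_A : ∀ t, 1 ≤ t → t ≤ I.T → B t ≤ A t
  D_le_B : ∀ t, 1 ≤ t → t ≤ I.T → I.D 1 t ≤ B t
  B_le : ∀ t, 1 ≤ t → t ≤ I.T → B t ≤ I.D 1 t + I.u t
  A_last : A I.T = I.D 1 I.T
  B_last : B I.T = I.D 1 I.T

/-- The plan with cumulative orders `A` and `B`. -/
def ofCum (A B : ℕ → ℝ) : Plan where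
  xR t := B t - B (t - 1)
  sR t := B t - I.D 1 t
  yR t := if B (t - 1) < B t then 1 else 0
  xS t := A t - A (t - 1)
  sS t := A t - B t
  yS t := if A (t - 1) < A t then 1 else 0

variable {I}

theorem D_self_zero (i : ℕ) (j : ℕ) (h : j < i) : I.D i j = 0 := by
  simp [D, Finset.Icc_eq_empty_of_lt h]

theorem D_one_zero : I.D 1 0 = 0 := D_self_zero _ _ (by norm_num)

theorem D_succ_right (i j : ℕ) (h : i ≤ j + 1) : I.D i (j + 1) = I.D i j + I.d (j + 1) := by
  unfold D
  rw [Finset.sum_Icc_succ_top h]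

theorem D_pred_right (i j : ℕ) (h : i ≤ j) (hi : 1 ≤ i) : I.D i j = I.D i (j - 1) + I.d j := by
  obtain ⟨m, rfl⟩ : ∃ m, j = m + 1 := ⟨j - 1, by omega⟩
  rw [D_succ_right _ _ h]; rfl

theorem D_add (i m j : ℕ) (h : i ≤ m + 1) (h' : m ≤ j) : I.D i m + I.D (m + 1) j = I.D i j := by
  induction j, h' using Nat.le_induction with
  | base => rw [D_self_zero (m + 1) m (by omega), add_zero]
  | succ j hj ih => rw [D_succ_right (m + 1) j (by omega), D_succ_right i j (by omega), ← ih]; ring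

theorem Valid.D_nonneg (hI : I.Valid) (i j : ℕ) (hi : 1 ≤ i) (hj : j ≤ I.T) : 0 ≤ I.D i j := by
  refine Finset.sum_nonneg fun n hn => ?_
  rw [Finset.mem_Icc] at hn
  exact (hI.2 n (by omega) (by omega)).1

theorem Valid.D_mono (hI : I.Valid) (i m j : ℕ) (hi : 1 ≤ i) (hm : m ≤ j) (hj : j ≤ I.T) :
    I.D i m ≤ I.D i j := by
  by_cases h : i ≤ m + 1
  · rw [← D_add i m j h hm]
    linarith [hI.D_nonneg (m + 1) j (by omega) hj]
  · rw [D_self_zero i m (by omega)]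
    exact hI.D_nonneg _ _ hi hj

theorem mono_of_step {f : ℕ → ℝ} {T : ℕ} (h : ∀ t, 1 ≤ t → t ≤ T → f (t - 1) ≤ f t) {m n : ℕ}
    (hmn : m ≤ n) (hn : n ≤ T) : f m ≤ f n := by
  induction n, hmn using Nat.le_induction with
  | base => exact le_rfl
  | succ k hk ih => exact (ih (by omega)).trans (h (k + 1) (by omega) hn)

/-- The constraints with `M_t` hold because the order at `t` is at most `A T - A (t - 1)`, and `A (t
- 1)` already covers the demand before `t`; likewise for `B`. -/
theorem Cum.feasible (hI : I.Valid) {A B : ℕ → ℝ} (h : I.Cum A B) : I.Feasible (I.ofCum A B) := by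
  have hA : ∀ t, 1 ≤ t → t ≤ I.T → A t - A (t - 1) ≤ I.D t I.T := by
    intro t h1 h2
    have e1 := mono_of_step h.A_mono h2 le_rfl
    have e2 : I.D 1 (t - 1) ≤ A (t - 1) := by
      rcases Nat.eq_or_lt_of_le h1 with h3 | h3
      · subst h3; simp [h.A_zero, D_one_zero]
      · exact (h.D_le_B _ (by omega) (by omega)).trans (h.B_le_A _ (by omega) (by omega))
    have e3 := D_add (I := I) 1 (t - 1) I.T (by omega) (by omega)
    rw [Nat.sub_add_cancel h1] at e3
    rw [h.A_last] at e1
    linarith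
  have hB : ∀ t, 1 ≤ t → t ≤ I.T → B t - B (t - 1) ≤ I.D t I.T := by
    intro t h1 h2
    have e1 := mono_of_step h.B_mono h2 le_rfl
    have e2 : I.D 1 (t - 1) ≤ B (t - 1) := by
      rcases Nat.eq_or_lt_of_le h1 with h3 | h3
      · subst h3; simp [h.B_zero, D_one_zero]
      · exact h.D_le_B _ (by omega) (by omega)
    have e3 := D_add (I := I) 1 (t - 1) I.T (by omega) (by omega)
    rw [Nat.sub_add_cancel h1] at e3
    rw [h.B_last] at e1
    linarith
  refine ⟨by simp [ofCum, h.B_zero, D_one_zero], by simp [ofCum, h.A_zero, h.B_zero], ?_⟩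
  intro t h1 h2
  have eD := D_pred_right (I := I) 1 t h1 le_rfl
  have a1 := h.A_mono t h1 h2
  have a2 := h.B_mono t h1 h2
  have a3 := h.B_le_A t h1 h2
  have a4 := h.D_le_B t h1 h2
  have a5 := h.B_le t h1 h2
  have a6 := hI.D_nonneg t I.T h1 le_rfl
  simp only [ofCum]
  refine ⟨by linarith, by ring, ?_, ?_, by linarith, by linarith, by linarith, by linarith, ?_, ?_,
    by linarith⟩
  · split_ifs with h3
    · linarith [hB t h1 h2]
    · linarith
  · split_ifs with h3
    · linarith [hA t h1 h2]
    · linarith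
  · split_ifs <;> simp
  · split_ifs <;> simp

/-- Capping both cumulative orders at the total demand removes the final stocks, and increases no
order, no inventory and no setup indicator. -/
theorem Feasible.exists_cum_le (hI : I.Valid) {P : Plan} (hP : I.Feasible P) :
    ∃ A B, I.Cum A B ∧ I.cost (I.ofCum A B) ≤ I.cost P := by
  obtain ⟨hR0, hS0, hP⟩ := hP
  set Δ := I.D 1 I.T with hΔ
  let A₀ : ℕ → ℝ := fun t => ∑ n ∈ Finset.Icc 1 t, P.xS n
  let B₀ : ℕ → ℝ := fun t => ∑ n ∈ Finset.Icc 1 t, P.xR n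
  have hA₀ : ∀ t, 1 ≤ t → A₀ t = A₀ (t - 1) + P.xS t := by
    intro t ht
    obtain ⟨m, rfl⟩ : ∃ m, t = m + 1 := ⟨t - 1, by omega⟩
    exact Finset.sum_Icc_succ_top (by omega) _
  have hB₀ : ∀ t, 1 ≤ t → B₀ t = B₀ (t - 1) + P.xR t := by
    intro t ht
    obtain ⟨m, rfl⟩ : ∃ m, t = m + 1 := ⟨t - 1, by omega⟩
    exact Finset.sum_Icc_succ_top (by omega) _
  have hbal : ∀ t, t ≤ I.T → P.sR t = B₀ t - I.D 1 t ∧ P.sS t = A₀ t - B₀ t := by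
    intro t
    induction t with
    | zero => intro _; simp [hR0, hS0, A₀, B₀, D_one_zero]
    | succ t ih =>
      intro ht
      obtain ⟨i1, i2⟩ := ih (by omega)
      obtain ⟨e1, e2, -⟩ := hP (t + 1) (by omega) ht
      have e3 := hA₀ (t + 1) (by omega)
      have e4 := hB₀ (t + 1) (by omega)
      have e5 := D_succ_right (I := I) 1 t (by omega)
      simp only [Nat.add_sub_cancel] at e1 e2 e3 e4
      constructor <;> linarith
  have hΔ0 : 0 ≤ Δ := hI.D_nonneg 1 I.T le_rfl le_rfl
  have hT := hbal I.T le_rfl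
  obtain ⟨-, -, -, -, -, -, q1, q2, -⟩ := hP I.T hI.1 le_rfl
  refine ⟨fun t => min (A₀ t) Δ, fun t => min (B₀ t) Δ, ?_, ?_⟩
  · refine ⟨?_, ?_, ?_, ?_, ?_, ?_, ?_, ?_, ?_⟩
    · simp [A₀, hΔ0]
    · simp [B₀, hΔ0]
    · intro t h1 h2
      obtain ⟨-, -, -, -, p1, p2, -⟩ := hP t h1 h2
      exact min_le_min_right _ (by linarith [hA₀ t h1])
    · intro t h1 h2
      obtain ⟨-, -, -, -, p1, p2, -⟩ := hP t h1 h2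
      exact min_le_min_right _ (by linarith [hB₀ t h1])
    · intro t h1 h2
      obtain ⟨-, -, -, -, p1, p2, p3, p4, -⟩ := hP t h1 h2
      exact min_le_min_right _ (by linarith [(hbal t h2).2])
    · intro t h1 h2
      obtain ⟨-, -, -, -, p1, p2, p3, p4, -⟩ := hP t h1 h2
      exact le_min (by linarith [(hbal t h2).1]) (hI.D_mono 1 t I.T le_rfl h2 le_rfl)
    · intro t h1 h2
      obtain ⟨-, -, -, -, p1, p2, p3, p4, -, -, p5⟩ := hP t h1 h2
      exact (min_le_left _ _).trans (by linarith [(hbal t h2).1])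
    · exact min_eq_right (by linarith)
    · exact min_eq_right (by linarith)
  · refine Finset.sum_le_sum fun t ht => ?_
    rw [Finset.mem_Icc] at ht
    obtain ⟨h1, h2⟩ := ht
    obtain ⟨-, -, m1, m2, p1, p2, p3, p4, y1, y2, p5⟩ := hP t h1 h2
    obtain ⟨v0, v1, v2, v3, v4, v5, v6, v7⟩ := hI.2 t h1 h2
    obtain ⟨b1, b2⟩ := hbal t h2
    have e3 := hA₀ t h1
    have e4 := hB₀ t h1
    simp only [ofCum]
    have hDt := hI.D_mono 1 t I.T le_rfl h2 le_rfl
    have xS_le : min (A₀ t) Δ - min (A₀ (t - 1)) Δ ≤ P.xS t := by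
      rcases min_cases (A₀ t) Δ with ⟨h, h'⟩ | ⟨h, h'⟩ <;>
      rcases min_cases (A₀ (t - 1)) Δ with ⟨g, g'⟩ | ⟨g, g'⟩ <;> (rw [h, g]; linarith)
    have xR_le : min (B₀ t) Δ - min (B₀ (t - 1)) Δ ≤ P.xR t := by
      rcases min_cases (B₀ t) Δ with ⟨h, h'⟩ | ⟨h, h'⟩ <;>
      rcases min_cases (B₀ (t - 1)) Δ with ⟨g, g'⟩ | ⟨g, g'⟩ <;> (rw [h, g]; linarith)
    have sS_le : min (A₀ t) Δ - min (B₀ t) Δ ≤ P.sS t := by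
      rcases min_cases (A₀ t) Δ with ⟨h, h'⟩ | ⟨h, h'⟩ <;>
      rcases min_cases (B₀ t) Δ with ⟨g, g'⟩ | ⟨g, g'⟩ <;> (rw [h, g]; linarith)
    have sR_le : min (B₀ t) Δ - I.D 1 t ≤ P.sR t := by
      linarith [min_le_left (B₀ t) Δ]
    -- If the capped order is positive then so is the original one, which forces its indicator to be
    -- `1`.
    have yS_le : (if min (A₀ (t - 1)) Δ < min (A₀ t) Δ then (1 : ℝ) else 0) ≤ P.yS t := by
      split_ifs with h
      · rcases y2 with y | y
        · rw [y] at m2; linarith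
        · linarith
      · rcases y2 with y | y <;> rw [y] <;> norm_num
    have yR_le : (if min (B₀ (t - 1)) Δ < min (B₀ t) Δ then (1 : ℝ) else 0) ≤ P.yR t := by
      split_ifs with h
      · rcases y1 with y | y
        · rw [y] at m1; linarith
        · linarith
      · rcases y1 with y | y <;> rw [y] <;> norm_num
    gcongr

end Data

-- Plans without final stock as a polyhedron, and the structure of an optimal vertex

namespace Data

variable {I : Data}

/-- The constraints on cumulative orders, as linear functionals. -/
def cumForm (T : ℕ) : Fin 6 × Fin (T + 1) → ((ℕ → ℝ) × (ℕ → ℝ)) →ₗ[ℝ] ℝ := fun i =>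
  let A : ℕ → ((ℕ → ℝ) × (ℕ → ℝ)) →ₗ[ℝ] ℝ := fun n => LinearMap.proj n ∘ₗ LinearMap.fst ℝ _ _
  let B : ℕ → ((ℕ → ℝ) × (ℕ → ℝ)) →ₗ[ℝ] ℝ := fun n => LinearMap.proj n ∘ₗ LinearMap.snd ℝ _ _
  let n : ℕ := i.2
  match i.1 with
  | 0 => A n - A (n - 1)
  | 1 => B n - B (n - 1)
  | 2 => A n - B n
  | 3 => B n
  | 4 => - B n
  | 5 => - A n

/-- Lower bounds of the constraints on cumulative orders. -/
def cumBound (I : Data) : Fin 6 × Fin (I.T + 1) → ℝ := fun i =>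
  let n : ℕ := i.2
  match i.1 with
  | 0 => 0
  | 1 => 0
  | 2 => 0
  | 3 => I.D 1 n
  | 4 => - (I.D 1 n + I.lev true n)
  -- At `n = 0` families 2 to 5 force `A 0 = B 0 = 0`. At `n = T`, where `A T ≤ D 1 T`, they force
  -- `A T = B T = D 1 T`.
  | 5 => - (if n = 0 then 0 else I.D 1 I.T)

theorem forall_fin_six_prod {T : ℕ} {p : Fin 6 × Fin (T + 1) → Prop} :
    (∀ i, p i) ↔ ∀ n (hn : n < T + 1), p (0, ⟨n, hn⟩) ∧ p (1, ⟨n, hn⟩) ∧ p (2, ⟨n, hn⟩) ∧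
      p (3, ⟨n, hn⟩) ∧ p (4, ⟨n, hn⟩) ∧ p (5, ⟨n, hn⟩) := by
  constructor
  · exact fun h n hn => ⟨h _, h _, h _, h _, h _, h _⟩
  · rintro h ⟨c, ⟨n, hn⟩⟩
    obtain ⟨h0, h1, h2, h3, h4, h5⟩ := h n hn
    fin_cases c <;> assumption

/-- The equalities of `Cum` are squeezed between inequalities `D ≤ B ≤ A` and the upper bound of
`A`; the monotonicity constraints at `n = 0` are void since `0 - 1 = 0`. -/
theorem cum_iff (hI : I.Valid) (z : (ℕ → ℝ) × (ℕ → ℝ)) :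
    I.Cum z.1 z.2 ↔ ∀ i, I.cumBound i ≤ cumForm I.T i z := by
  rw [forall_fin_six_prod]
  simp only [cumBound, cumForm, LinearMap.sub_apply, LinearMap.neg_apply, LinearMap.comp_apply,
    LinearMap.fst_apply, LinearMap.snd_apply, LinearMap.proj_apply]
  have hT := hI.1
  constructor
  · intro h n hn
    rcases Nat.eq_zero_or_pos n with rfl | h1
    · simp [h.A_zero, h.B_zero, D_one_zero, lev]
    · have h2 : n ≤ I.T := by omega
      have a1 := h.A_mono n h1 h2
      have a2 := h.B_mono n h1 h2
      have a3 := h.B_le_A n h1 h2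
      have a4 := h.D_le_B n h1 h2
      have a5 := h.B_le n h1 h2
      have a6 := mono_of_step h.A_mono h2 le_rfl
      rw [h.A_last] at a6
      have : n ≠ 0 := by omega
      simp only [lev, this, if_false]
      rw [if_pos ⟨trivial, by omega⟩]
      refine ⟨?_, ?_, ?_, ?_, ?_, ?_⟩ <;> linarith
  · intro h
    have hpos : ∀ n, 1 ≤ n → n ≤ I.T → z.1 (n - 1) ≤ z.1 n ∧ z.2 (n - 1) ≤ z.2 n ∧ z.2 n ≤ z.1 n ∧
        I.D 1 n ≤ z.2 n ∧ z.2 n ≤ I.D 1 n + I.u n ∧ z.1 n ≤ I.D 1 I.T := by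
      intro n h1 h2
      have hn := h n (by omega)
      have h0 : n ≠ 0 := by omega
      simp only [lev, h0, if_false] at hn
      rw [if_pos ⟨trivial, by omega⟩] at hn
      obtain ⟨q0, q1, q2, q3, q4, q5⟩ := hn
      refine ⟨?_, ?_, ?_, ?_, ?_, ?_⟩ <;> linarith
    have hz := h 0 (by omega)
    simp [D_one_zero, lev] at hz
    have hl := hpos I.T hT le_rfl
    refine ⟨?_, ?_, fun t h1 h2 => (hpos t h1 h2).1, fun t h1 h2 => (hpos t h1 h2).2.1,
      fun t h1 h2 => (hpos t h1 h2).2.2.1, fun t h1 h2 => (hpos t h1 h2).2.2.2.1,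
      fun t h1 h2 => (hpos t h1 h2).2.2.2.2.1, ?_, ?_⟩ <;> linarith

/-- The linear part of the cost in terms of cumulative orders. -/
def cumCost (I : Data) : ((ℕ → ℝ) × (ℕ → ℝ)) →ₗ[ℝ] ℝ :=
  let A : ℕ → ((ℕ → ℝ) × (ℕ → ℝ)) →ₗ[ℝ] ℝ := fun n => LinearMap.proj n ∘ₗ LinearMap.fst ℝ _ _
  let B : ℕ → ((ℕ → ℝ) × (ℕ → ℝ)) →ₗ[ℝ] ℝ := fun n => LinearMap.proj n ∘ₗ LinearMap.snd ℝ _ _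
  ∑ t ∈ Finset.Icc 1 I.T, (I.pS t • (A t - A (t - 1)) + I.hS t • (A t - B t) +
    I.pR t • (B t - B (t - 1)) + I.hR t • B t)

theorem cumCost_apply (z : (ℕ → ℝ) × (ℕ → ℝ)) : I.cumCost z = ∑ t ∈ Finset.Icc 1 I.T,
    (I.pS t * (z.1 t - z.1 (t - 1)) + I.hS t * (z.1 t - z.2 t) +
      I.pR t * (z.2 t - z.2 (t - 1)) + I.hR t * z.2 t) := by
  simp [cumCost, LinearMap.sum_apply]

/-- The setup indicators are the only nonlinear part, and they depend only on which monotonicity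
constraints are slack; the last term is a constant. -/
theorem cost_ofCum (z : (ℕ → ℝ) × (ℕ → ℝ)) : I.cost (I.ofCum z.1 z.2) = I.cumCost z +
    ∑ t ∈ Finset.Icc 1 I.T, (I.fS t * (if z.1 (t - 1) < z.1 t then 1 else 0) +
      I.fR t * (if z.2 (t - 1) < z.2 t then 1 else 0) - I.hR t * I.D 1 t) := by
  rw [cumCost_apply, ← Finset.sum_add_distrib]
  refine Finset.sum_congr rfl fun t _ => ?_
  simp only [ofCum]
  ring

/-- Both levels order every demand in its own period. -/
theorem exists_cum (hI : I.Valid) : I.Cum (I.D 1) (I.D 1) := by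
  refine ⟨D_one_zero, D_one_zero, ?_, ?_, fun _ _ _ => le_rfl, fun _ _ _ => le_rfl, ?_, rfl, rfl⟩
  · exact fun t h1 h2 => hI.D_mono 1 _ _ le_rfl (by omega) h2
  · exact fun t h1 h2 => hI.D_mono 1 _ _ le_rfl (by omega) h2
  · intro t h1 h2
    linarith [(hI.2 t h1 h2).2.2.2.2.2.2.2]

/-- Some optimal plan has the zero-inventory-ordering property, and between two retailer orders
its retailer inventory reaches `0` or its bound. -/
theorem exists_structured_optimum (hI : I.Valid) : ∃ A B, I.Cum A B ∧
    (∀ A' B', I.Cum A' B' → I.cost (I.ofCum A B) ≤ I.cost (I.ofCum A' B')) ∧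
    (∀ t, 1 ≤ t → t ≤ I.T → A (t - 1) = B (t - 1) ∨ A t = A (t - 1)) ∧
    (∀ k l, 1 ≤ k → k < l → l ≤ I.T → B (k - 1) < B k → B (l - 1) < B l →
      ∃ m, k ≤ m ∧ m < l ∧ (B m = I.D 1 m ∨ B m = I.D 1 m + I.u m)) := by
  classical
  have evform : ∀ (z : (ℕ → ℝ) × (ℕ → ℝ)) (n : ℕ) (hn : n < I.T + 1),
      cumForm I.T (0, ⟨n, hn⟩) z = z.1 n - z.1 (n - 1) ∧
      cumForm I.T (1, ⟨n, hn⟩) z = z.2 n - z.2 (n - 1) ∧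
      cumForm I.T (2, ⟨n, hn⟩) z = z.1 n - z.2 n ∧
      cumForm I.T (3, ⟨n, hn⟩) z = z.2 n ∧
      cumForm I.T (4, ⟨n, hn⟩) z = - z.2 n ∧
      cumForm I.T (5, ⟨n, hn⟩) z = - z.1 n := by
    intro z n hn
    refine ⟨?_, ?_, ?_, ?_, ?_, ?_⟩ <;> simp [cumForm]
  -- The coordinates up to `T` are bounded on the polyhedron: `B n` is bounded on both sides, `A n`
  -- lies between `A 0` and the total demand.
  have hrec : ∀ δ, (∀ i, 0 ≤ cumForm I.T i δ) → ∀ i, cumForm I.T i δ = 0 := by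
    intro δ hδ
    rw [forall_fin_six_prod] at hδ ⊢
    simp only [evform] at hδ ⊢
    have hA : ∀ n, n ≤ I.T → δ.1 n = 0 := by
      intro n hn
      have e0 := hδ 0 (by omega)
      have e1 : δ.1 0 ≤ δ.1 n := mono_of_step (T := I.T)
        (fun t h1 h2 => by linarith [(hδ t (by omega)).1]) (Nat.zero_le n) hn
      have e2 := hδ n (by omega)
      linarith [e0.2.2.1, e0.2.2.2.1, e2.2.2.2.2.2]
    have hB : ∀ n, n ≤ I.T → δ.2 n = 0 := by
      intro n hn
      have e2 := hδ n (by omega)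
      linarith [e2.2.2.2.1, e2.2.2.2.2.1]
    intro n hn
    rw [hA n (by omega), hB n (by omega), hA (n - 1) (by omega), hB (n - 1) (by omega)]
    simp
  have hφ : ∀ δ, (∀ i, cumForm I.T i δ = 0) → I.cumCost δ = 0 := by
    intro δ hδ
    rw [forall_fin_six_prod] at hδ
    simp only [evform] at hδ
    rw [cumCost_apply]
    refine Finset.sum_eq_zero fun t ht => ?_
    rw [Finset.mem_Icc] at ht
    obtain ⟨a1, a2, a3, a4, -, -⟩ := hδ t (by omega)
    rw [a1, a2, a3, a4]
    simp
  -- A setup absent from `x` means an active monotonicity constraint, which stays active in `x'`; so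
  -- the setup costs cannot grow.
  have hF : ∀ x x' : (ℕ → ℝ) × (ℕ → ℝ), (∀ i, I.cumBound i ≤ cumForm I.T i x) →
      (∀ i, I.cumBound i ≤ cumForm I.T i x') →
      (∀ i, cumForm I.T i x = I.cumBound i → cumForm I.T i x' = I.cumBound i) →
      I.cumCost x' ≤ I.cumCost x → I.cost (I.ofCum x'.1 x'.2) ≤ I.cost (I.ofCum x.1 x.2) := by
    intro x x' hx hx' ht hle
    have hc := (cum_iff hI x).mpr hx
    have hc' := (cum_iff hI x').mpr hx'
    rw [forall_fin_six_prod] at ht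
    simp only [evform, cumBound] at ht
    simp only [cost_ofCum]
    refine add_le_add hle (Finset.sum_le_sum fun t h => ?_)
    rw [Finset.mem_Icc] at h
    obtain ⟨-, hfR, -, -, hfS, -⟩ := hI.2 t h.1 h.2
    obtain ⟨t1, t2, -⟩ := ht t (by omega)
    have i1 : (if x'.1 (t - 1) < x'.1 t then (1 : ℝ) else 0) ≤
        if x.1 (t - 1) < x.1 t then 1 else 0 := by
      split_ifs with h1 h2
      · exact le_rfl
      · have := hc.A_mono t h.1 h.2
        linarith [t1 (by linarith)]
      · exact zero_le_one
      · exact le_rfl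
    have i2 : (if x'.2 (t - 1) < x'.2 t then (1 : ℝ) else 0) ≤
        if x.2 (t - 1) < x.2 t then 1 else 0 := by
      split_ifs with h1 h2
      · exact le_rfl
      · have := hc.B_mono t h.1 h.2
        linarith [t2 (by linarith)]
      · exact zero_le_one
      · exact le_rfl
    gcongr
  obtain ⟨z, hz, hver, hmin⟩ := exists_isVertex_min (cumForm I.T) I.cumBound I.cumCost
    (fun z => I.cost (I.ofCum z.1 z.2)) hrec hφ hF (I.D 1, I.D 1)
    ((cum_iff hI _).mp (exists_cum hI))
  have hc := (cum_iff hI z).mpr hz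
  refine ⟨z.1, z.2, hc, fun A' B' h' => hmin (A', B') ((cum_iff hI (A', B')).mp h'), ?_, ?_⟩
  · intro t h1 h2
    by_contra! hcon
    obtain ⟨c1, c2⟩ := hcon
    have hA := hc.A_mono t h1 h2
    have c2' : z.1 (t - 1) < z.1 t := lt_of_le_of_ne hA (Ne.symm c2)
    have c1' : z.2 (t - 1) < z.1 (t - 1) := by
      refine lt_of_le_of_ne ?_ (Ne.symm c1)
      rcases Nat.eq_or_lt_of_le h1 with h3 | h3
      · subst h3; simp [hc.A_zero, hc.B_zero]
      · exact hc.B_le_A _ (by omega) (by omega)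
    have hB0 : 0 ≤ z.2 (t - 1) := by
      have := mono_of_step hc.B_mono (Nat.zero_le (t - 1)) (by omega)
      rwa [hc.B_zero] at this
    -- The direction raises `A` on its level set of value `A (t - 1)`. It keeps all active
    -- constraints, yet it changes the jump of `A` at `t`.
    have hv := hver (fun n => if z.1 n = z.1 (t - 1) then 1 else 0, fun _ => 0) ?_
    · rw [forall_fin_six_prod] at hv
      have := (hv t (by omega)).1
      rw [(evform _ t _).1] at this
      simp [c2] at this
    · rw [forall_fin_six_prod]
      intro n hn
      simp only [evform, cumBound]
      refine ⟨?_, by simp, ?_, by simp, by simp, ?_⟩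
      · intro h; rw [sub_eq_zero.mp h]; simp
      · intro h
        have h' : z.1 n = z.2 n := sub_eq_zero.mp h
        -- On the level set `n ≤ t - 1`, so that `B n ≤ B (t - 1) < A (t - 1)`: the constraint `B n
        -- ≤ A n` is slack there.
        have : z.1 n ≠ z.1 (t - 1) := by
          intro h3
          have hn' : n ≤ t - 1 := by
            by_contra hlt
            have := mono_of_step hc.A_mono (show t ≤ n by omega) (by omega)
            linarith
          have := mono_of_step hc.B_mono hn' (by omega)
          linarith
        simp [this]
      · intro h
        have : z.1 n ≠ z.1 (t - 1) := by
          intro h3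
          have h4 := mono_of_step hc.A_mono h2 le_rfl
          rw [hc.A_last] at h4
          split_ifs at h <;> linarith
        simp [this]
  · intro k l h1 hkl hl hk hl'
    by_contra! hcon
    -- The level sets of value `B k` of `A` and `B` are raised together, so that an equality `A n =
    -- B n` is preserved. On this set `B` has `k ≤ n < l`, where by assumption it touches neither
    -- bound.
    have hv := hver (fun n => if z.1 n = z.2 k then 1 else 0,
      fun n => if z.2 n = z.2 k then 1 else 0) ?_
    · rw [forall_fin_six_prod] at hv
      have := (hv k (by omega)).2.1
      rw [(evform _ k _).2.1] at this
      simp [hk.ne] at this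
    · have hB0 : 0 ≤ z.2 (k - 1) := by
        have := mono_of_step hc.B_mono (Nat.zero_le (k - 1)) (by omega)
        rwa [hc.B_zero] at this
      have hBT : z.2 k < I.D 1 I.T := by
        have e1 := mono_of_step hc.B_mono hl le_rfl
        have e2 := mono_of_step hc.B_mono (show k ≤ l - 1 by omega) (by omega)
        rw [hc.B_last] at e1
        linarith
      have hrange : ∀ n, n ≤ I.T → z.2 n = z.2 k → k ≤ n ∧ n < l := by
        intro n hn he
        constructor
        · by_contra hlt
          have := mono_of_step hc.B_mono (show n ≤ k - 1 by omega) (by omega)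
          linarith
        · by_contra hlt
          have e1 := mono_of_step hc.B_mono (show l ≤ n by omega) (by omega)
          have e2 := mono_of_step hc.B_mono (show k ≤ l - 1 by omega) (by omega)
          linarith
      rw [forall_fin_six_prod]
      intro n hn
      simp only [evform, cumBound]
      refine ⟨?_, ?_, ?_, ?_, ?_, ?_⟩
      · intro h; rw [sub_eq_zero.mp h]; simp
      · intro h; rw [sub_eq_zero.mp h]; simp
      · intro h; rw [sub_eq_zero.mp h]; simp
      · intro h
        have : z.2 n ≠ z.2 k := by
          intro h3
          obtain ⟨r1, r2⟩ := hrange n (by omega) h3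
          exact (hcon n r1 r2).1 h
        simp [this]
      · intro h
        have : z.2 n ≠ z.2 k := by
          intro h3
          obtain ⟨r1, r2⟩ := hrange n (by omega) h3
          refine (hcon n r1 r2).2 ?_
          simp only [lev] at h
          rw [if_pos ⟨trivial, by omega⟩] at h
          linarith
        simp [this]
      · intro h
        -- The value `B k` exceeds `B (k - 1) ≥ 0`, and it is below the total demand because another
        -- order follows at `l`.
        have : z.1 n ≠ z.2 k := by
          intro h3
          split_ifs at h <;> linarith
        simp [this]

end Data

namespace Data

variable {I : Data}

/-! ### Retailer subplans -/

/-- Supplier cost of holding one unit from period `t` to period `k`. -/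
def unitHold (I : Data) (t k : ℕ) : ℝ := ∑ p ∈ Finset.Ico t k, I.hS p

theorem carry_eq (t k : ℕ) (q : ℝ) : I.carry t k q = I.unitHold t k * q := rfl

theorem unitHold_add {t k m : ℕ} (h : t ≤ k) (h' : k ≤ m) :
    I.unitHold t k + I.unitHold k m = I.unitHold t m :=
  Finset.sum_Ico_consecutive _ h h'

/-- Retailer inventory at the end of period `n` if it has level `α` before period `i` and `x` is
ordered. -/
def inv (I : Data) (α : Bool) (i : ℕ) (x : ℕ → ℝ) (n : ℕ) : ℝ :=
  I.lev α (i - 1) + ∑ m ∈ Finset.Icc i n, x m - I.D i n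

/-- Retailer cost at period `n`. -/
def retCost (I : Data) (α : Bool) (i : ℕ) (x : ℕ → ℝ) (n : ℕ) : ℝ :=
  I.fR n * (if 0 < x n then 1 else 0) + I.pR n * x n + I.hR n * I.inv α i x n

/-- The orders `x` form a feasible retailer plan of the periods `i, …, j` from level `α` to level
`β` which reaches `0` or the bound between any two orders. -/
structure RetPlan (I : Data) (α β : Bool) (t i j : ℕ) (x : ℕ → ℝ) : Prop where
  nonneg : ∀ n, i ≤ n → n ≤ j → 0 ≤ x n
  start_le : ∀ n, i ≤ n → n ≤ j → 0 < x n → t ≤ n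
  inv_nonneg : ∀ n, i ≤ n → n ≤ j → 0 ≤ I.inv α i x n
  inv_le : ∀ n, i ≤ n → n ≤ j → I.inv α i x n ≤ I.u n
  inv_last : I.inv α i x j = I.lev β j
  sep : ∀ k l, i ≤ k → k < l → l ≤ j → 0 < x k → 0 < x l →
    ∃ m, k ≤ m ∧ m < l ∧ (I.inv α i x m = 0 ∨ I.inv α i x m = I.u m)

/-- The orders `x` are a retailer subplan as counted by `G`, of cost `c` and without orders after
period `τ`. -/
structure RealG (I : Data) (α β : Bool) (t i j : ℕ) (x : ℕ → ℝ) (τ : ℕ) (c : ℝ) : Prop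
    extends RetPlan I α β t i j x where
  le_last : ∀ n, i ≤ n → n ≤ j → 0 < x n → n ≤ τ
  t_le : t ≤ τ
  last_le : τ ≤ j
  cost_eq : ∑ n ∈ Finset.Icc i j, (I.retCost α i x n + I.unitHold t n * x n) = c

theorem inv_congr {α : Bool} {i j : ℕ} {x y : ℕ → ℝ} (h : ∀ n, i ≤ n → n ≤ j → x n = y n) {n : ℕ}
    (hn : n ≤ j) : I.inv α i x n = I.inv α i y n := by
  unfold inv
  rw [Finset.sum_congr rfl fun m hm => ?_]
  rw [Finset.mem_Icc] at hm
  exact h m hm.1 (hm.2.trans hn)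

theorem retCost_congr {α : Bool} {i j : ℕ} {x y : ℕ → ℝ} (h : ∀ n, i ≤ n → n ≤ j → x n = y n)
    {n : ℕ} (hi : i ≤ n) (hn : n ≤ j) : I.retCost α i x n = I.retCost α i y n := by
  unfold retCost
  rw [inv_congr h hn, h n hi hn]

/-- Plans read from tables carry meaningless values outside `[i,j]`; only the values inside count.
-/
theorem RetPlan.congr {α β : Bool} {t i j : ℕ} {x y : ℕ → ℝ} (h : I.RetPlan α β t i j x)
    (hxy : ∀ n, i ≤ n → n ≤ j → x n = y n) : I.RetPlan α β t i j y := by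
  refine ⟨fun n h1 h2 => ?_, fun n h1 h2 => ?_, fun n h1 h2 => ?_, fun n h1 h2 => ?_, ?_,
    fun k l h1 h2 h3 => ?_⟩
  · rw [← hxy n h1 h2]; exact h.nonneg n h1 h2
  · rw [← hxy n h1 h2]; exact h.start_le n h1 h2
  · rw [← inv_congr hxy h2]; exact h.inv_nonneg n h1 h2
  · rw [← inv_congr hxy h2]; exact h.inv_le n h1 h2
  · rw [← inv_congr hxy le_rfl]; exact h.inv_last
  · rw [← hxy k h1 (by omega), ← hxy l (by omega) h3]
    intro h4 h5
    obtain ⟨m, m1, m2, m3⟩ := h.sep k l h1 h2 h3 h4 h5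
    exact ⟨m, m1, m2, by rwa [← inv_congr hxy (by omega)]⟩

theorem RealG.congr {α β : Bool} {t i j τ : ℕ} {x y : ℕ → ℝ} {c : ℝ}
    (h : I.RealG α β t i j x τ c) (hxy : ∀ n, i ≤ n → n ≤ j → x n = y n) :
    I.RealG α β t i j y τ c := by
  refine ⟨h.toRetPlan.congr hxy, fun n h1 h2 => ?_, h.t_le, h.last_le, ?_⟩
  · rw [← hxy n h1 h2]; exact h.le_last n h1 h2
  · rw [← h.cost_eq]
    refine Finset.sum_congr rfl fun n hn => ?_
    rw [Finset.mem_Icc] at hn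
    rw [retCost_congr hxy hn.1 hn.2, hxy n hn.1 hn.2]

theorem RetPlan.sum_eq {α β : Bool} {t i j : ℕ} {x : ℕ → ℝ} (h : I.RetPlan α β t i j x) :
    ∑ n ∈ Finset.Icc i j, x n = I.X α β i j := by
  have := h.inv_last
  unfold inv at this
  unfold X
  linarith

theorem RetPlan.eq_zero {α β : Bool} {t i j : ℕ} {x : ℕ → ℝ} (h : I.RetPlan α β t i j x) {n : ℕ}
    (h1 : i ≤ n) (h2 : n ≤ j) (h3 : n < t) : x n = 0 := by
  by_contra h4
  have := h.start_le n h1 h2 (lt_of_le_of_ne (h.nonneg n h1 h2) (Ne.symm h4))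
  omega

theorem RetPlan.of_le {α β : Bool} {t t' i j : ℕ} {x : ℕ → ℝ} (h : I.RetPlan α β t' i j x)
    (ht : t ≤ t') : I.RetPlan α β t i j x :=
  ⟨h.nonneg, fun n h1 h2 h3 => ht.trans (h.start_le n h1 h2 h3), h.inv_nonneg, h.inv_le, h.inv_last,
    h.sep⟩

/-- Making the units available earlier. -/
theorem RealG.of_le {α β : Bool} {t k i j τ : ℕ} {x : ℕ → ℝ} {c : ℝ}
    (h : I.RealG α β k i j x τ c) (ht : t ≤ k) :
    I.RealG α β t i j x τ (c + I.carry t k (I.X α β i j)) := by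
  refine ⟨h.toRetPlan.of_le ht, h.le_last, ht.trans h.t_le, h.last_le, ?_⟩
  rw [← h.cost_eq, carry_eq, ← h.sum_eq, Finset.mul_sum, ← Finset.sum_add_distrib]
  refine Finset.sum_congr rfl fun n hn => ?_
  rw [Finset.mem_Icc] at hn
  rcases (h.nonneg n hn.1 hn.2).eq_or_lt with h0 | h0
  · rw [← h0]; ring
  · rw [← unitHold_add ht (h.start_le n hn.1 hn.2 h0)]; ring

/-- `τ` is only an upper bound of the ordering periods: the recursion records `t`, or an arbitrary
`k`, for parts without orders. -/
theorem RealG.last_mono {α β : Bool} {t i j τ τ' : ℕ} {x : ℕ → ℝ} {c : ℝ}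
    (h : I.RealG α β t i j x τ c) (h1 : τ ≤ τ') (h2 : τ' ≤ j) : I.RealG α β t i j x τ' c :=
  ⟨h.toRetPlan, fun n a b c => (h.le_last n a b c).trans h1, h.t_le.trans h1, h2, h.cost_eq⟩

theorem X_add {α γ β : Bool} {i l j : ℕ} (hi : i ≤ l + 1) (hl : l ≤ j) :
    I.X α γ i l + I.X γ β (l + 1) j = I.X α β i j := by
  unfold X
  rw [← D_add i l j hi hl, Nat.add_sub_cancel]
  ring

/-- A subplan depends on the past only through the level at which it starts. This is what makes
concatenation possible. -/
theorem inv_append {α γ : Bool} {i l n : ℕ} {x x' : ℕ → ℝ} (hi : i ≤ l)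
    (hl : I.inv α i x l = I.lev γ l) (hn : l + 1 ≤ n) :
    I.inv α i (fun m => if m ≤ l then x m else x' m) n = I.inv γ (l + 1) x' n := by
  have h1 : I.inv α i (fun m => if m ≤ l then x m else x' m) l = I.lev γ l := by
    rw [← hl]
    exact inv_congr (fun m _ hm => by simp [hm]) le_rfl
  have h2 : ∑ m ∈ Finset.Icc i n, (if m ≤ l then x m else x' m) =
      ∑ m ∈ Finset.Icc i l, (if m ≤ l then x m else x' m) + ∑ m ∈ Finset.Icc (l + 1) n, x' m := by
    have e : ∀ a b : ℕ, Finset.Icc a b = Finset.Ico a (b + 1) := fun a b => by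
      ext; simp
    rw [e, e, e, ← Finset.sum_Ico_consecutive _ (show i ≤ l + 1 by omega)
      (show l + 1 ≤ n + 1 by omega)]
    congr 1
    refine Finset.sum_congr rfl fun m hm => ?_
    rw [Finset.mem_Ico] at hm
    rw [if_neg (by omega)]
  unfold inv at h1 ⊢
  rw [h2, ← D_add i l n (by omega) (by omega), Nat.add_sub_cancel]
  linarith

theorem RetPlan.append {α γ β : Bool} {t i l j : ℕ} {x x' : ℕ → ℝ} (hi : i ≤ l) (hl : l < j)
    (h : I.RetPlan α γ t i l x) (h' : I.RetPlan γ β t (l + 1) j x') :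
    I.RetPlan α β t i j (fun m => if m ≤ l then x m else x' m) := by
  have e1 : ∀ n, n ≤ l → I.inv α i (fun m => if m ≤ l then x m else x' m) n = I.inv α i x n :=
    fun n hn => inv_congr (fun m _ hm => by simp [hm]) hn
  have e2 : ∀ n, ¬ n ≤ l → I.inv α i (fun m => if m ≤ l then x m else x' m) n =
    I.inv γ (l + 1) x' n := fun n hn => inv_append hi h.inv_last (by omega)
  refine ⟨fun n h1 h2 => ?_, fun n h1 h2 h3 => ?_, fun n h1 h2 => ?_, fun n h1 h2 => ?_, ?_,
    fun k m h1 h2 h3 h4 h5 => ?_⟩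
  · split_ifs with hn
    · exact h.nonneg n h1 hn
    · exact h'.nonneg n (by omega) h2
  · split_ifs at h3 with hn
    · exact h.start_le n h1 hn h3
    · exact h'.start_le n (by omega) h2 h3
  · by_cases hn : n ≤ l
    · rw [e1 n hn]; exact h.inv_nonneg n h1 hn
    · rw [e2 n hn]; exact h'.inv_nonneg n (by omega) h2
  · by_cases hn : n ≤ l
    · rw [e1 n hn]; exact h.inv_le n h1 hn
    · rw [e2 n hn]; exact h'.inv_le n (by omega) h2
  · rw [e2 j (by omega)]; exact h'.inv_last
  · by_cases hm : m ≤ l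
    · rw [if_pos (by omega)] at h4
      rw [if_pos hm] at h5
      obtain ⟨p, p1, p2, p3⟩ := h.sep k m h1 h2 hm h4 h5
      exact ⟨p, p1, p2, by rwa [e1 p (by omega)]⟩
    · by_cases hk : k ≤ l
      -- Orders on different sides of the junction are separated by `l` itself, whose inventory is
      -- the level `γ`.
      · refine ⟨l, hk, by omega, ?_⟩
        rw [e1 l le_rfl, h.inv_last]
        by_cases hg : γ = true ∧ 1 ≤ l
        · right; simp [lev, hg]
        · left; simp only [lev, if_neg hg]
      · rw [if_neg hm] at h5
        rw [if_neg hk] at h4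
        obtain ⟨p, p1, p2, p3⟩ := h'.sep k m (by omega) h2 h3 h4 h5
        exact ⟨p, p1, p2, by rwa [e2 p (by omega)]⟩

/-- The extra term `a` is the holding cost at the supplier when values of `G` are added, and zero
when the supplier is accounted for separately. -/
theorem sum_retCost_append {α γ : Bool} {i l j : ℕ} {x x' : ℕ → ℝ} (hi : i ≤ l) (hl : l < j)
    (h : I.inv α i x l = I.lev γ l) (a : ℕ → ℝ → ℝ) :
    ∑ n ∈ Finset.Icc i j, (I.retCost α i (fun m => if m ≤ l then x m else x' m) n +
        a n (if n ≤ l then x n else x' n)) =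
      ∑ n ∈ Finset.Icc i l, (I.retCost α i x n + a n (x n)) +
        ∑ n ∈ Finset.Icc (l + 1) j, (I.retCost γ (l + 1) x' n + a n (x' n)) := by
  have e : ∀ a b : ℕ, Finset.Icc a b = Finset.Ico a (b + 1) := fun a b => by
    ext; simp
  rw [e, e, e, ← Finset.sum_Ico_consecutive _ (show i ≤ l + 1 by omega)
    (show l + 1 ≤ j + 1 by omega)]
  congr 1
  · refine Finset.sum_congr rfl fun n hn => ?_
    rw [Finset.mem_Ico] at hn
    rw [retCost_congr (j := l) (y := x) (fun m _ hm => by simp [hm]) hn.1 (by omega),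
      if_pos (by omega)]
  · refine Finset.sum_congr rfl fun n hn => ?_
    rw [Finset.mem_Ico] at hn
    rw [retCost, retCost, inv_append hi h hn.1]
    simp only [if_neg (show ¬ n ≤ l by omega)]

theorem RealG.append {α γ β : Bool} {t i l j τ τ' : ℕ} {x x' : ℕ → ℝ} {c c' : ℝ} (hi : i ≤ l)
    (hl : l < j) (hτ : τ ≤ τ') (h : I.RealG α γ t i l x τ c)
    (h' : I.RealG γ β t (l + 1) j x' τ' c') :
    I.RealG α β t i j (fun m => if m ≤ l then x m else x' m) τ' (c + c') := by
  refine ⟨h.toRetPlan.append hi hl h'.toRetPlan, fun n h1 h2 h3 => ?_, h'.t_le, h'.last_le, ?_⟩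
  · split_ifs at h3 with hn
    · exact (h.le_last n h1 hn h3).trans hτ
    · exact h'.le_last n (by omega) h2 h3
  · rw [← h.cost_eq, ← h'.cost_eq]
    exact sum_retCost_append hi hl h.inv_last fun n y => I.unitHold t n * y

/-! ### Single blocks -/

/-- Tightness iterated over several periods: a stock within its bound at `k` that is only consumed
stays within all later bounds. -/
theorem Tight.u_le (hI : I.Tight) {k n : ℕ} (h1 : 1 ≤ k) (hkn : k ≤ n) (hn : n ≤ I.T) :
    I.u k ≤ I.u n + I.D (k + 1) n := by
  induction n, hkn using Nat.le_induction with
  | base => rw [D_self_zero _ _ (by omega), add_zero]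
  | succ n hkn ih =>
    have := hI (n + 1) (by omega) hn
    rw [Nat.add_sub_cancel] at this
    rw [D_succ_right _ _ (by omega)]
    linarith [ih (by omega)]

/-- This covers the part of a block before its order, for both starting levels; thus `φ` needs no
upper bound conditions there. -/
theorem lev_sub_D_le (hV : I.Valid) (hI : I.Tight) (α : Bool) {i n : ℕ} (hi : 1 ≤ i) (hin : i ≤ n)
    (hn : n ≤ I.T) : I.lev α (i - 1) - I.D i n ≤ I.u n := by
  by_cases h : α = true ∧ 1 ≤ i - 1
  · have := hI.u_le (k := i - 1) (n := n) h.2 (by omega) hn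
    rw [Nat.sub_add_cancel hi] at this
    simp only [lev, if_pos h]
    linarith
  · have h1 := hV.D_nonneg i n hi hn
    have h2 := (hV.2 n (by omega) hn).2.2.2.2.2.2.2
    simp only [lev, if_neg h]
    linarith

theorem lev_nonneg (hV : I.Valid) (α : Bool) {i : ℕ} (hi : i ≤ I.T) : 0 ≤ I.lev α i := by
  unfold lev
  split_ifs with h
  · exact (hV.2 i h.2 hi).2.2.2.2.2.2.2
  · exact le_rfl

/-- Without orders the inventory decreases from `α` to `β`. Its final value bounds it below, and
tightness bounds it above. -/
theorem realG_none (hV : I.Valid) (hI : I.Tight) {α β : Bool} {t i j : ℕ} {x : ℕ → ℝ} (hi : 1 ≤ i)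
    (hj : j ≤ I.T) (ht : t ≤ j) (hX : I.X α β i j = 0)
    (hx : ∀ n, i ≤ n → n ≤ j → x n = 0) :
    I.RealG α β t i j x t (∑ n ∈ Finset.Icc i j, I.hR n * (I.lev α (i - 1) - I.D i n)) := by
  have hinv : ∀ n, n ≤ j → I.inv α i x n = I.lev α (i - 1) - I.D i n := by
    intro n hn
    unfold inv
    rw [Finset.sum_eq_zero fun m hm => ?_, add_zero]
    rw [Finset.mem_Icc] at hm
    exact hx m hm.1 (hm.2.trans hn)
  unfold X at hX
  refine ⟨⟨fun n h1 h2 => (hx n h1 h2).ge, fun n h1 h2 h3 => ?_, fun n h1 h2 => ?_, fun n h1 h2 => ?_,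
    ?_, fun k l h1 h2 h3 h4 => ?_⟩, fun n h1 h2 h3 => ?_, le_rfl, ht, ?_⟩
  · rw [hx n h1 h2] at h3; exact absurd h3 (lt_irrefl 0)
  · rw [hinv n h2]
    have := hV.D_mono i n j hi h2 hj
    have := lev_nonneg hV β hj
    linarith
  · rw [hinv n h2]
    exact lev_sub_D_le hV hI α hi h1 (h2.trans hj)
  · rw [hinv j le_rfl]; linarith
  · rw [hx k h1 (by omega)] at h4; exact absurd h4 (lt_irrefl 0)
  · rw [hx n h1 h2] at h3; exact absurd h3 (lt_irrefl 0)
  · refine Finset.sum_congr rfl fun n hn => ?_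
    rw [Finset.mem_Icc] at hn
    simp [retCost, hinv n hn.2, hx n hn.1 hn.2]

/-- Before the order the inventory is what remains of the initial level, and from the order on it is
what the rest of the block still needs. `h0` and `h1` are the feasibility of these two pieces. -/
theorem realG_single {α β : Bool} {t i j k : ℕ} {x : ℕ → ℝ}
    (hik : i ≤ k) (htk : t ≤ k) (hkj : k ≤ j) (hX : 0 < I.X α β i j)
    (hx : ∀ n, i ≤ n → n ≤ j → x n = if n = k then I.X α β i j else 0)
    (h0 : ∀ n, i ≤ n → n < k → 0 ≤ I.lev α (i - 1) - I.D i n ∧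
      I.lev α (i - 1) - I.D i n ≤ I.u n)
    (h1 : ∀ n, k ≤ n → n ≤ j → 0 ≤ I.D (n + 1) j + I.lev β j ∧
      I.D (n + 1) j + I.lev β j ≤ I.u n) :
    I.RealG α β t i j x k (I.fR k + I.pR k * I.X α β i j +
      ∑ n ∈ Finset.Ico i k, I.hR n * (I.lev α (i - 1) - I.D i n) +
      ∑ n ∈ Finset.Icc k j, I.hR n * (I.D (n + 1) j + I.lev β j) +
      I.carry t k (I.X α β i j)) := by
  have hinv : ∀ n, i ≤ n → n ≤ j → I.inv α i x n =
      if n < k then I.lev α (i - 1) - I.D i n else I.D (n + 1) j + I.lev β j := by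
    intro n hn hn'
    have hs : ∑ m ∈ Finset.Icc i n, x m =
        ∑ m ∈ Finset.Icc i n, if m = k then I.X α β i j else 0 := by
      refine Finset.sum_congr rfl fun m hm => ?_
      rw [Finset.mem_Icc] at hm
      exact hx m hm.1 (hm.2.trans hn')
    unfold inv
    rw [hs, Finset.sum_ite_eq']
    by_cases h : n < k
    · rw [if_neg (by simp; omega), if_pos h, add_zero]
    · rw [if_pos (by simp; omega), if_neg h]
      have := D_add (I := I) i n j (by omega) hn'
      unfold X
      linarith
  have honly : ∀ n, i ≤ n → n ≤ j → 0 < x n → n = k := by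
    intro n a b c
    by_contra h
    rw [hx n a b, if_neg h] at c
    exact lt_irrefl _ c
  refine ⟨⟨fun n a b => ?_, fun n a b c => honly n a b c ▸ htk, fun n a b => ?_, fun n a b => ?_,
    ?_, fun p l a b c d e => ?_⟩, fun n a b c => (honly n a b c).le, htk, hkj, ?_⟩
  · rw [hx n a b]; split_ifs <;> linarith
  · rw [hinv n a b]
    split_ifs with h
    · exact (h0 n a h).1
    · exact (h1 n (by omega) b).1
  · rw [hinv n a b]
    split_ifs with h
    · exact (h0 n a h).2
    · exact (h1 n (by omega) b).2
  · rw [hinv j (by omega) le_rfl, if_neg (by omega), D_self_zero _ _ (by omega), zero_add]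
  · have := honly p a (by omega) d
    have := honly l (by omega) c e
    omega
  · have e1 : ∑ n ∈ Finset.Icc i j, (I.retCost α i x n + I.unitHold t n * x n) =
        ∑ n ∈ Finset.Icc i j, (if n = k then
          I.fR k + I.pR k * I.X α β i j + I.carry t k (I.X α β i j) else 0) +
        ∑ n ∈ Finset.Icc i j, I.hR n *
          (if n < k then I.lev α (i - 1) - I.D i n else I.D (n + 1) j + I.lev β j) := by
      rw [← Finset.sum_add_distrib]
      refine Finset.sum_congr rfl fun n hn => ?_
      rw [Finset.mem_Icc] at hn
      rw [retCost, hinv n hn.1 hn.2, hx n hn.1 hn.2, carry_eq]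
      by_cases h : n = k
      · subst h; simp only [if_true, hX]; ring
      · simp only [if_neg h, lt_irrefl, if_false]; ring
    have e : ∀ a b : ℕ, Finset.Icc a b = Finset.Ico a (b + 1) := fun a b => by
      ext; simp
    rw [e1, Finset.sum_ite_eq', if_pos (by simp; omega), e, e,
      ← Finset.sum_Ico_consecutive _ hik (show k ≤ j + 1 by omega)]
    have e2 : ∑ n ∈ Finset.Ico i k, I.hR n *
          (if n < k then I.lev α (i - 1) - I.D i n else I.D (n + 1) j + I.lev β j) =
        ∑ n ∈ Finset.Ico i k, I.hR n * (I.lev α (i - 1) - I.D i n) := by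
      refine Finset.sum_congr rfl fun n hn => ?_
      rw [Finset.mem_Ico] at hn
      rw [if_pos hn.2]
    have e3 : ∑ n ∈ Finset.Ico k (j + 1), I.hR n *
          (if n < k then I.lev α (i - 1) - I.D i n else I.D (n + 1) j + I.lev β j) =
        ∑ n ∈ Finset.Ico k (j + 1), I.hR n * (I.D (n + 1) j + I.lev β j) := by
      refine Finset.sum_congr rfl fun n hn => ?_
      rw [Finset.mem_Ico] at hn
      rw [if_neg (by omega)]
    rw [e2, e3]
    ring

end Data

/-! ### Stage values -/

namespace Stage

theorem mk_coe (c : ℝ) (k : ℕ) : mk (c : WithTop ℝ) k = ((toLex (c, k) : ℝ ×ₗ ℕ) : Stage) := rfl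

theorem mk_top (k : ℕ) : mk ⊤ k = ⊤ := rfl

theorem cost_coe (q : ℝ ×ₗ ℕ) : cost (q : Stage) = ((ofLex q).1 : ℝ) := rfl

theorem cost_top : cost ⊤ = ⊤ := rfl

theorem addCost_top (c : WithTop ℝ) : addCost c ⊤ = ⊤ := rfl

theorem addCost_coe (c : WithTop ℝ) (q : ℝ ×ₗ ℕ) :
    addCost c (q : Stage) = mk (c + ((ofLex q).1 : ℝ)) (ofLex q).2 := rfl

theorem top_addCost (g : Stage) : addCost ⊤ g = ⊤ := by
  cases g using WithTop.recTopCoe with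
  | top => rfl
  | coe q => rw [addCost_coe, top_add]; rfl

theorem addCost_coe_mk (a c : ℝ) (k : ℕ) :
    addCost (a : WithTop ℝ) (mk (c : WithTop ℝ) k) = mk ((a + c : ℝ) : WithTop ℝ) k := rfl

theorem mk_eq_coe {c : WithTop ℝ} {k : ℕ} {q : ℝ ×ₗ ℕ} (h : mk c k = (q : Stage)) :
    c = ((ofLex q).1 : ℝ) ∧ k = (ofLex q).2 := by
  cases c using WithTop.recTopCoe with
  | top => exact absurd h (by rw [mk_top]; exact WithTop.top_ne_coe)
  | coe r =>
    rw [mk_coe, WithTop.coe_inj] at h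
    subst h
    exact ⟨rfl, rfl⟩

theorem eq_mk (q : ℝ ×ₗ ℕ) : (q : Stage) = mk ((ofLex q).1 : ℝ) (ofLex q).2 := rfl

theorem coe_le_coe {c c' : ℝ} {k k' : ℕ} :
    mk (c : WithTop ℝ) k ≤ mk (c' : WithTop ℝ) k' ↔ c < c' ∨ c = c' ∧ k ≤ k' := by
  rw [mk_coe, mk_coe, WithTop.coe_le_coe, Prod.Lex.toLex_le_toLex]

/-- Adding a cost leaves the second component alone, so it respects the lexicographic order and
commutes with minima. Costs common to all candidates can thus be taken out of a minimum without
changing the recorded period. -/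
theorem addCost_mono (c : WithTop ℝ) {g g' : Stage} (h : g ≤ g') : addCost c g ≤ addCost c g' := by
  cases c using WithTop.recTopCoe with
  | top => rw [top_addCost, top_addCost]
  | coe a =>
    cases g' using WithTop.recTopCoe with
    | top => exact le_top
    | coe q' =>
      cases g using WithTop.recTopCoe with
      | top => exact absurd h (not_le.mpr (WithTop.coe_lt_top q'))
      | coe q =>
        rw [eq_mk, eq_mk, coe_le_coe] at h
        rw [eq_mk, eq_mk, addCost_coe_mk, addCost_coe_mk, coe_le_coe]
        rcases h with h | ⟨h, h'⟩
        · left; linarith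
        · right; exact ⟨by rw [h], h'⟩

theorem addCost_min (c : WithTop ℝ) (g g' : Stage) :
    addCost c (min g g') = min (addCost c g) (addCost c g') :=
  Monotone.map_min (fun _ _ h => addCost_mono c h)

theorem addCost_inf (c : WithTop ℝ) {ι : Type*} (s : Finset ι) (f : ι → Stage) :
    addCost c (s.inf f) = s.inf fun i => addCost c (f i) := by
  classical
  induction s using Finset.induction_on with
  | empty => rfl
  | insert a s ha ih => rw [Finset.inf_insert, Finset.inf_insert, ← ih]; exact addCost_min _ _ _

theorem addCost_addCost (a b : WithTop ℝ) (g : Stage) :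
    addCost a (addCost b g) = addCost (b + a) g := by
  cases g using WithTop.recTopCoe with
  | top => rfl
  | coe q =>
    cases a using WithTop.recTopCoe with
    | top => rw [top_addCost, add_top, top_addCost]
    | coe a =>
      cases b using WithTop.recTopCoe with
      | top => rw [top_addCost, top_add, top_addCost]; rfl
      | coe b =>
        rw [eq_mk, addCost_coe_mk, addCost_coe_mk, ← WithTop.coe_add, addCost_coe_mk]
        congr 2
        ring

theorem cost_mk (c : WithTop ℝ) (k : ℕ) : (mk c k).cost = c := by
  cases c using WithTop.recTopCoe <;> rfl

theorem cost_mono {g g' : Stage} (h : g ≤ g') : g.cost ≤ g'.cost := by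
  cases g' using WithTop.recTopCoe with
  | top => exact le_top
  | coe q' =>
    cases g using WithTop.recTopCoe with
    | top => exact absurd h (not_le.mpr (WithTop.coe_lt_top q'))
    | coe q =>
      rw [eq_mk, eq_mk, coe_le_coe] at h
      rw [cost_coe, cost_coe, WithTop.coe_le_coe]
      rcases h with h | ⟨h, -⟩
      · exact h.le
      · exact h.le

end Stage

-- Every finite value of `G` is the cost of a retailer subplan

namespace Data

variable {I : Data}

/-- A finite block cost belongs to a feasible retailer plan with a single order. -/
theorem realG_block (hV : I.Valid) (hI : I.Tight) {α β : Bool} {t i j k : ℕ} {x : ℕ → ℝ} {c : ℝ}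
    (hi : 1 ≤ i) (hj : j ≤ I.T) (hik : i ≤ k) (htk : t ≤ k) (hkj : k ≤ j)
    (hphi : I.phi α β i j k = (c : WithTop ℝ))
    (hx : ∀ n, i ≤ n → n ≤ j → x n = if n = k then I.X α β i j else 0) :
    0 ≤ I.X α β i j ∧ I.RealG α β t i j x k (c + I.carry t k (I.X α β i j)) := by
  unfold phi at hphi
  by_cases hX : I.X α β i j = 0
  -- Nothing is ordered; the period `k` is recorded all the same.
  · rw [if_pos hX, phiNone, if_pos hX, WithTop.coe_inj] at hphi
    rw [hX, carry_eq, mul_zero, add_zero, ← hphi]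
    refine ⟨le_rfl, (realG_none hV hI hi hj (htk.trans hkj) hX fun n h1 h2 => ?_).last_mono htk hkj⟩
    rw [hx n h1 h2, hX, ite_self]
  rw [if_neg hX] at hphi
  have eI : ∀ a b : ℕ, Finset.Icc a b = Finset.Ico a (b + 1) := fun a b => by
    ext; simp
  cases α with
  | false =>
    simp only [phiOrder] at hphi
    split_ifs at hphi with h
    · obtain ⟨rfl, h1, h2⟩ := h
      rw [WithTop.coe_inj] at hphi
      have hX' : 0 < I.X false β k j := by simpa [X, lev] using h1
      refine ⟨hX'.le, ?_⟩
      have := realG_single (I := I) (α := false) (β := β) le_rfl htk hkj hX' hx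
        (fun n a b => absurd b (not_lt.mpr a)) (fun n a b => ⟨?_, ?_⟩)
      · rw [Finset.Ico_self, Finset.sum_empty, add_zero, hphi] at this
        exact this
      · linarith [hV.D_nonneg (n + 1) j (by omega) hj, lev_nonneg hV β hj]
      -- The bound at the ordering period suffices: later inventories are smaller by the demand `D
      -- (k + 1) n`, and `u k ≤ u n + D (k + 1) n`.
      · have e1 := hI.u_le hi a (b.trans hj)
        have e2 := D_add (I := I) (k + 1) n j (by omega) b
        linarith
    · exact absurd hphi WithTop.top_ne_coe
  | true =>
    cases β with
    | true =>
      simp only [phiOrder] at hphi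
      split_ifs at hphi with h
      · obtain ⟨rfl, h1, h2⟩ := h
        rw [WithTop.coe_inj] at hphi
        have hl : I.lev true k = I.u k := by simp [lev, show 1 ≤ k by omega]
        have hX' : 0 < I.X true true i k := by
          unfold X; rw [hl]; linarith
        refine ⟨hX'.le, ?_⟩
        have := realG_single (I := I) (α := true) (β := true) hik htk le_rfl hX' hx
          (fun n a b => ⟨?_, lev_sub_D_le hV hI true hi a (by omega)⟩) (fun n a b => ?_)
        · rw [Finset.Icc_self, Finset.sum_singleton, D_self_zero _ _ (Nat.lt_succ_self k), hl,
            zero_add, hphi] at this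
          exact this
        · linarith [hV.D_mono i n (k - 1) hi (by omega) (by omega)]
        · have : n = k := le_antisymm b a
          subst this
          rw [D_self_zero _ _ (Nat.lt_succ_self n), hl, zero_add]
          exact ⟨(hV.2 n (by omega) hj).2.2.2.2.2.2.2, le_rfl⟩
      · exact absurd hphi WithTop.top_ne_coe
    | false =>
      simp only [phiOrder] at hphi
      split_ifs at hphi with h
      · obtain ⟨-, -, h1, h2, h3⟩ := h
        rw [WithTop.coe_inj] at hphi
        have hl : I.lev false j = 0 := by simp [lev]
        have hX' : 0 < I.X true false i j := by
          unfold X; rw [hl]; linarith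
        refine ⟨hX'.le, ?_⟩
        have := realG_single (I := I) (α := true) (β := false) hik htk hkj hX' hx
          (fun n a b => ⟨?_, lev_sub_D_le hV hI true hi a (by omega)⟩) (fun n a b => ?_)
        · rw [eI, Finset.sum_Ico_succ_top hkj, D_self_zero _ _ (Nat.lt_succ_self j), hl] at this
          simp only [add_zero, mul_zero] at this
          rwa [hphi] at this
        · linarith [hV.D_mono i n (k - 1) hi (by omega) (by omega)]
        · rw [hl, add_zero]
          refine ⟨hV.D_nonneg _ _ (by omega) hj, ?_⟩
          have e1 := hI.u_le (by omega) a (b.trans hj)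
          have e2 := D_add (I := I) (k + 1) n j (by omega) b
          linarith
      · exact absurd hphi WithTop.top_ne_coe

/-- The value `g` of a regular subplan `[i,j]` is attained by a first block `[i,l]` ordered at `k`
which is the whole subplan if `l = j` and is followed by a regular subplan from level `γ`
otherwise. -/
def GWit (I : Data) (α β : Bool) (t i j : ℕ) (g : Stage) (k l : ℕ) (γ : Bool) : Prop :=
  i ≤ k ∧ t ≤ k ∧ k ≤ l ∧ l ≤ j ∧
  ((l = j ∧ γ = β ∧ g = Stage.mk (I.phi α β i j k + (I.carry t k (I.X α β i j) : ℝ)) k) ∨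
   (l < j ∧ g = Stage.addCost (I.phi α γ i l k + (I.carry t k (I.X α β i j) : ℝ))
      (I.G γ β k (l + 1) j)))

theorem coe_of_add_coe {c : WithTop ℝ} {a b : ℝ} (h : c + (a : WithTop ℝ) = (b : WithTop ℝ)) :
    ∃ r : ℝ, c = r ∧ r + a = b := by
  cases c using WithTop.recTopCoe with
  | top => rw [top_add] at h; exact absurd h WithTop.top_ne_coe
  | coe r => exact ⟨r, rfl, by rw [← WithTop.coe_add, WithTop.coe_inj] at h; exact h⟩

/-- The plan is prescribed pointwise by `hx`, which is also the form in which the program writes it,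
so that the lemma serves both the existence statement and the verification of the stored plans. -/
theorem realG_of_wit (hV : I.Valid) (hI : I.Tight) {α β γ : Bool} {t i j k l : ℕ}
    {x x' : ℕ → ℝ} {q : ℝ ×ₗ ℕ} (hi : 1 ≤ i) (hj : j ≤ I.T)
    (hw : I.GWit α β t i j q k l γ)
    (hrec : l < j → ∀ q' : ℝ ×ₗ ℕ, I.G γ β k (l + 1) j = q' →
      I.RealG γ β k (l + 1) j x' (ofLex q').2 (ofLex q').1)
    (hx : ∀ n, i ≤ n → n ≤ j →
      x n = if n ≤ l then (if n = k then I.X α γ i l else 0) else x' n) :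
    I.RealG α β t i j x (ofLex q).2 (ofLex q).1 := by
  obtain ⟨h1, h2, h3, h4, ⟨rfl, rfl, h5⟩ | ⟨h5, h6⟩⟩ := hw
  · obtain ⟨e1, e2⟩ := Stage.mk_eq_coe h5.symm
    obtain ⟨r, e3, e4⟩ := coe_of_add_coe e1
    rw [← e2, ← e4]
    refine (realG_block hV hI hi hj h1 h2 h3 e3 fun n a b => ?_).2
    rw [hx n a b, if_pos b]
  · cases hG : I.G γ β k (l + 1) j using WithTop.recTopCoe with
    | top => rw [hG, Stage.addCost_top] at h6; exact absurd h6 WithTop.coe_ne_top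
    | coe q' =>
      have hr := hrec h5 q' hG
      rw [hG, Stage.addCost_coe] at h6
      obtain ⟨e1, e2⟩ := Stage.mk_eq_coe h6.symm
      obtain ⟨r, e3, e4⟩ := coe_of_add_coe e1
      obtain ⟨r', e5, e6⟩ := coe_of_add_coe e3
      have hb := (realG_block (x := fun n => if n = k then I.X α γ i l else 0)
        hV hI hi (by omega) h1 h2 h3 e5 fun n a b => rfl).2
      have ha := (hb.append (by omega) h5 hr.t_le (hr.of_le h2)).congr (y := x)
        (fun n a b => (hx n a b).symm)
      rw [← e2]
      have hXadd := X_add (I := I) (α := α) (γ := γ) (β := β) (show i ≤ l + 1 by omega) h4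
      -- The whole quantity is held until `k`: its holding cost splits into that of the first block
      -- and that of the rest.
      convert ha using 1
      rw [← e4, ← e6, ← hXadd]
      simp only [carry_eq]
      ring

theorem G_none {α β : Bool} {t i j : ℕ} (hij : i ≤ j) (ht : t ≤ j) (hX : I.X α β i j = 0) :
    I.G α β t i j =
      Stage.mk ((∑ n ∈ Finset.Icc i j, I.hR n * (I.lev α (i - 1) - I.D i n) : ℝ) : WithTop ℝ) t := by
  rw [G, if_pos ⟨hij, ht⟩, if_neg (by rw [hX]; exact lt_irrefl 0), if_pos hX, phiNone, if_pos hX]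

theorem w_eq {α γ β : Bool} {t i j k : ℕ} (h : t ≤ k ∧ i ≤ k) :
    I.w α γ β t i j k = (Finset.Ico k j).inf fun l =>
      Stage.addCost (I.phi α γ i l k + (I.carry t k (I.X α β i j) : ℝ)) (I.G γ β k (l + 1) j) := by
  rw [w, dif_pos h]
  exact Finset.inf_attach (Finset.Ico k j) fun l =>
    Stage.addCost (I.phi α γ i l k + (I.carry t k (I.X α β i j) : ℝ)) (I.G γ β k (l + 1) j)

theorem w_top {α γ β : Bool} {t i j k : ℕ} (h : ¬ (t ≤ k ∧ i ≤ k)) : I.w α γ β t i j k = ⊤ := by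
  rw [w, dif_neg h]

theorem G_pos {α β : Bool} {t i j : ℕ} (hij : i ≤ j) (ht : t ≤ j) (hX : 0 < I.X α β i j) :
    I.G α β t i j = min ((Finset.Icc (max i t) j).inf fun k =>
      Stage.mk (I.phi α β i j k + (I.carry t k (I.X α β i j) : ℝ)) k) (I.v α β t i j) := by
  rw [G, if_pos ⟨hij, ht⟩, if_pos hX]

theorem G_eq_top_of_neg {α β : Bool} {t i j : ℕ} (hX : I.X α β i j < 0) : I.G α β t i j = ⊤ := by
  rw [G]
  split_ifs with h1 h2 h3
  · linarith
  · linarith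
  · rfl
  · rfl

theorem G_eq_top {α β : Bool} {t i j : ℕ} (h : ¬ (i ≤ j ∧ t ≤ j)) : I.G α β t i j = ⊤ := by
  rw [G, if_neg h]

theorem exists_of_inf_ne_top {ι : Type*} {s : Finset ι} {f : ι → Stage} (h : s.inf f ≠ ⊤) :
    ∃ a ∈ s, s.inf f = f a := by
  refine Finset.exists_mem_eq_inf s ?_ f
  by_contra hs
  rw [Finset.not_nonempty_iff_eq_empty] at hs
  subst hs
  exact h rfl

theorem exists_GWit {α β : Bool} {t i j : ℕ} (hij : i ≤ j) (ht : t ≤ j) (hX : 0 < I.X α β i j)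
    (h : I.G α β t i j ≠ ⊤) : ∃ k l γ, I.GWit α β t i j (I.G α β t i j) k l γ := by
  have hG := G_pos hij ht hX
  rcases min_choice ((Finset.Icc (max i t) j).inf fun k =>
      Stage.mk (I.phi α β i j k + (I.carry t k (I.X α β i j) : ℝ)) k) (I.v α β t i j) with h1 | h1
  · rw [h1] at hG
    rw [hG] at h ⊢
    obtain ⟨k, hk, e⟩ := exists_of_inf_ne_top h
    rw [Finset.mem_Icc] at hk
    refine ⟨k, j, β, by omega, by omega, hk.2, le_rfl, Or.inl ⟨rfl, rfl, e⟩⟩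
  · rw [h1] at hG
    rw [hG, v] at h ⊢
    obtain ⟨k, hk, e⟩ := exists_of_inf_ne_top h
    rw [e] at h ⊢
    obtain ⟨γ, -, e'⟩ := exists_of_inf_ne_top h
    rw [e'] at h ⊢
    have hw : t ≤ k ∧ i ≤ k := by
      by_contra hc
      exact h (w_top hc)
    rw [w_eq hw] at h ⊢
    obtain ⟨l, hl, e''⟩ := exists_of_inf_ne_top h
    rw [Finset.mem_Ico] at hl
    exact ⟨k, l, γ, hw.2, hw.1, hl.1, hl.2.le, Or.inr ⟨hl.2, e''⟩⟩

/-- Induction on the length: the first block of an optimal candidate is followed by a shorter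
subplan, available from the ordering period of that block on. -/
theorem G_realizable (hV : I.Valid) (hI : I.Tight) {j : ℕ} (hj : j ≤ I.T) {α β : Bool} {t i : ℕ}
    (hi : 1 ≤ i) {q : ℝ ×ₗ ℕ} (h : I.G α β t i j = q) :
    ∃ x, I.RealG α β t i j x (ofLex q).2 (ofLex q).1 := by
  induction hn : j - i using Nat.strong_induction_on generalizing α β t i q with
  | _ N ih =>
    by_cases hij : i ≤ j ∧ t ≤ j
    · rcases lt_trichotomy (I.X α β i j) 0 with hX | hX | hX
      · rw [G_eq_top_of_neg hX] at h; exact absurd h WithTop.top_ne_coe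
      · rw [G_none hij.1 hij.2 hX] at h
        obtain ⟨e1, e2⟩ := Stage.mk_eq_coe h
        rw [WithTop.coe_inj] at e1
        refine ⟨fun _ => 0, ?_⟩
        rw [← e1, ← e2]
        exact realG_none hV hI hi hj hij.2 hX fun _ _ _ => rfl
      · obtain ⟨k, l, γ, hw⟩ := exists_GWit hij.1 hij.2 hX (by rw [h]; exact WithTop.coe_ne_top)
        rw [h] at hw
        by_cases hl : l < j
        · cases hG : I.G γ β k (l + 1) j using WithTop.recTopCoe with
          | top =>
            obtain ⟨h1, h2, h3, h4, ⟨h5, -⟩ | ⟨-, h6⟩⟩ := hw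
            · omega
            · rw [hG, Stage.addCost_top] at h6; exact absurd h6 WithTop.coe_ne_top
          | coe q' =>
            have hil : i ≤ l := hw.1.trans hw.2.2.1
            obtain ⟨x', hx'⟩ := ih (j - (l + 1)) (by omega) (by omega) hG rfl
            refine ⟨_, realG_of_wit hV hI hi hj hw (x' := x') (fun _ q'' hq'' => ?_)
              fun n _ _ => rfl⟩
            rw [hG, WithTop.coe_inj] at hq''
            rwa [← hq'']
        · exact ⟨_, realG_of_wit hV hI hi hj hw (x' := fun _ => 0) (fun hl' => absurd hl' hl)
              fun n _ _ => rfl⟩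
    · rw [G_eq_top hij] at h; exact absurd h WithTop.top_ne_coe

end Data

namespace Data

variable {I : Data}

/-! ### Subplans of both levels -/

/-- Supplier stock at the end of period `n` if supplier orders `y` are placed from period `t` on
and retailer orders `x` from period `i` on. -/
def stock (t i : ℕ) (x y : ℕ → ℝ) (n : ℕ) : ℝ :=
  ∑ m ∈ Finset.Icc t n, y m - ∑ m ∈ Finset.Icc i n, x m

/-- Supplier cost at period `n`. -/
def supCost (I : Data) (t i : ℕ) (x y : ℕ → ℝ) (n : ℕ) : ℝ :=
  I.fS n * (if 0 < y n then 1 else 0) + I.pS n * y n + I.hS n * stock t i x y n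

/-- The retailer orders `x` and supplier orders `y` are a subplan as counted by `C`, of cost `c`. -/
structure RealC (I : Data) (α β : Bool) (t i j : ℕ) (x y : ℕ → ℝ) (c : ℝ) : Prop
    extends RetPlan I α β t i j x where
  sup_nonneg : ∀ n, t ≤ n → n ≤ j → 0 ≤ y n
  stock_nonneg : ∀ n, t ≤ n → n ≤ j → 0 ≤ stock t i x y n
  stock_last : stock t i x y j = 0
  zio : ∀ n, t < n → n ≤ j → stock t i x y (n - 1) * y n = 0
  cost_eq : ∑ n ∈ Finset.Icc i j, I.retCost α i x n + ∑ n ∈ Finset.Icc t j, I.supCost t i x y n = c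

theorem Icc_eq_Ico_succ (a b : ℕ) : Finset.Icc a b = Finset.Ico a (b + 1) := by
  ext; simp

theorem sum_Icc_split {a m b : ℕ} (h : a ≤ m + 1) (h' : m ≤ b) (f : ℕ → ℝ) :
    ∑ n ∈ Finset.Icc a b, f n = ∑ n ∈ Finset.Icc a m, f n + ∑ n ∈ Finset.Icc (m + 1) b, f n := by
  rw [Icc_eq_Ico_succ, Icc_eq_Ico_succ, Icc_eq_Ico_succ,
    Finset.sum_Ico_consecutive _ h (by omega)]

theorem stock_congr {t i j : ℕ} {x y x' y' : ℕ → ℝ} (hx : ∀ n, i ≤ n → n ≤ j → x n = x' n)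
    (hy : ∀ n, t ≤ n → n ≤ j → y n = y' n) {n : ℕ} (hn : n ≤ j) :
    stock t i x y n = stock t i x' y' n := by
  unfold stock
  congr 1
  · refine Finset.sum_congr rfl fun m hm => ?_
    rw [Finset.mem_Icc] at hm
    exact hy m hm.1 (hm.2.trans hn)
  · refine Finset.sum_congr rfl fun m hm => ?_
    rw [Finset.mem_Icc] at hm
    exact hx m hm.1 (hm.2.trans hn)

theorem RealC.congr {α β : Bool} {t i j : ℕ} {x y x' y' : ℕ → ℝ} {c : ℝ}
    (h : I.RealC α β t i j x y c) (hx : ∀ n, i ≤ n → n ≤ j → x n = x' n)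
    (hy : ∀ n, t ≤ n → n ≤ j → y n = y' n) : I.RealC α β t i j x' y' c := by
  refine ⟨h.toRetPlan.congr hx, fun n h1 h2 => ?_, fun n h1 h2 => ?_, ?_, fun n h1 h2 => ?_, ?_⟩
  · rw [← hy n h1 h2]; exact h.sup_nonneg n h1 h2
  · rw [← stock_congr hx hy h2]; exact h.stock_nonneg n h1 h2
  · rw [← stock_congr hx hy le_rfl]; exact h.stock_last
  · rw [← stock_congr hx hy (by omega), ← hy n h1.le h2]; exact h.zio n h1 h2
  · rw [← h.cost_eq]
    congr 1
    · refine Finset.sum_congr rfl fun n hn => ?_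
      rw [Finset.mem_Icc] at hn
      rw [retCost_congr hx hn.1 hn.2]
    · refine Finset.sum_congr rfl fun n hn => ?_
      rw [Finset.mem_Icc] at hn
      rw [supCost, supCost, stock_congr hx hy hn.2, hy n hn.1 hn.2]

/-- Holding cost of a group of retailer orders delivered from a single supplier order. -/
theorem sum_hold_group {t i l τ : ℕ} {x : ℕ → ℝ} (hτ : τ ≤ l)
    (hx : ∀ n, i ≤ n → n ≤ l → x n ≠ 0 → t ≤ n ∧ n ≤ τ) :
    ∑ n ∈ Finset.Icc t τ, I.hS n * (∑ m ∈ Finset.Icc i l, x m - ∑ m ∈ Finset.Icc i n, x m) =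
      ∑ m ∈ Finset.Icc i l, I.unitHold t m * x m := by
  -- A unit delivered at `m` is in stock at the end of `n` exactly if `n < m`; exchanging the sums
  -- charges each delivery for its time in stock.
  have h1 : ∀ n ∈ Finset.Icc t τ,
      I.hS n * (∑ m ∈ Finset.Icc i l, x m - ∑ m ∈ Finset.Icc i n, x m) =
      ∑ m ∈ Finset.Icc i l, (if n < m then I.hS n else 0) * x m := by
    intro n hn
    rw [Finset.mem_Icc] at hn
    have e : ∑ m ∈ Finset.Icc i n, x m = ∑ m ∈ Finset.Icc i l, if m ≤ n then x m else 0 := by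
      rw [← Finset.sum_filter]
      refine Finset.sum_congr ?_ fun _ _ => rfl
      ext m; simp; omega
    rw [e, ← Finset.sum_sub_distrib, Finset.mul_sum]
    refine Finset.sum_congr rfl fun m _ => ?_
    rcases le_or_gt m n with hm | hm
    · rw [if_pos hm, if_neg (by omega)]; ring
    · rw [if_neg (by omega), if_pos hm]; ring
  rw [Finset.sum_congr rfl h1, Finset.sum_comm]
  refine Finset.sum_congr rfl fun m hm => ?_
  rw [Finset.mem_Icc] at hm
  rw [← Finset.sum_mul]
  by_cases h0 : x m = 0
  · rw [h0, mul_zero, mul_zero]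
  · obtain ⟨a, b⟩ := hx m hm.1 hm.2 h0
    rw [← Finset.sum_filter]
    congr 1
    refine Finset.sum_congr ?_ fun _ _ => rfl
    ext n; simp; omega

/-- Cost of a supplier order of `q` units at period `t`, without setup if `q = 0`. -/
def orderCost (I : Data) (t : ℕ) (q : ℝ) : ℝ := if 0 < q then I.fS t + I.pS t * q else 0

theorem RealG.eq_zero {α β : Bool} {t i j τ : ℕ} {x : ℕ → ℝ} {c : ℝ}
    (h : I.RealG α β t i j x τ c) {n : ℕ} (h1 : i ≤ n) (h2 : n ≤ j) (h3 : τ < n) : x n = 0 := by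
  by_contra h4
  have := h.le_last n h1 h2 (lt_of_le_of_ne (h.nonneg n h1 h2) (Ne.symm h4))
  omega

/-- From `t` to `τ` the stock consists of the undelivered part of one order, so `sum_hold_group`
turns the holding cost into the charges `unitHold` contained in the value of `G`. After `τ` nothing
of the group is left in stock. -/
theorem RealG.sum_supCost {α β : Bool} {t i l τ : ℕ} {x x' y : ℕ → ℝ} {c : ℝ}
    (h : I.RealG α β t i l x τ c) (hy : ∀ n, t ≤ n → n ≤ τ → y n = if n = t then I.X α β i l else 0)
    (hx : ∀ n, i ≤ n → n ≤ τ → x' n = x n) :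
    ∑ n ∈ Finset.Icc t τ, I.supCost t i x' y n =
      I.orderCost t (I.X α β i l) + ∑ m ∈ Finset.Icc i l, I.unitHold t m * x m := by
  rw [← sum_hold_group h.last_le fun n h1 h2 h3 => ?_]
  · have e : ∀ n ∈ Finset.Icc t τ, I.supCost t i x' y n =
        (if n = t then I.orderCost t (I.X α β i l) else 0) +
        I.hS n * (∑ m ∈ Finset.Icc i l, x m - ∑ m ∈ Finset.Icc i n, x m) := by
      intro n hn
      rw [Finset.mem_Icc] at hn
      have e1 : ∑ m ∈ Finset.Icc t n, y m = I.X α β i l := by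
        rw [Finset.sum_congr rfl fun m hm => hy m (Finset.mem_Icc.mp hm).1
          ((Finset.mem_Icc.mp hm).2.trans hn.2), Finset.sum_ite_eq', if_pos (by simp; omega)]
      have e2 : ∑ m ∈ Finset.Icc i n, x' m = ∑ m ∈ Finset.Icc i n, x m :=
        Finset.sum_congr rfl fun m hm => hx m (Finset.mem_Icc.mp hm).1
          ((Finset.mem_Icc.mp hm).2.trans hn.2)
      rw [supCost, stock, e1, e2, h.sum_eq, hy n hn.1 hn.2]
      by_cases hnt : n = t
      · subst hnt
        simp only [if_true, orderCost]
        have := h.sum_eq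
        have h0 : 0 ≤ I.X α β i l := by
          rw [← this]
          exact Finset.sum_nonneg fun m hm => h.nonneg m (Finset.mem_Icc.mp hm).1
            (Finset.mem_Icc.mp hm).2
        rcases h0.eq_or_lt with h0 | h0
        · rw [← h0]; simp
        · simp only [h0, if_true]; ring
      · simp only [if_neg hnt, lt_irrefl, if_false]; ring
    rw [Finset.sum_congr rfl e, Finset.sum_add_distrib, Finset.sum_ite_eq', if_pos]
    rw [Finset.mem_Icc]
    exact ⟨le_rfl, h.t_le⟩
  · have h4 := lt_of_le_of_ne (h.nonneg n h1 h2) (Ne.symm h3)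
    exact ⟨h.start_le n h1 h2 h4, h.le_last n h1 h2 h4⟩

theorem RetPlan.X_nonneg {α β : Bool} {t i j : ℕ} {x : ℕ → ℝ} (h : I.RetPlan α β t i j x) :
    0 ≤ I.X α β i j := by
  rw [← h.sum_eq]
  exact Finset.sum_nonneg fun m hm => h.nonneg m (Finset.mem_Icc.mp hm).1 (Finset.mem_Icc.mp hm).2

theorem RetPlan.sum_le_X {α β : Bool} {t i j : ℕ} {x : ℕ → ℝ} (h : I.RetPlan α β t i j x) {n : ℕ}
    (hn : n ≤ j) : ∑ m ∈ Finset.Icc i n, x m ≤ I.X α β i j := by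
  rw [← h.sum_eq]
  refine Finset.sum_le_sum_of_subset_of_nonneg (Finset.Icc_subset_Icc_right hn) fun m hm _ => ?_
  exact h.nonneg m (Finset.mem_Icc.mp hm).1 (Finset.mem_Icc.mp hm).2

/-- The supplier waits at period `t`. -/
theorem RealC.wait {α β : Bool} {t i j : ℕ} {x y y' : ℕ → ℝ} {c : ℝ}
    (h : I.RealC α β (t + 1) i j x y c) (ht : t < j) (h0 : y' t = 0)
    (hy : ∀ n, t < n → n ≤ j → y' n = y n) : I.RealC α β t i j x y' c := by
  have hs : ∀ n, t ≤ n → n ≤ j → stock t i x y' n = stock (t + 1) i x y n := by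
    intro n h1 h2
    unfold stock
    rw [sum_Icc_split (show t ≤ t + 1 by omega) h1, Finset.Icc_self, Finset.sum_singleton, h0,
      zero_add, Finset.sum_congr rfl fun m hm => hy m (Finset.mem_Icc.mp hm).1
          ((Finset.mem_Icc.mp hm).2.trans h2)]
  have hst : stock (t + 1) i x y t = 0 := by
    unfold stock
    rw [Finset.Icc_eq_empty (by omega), Finset.sum_empty, zero_sub, neg_eq_zero]
    exact Finset.sum_eq_zero fun m hm => h.toRetPlan.eq_zero (Finset.mem_Icc.mp hm).1
      ((Finset.mem_Icc.mp hm).2.trans ht.le) (by have := (Finset.mem_Icc.mp hm).2; omega)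
  refine ⟨h.toRetPlan.of_le (by omega), fun n h1 h2 => ?_, fun n h1 h2 => ?_, ?_,
    fun n h1 h2 => ?_, ?_⟩
  · rcases h1.eq_or_lt with rfl | h1
    · exact h0.ge
    · rw [hy n h1 h2]; exact h.sup_nonneg n h1 h2
  · rw [hs n h1 h2]
    rcases h1.eq_or_lt with rfl | h1
    · exact hst.ge
    · exact h.stock_nonneg n h1 h2
  · rw [hs j ht.le le_rfl]; exact h.stock_last
  · rw [hs _ (by omega) (by omega), hy n h1 h2]
    rcases (show t + 1 ≤ n from h1).eq_or_lt with rfl | h3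
    · rw [Nat.add_sub_cancel, hst, zero_mul]
    · exact h.zio n h3 h2
  · rw [← h.cost_eq, sum_Icc_split (show t ≤ t + 1 by omega) ht.le, Finset.Icc_self,
      Finset.sum_singleton, supCost, hs t le_rfl ht.le, hst, h0]
    simp only [lt_irrefl, if_false, mul_zero, add_zero, zero_add]
    congr 1
    refine Finset.sum_congr rfl fun n hn => ?_
    rw [Finset.mem_Icc] at hn
    rw [supCost, supCost, hs n (by omega) hn.2, hy n hn.1 hn.2]

/-- A single supplier order, at period `t`. -/
theorem RealG.realC {α β : Bool} {t i j τ : ℕ} {x y : ℕ → ℝ} {c : ℝ}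
    (h : I.RealG α β t i j x τ c) (hy : ∀ n, t ≤ n → n ≤ j → y n = if n = t then I.X α β i j else 0) :
    I.RealC α β t i j x y (I.orderCost t (I.X α β i j) + c) := by
  have htj : t ≤ j := h.t_le.trans h.last_le
  have hs : ∀ n, t ≤ n → n ≤ j → stock t i x y n = I.X α β i j - ∑ m ∈ Finset.Icc i n, x m := by
    intro n h1 h2
    unfold stock
    rw [Finset.sum_congr rfl fun m hm => hy m (Finset.mem_Icc.mp hm).1
          ((Finset.mem_Icc.mp hm).2.trans h2), Finset.sum_ite_eq', if_pos (by simp; omega)]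
  refine ⟨h.toRetPlan, fun n h1 h2 => ?_, fun n h1 h2 => ?_, ?_, fun n h1 h2 => ?_, ?_⟩
  · rw [hy n h1 h2]
    split_ifs
    · exact h.toRetPlan.X_nonneg
    · exact le_rfl
  · rw [hs n h1 h2]
    linarith [h.toRetPlan.sum_le_X h2]
  · rw [hs j htj le_rfl, h.sum_eq, sub_self]
  · rw [hy n h1.le h2, if_neg (by omega), mul_zero]
  · rw [(h.last_mono h.last_le le_rfl).sum_supCost hy fun _ _ _ => rfl, ← h.cost_eq,
      Finset.sum_add_distrib]
    ring

/-- A supplier order at period `t` for the periods up to `l`. -/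
theorem RealG.append_realC {α γ β : Bool} {t i l j τ : ℕ} {x x' y y' : ℕ → ℝ} {c c' : ℝ}
    (hi : i ≤ l) (hl : l < j) (h : I.RealG α γ t i l x τ c)
    (h' : I.RealC γ β (τ + 1) (l + 1) j x' y' c')
    (hy : ∀ n, t ≤ n → n ≤ j →
      y n = if n = t then I.X α γ i l else if n ≤ τ then 0 else y' n) :
    I.RealC α β t i j (fun m => if m ≤ l then x m else x' m) y
      (I.orderCost t (I.X α γ i l) + c + c') := by
  have hτl := h.last_le
  have htτ := h.t_le
  have hsy : ∀ n, t ≤ n → n ≤ j →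
      ∑ m ∈ Finset.Icc t n, y m = I.X α γ i l + ∑ m ∈ Finset.Icc (τ + 1) n, y' m := by
    intro n h1 h2
    have e : ∀ m ∈ Finset.Icc t n, y m =
        (if m = t then I.X α γ i l else 0) + if τ + 1 ≤ m then y' m else 0 := by
      intro m hm
      rw [Finset.mem_Icc] at hm
      rw [hy m hm.1 (hm.2.trans h2)]
      by_cases e1 : m = t
      · rw [if_pos e1, if_pos e1, if_neg (by omega), add_zero]
      · rw [if_neg e1, if_neg e1, zero_add]
        by_cases e2 : m ≤ τ
        · rw [if_pos e2, if_neg (by omega)]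
        · rw [if_neg e2, if_pos (by omega)]
    rw [Finset.sum_congr rfl e, Finset.sum_add_distrib, Finset.sum_ite_eq',
      if_pos (by simp; omega), ← Finset.sum_filter]
    congr 1
    refine Finset.sum_congr ?_ fun _ _ => rfl
    ext m; simp; omega
  have hsx : ∀ n, n ≤ l → ∑ m ∈ Finset.Icc i n, (if m ≤ l then x m else x' m) =
      ∑ m ∈ Finset.Icc i n, x m := by
    intro n hn
    refine Finset.sum_congr rfl fun m hm => ?_
    rw [if_pos ((Finset.mem_Icc.mp hm).2.trans hn)]
  have hsx' : ∀ n, l ≤ n → ∑ m ∈ Finset.Icc i n, (if m ≤ l then x m else x' m) =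
      I.X α γ i l + ∑ m ∈ Finset.Icc (l + 1) n, x' m := by
    intro n hn
    rw [sum_Icc_split (show i ≤ l + 1 by omega) hn, hsx l le_rfl, h.sum_eq]
    congr 1
    refine Finset.sum_congr rfl fun m hm => ?_
    rw [if_neg (by have := (Finset.mem_Icc.mp hm).1; omega)]
  have hs1 : ∀ n, t ≤ n → n ≤ τ → stock t i (fun m => if m ≤ l then x m else x' m) y n =
      I.X α γ i l - ∑ m ∈ Finset.Icc i n, x m := by
    intro n h1 h2
    unfold stock
    rw [hsy n h1 (by omega), hsx n (by omega), Finset.Icc_eq_empty (by omega), Finset.sum_empty,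
      add_zero]
  -- From `τ` on the first group is completely delivered, even before its last period `l`, and only
  -- the later plan contributes to the stock.
  have hs2 : ∀ n, τ ≤ n → n ≤ j → stock t i (fun m => if m ≤ l then x m else x' m) y n =
      stock (τ + 1) (l + 1) x' y' n := by
    intro n h1 h2
    unfold stock
    rw [hsy n (by omega) h2]
    by_cases hn : n ≤ l
    · have e : ∑ m ∈ Finset.Icc i n, x m = I.X α γ i l := by
        rw [← h.sum_eq]
        by_cases hin : i ≤ n + 1
        · rw [sum_Icc_split hin hn, left_eq_add]
          exact Finset.sum_eq_zero fun m hm => h.eq_zero (by have := (Finset.mem_Icc.mp hm).1; omega)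
            (Finset.mem_Icc.mp hm).2 (by have := (Finset.mem_Icc.mp hm).1; omega)
        · rw [Finset.Icc_eq_empty (by omega), Finset.sum_empty]
          exact (Finset.sum_eq_zero fun m hm => h.eq_zero (Finset.mem_Icc.mp hm).1
            (Finset.mem_Icc.mp hm).2 (by have := (Finset.mem_Icc.mp hm).1; omega)).symm
      rw [hsx n hn, e, Finset.Icc_eq_empty (show ¬ l + 1 ≤ n by omega), Finset.sum_empty]
      ring
    · rw [hsx' n (by omega)]
      ring
  -- The stock is empty at the handover, which makes an order at `τ + 1` compatible with
  -- zero-inventory ordering.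
  have hst : stock (τ + 1) (l + 1) x' y' τ = 0 := by
    unfold stock
    rw [Finset.Icc_eq_empty (show ¬ τ + 1 ≤ τ by omega),
      Finset.Icc_eq_empty (show ¬ l + 1 ≤ τ by omega), Finset.sum_empty, Finset.sum_empty, sub_self]
  have hy1 : ∀ n, τ < n → n ≤ j → y n = y' n := by
    intro n h1 h2
    rw [hy n (by omega) h2, if_neg (by omega), if_neg (by omega)]
  refine ⟨h.toRetPlan.append hi hl (h'.toRetPlan.of_le (by omega)), fun n h1 h2 => ?_,
    fun n h1 h2 => ?_, ?_, fun n h1 h2 => ?_, ?_⟩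
  · rw [hy n h1 h2]
    split_ifs
    · exact h.toRetPlan.X_nonneg
    · exact le_rfl
    · exact h'.sup_nonneg n (by omega) h2
  · by_cases hn : n ≤ τ
    · rw [hs1 n h1 hn]
      linarith [h.toRetPlan.sum_le_X (hn.trans hτl)]
    · rw [hs2 n (by omega) h2]
      exact h'.stock_nonneg n (by omega) h2
  · rw [hs2 j (by omega) le_rfl]; exact h'.stock_last
  · by_cases hn : n ≤ τ
    · rw [hy n h1.le h2, if_neg (by omega), if_pos hn, mul_zero]
    · rw [hs2 (n - 1) (by omega) (by omega), hy1 n (by omega) h2]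
      rcases (show τ + 1 ≤ n by omega).eq_or_lt with rfl | h3
      · rw [Nat.add_sub_cancel, hst, zero_mul]
      · exact h'.zio n h3 h2
  · have e1 := sum_retCost_append (x' := x') hi hl h.inv_last fun _ _ => 0
    simp only [add_zero] at e1
    have e2 : ∑ n ∈ Finset.Icc (τ + 1) j,
        I.supCost t i (fun m => if m ≤ l then x m else x' m) y n =
        ∑ n ∈ Finset.Icc (τ + 1) j, I.supCost (τ + 1) (l + 1) x' y' n := by
      refine Finset.sum_congr rfl fun n hn => ?_
      rw [Finset.mem_Icc] at hn
      rw [supCost, supCost, hs2 n (by omega) hn.2, hy1 n hn.1 hn.2]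
    rw [e1, sum_Icc_split (show t ≤ τ + 1 by omega) (show τ ≤ j by omega), e2,
      h.sum_supCost (fun n h1 h2 => by rw [hy n h1 (by omega), if_pos h2])
        (fun n h1 h2 => if_pos (h2.trans hτl)), ← h.cost_eq, ← h'.cost_eq, Finset.sum_add_distrib]
    ring

/-! ### Complete plans -/

theorem Feasible.congr {P Q : Plan} (h : I.Feasible P) (hR : Q.sR 0 = P.sR 0)
    (hS : Q.sS 0 = P.sS 0) (heq : ∀ t, 1 ≤ t → t ≤ I.T → Q.xR t = P.xR t ∧ Q.sR t = P.sR t ∧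
      Q.yR t = P.yR t ∧ Q.xS t = P.xS t ∧ Q.sS t = P.sS t ∧ Q.yS t = P.yS t) :
    I.Feasible Q := by
  have hR' : ∀ t, t ≤ I.T → Q.sR t = P.sR t := by
    intro t ht
    rcases Nat.eq_zero_or_pos t with rfl | h0
    · exact hR
    · exact (heq t h0 ht).2.1
  have hS' : ∀ t, t ≤ I.T → Q.sS t = P.sS t := by
    intro t ht
    rcases Nat.eq_zero_or_pos t with rfl | h0
    · exact hS
    · exact (heq t h0 ht).2.2.2.2.1
  refine ⟨hR.trans h.1, hS.trans h.2.1, fun t h1 h2 => ?_⟩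
  obtain ⟨e1, e2, e3, e4, e5, e6⟩ := heq t h1 h2
  rw [e1, e2, e3, e4, e5, e6, hR' (t - 1) (by omega), hS' (t - 1) (by omega)]
  exact h.2.2 t h1 h2

/-- The plan `Q` consists of the orders `x` and `y`. -/
structure IsPlanOf (I : Data) (x y : ℕ → ℝ) (Q : Plan) : Prop where
  sR_zero : Q.sR 0 = 0
  sS_zero : Q.sS 0 = 0
  xR : ∀ t, 1 ≤ t → t ≤ I.T → Q.xR t = x t
  xS : ∀ t, 1 ≤ t → t ≤ I.T → Q.xS t = y t
  sR : ∀ t, 1 ≤ t → t ≤ I.T → Q.sR t = Q.sR (t - 1) + x t - I.d t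
  sS : ∀ t, 1 ≤ t → t ≤ I.T → Q.sS t = Q.sS (t - 1) + y t - x t
  yR : ∀ t, 1 ≤ t → t ≤ I.T → Q.yR t = if 0 < x t then 1 else 0
  yS : ∀ t, 1 ≤ t → t ≤ I.T → Q.yS t = if 0 < y t then 1 else 0

theorem IsPlanOf.sR_eq {x y : ℕ → ℝ} {Q : Plan} (h : I.IsPlanOf x y Q) {t : ℕ} (ht : t ≤ I.T) :
    Q.sR t = I.inv false 1 x t := by
  induction t with
  | zero => simp [h.sR_zero, inv, lev, D_one_zero]
  | succ t ih =>
    rw [h.sR (t + 1) (by omega) ht, Nat.add_sub_cancel, ih (by omega), inv, inv,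
      Finset.sum_Icc_succ_top (by omega), D_succ_right _ _ (by omega)]
    ring

theorem IsPlanOf.sS_eq {x y : ℕ → ℝ} {Q : Plan} (h : I.IsPlanOf x y Q) {t : ℕ} (ht : t ≤ I.T) :
    Q.sS t = stock 1 1 x y t := by
  induction t with
  | zero => simp [h.sS_zero, stock]
  | succ t ih =>
    rw [h.sS (t + 1) (by omega) ht, Nat.add_sub_cancel, ih (by omega), stock, stock,
      Finset.sum_Icc_succ_top (by omega), Finset.sum_Icc_succ_top (by omega)]
    ring

/-- The passage to cumulative orders reuses `Cum.feasible` for the constraints with `M_t`. The block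
property holds because `sep` puts a level between two orders, whereas a block has none inside. -/
theorem RealC.plan (hV : I.Valid) {x y : ℕ → ℝ} {c : ℝ} (h : I.RealC false false 1 1 I.T x y c)
    {Q : Plan} (hQ : I.IsPlanOf x y Q) :
    I.Feasible Q ∧ I.cost Q = c ∧ I.ZeroInvOrdering Q ∧ I.OneOrderPerBlock Q := by
  let A : ℕ → ℝ := fun t => ∑ n ∈ Finset.Icc 1 t, y n
  let B : ℕ → ℝ := fun t => ∑ n ∈ Finset.Icc 1 t, x n
  have hA : ∀ t, 1 ≤ t → A t = A (t - 1) + y t := by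
    intro t ht
    obtain ⟨m, rfl⟩ : ∃ m, t = m + 1 := ⟨t - 1, by omega⟩
    exact Finset.sum_Icc_succ_top (by omega) _
  have hB : ∀ t, 1 ≤ t → B t = B (t - 1) + x t := by
    intro t ht
    obtain ⟨m, rfl⟩ : ∃ m, t = m + 1 := ⟨t - 1, by omega⟩
    exact Finset.sum_Icc_succ_top (by omega) _
  have hinv : ∀ t, I.inv false 1 x t = B t - I.D 1 t := by
    intro t; simp [inv, lev, B]
  have hstock : ∀ t, stock 1 1 x y t = A t - B t := fun t => rfl
  have hB1 : B I.T = I.D 1 I.T := by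
    have := h.inv_last
    rw [hinv] at this
    simp only [lev] at this
    simp at this
    linarith
  have hc : I.Cum A B := by
    refine ⟨by simp [A], by simp [B], fun t h1 h2 => ?_, fun t h1 h2 => ?_, fun t h1 h2 => ?_,
      fun t h1 h2 => ?_, fun t h1 h2 => ?_, ?_, hB1⟩
    · linarith [hA t h1, h.sup_nonneg t h1 h2]
    · linarith [hB t h1, h.nonneg t h1 h2]
    · have := h.stock_nonneg t h1 h2
      rw [hstock] at this; linarith
    · have := h.inv_nonneg t h1 h2
      rw [hinv] at this; linarith
    · have := h.inv_le t h1 h2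
      rw [hinv] at this; linarith
    · have := h.stock_last
      rw [hstock] at this; linarith
  have heq : ∀ t, 1 ≤ t → t ≤ I.T → Q.xR t = (I.ofCum A B).xR t ∧ Q.sR t = (I.ofCum A B).sR t ∧
      Q.yR t = (I.ofCum A B).yR t ∧ Q.xS t = (I.ofCum A B).xS t ∧ Q.sS t = (I.ofCum A B).sS t ∧
      Q.yS t = (I.ofCum A B).yS t := by
    intro t h1 h2
    simp only [ofCum]
    rw [hQ.xR t h1 h2, hQ.xS t h1 h2, hQ.sR_eq h2, hQ.sS_eq h2, hQ.yR t h1 h2, hQ.yS t h1 h2,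
      hA t h1, hB t h1, hinv, hstock, hA t h1, hB t h1]
    refine ⟨by ring, by ring, ?_, by ring, by ring, ?_⟩ <;> simp
  refine ⟨(hc.feasible hV).congr ?_ ?_ heq, ?_, fun t h1 h2 => ?_, ?_⟩
  · simp [hQ.sR_zero, ofCum, B, D_one_zero]
  · simp [hQ.sS_zero, ofCum, A, B]
  · rw [← h.cost_eq, ← Finset.sum_add_distrib]
    refine Finset.sum_congr rfl fun t ht => ?_
    rw [Finset.mem_Icc] at ht
    obtain ⟨h1, h2⟩ := ht
    rw [hQ.xR t h1 h2, hQ.xS t h1 h2, hQ.sR_eq h2, hQ.sS_eq h2, hQ.yR t h1 h2, hQ.yS t h1 h2,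
      retCost, supCost]
    ring
  · rcases h1.eq_or_lt with rfl | h1
    · rw [Nat.sub_self, hQ.sS_zero, zero_mul]
    · rw [hQ.sS_eq (by omega), hQ.xS t h1.le h2]
      exact h.zio t h1 h2
  · have key : ∀ i j, 1 ≤ i → j ≤ I.T → I.IsBlock Q i j → ∀ k l, i ≤ k → l ≤ j →
        0 < Q.xR k → 0 < Q.xR l → ¬ k < l := by
      intro i j hi hj hb k l hk hl h1 h2 hkl
      rw [hQ.xR k (by omega) (by omega)] at h1
      rw [hQ.xR l (by omega) (by omega)] at h2
      obtain ⟨m, m1, m2, m3⟩ := h.sep k l (by omega) hkl (by omega) h1 h2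
      have := hb.2.2 m (by omega) (by omega)
      rw [hQ.sR_eq (by omega)] at this
      rcases m3 with m3 | m3 <;> rw [m3] at this
      · exact lt_irrefl _ this.1
      · exact lt_irrefl _ this.2
    intro i j hi _ hj hb k l k1 k2 l1 l2 h1 h2
    have a := key i j hi hj hb k l k1 l2 h1 h2
    have b := key i j hi hj hb l k l1 k2 h2 h1
    omega

end Data

namespace Data

variable {I : Data}

/-! ### The recursion for the supply chain -/

/-- Candidate for `C` in which the supplier order at period `t` serves `[i,l]` with `l < j`. -/
def CSplit (I : Data) (α γ β : Bool) (t i j l : ℕ) : WithTop ℝ :=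
  match I.G α γ t i l with
  | none => ⊤
  | some q => ((I.orderCost t (I.X α γ i l) + (ofLex q).1 : ℝ) : WithTop ℝ) +
      I.C γ β ((ofLex q).2 + 1) (l + 1) j

theorem CSplit_coe {α γ β : Bool} {t i j l : ℕ} {q : ℝ ×ₗ ℕ} (h : I.G α γ t i l = q) :
    I.CSplit α γ β t i j l = ((I.orderCost t (I.X α γ i l) + (ofLex q).1 : ℝ) : WithTop ℝ) +
      I.C γ β ((ofLex q).2 + 1) (l + 1) j := by
  unfold CSplit
  rw [h]

theorem CSplit_top {α γ β : Bool} {t i j l : ℕ} (h : I.G α γ t i l = ⊤) :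
    I.CSplit α γ β t i j l = ⊤ := by
  unfold CSplit
  rw [h]

theorem C_eq_top {α β : Bool} {t i j : ℕ} (h : ¬ (i ≤ j ∧ t ≤ j)) : I.C α β t i j = ⊤ := by
  rw [C, dif_neg h]

theorem C_nonpos {α β : Bool} {t i j : ℕ} (hX : ¬ 0 < I.X α β i j) :
    I.C α β t i j = (I.G α β t i j).cost := by
  by_cases h : i ≤ j ∧ t ≤ j
  · rw [C, dif_pos h, if_neg hX]
  · rw [C_eq_top h, G_eq_top h]; rfl

theorem X_nonneg_of_G {α β : Bool} {t i j : ℕ} (h : I.G α β t i j ≠ ⊤) : 0 ≤ I.X α β i j := by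
  by_contra hX
  exact h (G_eq_top_of_neg (not_le.mp hX))

/-- When `G` is finite the quantity is nonnegative. For a positive one the indicator term is
infinite; for zero it wins since `f^S_t ≥ 0`. So the inner minimum is `orderCost`. -/
theorem C_pos (hV : I.Valid) {α β : Bool} {t i j : ℕ} (ht : 1 ≤ t) (hj : j ≤ I.T)
    (h : i ≤ j ∧ t ≤ j) (hX : 0 < I.X α β i j) :
    I.C α β t i j = min (I.C α β (t + 1) i j)
      (min ((I.orderCost t (I.X α β i j) : WithTop ℝ) + (I.G α β t i j).cost)
        ((Finset.Ico i j).inf fun l => (Finset.univ : Finset Bool).inf fun γ =>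
          I.CSplit α γ β t i j l)) := by
  have hf : 0 ≤ I.fS t := (hV.2 t ht (h.2.trans hj)).2.2.2.2.1
  rw [C, dif_pos h, if_pos hX, orderCost, if_pos hX]
  congr 2
  refine Eq.trans ?_ (Finset.inf_attach (Finset.Ico i j) fun l =>
    (Finset.univ : Finset Bool).inf fun γ => I.CSplit α γ β t i j l)
  refine Finset.inf_congr rfl fun l _ => Finset.inf_congr rfl fun γ _ => ?_
  cases hG : I.G α γ t i l.1 using WithTop.recTopCoe with
  | top => rw [CSplit_top hG]
  | coe q =>
    rw [CSplit_coe hG]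
    have h0 : 0 ≤ I.X α γ i l.1 := X_nonneg_of_G (by rw [hG]; exact WithTop.coe_ne_top)
    change min ((I.fS t + I.pS t * I.X α γ i l.1 : ℝ) : WithTop ℝ)
      (if I.X α γ i l.1 = 0 then 0 else ⊤) + ((ofLex q).1 : ℝ) + _ = _
    rcases h0.eq_or_lt with h0 | h0
    · rw [if_pos h0.symm, orderCost, if_neg (by rw [← h0]; exact lt_irrefl 0), ← h0, mul_zero,
        add_zero, zero_add, min_eq_right (by exact_mod_cast hf), zero_add]
    · rw [if_neg h0.ne', orderCost, if_pos h0, min_eq_left le_top]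
      simp only [WithTop.coe_add]

/-- Waiting is a candidate whenever something has to be ordered, and otherwise the cost does not
depend on the first supplier period. This monotonicity allows the recursion to keep only the
smallest last ordering period. -/
theorem C_anti (hV : I.Valid) {α β : Bool} {t t' i j : ℕ} (ht : 1 ≤ t) (htt : t ≤ t')
    (hj : j ≤ I.T) (hij : i ≤ j) : I.C α β t i j ≤ I.C α β t' i j := by
  induction t', htt using Nat.le_induction with
  | base => exact le_rfl
  | succ n hn ih =>
    refine ih.trans ?_
    by_cases hnj : n + 1 ≤ j
    · by_cases hX : 0 < I.X α β i j
      · rw [C_pos hV (by omega) hj ⟨hij, by omega⟩ hX]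
        exact min_le_left _ _
      · rw [C_nonpos hX, C_nonpos hX]
        rcases (not_lt.mp hX).eq_or_lt with h0 | h0
        · rw [G_none hij (by omega) h0, G_none hij hnj h0, Stage.cost_mk, Stage.cost_mk]
        · rw [G_eq_top_of_neg h0, G_eq_top_of_neg h0]
    · rw [C_eq_top (t := n + 1) (by omega)]
      exact le_top

/-- The value `c` of `C` is attained by waiting at period `t` if `m = 0`, and otherwise by an order
at period `t` serving `[i,l]`, the inventory at the end of period `l` being at level `γ`. -/
def CWit (I : Data) (α β : Bool) (t i j : ℕ) (c : ℝ) (m l : ℕ) (γ : Bool) : Prop :=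
  if m = 0 then t < j ∧ I.C α β (t + 1) i j = (c : WithTop ℝ)
  else i ≤ l ∧ l ≤ j ∧ ∃ q : ℝ ×ₗ ℕ, I.G α γ t i l = q ∧
    ((l = j ∧ γ = β ∧ c = I.orderCost t (I.X α β i j) + (ofLex q).1) ∨
     (l < j ∧ ∃ c' : ℝ, I.C γ β ((ofLex q).2 + 1) (l + 1) j = (c' : WithTop ℝ) ∧
        c = I.orderCost t (I.X α γ i l) + (ofLex q).1 + c'))

theorem realC_of_wait {α β : Bool} {t i j l : ℕ} {γ : Bool} {c : ℝ} {x y y' : ℕ → ℝ}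
    (hw : I.CWit α β t i j c 0 l γ)
    (hrec : ∀ c' : ℝ, I.C α β (t + 1) i j = (c' : WithTop ℝ) → I.RealC α β (t + 1) i j x y' c')
    (hy : ∀ n, t ≤ n → n ≤ j → y n = if n = t then 0 else y' n) :
    I.RealC α β t i j x y c := by
  rw [CWit, if_pos rfl] at hw
  refine (hrec c hw.2).wait hw.1 ?_ fun n h1 h2 => ?_
  · rw [hy t le_rfl hw.1.le, if_pos rfl]
  · rw [hy n h1.le h2, if_neg (by omega)]

/-- `τ` is the period after which the later supplier orders start. With `l = j` there are none, and
`τ = j` makes the same formula for `y` fill the remaining periods with zeros. -/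
theorem realC_of_order {α β γ : Bool} {t i j m l τ : ℕ} {c : ℝ} {x y xG x' y' : ℕ → ℝ} (hm : m ≠ 0)
    (hw : I.CWit α β t i j c m l γ)
    (hG : ∀ q : ℝ ×ₗ ℕ, I.G α γ t i l = q → I.RealG α γ t i l xG (ofLex q).2 (ofLex q).1)
    (hτ : l < j → ∀ q : ℝ ×ₗ ℕ, I.G α γ t i l = q → τ = (ofLex q).2)
    (hτj : ¬ l < j → τ = j)
    (hrec : l < j → ∀ c' : ℝ, I.C γ β (τ + 1) (l + 1) j = (c' : WithTop ℝ) →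
      I.RealC γ β (τ + 1) (l + 1) j x' y' c')
    (hx : ∀ n, i ≤ n → n ≤ j → x n = if n ≤ l then xG n else x' n)
    (hy : ∀ n, t ≤ n → n ≤ j →
      y n = if n = t then I.X α γ i l else if n ≤ τ then 0 else y' n) :
    I.RealC α β t i j x y c := by
  rw [CWit, if_neg hm] at hw
  obtain ⟨h1, h2, q, h3, ⟨rfl, rfl, h5⟩ | ⟨h4, c', h5, h6⟩⟩ := hw
  · have e := hG q h3
    have hτ' := hτj (lt_irrefl l)
    rw [h5]
    refine (e.congr (y := x) fun n a b => ?_).realC fun n a b => ?_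
    · rw [hx n a b, if_pos b]
    · rw [hy n a b, if_pos (show n ≤ τ by omega)]
  · have hτ' := hτ h4 q h3
    rw [← hτ'] at h5
    have := (hτ' ▸ hG q h3).append_realC h1 h4 (hrec h4 c' h5) hy
    rw [h6]
    exact this.congr (fun n a b => (hx n a b).symm) fun _ _ _ => rfl

theorem exists_of_inf_ne_top' {ι : Type*} {s : Finset ι} {f : ι → WithTop ℝ} (h : s.inf f ≠ ⊤) :
    ∃ a ∈ s, s.inf f = f a := by
  refine Finset.exists_mem_eq_inf s ?_ f
  by_contra hs
  rw [Finset.not_nonempty_iff_eq_empty] at hs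
  subst hs
  exact h rfl

/-- Any nonzero value of `m` marks an order at `t`; the value `1` is used. -/
theorem exists_CWit (hV : I.Valid) {α β : Bool} {t i j : ℕ} {c : ℝ} (ht : 1 ≤ t) (hj : j ≤ I.T)
    (h : I.C α β t i j = (c : WithTop ℝ)) : ∃ m l γ, I.CWit α β t i j c m l γ := by
  by_cases hij : i ≤ j ∧ t ≤ j
  swap
  · rw [C_eq_top hij] at h; exact absurd h WithTop.top_ne_coe
  by_cases hX : 0 < I.X α β i j
  · rw [C_pos hV ht hj hij hX] at h
    rcases min_choice (I.C α β (t + 1) i j)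
      (min ((I.orderCost t (I.X α β i j) : WithTop ℝ) + (I.G α β t i j).cost)
        ((Finset.Ico i j).inf fun l => (Finset.univ : Finset Bool).inf fun γ =>
          I.CSplit α γ β t i j l)) with h1 | h1
    · rw [h1] at h
      have htj : t < j := by
        by_contra hc
        rw [C_eq_top (by omega)] at h
        exact absurd h WithTop.top_ne_coe
      exact ⟨0, 0, false, by rw [CWit, if_pos rfl]; exact ⟨htj, h⟩⟩
    · rw [h1] at h
      rcases min_choice ((I.orderCost t (I.X α β i j) : WithTop ℝ) + (I.G α β t i j).cost)
        ((Finset.Ico i j).inf fun l => (Finset.univ : Finset Bool).inf fun γ =>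
          I.CSplit α γ β t i j l) with h2 | h2
      · rw [h2] at h
        refine ⟨1, j, β, ?_⟩
        rw [CWit, if_neg one_ne_zero]
        cases hG : I.G α β t i j using WithTop.recTopCoe with
        | top => rw [hG, Stage.cost_top, add_top] at h; exact absurd h WithTop.top_ne_coe
        | coe q =>
          rw [hG, Stage.cost_coe, ← WithTop.coe_add, WithTop.coe_inj] at h
          exact ⟨hij.1, le_rfl, q, rfl, Or.inl ⟨rfl, rfl, h.symm⟩⟩
      · rw [h2] at h
        obtain ⟨l, hl, e⟩ := exists_of_inf_ne_top' (by rw [h]; exact WithTop.coe_ne_top)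
        rw [e] at h
        obtain ⟨γ, -, e'⟩ := exists_of_inf_ne_top' (by rw [h]; exact WithTop.coe_ne_top)
        rw [e'] at h
        rw [Finset.mem_Ico] at hl
        refine ⟨1, l, γ, ?_⟩
        rw [CWit, if_neg one_ne_zero]
        cases hG : I.G α γ t i l using WithTop.recTopCoe with
        | top => rw [CSplit_top hG] at h; exact absurd h WithTop.top_ne_coe
        | coe q =>
          rw [CSplit_coe hG, add_comm] at h
          obtain ⟨c', e1, e2⟩ := coe_of_add_coe h
          exact ⟨hl.1, hl.2.le, q, rfl, Or.inr ⟨hl.2, c', e1, by linarith⟩⟩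
  · rw [C_nonpos hX] at h
    refine ⟨1, j, β, ?_⟩
    rw [CWit, if_neg one_ne_zero]
    cases hG : I.G α β t i j using WithTop.recTopCoe with
    | top => rw [hG, Stage.cost_top] at h; exact absurd h WithTop.top_ne_coe
    | coe q =>
      rw [hG, Stage.cost_coe, WithTop.coe_inj] at h
      -- A subplan with `X ≤ 0` counts as served at `t` by an order of zero units, which is free in
      -- `orderCost`.
      refine ⟨hij.1, le_rfl, q, rfl, Or.inl ⟨rfl, rfl, ?_⟩⟩
      rw [orderCost, if_neg hX, zero_add, h]

/-- Induction on the two remaining lengths together: waiting shortens that of the supplier, and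
splitting off `[i,l]` shortens both, because the stored period is at least `t`. -/
theorem C_realizable (hV : I.Valid) (hI : I.Tight) {j : ℕ} (hj : j ≤ I.T) {α β : Bool} {t i : ℕ}
    (ht : 1 ≤ t) (hi : 1 ≤ i) {c : ℝ} (h : I.C α β t i j = (c : WithTop ℝ)) :
    ∃ x y, I.RealC α β t i j x y c := by
  induction hn : j + 1 - i + (j + 1 - t) using Nat.strong_induction_on
    generalizing α β t i c with
  | _ N ih =>
    have hij : i ≤ j ∧ t ≤ j := by
      by_contra hc
      rw [C_eq_top hc] at h
      exact absurd h WithTop.top_ne_coe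
    obtain ⟨m, l, γ, hw⟩ := exists_CWit hV ht hj h
    by_cases hm : m = 0
    · subst hm
      have hw' := hw
      rw [CWit, if_pos rfl] at hw'
      obtain ⟨x, y, hxy⟩ := ih (j + 1 - i + (j + 1 - (t + 1))) (by omega) (by omega) hi hw'.2 rfl
      refine ⟨x, _, realC_of_wait hw (y' := y) (fun c' hc' => ?_) fun n _ _ => rfl⟩
      rw [hw'.2, WithTop.coe_inj] at hc'
      rwa [← hc']
    · have hw' := hw
      rw [CWit, if_neg hm] at hw'
      obtain ⟨h1, h2, q, h3, h4⟩ := hw'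
      obtain ⟨xG, hxG⟩ := G_realizable hV hI (h2.trans hj) hi h3
      have hG : ∀ q' : ℝ ×ₗ ℕ, I.G α γ t i l = q' →
          I.RealG α γ t i l xG (ofLex q').2 (ofLex q').1 := by
        intro q' hq'
        rw [h3, WithTop.coe_inj] at hq'
        rwa [← hq']
      by_cases hl : l < j
      · rcases h4 with ⟨h4, -⟩ | ⟨-, c', h5, h6⟩
        · omega
        obtain ⟨x', y', hxy⟩ := ih (j + 1 - (l + 1) + (j + 1 - ((ofLex q).2 + 1)))
          (by have := hxG.t_le; omega) (by omega) (by omega) h5 rfl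
        refine ⟨_, _, realC_of_order hm hw hG (τ := (ofLex q).2) (x' := x') (y' := y') (fun _ q' hq' => ?_)
          (fun hl' => absurd hl hl') (fun _ c'' hc'' => ?_) (fun n _ _ => rfl) fun n _ _ => rfl⟩
        · rw [h3, WithTop.coe_inj] at hq'
          rw [hq']
        · rw [h5, WithTop.coe_inj] at hc''
          rwa [← hc'']
      · exact ⟨_, _, realC_of_order hm hw hG (τ := j) (x' := fun _ => 0) (y' := fun _ => 0)
          (fun hl' => absurd hl' hl) (fun _ => rfl) (fun hl' => absurd hl' hl) (fun n _ _ => rfl)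
          fun n _ _ => rfl⟩

end Data

namespace Data

variable {I : Data}

/-! ### Lower bounds -/

/-- The cumulative orders `A`, `B` are an optimal plan with the structure of a vertex. -/
structure OptCum (I : Data) (A B : ℕ → ℝ) : Prop extends I.Cum A B where
  cost_le : ∀ A' B', I.Cum A' B' → I.cost (I.ofCum A B) ≤ I.cost (I.ofCum A' B')
  zio : ∀ t, 1 ≤ t → t ≤ I.T → A (t - 1) = B (t - 1) ∨ A t = A (t - 1)
  sep : ∀ k l, 1 ≤ k → k < l → l ≤ I.T → B (k - 1) < B k → B (l - 1) < B l →
    ∃ m, k ≤ m ∧ m < l ∧ (B m = I.D 1 m ∨ B m = I.D 1 m + I.u m)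

/-- The retailer inventory is `0` or at its bound. -/
def AtLevel (I : Data) (B : ℕ → ℝ) (n : ℕ) : Prop :=
  B n = I.D 1 n ∨ (1 ≤ n ∧ B n = I.D 1 n + I.u n)

/-- Label of the retailer inventory, `0` if possible. -/
def label (I : Data) (B : ℕ → ℝ) (n : ℕ) : Bool :=
  open Classical in decide (B n ≠ I.D 1 n)

theorem label_eq_false {B : ℕ → ℝ} {n : ℕ} : I.label B n = false ↔ B n = I.D 1 n := by
  simp [label]

theorem label_eq_true {B : ℕ → ℝ} {n : ℕ} : I.label B n = true ↔ B n ≠ I.D 1 n := by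
  simp [label]

/-- If the bound itself is `0`, the label is "0". At period `0` only the level zero is admitted, in
accordance with `u_0 = 0`. -/
theorem AtLevel.lev_eq {B : ℕ → ℝ} {n : ℕ} (h : I.AtLevel B n) :
    I.lev (I.label B n) n = B n - I.D 1 n := by
  rcases hb : I.label B n with _ | _
  · rw [label_eq_false] at hb
    simp [lev, hb]
  · rw [label_eq_true] at hb
    rcases h with h | ⟨h1, h2⟩
    · exact absurd h hb
    · simp only [lev, h1, and_self, if_true]
      linarith

/-- Retailer orders of cumulative orders. -/
def inc (B : ℕ → ℝ) (n : ℕ) : ℝ := B n - B (n - 1)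

theorem sum_inc (B : ℕ → ℝ) {i j : ℕ} (hi : 1 ≤ i) (hij : i ≤ j + 1) :
    ∑ n ∈ Finset.Icc i j, inc B n = B j - B (i - 1) := by
  rw [Icc_eq_Ico_succ]
  induction j with
  | zero =>
    obtain rfl : i = 1 := by omega
    simp
  | succ j ih =>
    rcases Nat.eq_or_lt_of_le hij with h | h
    · subst h; simp
    · rw [Finset.sum_Ico_succ_top (by omega), ih (by omega)]
      simp [inc]

theorem inv_inc {B : ℕ → ℝ} {i n : ℕ} (h : I.AtLevel B (i - 1)) (hi : 1 ≤ i) (hin : i ≤ n + 1) :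
    I.inv (I.label B (i - 1)) i (inc B) n = B n - I.D 1 n := by
  have := D_add (I := I) 1 (i - 1) n (by omega) (by omega)
  rw [Nat.sub_add_cancel hi] at this
  rw [inv, h.lev_eq, sum_inc B hi hin]
  linarith

theorem X_inc {B : ℕ → ℝ} {i j : ℕ} (h : I.AtLevel B (i - 1)) (h' : I.AtLevel B j) (hi : 1 ≤ i)
    (hij : i ≤ j + 1) : I.X (I.label B (i - 1)) (I.label B j) i j = B j - B (i - 1) := by
  have := D_add (I := I) 1 (i - 1) j (by omega) (by omega)
  rw [Nat.sub_add_cancel hi] at this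
  rw [X, h.lev_eq, h'.lev_eq]
  linarith

/-- Retailer cost at period `n`. -/
def rc (I : Data) (B : ℕ → ℝ) (n : ℕ) : ℝ :=
  I.fR n * (if 0 < inc B n then 1 else 0) + I.pR n * inc B n + I.hR n * (B n - I.D 1 n)

/-- Supplier cost at period `n`. -/
def sc (I : Data) (A B : ℕ → ℝ) (n : ℕ) : ℝ :=
  I.fS n * (if 0 < inc A n then 1 else 0) + I.pS n * inc A n + I.hS n * (A n - B n)

theorem cost_ofCum_eq (A B : ℕ → ℝ) : I.cost (I.ofCum A B) =
    ∑ n ∈ Finset.Icc 1 I.T, (I.rc B n + I.sc A B n) := by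
  refine Finset.sum_congr rfl fun n _ => ?_
  simp only [ofCum, rc, sc, inc, sub_pos]
  ring

/-- Cost of the retailer orders of `[i,j]` if the units are available at the supplier from period
`t` on. -/
def groupCost (I : Data) (B : ℕ → ℝ) (t i j : ℕ) : ℝ :=
  ∑ n ∈ Finset.Icc i j, (I.rc B n + I.unitHold t n * inc B n)

theorem Cum.inc_nonneg {A B : ℕ → ℝ} (h : I.Cum A B) {n : ℕ} (h1 : 1 ≤ n) (h2 : n ≤ I.T) :
    0 ≤ inc B n := sub_nonneg.mpr (h.B_mono n h1 h2)

theorem inc_eq_zero_of_eq {A B : ℕ → ℝ} (h : I.Cum A B) {i j : ℕ} (hi : 1 ≤ i) (hj : j ≤ I.T)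
    (he : B j = B (i - 1)) {n : ℕ} (h1 : i ≤ n) (h2 : n ≤ j) : inc B n = 0 := by
  have e1 := mono_of_step h.B_mono (show i - 1 ≤ n - 1 by omega) (by omega)
  have e2 := mono_of_step h.B_mono h2 hj
  have e3 := h.inc_nonneg (n := n) (by omega) (by omega)
  unfold inc at e3 ⊢
  linarith

/-- Cost of a block with at most one order. -/
theorem phi_inc (hV : I.Valid) (hI : I.Tight) {A B : ℕ → ℝ} (h : I.Cum A B) {i j k : ℕ}
    (hi : 1 ≤ i) (hj : j ≤ I.T) (hik : i ≤ k) (hkj : k ≤ j) (b1 : I.AtLevel B (i - 1))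
    (b2 : I.AtLevel B j) (hint : ∀ m, i ≤ m → m < j → ¬ I.AtLevel B m)
    (hone : ∀ n, i ≤ n → n ≤ j → n ≠ k → inc B n = 0) :
    I.phi (I.label B (i - 1)) (I.label B j) i j k =
      ((∑ n ∈ Finset.Icc i j, I.rc B n : ℝ) : WithTop ℝ) := by
  have hX := X_inc b1 b2 hi (show i ≤ j + 1 by omega)
  -- With `k` as the only possible order, `B` is constant before `k` and constant from `k` on.
  have hlow : ∀ n, i ≤ n + 1 → n < k → B n = B (i - 1) := by
    intro n hn hnk
    have := sum_inc B hi hn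
    rw [Finset.sum_eq_zero fun m hm => hone m (Finset.mem_Icc.mp hm).1
      (by have := (Finset.mem_Icc.mp hm).2; omega) (by have := (Finset.mem_Icc.mp hm).2; omega)] at this
    linarith
  have hhigh : ∀ n, k ≤ n → n ≤ j → B n = B j := by
    intro n hn hnj
    have := sum_inc B (show 1 ≤ n + 1 by omega) (show n + 1 ≤ j + 1 by omega)
    rw [Finset.sum_eq_zero fun m hm => hone m (by have := (Finset.mem_Icc.mp hm).1; omega)
      (Finset.mem_Icc.mp hm).2 (by have := (Finset.mem_Icc.mp hm).1; omega), Nat.add_sub_cancel]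
      at this
    linarith
  have hDlow : ∀ n, i ≤ n + 1 → I.D 1 n = I.D 1 (i - 1) + I.D i n := by
    intro n hn
    have := D_add (I := I) 1 (i - 1) n (by omega) (by omega)
    rw [Nat.sub_add_cancel hi] at this
    exact this.symm
  have hDhigh : ∀ n, n ≤ j → I.D 1 n = I.D 1 j - I.D (n + 1) j := by
    intro n hn
    have := D_add (I := I) 1 n j (by omega) hn
    linarith
  have l1 := b1.lev_eq
  have l2 := b2.lev_eq
  have slow : ∀ n, i ≤ n + 1 → n < k →
      B n - I.D 1 n = I.lev (I.label B (i - 1)) (i - 1) - I.D i n := by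
    intro n hn hnk
    rw [hlow n hn hnk, hDlow n hn, l1]; ring
  have shigh : ∀ n, k ≤ n → n ≤ j → B n - I.D 1 n = I.D (n + 1) j + I.lev (I.label B j) j := by
    intro n hn hnj
    rw [hhigh n hn hnj, hDhigh n hnj, l2]; ring
  have hpos : ∀ n, i ≤ n → n < j → I.D 1 n < B n ∧ B n < I.D 1 n + I.u n := by
    intro n hn hnj
    have h1 := hint n hn hnj
    have h2 := h.D_le_B n (by omega) (by omega)
    have h3 := h.B_le n (by omega) (by omega)
    constructor
    · exact lt_of_le_of_ne h2 fun e => h1 (Or.inl e.symm)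
    · exact lt_of_le_of_ne h3 fun e => h1 (Or.inr ⟨by omega, e⟩)
  by_cases hX0 : I.X (I.label B (i - 1)) (I.label B j) i j = 0
  · rw [phi, if_pos hX0, phiNone, if_pos hX0, WithTop.coe_inj]
    rw [hX] at hX0
    refine Finset.sum_congr rfl fun n hn => ?_
    obtain ⟨n1, n2⟩ := Finset.mem_Icc.mp hn
    have h0 : ∀ m, i ≤ m → m ≤ j → inc B m = 0 := fun m a b =>
      inc_eq_zero_of_eq h hi hj (by linarith) a b
    have := sum_inc B hi (show i ≤ n + 1 by omega)
    rw [Finset.sum_eq_zero fun m hm => h0 m (Finset.mem_Icc.mp hm).1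
      ((Finset.mem_Icc.mp hm).2.trans n2)] at this
    rw [rc, h0 n n1 n2, hDlow n (by omega), l1]
    simp only [lt_irrefl, if_false, mul_zero, zero_add]
    rw [show B n = B (i - 1) by linarith]
    ring
  rw [phi, if_neg hX0]
  have hk : inc B k = B j - B (i - 1) := by
    rw [← sum_inc B hi (show i ≤ j + 1 by omega)]
    refine (Finset.sum_eq_single k (fun n hn hnk => ?_) fun hk => ?_).symm
    · exact hone n (Finset.mem_Icc.mp hn).1 (Finset.mem_Icc.mp hn).2 hnk
    · exact absurd (Finset.mem_Icc.mpr ⟨hik, hkj⟩) hk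
  have hXpos : 0 < B j - B (i - 1) := by
    rw [hX] at hX0
    exact lt_of_le_of_ne (hk ▸ h.inc_nonneg (by omega) (by omega)) (Ne.symm hX0)
  have hsum : ∑ n ∈ Finset.Icc i j, I.rc B n = I.fR k +
      I.pR k * I.X (I.label B (i - 1)) (I.label B j) i j +
      ∑ n ∈ Finset.Ico i k, I.hR n * (I.lev (I.label B (i - 1)) (i - 1) - I.D i n) +
      ∑ n ∈ Finset.Icc k j, I.hR n * (I.D (n + 1) j + I.lev (I.label B j) j) := by
    have e1 : ∑ n ∈ Finset.Icc i j, I.rc B n = ∑ n ∈ Finset.Icc i j, (if n = k then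
        I.fR k + I.pR k * I.X (I.label B (i - 1)) (I.label B j) i j else 0) +
        ∑ n ∈ Finset.Icc i j, I.hR n * (B n - I.D 1 n) := by
      rw [← Finset.sum_add_distrib]
      refine Finset.sum_congr rfl fun n hn => ?_
      obtain ⟨n1, n2⟩ := Finset.mem_Icc.mp hn
      rw [rc, hX]
      by_cases hnk : n = k
      · subst hnk
        rw [hk]
        simp only [hXpos, if_true, mul_one]
      · rw [hone n n1 n2 hnk]
        simp only [lt_irrefl, if_false, if_neg hnk, mul_zero, add_zero]
    have e2 : ∑ n ∈ Finset.Ico i k, I.hR n * (B n - I.D 1 n) =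
        ∑ n ∈ Finset.Ico i k, I.hR n * (I.lev (I.label B (i - 1)) (i - 1) - I.D i n) := by
      refine Finset.sum_congr rfl fun n hn => ?_
      obtain ⟨n1, n2⟩ := Finset.mem_Ico.mp hn
      rw [slow n (by omega) n2]
    have e3 : ∑ n ∈ Finset.Icc k j, I.hR n * (B n - I.D 1 n) =
        ∑ n ∈ Finset.Icc k j, I.hR n * (I.D (n + 1) j + I.lev (I.label B j) j) := by
      refine Finset.sum_congr rfl fun n hn => ?_
      obtain ⟨n1, n2⟩ := Finset.mem_Icc.mp hn
      rw [shigh n n1 n2]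
    rw [e1, Finset.sum_ite_eq', if_pos (Finset.mem_Icc.mpr ⟨hik, hkj⟩), Icc_eq_Ico_succ i j,
      ← Finset.sum_Ico_consecutive _ hik (show k ≤ j + 1 by omega), ← Icc_eq_Ico_succ, e2, e3]
    ring
  rcases ha : I.label B (i - 1) with _ | _
  · rw [ha] at hsum hX l1 slow
    have hz : I.lev false (i - 1) = 0 := by simp [lev]
    -- Starting empty, the retailer cannot postpone the order: without it the inventory at `i` would
    -- not be positive, although `i` is interior to the block.
    obtain rfl : k = i := by
      by_contra hne
      have := hpos i le_rfl (by omega)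
      have e := slow i (by omega) (by omega)
      rw [hz] at e
      linarith [hV.D_nonneg i i hi (by omega)]
    have e : 0 < I.D k j + I.lev (I.label B j) j := by
      unfold X at hX; rw [hz] at hX; linarith
    have e' : I.D (k + 1) j + I.lev (I.label B j) j ≤ I.u k := by
      rw [← shigh k le_rfl hkj]
      linarith [h.B_le k hi (by omega)]
    simp only [phiOrder]
    rw [if_pos ⟨trivial, e, e'⟩, WithTop.coe_inj, hsum, Finset.Ico_self, Finset.sum_empty, add_zero]
  · rw [ha] at hsum hX l1 slow
    rw [label_eq_true] at ha
    have hlevpos : 0 < I.lev true (i - 1) := by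
      have hge : I.D 1 (i - 1) ≤ B (i - 1) := by
        rcases hi.eq_or_lt with rfl | hi'
        · simp [D_one_zero, h.B_zero]
        · exact h.D_le_B _ (by omega) (by omega)
      rw [l1]
      exact sub_pos.mpr (lt_of_le_of_ne hge (Ne.symm ha))
    -- The inventory before the order is still positive: for `k = i` it is the initial level, and
    -- otherwise `k - 1` is interior to the block.
    have hbefore : I.D i (k - 1) < I.lev true (i - 1) := by
      rcases hik.eq_or_lt with rfl | hlt
      · rw [D_self_zero _ _ (by omega)]; exact hlevpos
      · have e1 := slow (k - 1) (by omega) (by omega)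
        have e2 := (hpos (k - 1) (by omega) (by omega)).1
        linarith
    rcases hb : I.label B j with _ | _
    · rw [hb] at hsum hX l2 shigh
      have hz : I.lev false j = 0 := by simp [lev]
      have e1 : I.lev true (i - 1) < I.D i j := by
        unfold X at hX; rw [hz] at hX; linarith
      have e2 : I.D (k + 1) j ≤ I.u k := by
        have := shigh k le_rfl hkj
        rw [hz] at this
        linarith [h.B_le k (by omega) (by omega)]
      simp only [phiOrder]
      rw [if_pos ⟨hik, hkj, e1, hbefore, e2⟩, WithTop.coe_inj, hsum, hz]
      simp only [add_zero]
      rw [Icc_eq_Ico_succ, Finset.sum_Ico_succ_top hkj, D_self_zero _ _ (Nat.lt_succ_self j),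
        mul_zero, add_zero]
    · rw [hb] at hsum hX l2 shigh
      have hl : I.lev true j = I.u j := by simp [lev, show 1 ≤ j by omega]
      -- An order at `k < j` would leave the inventory `D (k + 1) j + u j`, which is at least `u k`
      -- by tightness, against the strict bound inside a block.
      obtain rfl : k = j := by
        by_contra hne
        have e1 := shigh k le_rfl hkj
        have e2 := (hpos k hik (by omega)).2
        have e3 := hI.u_le (k := k) (n := j) (by omega) hkj hj
        rw [hl] at e1
        linarith
      have e1 : I.lev true (i - 1) < I.D i k + I.u k := by
        unfold X at hX; rw [hl] at hX; linarith
      simp only [phiOrder]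
      rw [if_pos ⟨trivial, e1, hbefore⟩, WithTop.coe_inj, hsum, Finset.Icc_self, Finset.sum_singleton,
        D_self_zero _ _ (Nat.lt_succ_self k), hl, zero_add]

end Data

-- Comparison of `G` with the retailer groups of an optimal plan

namespace Data

variable {I : Data}

theorem exists_next_level {B : ℕ → ℝ} {i j : ℕ} (hij : i ≤ j) (h : I.AtLevel B j) :
    ∃ e, i ≤ e ∧ e ≤ j ∧ I.AtLevel B e ∧ ∀ m, i ≤ m → m < e → ¬ I.AtLevel B m := by
  classical
  have hex : ∃ e, i ≤ e ∧ I.AtLevel B e := ⟨j, hij, h⟩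
  refine ⟨Nat.find hex, (Nat.find_spec hex).1, Nat.find_min' hex ⟨hij, h⟩, (Nat.find_spec hex).2,
    fun m h1 h2 h3 => Nat.find_min hex h2 ⟨h1, h3⟩⟩

/-- Between two orders a vertex reaches a level, and there is none strictly inside the interval. -/
theorem OptCum.one_order {A B : ℕ → ℝ} (h : I.OptCum A B) {i e : ℕ} (hi : 1 ≤ i) (he : e ≤ I.T)
    (hint : ∀ m, i ≤ m → m < e → ¬ I.AtLevel B m) {k l : ℕ} (hk : i ≤ k) (hkl : k < l)
    (hl : l ≤ e) (h1 : 0 < inc B k) (h2 : 0 < inc B l) : False := by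
  obtain ⟨m, m1, m2, m3⟩ := h.sep k l (by omega) hkl (by omega) (sub_pos.mp h1) (sub_pos.mp h2)
  refine hint m (by omega) (by omega) ?_
  rcases m3 with m3 | m3
  · exact Or.inl m3
  · exact Or.inr ⟨by omega, m3⟩

theorem Cum.inc_eq_zero {A B : ℕ → ℝ} (h : I.Cum A B) {n : ℕ} (h1 : 1 ≤ n) (h2 : n ≤ I.T)
    (h3 : ¬ 0 < inc B n) : inc B n = 0 :=
  le_antisymm (not_lt.mp h3) (h.inc_nonneg h1 h2)

/-- `G` is at most the cost of the corresponding part of a structured plan. -/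
theorem OptCum.G_le (hV : I.Valid) (hI : I.Tight) {A B : ℕ → ℝ} (h : I.OptCum A B) {j : ℕ}
    (hj : j ≤ I.T) (b2 : I.AtLevel B j) {i t τ : ℕ} (hi : 1 ≤ i) (hij : i ≤ j)
    (b1 : I.AtLevel B (i - 1)) (htτ : t ≤ τ) (hτ : τ ≤ j)
    (hint : ∀ m, i ≤ m → m < t → ¬ I.AtLevel B m)
    (hord : ∀ n, i ≤ n → n ≤ j → 0 < inc B n → t ≤ n ∧ n ≤ τ) :
    I.G (I.label B (i - 1)) (I.label B j) t i j ≤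
      Stage.mk ((I.groupCost B t i j : ℝ) : WithTop ℝ) τ := by
  induction hn : j - i using Nat.strong_induction_on generalizing i t with
  | _ N ih =>
    have hX := X_inc b1 b2 hi (show i ≤ j + 1 by omega)
    have hc := h.toCum
    have hmono := mono_of_step hc.B_mono (show i - 1 ≤ j by omega) hj
    rcases hmono.eq_or_lt with h0 | hpos
    -- Nothing is ordered; the recorded period `t` does not exceed `τ`.
    · rw [G_none hij (by omega) (by rw [hX]; linarith), Stage.coe_le_coe]
      right
      refine ⟨Finset.sum_congr rfl fun n hn => ?_, htτ⟩
      obtain ⟨n1, n2⟩ := Finset.mem_Icc.mp hn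
      have hz : ∀ m, i ≤ m → m ≤ j → inc B m = 0 := fun m a b =>
        inc_eq_zero_of_eq hc hi hj h0.symm a b
      have hinv := inv_inc b1 hi (show i ≤ n + 1 by omega)
      rw [inv, Finset.sum_eq_zero fun m hm => hz m (Finset.mem_Icc.mp hm).1
        ((Finset.mem_Icc.mp hm).2.trans n2), add_zero] at hinv
      rw [rc, hz n n1 n2, hinv]
      simp
    have hXpos : 0 < I.X (I.label B (i - 1)) (I.label B j) i j := by rw [hX]; linarith
    obtain ⟨e, e1, e2, b3, hint'⟩ := exists_next_level hij b2
    -- The first block must contain a period from `t` on, so that an ordering period is available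
    -- for it; this is the purpose of `hint`.
    have hte : t ≤ e := by
      by_contra hc'
      exact hint e e1 (by omega) b3
    obtain ⟨k, hik, htk, hke, hkτ, hone⟩ : ∃ k, i ≤ k ∧ t ≤ k ∧ k ≤ e ∧ k ≤ τ ∧
        ∀ n, i ≤ n → n ≤ e → n ≠ k → inc B n = 0 := by
      by_cases hex : ∃ n, i ≤ n ∧ n ≤ e ∧ 0 < inc B n
      · obtain ⟨k, k1, k2, k3⟩ := hex
        obtain ⟨k4, k5⟩ := hord k k1 (by omega) k3
        refine ⟨k, k1, k4, k2, k5, fun n n1 n2 n3 => hc.inc_eq_zero (by omega) (by omega) ?_⟩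
        intro n4
        rcases lt_or_gt_of_ne n3 with n5 | n5
        · exact h.one_order hi (by omega) hint' n1 n5 k2 n4 k3
        · exact h.one_order hi (by omega) hint' k1 n5 n2 k3 n4
      · have hnone : ∀ n, i ≤ n → n ≤ e → inc B n = 0 := fun n n1 n2 =>
          hc.inc_eq_zero (by omega) (by omega) fun n3 => hex ⟨n, n1, n2, n3⟩
        have : ∃ n, i ≤ n ∧ n ≤ j ∧ 0 < inc B n := by
          by_contra! hcon
          have e3 := sum_inc B hi (show i ≤ j + 1 by omega)
          have e4 : ∑ n ∈ Finset.Icc i j, inc B n ≤ 0 := Finset.sum_nonpos fun n hn =>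
            hcon n (Finset.mem_Icc.mp hn).1 (Finset.mem_Icc.mp hn).2
          linarith
        obtain ⟨n, n1, n2, n3⟩ := this
        have n4 := hord n n1 n2 n3
        have n5 : e < n := by
          by_contra hle
          exact hex ⟨n, n1, by omega, n3⟩
        -- A first block without order has a cost independent of `k`. The earliest admissible period
        -- is taken; it precedes the later orders, hence also `τ`.
        exact ⟨max i t, by omega, by omega, by omega, by omega, fun n n1 n2 _ => hnone n n1 n2⟩
    have hphi := phi_inc hV hI hc hi (show e ≤ I.T by omega) hik hke b1 b3 hint' hone
    have hsumk : ∑ n ∈ Finset.Icc i e, I.unitHold t n * inc B n = I.unitHold t k * inc B k := by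
      refine Finset.sum_eq_single k (fun n hn hnk => ?_) fun hk => ?_
      · rw [hone n (Finset.mem_Icc.mp hn).1 (Finset.mem_Icc.mp hn).2 hnk, mul_zero]
      · exact absurd (Finset.mem_Icc.mpr ⟨hik, hke⟩) hk
    have hk : inc B k = B e - B (i - 1) := by
      rw [← sum_inc B hi (show i ≤ e + 1 by omega)]
      refine (Finset.sum_eq_single k (fun n hn hnk => ?_) fun hk => ?_).symm
      · exact hone n (Finset.mem_Icc.mp hn).1 (Finset.mem_Icc.mp hn).2 hnk
      · exact absurd (Finset.mem_Icc.mpr ⟨hik, hke⟩) hk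
    rw [G_pos hij (by omega) hXpos]
    by_cases hej : e = j
    · subst hej
      refine (min_le_left _ _).trans ((Finset.inf_le (b := k) (Finset.mem_Icc.mpr
        ⟨by omega, hke⟩)).trans ?_)
      rw [hphi, ← WithTop.coe_add, Stage.coe_le_coe]
      right
      refine ⟨?_, hkτ⟩
      rw [groupCost, Finset.sum_add_distrib, hsumk, carry_eq, hX, hk]
    · have hej' : e < j := by omega
      refine (min_le_right _ _).trans ?_
      rw [v]
      refine (Finset.inf_le (b := k) (Finset.mem_Ico.mpr ⟨hik, by omega⟩)).trans ?_
      refine (Finset.inf_le (b := I.label B e) (Finset.mem_univ _)).trans ?_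
      rw [w_eq ⟨htk, hik⟩]
      refine (Finset.inf_le (b := e) (Finset.mem_Ico.mpr ⟨hke, hej'⟩)).trans ?_
      -- The rest is available from `k ≤ e`, so the condition on levels before the availability
      -- period is void.
      have hrec := ih (j - (e + 1)) (by omega) (i := e + 1) (t := k) (by omega) (by omega)
        (by rwa [Nat.add_sub_cancel]) hkτ (fun m m1 m2 => by omega)
        (fun n n1 n2 n3 => ⟨by omega, (hord n (by omega) n2 n3).2⟩) rfl
      rw [Nat.add_sub_cancel] at hrec
      refine (Stage.addCost_mono _ hrec).trans ?_
      rw [hphi, ← WithTop.coe_add, Stage.addCost_coe_mk, Stage.coe_le_coe]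
      right
      refine ⟨?_, le_rfl⟩
      -- The units of the later blocks are charged from `t` to `k` by the first block, and from `k`
      -- on by the recursion.
      have e5 : I.groupCost B k (e + 1) j + I.unitHold t k * (B j - B e) =
          ∑ n ∈ Finset.Icc (e + 1) j, (I.rc B n + I.unitHold t n * inc B n) := by
        have e7 := sum_inc B (show 1 ≤ e + 1 by omega) (show e + 1 ≤ j + 1 by omega)
        rw [Nat.add_sub_cancel] at e7
        rw [groupCost, ← e7, Finset.mul_sum, ← Finset.sum_add_distrib]
        refine Finset.sum_congr rfl fun n hn => ?_
        have := (Finset.mem_Icc.mp hn).1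
        rw [← unitHold_add htk (show k ≤ n by omega)]
        ring
      have e6 : I.groupCost B t i j = ∑ n ∈ Finset.Icc i e, I.rc B n + I.unitHold t k * inc B k +
          (I.groupCost B k (e + 1) j + I.unitHold t k * (B j - B e)) := by
        rw [e5, groupCost, sum_Icc_split (show i ≤ e + 1 by omega) e2, Finset.sum_add_distrib,
          hsumk]
      rw [e6, carry_eq, hX, hk]
      ring

/-- In an optimal plan no group of retailer orders can be replaced by a cheaper one. -/
theorem OptCum.groupCost_le {A B : ℕ → ℝ} (h : I.OptCum A B)
    {i l t τ : ℕ} {z : ℕ → ℝ} {c : ℝ} (hi : 1 ≤ i) (hil : i ≤ l) (hl : l ≤ I.T) (ht : 1 ≤ t)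
    (b1 : I.AtLevel B (i - 1)) (b2 : I.AtLevel B l) (htl : t ≤ l)
    (hord : ∀ n, i ≤ n → n ≤ l → 0 < inc B n → t ≤ n) (hA : ∀ n, t ≤ n → n ≤ l → B l ≤ A n)
    (hz : I.RealG (I.label B (i - 1)) (I.label B l) t i l z τ c) : I.groupCost B t i l ≤ c := by
  have hc := h.toCum
  have hsz : ∑ n ∈ Finset.Icc i l, z n = B l - B (i - 1) := by
    rw [hz.toRetPlan.sum_eq, X_inc b1 b2 hi (by omega)]
  -- `E n` is the excess of the old cumulative orders of the group over the new ones. It vanishes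
  -- before the group, before `t` and at `l`, so that exchanging the group changes nothing
  -- elsewhere.
  let E : ℕ → ℝ := fun n => ∑ m ∈ Finset.Icc i n, inc B m - ∑ m ∈ Finset.Icc i n, z m
  have hE0 : ∀ n, n < i → E n = 0 := by
    intro n hn
    simp only [E]
    rw [Finset.Icc_eq_empty (by omega), Finset.sum_empty, Finset.sum_empty, sub_self]
  have hEt : ∀ n, n < t → n ≤ l → E n = 0 := by
    intro n hn hnl
    simp only [E]
    rw [Finset.sum_eq_zero fun m hm => ?_, Finset.sum_eq_zero fun m hm => ?_, sub_self]
    · have := Finset.mem_Icc.mp hm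
      exact hz.toRetPlan.eq_zero this.1 (by omega) (by omega)
    · have := Finset.mem_Icc.mp hm
      refine hc.inc_eq_zero (by omega) (by omega) fun h0 => ?_
      have := hord m this.1 (by omega) h0
      omega
  have hEl : E l = 0 := by
    simp only [E]
    rw [sum_inc B hi (by omega), hsz, sub_self]
  have hEstep : ∀ n, i ≤ n → E n = E (n - 1) + inc B n - z n := by
    intro n hn
    obtain ⟨m, rfl⟩ : ∃ m, n = m + 1 := ⟨n - 1, by omega⟩
    simp only [E, Nat.add_sub_cancel]
    rw [Finset.sum_Icc_succ_top hn, Finset.sum_Icc_succ_top hn]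
    ring
  let B' : ℕ → ℝ := fun n => if n ≤ l then B n - E n else B n
  have hB'le : ∀ n, n ≤ l → B' n = B n - E n := fun n hn => if_pos hn
  have hB'gt : ∀ n, l ≤ n → B' n = B n := by
    intro n hn
    rcases hn.eq_or_lt with rfl | hn
    · rw [hB'le l le_rfl, hEl, sub_zero]
    · exact if_neg (by omega)
  have hB'lt : ∀ n, n < i → B' n = B n := by
    intro n hn
    rw [hB'le n (by omega), hE0 n hn, sub_zero]
  have hB'inv : ∀ n, i ≤ n → n ≤ l →
      B' n - I.D 1 n = I.inv (I.label B (i - 1)) i z n := by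
    intro n h1 h2
    have := inv_inc b1 hi (show i ≤ n + 1 by omega)
    rw [inv] at this ⊢
    rw [hB'le n h2]
    simp only [E]
    linarith
  have hinc : ∀ n, i ≤ n → n ≤ l → inc B' n = z n := by
    intro n h1 h2
    rw [inc, hB'le n h2, hB'le (n - 1) (by omega), hEstep n h1, inc]
    ring
  have hinc' : ∀ n, 1 ≤ n → (n < i ∨ l < n) → inc B' n = inc B n := by
    rintro n h0 (h1 | h1)
    · rw [inc, inc, hB'lt n h1, hB'lt (n - 1) (by omega)]
    · rw [inc, inc, hB'gt n h1.le, hB'gt (n - 1) (by omega)]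
  have hcum : I.Cum A B' := by
    refine ⟨hc.A_zero, ?_, hc.A_mono, fun n h1 h2 => ?_, fun n h1 h2 => ?_, fun n h1 h2 => ?_,
      fun n h1 h2 => ?_, hc.A_last, ?_⟩
    · rw [hB'lt 0 (by omega), hc.B_zero]
    · rw [← sub_nonneg]
      change 0 ≤ inc B' n
      by_cases hn : i ≤ n ∧ n ≤ l
      · rw [hinc n hn.1 hn.2]; exact hz.nonneg n hn.1 hn.2
      · rw [hinc' n h1 (by omega)]; exact hc.inc_nonneg h1 h2
    · by_cases hn : i ≤ n ∧ n ≤ l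
      · by_cases hnt : n < t
        · rw [hB'le n hn.2, hEt n hnt hn.2, sub_zero]; exact hc.B_le_A n h1 h2
        -- The supplier orders are kept. They suffice because from `t` on they already cover
        -- everything ordered by the retailer until `l`.
        · refine le_trans ?_ (hA n (by omega) hn.2)
          have e1 := hz.toRetPlan.sum_le_X hn.2
          rw [X_inc b1 b2 hi (by omega)] at e1
          rw [hB'le n hn.2]
          simp only [E]
          rw [sum_inc B hi (by omega)]
          linarith
      · by_cases hnl : n ≤ l
        · rw [hB'lt n (by omega)]; exact hc.B_le_A n h1 h2
        · rw [hB'gt n (by omega)]; exact hc.B_le_A n h1 h2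
    · by_cases hn : i ≤ n ∧ n ≤ l
      · have := hB'inv n hn.1 hn.2
        have := hz.inv_nonneg n hn.1 hn.2
        linarith
      · by_cases hnl : n ≤ l
        · rw [hB'lt n (by omega)]; exact hc.D_le_B n h1 h2
        · rw [hB'gt n (by omega)]; exact hc.D_le_B n h1 h2
    · by_cases hn : i ≤ n ∧ n ≤ l
      · have := hB'inv n hn.1 hn.2
        have := hz.inv_le n hn.1 hn.2
        linarith
      · by_cases hnl : n ≤ l
        · rw [hB'lt n (by omega)]; exact hc.B_le n h1 h2
        · rw [hB'gt n (by omega)]; exact hc.B_le n h1 h2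
    · rw [hB'gt _ hl]; exact hc.B_last
  have hcost := h.cost_le A B' hcum
  rw [cost_ofCum_eq, cost_ofCum_eq, Finset.sum_add_distrib, Finset.sum_add_distrib] at hcost
  -- With `A` unchanged, the supplier cost changes only by holding the excess `E n` longer.
  have hsc : ∑ n ∈ Finset.Icc 1 I.T, I.sc A B' n = ∑ n ∈ Finset.Icc 1 I.T, I.sc A B n +
      ∑ n ∈ Finset.Icc t l, I.hS n * E n := by
    have e1 : ∑ n ∈ Finset.Icc t l, I.hS n * E n =
        ∑ n ∈ Finset.Icc 1 I.T, I.hS n * (B n - B' n) := by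
      refine Finset.sum_subset_zero_on_sdiff (Finset.Icc_subset_Icc ht hl) (fun n hn => ?_)
        fun n hn => ?_
      · rw [Finset.mem_sdiff, Finset.mem_Icc, Finset.mem_Icc] at hn
        by_cases hnl : n ≤ l
        · rw [hB'le n hnl, hEt n (by omega) hnl]; ring
        · rw [hB'gt n (by omega)]; ring
      · rw [hB'le n (Finset.mem_Icc.mp hn).2]; ring
    rw [e1, ← Finset.sum_add_distrib]
    refine Finset.sum_congr rfl fun n _ => ?_
    rw [sc, sc]; ring
  have hrc : ∑ n ∈ Finset.Icc 1 I.T, I.rc B' n + ∑ n ∈ Finset.Icc i l, I.rc B n =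
      ∑ n ∈ Finset.Icc 1 I.T, I.rc B n +
      ∑ n ∈ Finset.Icc i l, I.retCost (I.label B (i - 1)) i z n := by
    have split : ∀ f : ℕ → ℝ, ∑ n ∈ Finset.Icc 1 I.T, f n = ∑ n ∈ Finset.Icc 1 (i - 1), f n +
        ∑ n ∈ Finset.Icc i l, f n + ∑ n ∈ Finset.Icc (l + 1) I.T, f n := by
      intro f
      rw [sum_Icc_split (show 1 ≤ l + 1 by omega) hl,
        sum_Icc_split (a := 1) (m := i - 1) (b := l) (by omega) (by omega), Nat.sub_add_cancel hi]
    rw [split, split (I.rc B)]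
    have e1 : ∑ n ∈ Finset.Icc 1 (i - 1), I.rc B' n = ∑ n ∈ Finset.Icc 1 (i - 1), I.rc B n := by
      refine Finset.sum_congr rfl fun n hn => ?_
      obtain ⟨n1, n2⟩ := Finset.mem_Icc.mp hn
      rw [rc, rc, hinc' n n1 (by omega), hB'lt n (by omega)]
    have e2 : ∑ n ∈ Finset.Icc (l + 1) I.T, I.rc B' n = ∑ n ∈ Finset.Icc (l + 1) I.T, I.rc B n := by
      refine Finset.sum_congr rfl fun n hn => ?_
      obtain ⟨n1, n2⟩ := Finset.mem_Icc.mp hn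
      rw [rc, rc, hinc' n (by omega) (by omega), hB'gt n (by omega)]
    have e3 : ∑ n ∈ Finset.Icc i l, I.rc B' n =
        ∑ n ∈ Finset.Icc i l, I.retCost (I.label B (i - 1)) i z n := by
      refine Finset.sum_congr rfl fun n hn => ?_
      obtain ⟨n1, n2⟩ := Finset.mem_Icc.mp hn
      rw [rc, hinc n n1 n2, hB'inv n n1 n2, retCost]
    rw [e1, e2, e3]
    ring
  -- Both totals agree at `l`, so `E n` is the difference of the undelivered parts; each part is
  -- evaluated by `sum_hold_group`.
  have hold : ∑ n ∈ Finset.Icc t l, I.hS n * E n =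
      ∑ m ∈ Finset.Icc i l, I.unitHold t m * z m - ∑ m ∈ Finset.Icc i l, I.unitHold t m * inc B m := by
    have g1 := sum_hold_group (I := I) (x := z) (t := t) (le_refl l) fun n n1 n2 n3 =>
      ⟨by by_contra hlt; exact n3 (hz.toRetPlan.eq_zero n1 n2 (by omega)), n2⟩
    have g2 := sum_hold_group (I := I) (x := inc B) (i := i) (t := t) (le_refl l) fun n n1 n2 n3 =>
      ⟨hord n n1 n2 (lt_of_le_of_ne (hc.inc_nonneg (by omega) (by omega)) (Ne.symm n3)), n2⟩
    rw [← g1, ← g2, ← Finset.sum_sub_distrib]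
    refine Finset.sum_congr rfl fun n _ => ?_
    rw [hsz, sum_inc B hi (show i ≤ l + 1 by omega)]
    simp only [E]
    ring
  rw [← hz.cost_eq, groupCost, Finset.sum_add_distrib, Finset.sum_add_distrib]
  linarith

end Data

-- The recursion is at most the optimal cost

namespace Data

variable {I : Data}

/-- Cost of the retailer from period `i` on and of the supplier from period `t` on. -/
def restCost (I : Data) (A B : ℕ → ℝ) (t i : ℕ) : ℝ :=
  ∑ n ∈ Finset.Icc i I.T, I.rc B n + ∑ n ∈ Finset.Icc t I.T, I.sc A B n

theorem Cum.B_le_A' {A B : ℕ → ℝ} (h : I.Cum A B) {n : ℕ} (hn : n ≤ I.T) : B n ≤ A n := by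
  rcases Nat.eq_zero_or_pos n with rfl | h0
  · rw [h.A_zero, h.B_zero]
  · exact h.B_le_A n h0 hn

theorem Cum.sc_nonneg (hV : I.Valid) {A B : ℕ → ℝ} (h : I.Cum A B) {n : ℕ} (h1 : 1 ≤ n)
    (h2 : n ≤ I.T) : 0 ≤ I.sc A B n := by
  obtain ⟨-, -, -, -, v1, v2, v3, -⟩ := hV.2 n h1 h2
  have a1 : 0 ≤ inc A n := sub_nonneg.mpr (h.A_mono n h1 h2)
  have a2 := sub_nonneg.mpr (h.B_le_A n h1 h2)
  have a3 : (0 : ℝ) ≤ if 0 < inc A n then 1 else 0 := by split_ifs <;> norm_num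
  unfold sc
  positivity

/-- Supplier cost of a group of retailer orders `[i,l]` delivered from an order at period `t`. -/
theorem Cum.sum_sc_group {A B : ℕ → ℝ} (h : I.Cum A B) {t i l τ : ℕ} (hi : 1 ≤ i) (ht : 1 ≤ t)
    (htτ : t ≤ τ) (hτl : τ ≤ l) (hil : i ≤ l) (hl : l ≤ I.T)
    (hord : ∀ n, i ≤ n → n ≤ l → 0 < inc B n → t ≤ n ∧ n ≤ τ)
    (hA : ∀ n, t ≤ n → n ≤ τ → A n = B l) (hA0 : A (t - 1) = B (i - 1))
    (hB : ∀ n, t ≤ n → n < i → B n = B (i - 1)) (hpos : B (i - 1) < B l) :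
    ∑ n ∈ Finset.Icc t τ, I.sc A B n = I.orderCost t (B l - B (i - 1)) +
      ∑ m ∈ Finset.Icc i l, I.unitHold t m * inc B m := by
  rw [← sum_hold_group (I := I) (x := inc B) hτl fun n n1 n2 n3 =>
    hord n n1 n2 (lt_of_le_of_ne (h.inc_nonneg (by omega) (by omega)) (Ne.symm n3))]
  have e : ∀ n ∈ Finset.Icc t τ, I.sc A B n =
      (if n = t then I.orderCost t (B l - B (i - 1)) else 0) +
      I.hS n * (∑ m ∈ Finset.Icc i l, inc B m - ∑ m ∈ Finset.Icc i n, inc B m) := by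
    intro n hn
    obtain ⟨n1, n2⟩ := Finset.mem_Icc.mp hn
    have e1 : ∑ m ∈ Finset.Icc i l, inc B m - ∑ m ∈ Finset.Icc i n, inc B m = A n - B n := by
      rw [sum_inc B hi (by omega), hA n n1 n2]
      by_cases hin : i ≤ n + 1
      · rw [sum_inc B hi hin]; ring
      · rw [Finset.Icc_eq_empty (by omega), Finset.sum_empty, hB n n1 (by omega)]; ring
    rw [e1, sc]
    by_cases hnt : n = t
    · subst hnt
      have e2 : inc A n = B l - B (i - 1) := by rw [inc, hA n n1 n2, hA0]
      rw [e2, orderCost, if_pos (by linarith), if_pos rfl, if_pos (by linarith)]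
      ring
    · have e2 : inc A n = 0 := by
        rw [inc, hA n n1 n2, hA (n - 1) (by omega) (by omega), sub_self]
      rw [e2, if_neg hnt]
      simp
  rw [Finset.sum_congr rfl e, Finset.sum_add_distrib, Finset.sum_ite_eq',
    if_pos (Finset.mem_Icc.mpr ⟨le_rfl, htτ⟩)]

theorem const_of_inc_eq_zero {A : ℕ → ℝ} {a b : ℕ} (hab : a ≤ b)
    (h : ∀ n, a < n → n ≤ b → inc A n = 0) : A b = A a := by
  have := sum_inc A (show 1 ≤ a + 1 by omega) (show a + 1 ≤ b + 1 by omega)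
  rw [Finset.sum_eq_zero fun n hn => h n (by have := (Finset.mem_Icc.mp hn).1; omega)
    (Finset.mem_Icc.mp hn).2, Nat.add_sub_cancel] at this
  linarith

/-- `C` is at most the cost of the corresponding part of a structured plan. -/
theorem OptCum.C_le (hV : I.Valid) (hI : I.Tight) {A B : ℕ → ℝ} (h : I.OptCum A B) {i t : ℕ}
    (ht : 1 ≤ t) (hti : t ≤ i) (hiT : i ≤ I.T) (b1 : I.AtLevel B (i - 1))
    (hS : A (t - 1) = B (t - 1)) (hbefore : ∀ n, t ≤ n → n < i → inc B n = 0) :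
    I.C (I.label B (i - 1)) (I.label B I.T) t i I.T ≤ ((I.restCost A B t i : ℝ) : WithTop ℝ) := by
  classical
  induction hn : I.T - i using Nat.strong_induction_on generalizing i t with
  | _ N ih =>
    have hc := h.toCum
    have hi : 1 ≤ i := ht.trans hti
    have b2 : I.AtLevel B I.T := Or.inl hc.B_last
    have hX := X_inc b1 b2 hi (show i ≤ I.T + 1 by omega)
    have hBti : ∀ n, t ≤ n + 1 → n < i → B n = B (t - 1) := fun n n1 n2 =>
      const_of_inc_eq_zero (by omega) fun m m1 m2 => hbefore m (by omega) (by omega)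
    have hBi : B (i - 1) = B (t - 1) := hBti (i - 1) (by omega) (by omega)
    have hscpos : ∀ a b, 1 ≤ a → b ≤ I.T → 0 ≤ ∑ n ∈ Finset.Icc a b, I.sc A B n := fun a b h1 h2 =>
      Finset.sum_nonneg fun n hn => hc.sc_nonneg hV (h1.trans (Finset.mem_Icc.mp hn).1)
        ((Finset.mem_Icc.mp hn).2.trans h2)
    have hmono := mono_of_step hc.B_mono (show i - 1 ≤ I.T by omega) le_rfl
    have hrc0 : ∀ e, i ≤ e → e ≤ I.T → (∀ m, i ≤ m → m ≤ e → inc B m = 0) →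
        ∑ n ∈ Finset.Icc i e, I.hR n * (I.lev (I.label B (i - 1)) (i - 1) - I.D i n) =
          ∑ n ∈ Finset.Icc i e, I.rc B n := by
      intro e he1 he2 hz
      refine Finset.sum_congr rfl fun n hn => ?_
      obtain ⟨n1, n2⟩ := Finset.mem_Icc.mp hn
      have hinv := inv_inc b1 hi (show i ≤ n + 1 by omega)
      rw [inv, Finset.sum_eq_zero fun m hm => hz m (Finset.mem_Icc.mp hm).1
        ((Finset.mem_Icc.mp hm).2.trans n2), add_zero] at hinv
      rw [rc, hz n n1 n2, hinv]
      simp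
    rcases hmono.eq_or_lt with h0 | hpos
    · have hz : ∀ m, i ≤ m → m ≤ I.T → inc B m = 0 := fun m a b =>
        inc_eq_zero_of_eq hc hi le_rfl h0.symm a b
      rw [C_nonpos (by rw [hX]; linarith), G_none hiT (by omega) (by rw [hX]; linarith),
        Stage.cost_mk, WithTop.coe_le_coe, hrc0 I.T hiT le_rfl hz, restCost]
      linarith [hscpos t I.T ht le_rfl]
    have hXpos : 0 < I.X (I.label B (i - 1)) (I.label B I.T) i I.T := by rw [hX]; linarith
    obtain ⟨e, e1, e2, b3, hint⟩ := exists_next_level hiT b2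
    -- A first block without orders, with the supplier idle at `t`, is split off by the free
    -- candidate `𝟙(0)`. Its stored period is `t`, so both levels advance and the induction applies
    -- at `t + 1` and `e + 1`.
    by_cases hcase : (∀ m, i ≤ m → m ≤ e → inc B m = 0) ∧ inc A t = 0
    · -- no order in the first block, and none at the supplier at period `t`
      obtain ⟨hz, hA⟩ := hcase
      have hBe : B e = B (i - 1) := const_of_inc_eq_zero (by omega) fun m m1 m2 =>
        hz m (by omega) m2
      have heT : e < I.T := by
        by_contra hcon
        obtain rfl : e = I.T := by omega
        linarith
      have hXe : I.X (I.label B (i - 1)) (I.label B e) i e = 0 := by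
        rw [X_inc b1 b3 hi (by omega)]; linarith
      rw [C_pos hV ht le_rfl ⟨hiT, by omega⟩ hXpos]
      refine (min_le_right _ _).trans ((min_le_right _ _).trans ?_)
      refine (Finset.inf_le (b := e) (Finset.mem_Ico.mpr ⟨e1, heT⟩)).trans ?_
      refine (Finset.inf_le (b := I.label B e) (Finset.mem_univ _)).trans ?_
      rw [CSplit_coe (G_none e1 (by omega) hXe)]
      have hBt : B t = B (t - 1) := by
        by_cases hlt : t < i
        · exact hBti t (by omega) hlt
        · have := hz t (by omega) (by omega)
          unfold inc at this
          linarith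
      have hrec := ih (I.T - (e + 1)) (by omega) (i := e + 1) (t := t + 1) (by omega) (by omega)
        heT (by rwa [Nat.add_sub_cancel])
        (by rw [Nat.add_sub_cancel, hBt, ← hS]; unfold inc at hA; linarith)
        (fun n n1 n2 => by
          by_cases hni : n < i
          · exact hbefore n (by omega) hni
          · exact hz n (by omega) (by omega)) rfl
      rw [Nat.add_sub_cancel] at hrec
      refine (add_le_add_right hrec _).trans ?_
      rw [← WithTop.coe_add, WithTop.coe_le_coe, orderCost, if_neg (by rw [hXe]; exact lt_irrefl 0),
        zero_add]
      change ∑ n ∈ Finset.Icc i e, I.hR n * (I.lev (I.label B (i - 1)) (i - 1) - I.D i n) + _ ≤ _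
      rw [hrc0 e e1 e2 hz, restCost, restCost, sum_Icc_split (show i ≤ e + 1 by omega) e2,
        sum_Icc_split (a := t) (m := t) (by omega) (by omega), Finset.Icc_self,
        Finset.sum_singleton]
      linarith [hc.sc_nonneg hV ht (by omega)]
    -- the next supplier order, at period `p`
    have hAT : A (t - 1) < A I.T := by
      rw [hc.A_last, ← hc.B_last, hS, ← hBi]; exact hpos
    have hexp : ∃ p, t ≤ p ∧ p ≤ I.T ∧ 0 < inc A p := by
      by_contra! hcon
      have := const_of_inc_eq_zero (A := A) (show t - 1 ≤ I.T by omega) fun n n1 n2 =>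
        le_antisymm (hcon n (by omega) n2) (sub_nonneg.mpr (hc.A_mono n (by omega) n2))
      linarith
    obtain ⟨p, ⟨p1, p2, p3⟩, pmin⟩ : ∃ p, (t ≤ p ∧ p ≤ I.T ∧ 0 < inc A p) ∧
        ∀ m, t ≤ m → m < p → inc A m = 0 := by
      refine ⟨Nat.find hexp, Nat.find_spec hexp, fun m m1 m2 => ?_⟩
      have := Nat.find_min hexp m2
      have hm : m ≤ I.T := m2.le.trans (Nat.find_spec hexp).2.1
      refine le_antisymm (not_lt.mp fun h0 => this ⟨m1, hm, h0⟩)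
        (sub_nonneg.mpr (hc.A_mono m (by omega) hm))
    have hAp : ∀ n, t ≤ n + 1 → n < p → A n = B (i - 1) := by
      intro n n1 n2
      rw [hBi, ← hS]
      exact const_of_inc_eq_zero (by omega) fun m m1 m2 => pmin m (by omega) (by omega)
    have hordp : ∀ n, i ≤ n → n ≤ I.T → 0 < inc B n → p ≤ n := by
      intro n n1 n2 n3
      by_contra hlt
      have a1 := hAp n (by omega) (by omega)
      have a2 := hc.B_le_A' n2
      have a3 := mono_of_step hc.B_mono (show i - 1 ≤ n - 1 by omega) (by omega)
      unfold inc at n3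
      linarith
    -- A level before `p` would mean that the whole first block lies before the next supplier order,
    -- hence contains no retailer order, while the supplier is idle at `t`. That case has been
    -- treated.
    have hpint : ∀ m, i ≤ m → m < p → ¬ I.AtLevel B m := by
      intro m m1 m2
      refine hint m m1 ?_
      by_contra hme
      apply hcase
      refine ⟨fun n n1 n2 => hc.inc_eq_zero (by omega) (by omega) fun n3 => ?_,
        pmin t le_rfl (by omega)⟩
      have := hordp n n1 (by omega) n3
      omega
    have hBp : ∀ n, p ≤ n → n < i → B n = B (i - 1) := fun n n1 n2 => by
      rw [hBi]; exact hBti n (by omega) n2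
    -- The supplier waits until its next order.
    refine (C_anti hV ht p1 le_rfl hiT).trans ?_
    rw [C_pos hV (by omega) le_rfl ⟨hiT, p2⟩ hXpos]
    refine (min_le_right _ _).trans ?_
    have hrest : ∑ n ∈ Finset.Icc t I.T, I.sc A B n ≥ ∑ n ∈ Finset.Icc p I.T, I.sc A B n := by
      refine Finset.sum_le_sum_of_subset_of_nonneg (Finset.Icc_subset_Icc_left p1) fun n hn _ => ?_
      exact hc.sc_nonneg hV (ht.trans (Finset.mem_Icc.mp hn).1) (Finset.mem_Icc.mp hn).2
    have hgroup : ∀ a b, I.groupCost B p a b = ∑ n ∈ Finset.Icc a b, I.rc B n +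
        ∑ m ∈ Finset.Icc a b, I.unitHold p m * inc B m := fun a b => Finset.sum_add_distrib
    by_cases hexr : ∃ r, p < r ∧ r ≤ I.T ∧ 0 < inc A r
    · obtain ⟨r, ⟨r1, r2, r3⟩, rmin⟩ : ∃ r, (p < r ∧ r ≤ I.T ∧ 0 < inc A r) ∧
          ∀ m, p < m → m < r → inc A m = 0 := by
        refine ⟨Nat.find hexr, Nat.find_spec hexr, fun m m1 m2 => ?_⟩
        have := Nat.find_min hexr m2
        have hm : m ≤ I.T := m2.le.trans (Nat.find_spec hexr).2.1
        refine le_antisymm (not_lt.mp fun h0 => this ⟨m1, hm, h0⟩)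
          (sub_nonneg.mpr (hc.A_mono m (by omega) hm))
      have hAr : ∀ n, p ≤ n → n < r → A n = A p := fun n n1 n2 =>
        const_of_inc_eq_zero n1 fun m m1 m2 => rmin m m1 (by omega)
      -- Zero-inventory ordering: the order at `p` is used up before the order at `r`.
      have hSr : A (r - 1) = B (r - 1) := by
        rcases h.zio r (by omega) r2 with h' | h'
        · exact h'
        · unfold inc at r3; linarith
      have hApp : B (i - 1) < A p := by
        have := hAp (p - 1) (by omega) (by omega)
        unfold inc at p3
        linarith
      -- the last retailer order before the following supplier order
      have hir : i ≤ r - 1 := by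
        by_contra hlt
        have := hBti (r - 1) (by omega) (by omega)
        rw [← hSr, hAr (r - 1) (by omega) (by omega), ← hBi] at this
        linarith
      have hexτ : ∃ τ, i ≤ τ ∧ τ ≤ r - 1 ∧ 0 < inc B τ := by
        by_contra! hcon
        have := const_of_inc_eq_zero (A := B) (show i - 1 ≤ r - 1 by omega) fun n n1 n2 =>
          le_antisymm (hcon n (by omega) n2) (hc.inc_nonneg (by omega) (by omega))
        rw [← hSr, hAr (r - 1) (by omega) (by omega)] at this
        linarith
      obtain ⟨τ, ⟨τ1, τ2, τ3⟩, τmax⟩ : ∃ τ, (i ≤ τ ∧ τ ≤ r - 1 ∧ 0 < inc B τ) ∧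
          ∀ m, τ < m → m ≤ r - 1 → inc B m = 0 := by
        obtain ⟨τ₀, hτ₀⟩ := hexτ
        have hb : τ₀ ≤ r - 1 := hτ₀.2.1
        refine ⟨Nat.findGreatest (fun τ => i ≤ τ ∧ τ ≤ r - 1 ∧ 0 < inc B τ) (r - 1),
          Nat.findGreatest_spec (P := fun τ => i ≤ τ ∧ τ ≤ r - 1 ∧ 0 < inc B τ) hb hτ₀,
          fun m m1 m2 => hc.inc_eq_zero (by omega) (by omega) fun m3 => ?_⟩
        have hg := Nat.findGreatest_spec (P := fun τ => i ≤ τ ∧ τ ≤ r - 1 ∧ 0 < inc B τ) hb hτ₀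
        exact Nat.findGreatest_is_greatest m1 m2 ⟨by omega, m2, m3⟩
      have hpτ : p ≤ τ := hordp τ τ1 (by omega) τ3
      -- The group ends at the first level from `τ` on, possibly after `r`. No order lies between
      -- `τ` and `l`, since it would share a block with the one at `τ`.
      obtain ⟨l, l1, l2, b4, lint⟩ := exists_next_level (show τ ≤ I.T by omega) b2
      have hafter : ∀ n, τ < n → n ≤ l → inc B n = 0 := fun n n1 n2 =>
        hc.inc_eq_zero (by omega) (by omega) fun n3 =>
          h.one_order (by omega) l2 lint le_rfl n1 n2 τ3 n3
      have hBl : B l = B τ := const_of_inc_eq_zero l1 hafter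
      have hBτ : B (r - 1) = B τ := const_of_inc_eq_zero τ2 τmax
      have hApl : A p = B l := by
        rw [hBl, ← hBτ, ← hSr, hAr (r - 1) (by omega) (by omega)]
      -- The order at `r` still has something to serve.
      have hlT : l < I.T := by
        by_contra hcon
        obtain rfl : l = I.T := by omega
        have := mono_of_step hc.A_mono r2 le_rfl
        rw [hc.A_last, ← hc.B_last, hBl, ← hBτ, ← hSr] at this
        unfold inc at r3
        linarith
      have hordl : ∀ n, i ≤ n → n ≤ l → 0 < inc B n → p ≤ n ∧ n ≤ τ := fun n n1 n2 n3 =>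
        ⟨hordp n n1 (by omega) n3, by
          by_contra hlt
          exact n3.ne' (hafter n (by omega) n2)⟩
      have hGle := h.G_le hV hI l2 b4 hi (by omega) b1 hpτ l1 hpint hordl
      have hSτ : A τ = B τ := by rw [hAr τ hpτ (by omega), hApl, hBl]
      have hrec := ih (I.T - (l + 1)) (by omega) (i := l + 1) (t := τ + 1) (by omega) (by omega)
        hlT (by rwa [Nat.add_sub_cancel]) (by rwa [Nat.add_sub_cancel])
        (fun n n1 n2 => hafter n (by omega) (by omega)) rfl
      rw [Nat.add_sub_cancel] at hrec
      have hXl := X_inc b1 b4 hi (show i ≤ l + 1 by omega)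
      have hsg := hc.sum_sc_group hi (ht.trans p1) hpτ l1 (by omega) l2 hordl
        (fun n n1 n2 => by rw [hAr n n1 (by omega), hApl]) (hAp (p - 1) (by omega) (by omega)) hBp
        (by rw [← hApl]; exact hApp)
      refine (min_le_right _ _).trans ?_
      refine (Finset.inf_le (b := l) (Finset.mem_Ico.mpr ⟨by omega, hlT⟩)).trans ?_
      refine (Finset.inf_le (b := I.label B l) (Finset.mem_univ _)).trans ?_
      cases hG : I.G (I.label B (i - 1)) (I.label B l) p i l using WithTop.recTopCoe with
      | top => rw [hG] at hGle; exact absurd hGle (not_le.mpr (WithTop.coe_lt_top _))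
      | coe q =>
        obtain ⟨z, hz⟩ := G_realizable hV hI l2 hi hG
        have hge := h.groupCost_le hi (by omega) l2 (ht.trans p1) b1 b4 (by omega)
          (fun n n1 n2 n3 => (hordl n n1 n2 n3).1)
          (fun n n1 n2 => by
            rw [← hApl]; exact mono_of_step hc.A_mono n1 (by omega)) hz
        rw [hG, Stage.eq_mk, Stage.coe_le_coe] at hGle
        -- `hGle` compares lexicographically, and a strictly smaller cost is excluded by optimality.
        -- So the costs agree and the stored period is at most `τ`.
        obtain ⟨hq1, hq2⟩ : (ofLex q).1 = I.groupCost B p i l ∧ (ofLex q).2 ≤ τ := by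
          rcases hGle with hGle | hGle
          · linarith
          · exact hGle
        rw [CSplit_coe hG]
        -- Continuing from the stored period instead of `τ` only gives the supplier more freedom.
        have hCC := (C_anti hV (α := I.label B l) (β := I.label B I.T)
          (show 1 ≤ (ofLex q).2 + 1 by omega)
          (show (ofLex q).2 + 1 ≤ τ + 1 by omega) le_rfl (show l + 1 ≤ I.T from hlT)).trans hrec
        refine (add_le_add_right hCC _).trans ?_
        rw [← WithTop.coe_add, WithTop.coe_le_coe, hq1, hXl, hgroup, restCost, restCost,
          sum_Icc_split (show i ≤ l + 1 by omega) l2]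
        rw [sum_Icc_split (show p ≤ τ + 1 by omega) (show τ ≤ I.T by omega), hsg] at hrest
        linarith
    -- The order at `p` is the last one and serves everything that is left.
    · have hnone : ∀ n, p < n → n ≤ I.T → inc A n = 0 := fun n n1 n2 =>
        le_antisymm (not_lt.mp fun n3 => hexr ⟨n, n1, n2, n3⟩)
          (sub_nonneg.mpr (hc.A_mono n (by omega) n2))
      have hAn : ∀ n, p ≤ n → n ≤ I.T → A n = B I.T := by
        intro n n1 n2
        rw [hc.B_last, ← hc.A_last]
        exact (const_of_inc_eq_zero n2 fun m m1 m2 => hnone m (by omega) m2).symm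
      have hordl : ∀ n, i ≤ n → n ≤ I.T → 0 < inc B n → p ≤ n ∧ n ≤ I.T := fun n n1 n2 n3 =>
        ⟨hordp n n1 n2 n3, n2⟩
      have hGle := h.G_le hV hI le_rfl b2 hi hiT b1 p2 le_rfl hpint hordl
      have hsg := hc.sum_sc_group hi (ht.trans p1) p2 le_rfl hiT le_rfl hordl hAn
        (hAp (p - 1) (by omega) (by omega)) hBp hpos
      refine (min_le_left _ _).trans ((add_le_add_right (Stage.cost_mono hGle) _).trans ?_)
      rw [Stage.cost_mk, ← WithTop.coe_add, WithTop.coe_le_coe, hX, hgroup, restCost]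
      linarith

/-- The recursion computes the optimal cost. -/
theorem isLeast_costs_of_tight (hV : I.Valid) (hI : I.Tight) :
    ∃ c : ℝ, I.C false false 1 1 I.T = (c : WithTop ℝ) ∧ IsLeast I.costs c := by
  obtain ⟨A, B, hc, hmin, hzio, hsep⟩ := exists_structured_optimum hV
  have h : I.OptCum A B := ⟨hc, hmin, hzio, hsep⟩
  have hle := h.C_le hV hI le_rfl le_rfl hV.1 (Or.inl (by simp [hc.B_zero, D_one_zero]))
    (by simp [hc.A_zero, hc.B_zero]) (fun n n1 n2 => absurd n1 (by omega))
  have l0 : I.label B (1 - 1) = false := label_eq_false.mpr (by simp [hc.B_zero, D_one_zero])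
  have lT : I.label B I.T = false := label_eq_false.mpr hc.B_last
  rw [l0, lT] at hle
  have hrest : I.restCost A B 1 1 = I.cost (I.ofCum A B) := by
    rw [cost_ofCum_eq, Finset.sum_add_distrib, restCost]
  rw [hrest] at hle
  cases hC : I.C false false 1 1 I.T using WithTop.recTopCoe with
  | top => rw [hC] at hle; exact absurd hle (not_le.mpr (WithTop.coe_lt_top _))
  | coe c =>
    rw [hC, WithTop.coe_le_coe] at hle
    refine ⟨c, rfl, ?_, ?_⟩
    · obtain ⟨x, y, hxy⟩ := C_realizable hV hI le_rfl le_rfl le_rfl hC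
      let Q : Plan :=
        { xR := x, xS := y, sR := fun t => I.inv false 1 x t, sS := fun t => stock 1 1 x y t,
          yR := fun t => if 0 < x t then 1 else 0, yS := fun t => if 0 < y t then 1 else 0 }
      have hQ : I.IsPlanOf x y Q := by
        refine ⟨by simp [Q, inv, lev, D_one_zero], by simp [Q, stock], fun _ _ _ => rfl,
          fun _ _ _ => rfl, fun t h1 h2 => ?_, fun t h1 h2 => ?_, fun _ _ _ => rfl,
          fun _ _ _ => rfl⟩
        · obtain ⟨m, rfl⟩ : ∃ m, t = m + 1 := ⟨t - 1, by omega⟩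
          simp only [Q, Nat.add_sub_cancel, inv]
          rw [Finset.sum_Icc_succ_top (by omega), D_succ_right _ _ (by omega)]
          ring
        · obtain ⟨m, rfl⟩ : ∃ m, t = m + 1 := ⟨t - 1, by omega⟩
          simp only [Q, Nat.add_sub_cancel, stock]
          rw [Finset.sum_Icc_succ_top (by omega), Finset.sum_Icc_succ_top (by omega)]
          ring
      obtain ⟨p1, p2, -, -⟩ := hxy.plan hV hQ
      exact ⟨Q, p1, p2⟩
    · rintro _ ⟨P, hP, rfl⟩
      obtain ⟨A', B', h1, h2⟩ := hP.exists_cum_le hV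
      exact hle.trans ((hmin A' B' h1).trans h2)

end Data

/-! ### Reasoning about programs -/

theorem foldl_range'_inv {σ : Type*} (f : σ → ℕ → σ) (Inv : ℕ → σ → Prop) (a n : ℕ) (q : σ)
    (h0 : Inv a q) (hstep : ∀ m q, a ≤ m → m < a + n → Inv m q → Inv (m + 1) (f q m)) :
    Inv (a + n) ((List.range' a n).foldl f q) := by
  induction n generalizing a q with
  | zero => exact h0
  | succ n ih =>
    rw [List.range'_succ, List.foldl_cons]
    have := ih (a + 1) (f q a) (hstep a q le_rfl (by omega) h0)
      fun m q h1 h2 h3 => hstep m q (by omega) (by omega) h3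
    rwa [show a + 1 + n = a + (n + 1) by omega] at this

namespace State

variable {s : State} {a b : ℕ} {ix jx : List ℕ}

@[simp] theorem nat_setNat {n : ℕ} :
    (s.setNat a ix n).nat b jx = if b = a ∧ jx = ix then n else s.nat b jx := rfl

@[simp] theorem real_setNat {n : ℕ} : (s.setNat a ix n).real = s.real := rfl

@[simp] theorem nat_setReal {r : ℝ} : (s.setReal a ix r).nat = s.nat := rfl

@[simp] theorem real_setReal {r : ℝ} :
    (s.setReal a ix r).real b jx = if b = a ∧ jx = ix then r else s.real b jx := rfl

theorem nat_setNat_of_ne {n : ℕ} (h : b ≠ a) : (s.setNat a ix n).nat b = s.nat b := by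
  funext jx; simp [h]

theorem real_setReal_of_ne {r : ℝ} (h : b ≠ a) : (s.setReal a ix r).real b = s.real b := by
  funext jx; simp [h]

end State

-- Frame conditions and loop invariants

namespace Cmd

/-- Arrays of naturals written by a command. -/
def natW : Cmd → List ℕ
  | skip => []
  | setNat a _ _ => [a]
  | setReal _ _ _ => []
  | seq c c' => c.natW ++ c'.natW
  | ite _ c c' => c.natW ++ c'.natW
  | loop x _ _ c => x :: c.natW

/-- Arrays of reals written by a command. -/
def realW : Cmd → List ℕ
  | skip => []
  | setNat _ _ _ => []
  | setReal a _ _ => [a]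
  | seq c c' => c.realW ++ c'.realW
  | ite _ c c' => c.realW ++ c'.realW
  | loop _ _ _ c => c.realW

/-- The states differ only on arrays written by `c`. -/
structure Agree (c : Cmd) (s s' : State) : Prop where
  nat : ∀ a, a ∉ c.natW → s'.nat a = s.nat a
  real : ∀ a, a ∉ c.realW → s'.real a = s.real a

theorem Agree.refl (c : Cmd) (s : State) : Agree c s s := ⟨fun _ _ => rfl, fun _ _ => rfl⟩

theorem Agree.trans {c : Cmd} {s s' s'' : State} (h : Agree c s s') (h' : Agree c s' s'') :
    Agree c s s'' :=
  ⟨fun a ha => (h'.nat a ha).trans (h.nat a ha), fun a ha => (h'.real a ha).trans (h.real a ha)⟩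

theorem Agree.mono {c c' : Cmd} {s s' : State} (h : Agree c s s')
    (hn : ∀ a ∈ c.natW, a ∈ c'.natW) (hr : ∀ a ∈ c.realW, a ∈ c'.realW) : Agree c' s s' :=
  ⟨fun a ha => h.nat a fun h' => ha (hn a h'), fun a ha => h.real a fun h' => ha (hr a h')⟩

theorem Agree.setNat {c : Cmd} {s : State} {x : ℕ} (hx : x ∈ c.natW) (ix : List ℕ) (n : ℕ) :
    Agree c s (s.setNat x ix n) :=
  ⟨fun _ ha => State.nat_setNat_of_ne fun h => ha (h ▸ hx), fun _ _ => rfl⟩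

theorem run_loop_inv_pair {x : ℕ} {lo hi : NExp} {c : Cmd} {s : State}
    (Inv : ℕ → State × ℕ → Prop) (h0 : Inv (lo.eval s) (s, 1 + lo.steps + hi.steps))
    (hstep : ∀ n q, lo.eval s ≤ n → n < hi.eval s → Inv n q →
      Inv (n + 1) ((c.run (q.1.setNat x [] n)).1, q.2 + 1 + (c.run (q.1.setNat x [] n)).2)) :
    Inv (lo.eval s + (hi.eval s - lo.eval s)) ((loop x lo hi c).run s) := by
  rw [Cmd.run]
  exact foldl_range'_inv _ Inv _ _ _ h0 fun m q h1 h2 h3 => hstep m q h1 (by omega) h3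

theorem run_loop_inv {x : ℕ} {lo hi : NExp} {c : Cmd} {s : State}
    (Inv : ℕ → State → Prop) (h0 : Inv (lo.eval s) s)
    (hstep : ∀ n s', lo.eval s ≤ n → n < hi.eval s → Inv n s' →
      Inv (n + 1) (c.run (s'.setNat x [] n)).1) :
    Inv (lo.eval s + (hi.eval s - lo.eval s)) ((loop x lo hi c).run s).1 :=
  run_loop_inv_pair (fun n q => Inv n q.1) h0 fun n q => hstep n q.1

/-- The written arrays are a function of the program text, so facts about untouched arrays survive
any run after a check by `decide`. -/
theorem agree_run (c : Cmd) (s : State) : Agree c s (c.run s).1 := by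
  induction c generalizing s with
  | skip => exact Agree.refl _ _
  | setNat a ix e => exact Agree.setNat (by simp [natW]) _ _
  | setReal a ix e =>
    refine ⟨fun _ _ => rfl, fun b hb => State.real_setReal_of_ne ?_⟩
    simpa [realW] using hb
  | seq c c' ih ih' =>
    exact ((ih s).mono (by simp +contextual [natW]) (by simp +contextual [realW])).trans
      ((ih' _).mono (by simp +contextual [natW]) (by simp +contextual [realW]))
  | ite b c c' ih ih' =>
    rw [Cmd.run]
    dsimp only
    split_ifs
    · exact (ih s).mono (by simp +contextual [natW]) (by simp +contextual [realW])
    · exact (ih' s).mono (by simp +contextual [natW]) (by simp +contextual [realW])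
  | loop x lo hi c ih =>
    refine run_loop_inv (fun _ s' => Agree (loop x lo hi c) s s') (Agree.refl _ _) ?_
    intro n s' _ _ h
    refine h.trans ((Agree.setNat (by simp [natW]) [] n).trans ((ih _).mono ?_ ?_))
    · simp +contextual [natW]
    · simp +contextual [realW]

/-- Loop rule; the states met by the body differ from the initial one only on arrays written by the
loop. -/
theorem run_loop_agree {x : ℕ} {lo hi : NExp} {c : Cmd} {s : State} (Inv : ℕ → State → Prop)
    (h0 : Inv (lo.eval s) s)
    (hstep : ∀ n s', lo.eval s ≤ n → n < hi.eval s → Agree (loop x lo hi c) s s' → Inv n s' →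
      Inv (n + 1) (c.run (s'.setNat x [] n)).1) :
    Inv (lo.eval s + (hi.eval s - lo.eval s)) ((loop x lo hi c).run s).1 := by
  refine (run_loop_inv (fun n s' => Agree (loop x lo hi c) s s' ∧ Inv n s')
    ⟨Agree.refl _ _, h0⟩ fun n s' h1 h2 h3 => ⟨?_, hstep n s' h1 h2 h3.1 h3.2⟩).2
  refine h3.1.trans ((Agree.setNat (by simp [natW]) [] n).trans ((agree_run c _).mono ?_ ?_))
  · simp +contextual [natW]
  · simp +contextual [realW]

end Cmd

/-! #### Time -/

/-- An upper bound of the value of a loop bound: `some none` stands for one more than the number of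
periods. -/
def NExp.cap : NExp → Option (Option ℕ)
  | const n => some (some n)
  | succ (cell 0 []) => some none
  | sub (succ (cell 0 [])) _ => some none
  | _ => none

namespace Cmd

/-- All loops have bounds that are constants or at most one more than the number of periods. -/
def capped : Cmd → Bool
  | skip => true
  | setNat _ _ _ => true
  | setReal _ _ _ => true
  | seq c c' => c.capped && c'.capped
  | ite _ c c' => c.capped && c'.capped
  | loop _ _ hi c => hi.cap.isSome && c.capped

/-- Nesting depth of the loops over periods. -/
def depth : Cmd → ℕ
  | skip => 0
  | setNat _ _ _ => 0
  | setReal _ _ _ => 0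
  | seq c c' => max c.depth c'.depth
  | ite _ c c' => max c.depth c'.depth
  | loop _ _ hi c => if hi.cap = some none then c.depth + 1 else c.depth

/-- Constant factor of the running time. -/
def coef : Cmd → ℕ
  | skip => 1
  | setNat _ ix e => 1 + (ix.map NExp.steps).sum + e.steps
  | setReal _ ix e => 1 + (ix.map NExp.steps).sum + e.steps
  | seq c c' => 1 + c.coef + c'.coef
  | ite b c c' => 1 + b.steps + (c.coef + c'.coef)
  | loop _ lo hi c => 1 + lo.steps + hi.steps +
      match hi.cap with
      | some (some n) => n * (1 + c.coef)
      | _ => 1 + c.coef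

theorem _root_.LotSizing.NExp.eval_le_of_cap {e : NExp} {s : State} {n : ℕ}
    (h : e.cap = some (some n)) : e.eval s ≤ n := by
  unfold NExp.cap at h
  split at h <;> simp_all [NExp.eval]

theorem _root_.LotSizing.NExp.eval_le_of_cap_none {e : NExp} {s : State}
    (h : e.cap = some none) : e.eval s ≤ s.nat 0 [] + 1 := by
  unfold NExp.cap at h
  split at h <;> simp_all [NExp.eval]

/-- Each loop over periods makes at most `T + 1` rounds and raises the exponent by one; loops with
constant bounds enter the coefficient. `T` itself must not be overwritten. -/
theorem steps_le (c : Cmd) (hc : c.capped = true) (h0 : 0 ∉ c.natW) (s : State) :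
    (c.run s).2 ≤ c.coef * (s.nat 0 [] + 1) ^ c.depth := by
  induction c generalizing s with
  | skip => simp [Cmd.run, coef, depth]
  | setNat a ix e => simp [Cmd.run, coef, depth]
  | setReal a ix e => simp [Cmd.run, coef, depth]
  | seq c c' ih ih' =>
    simp only [capped, Bool.and_eq_true] at hc
    simp only [natW, List.mem_append, not_or] at h0
    have e1 := ih hc.1 h0.1 s
    have e2 := ih' hc.2 h0.2 (c.run s).1
    rw [(agree_run c s).nat 0 h0.1] at e2
    have e3 : (s.nat 0 [] + 1) ^ c.depth ≤ (s.nat 0 [] + 1) ^ max c.depth c'.depth :=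
      Nat.pow_le_pow_right (by omega) (le_max_left _ _)
    have e4 : (s.nat 0 [] + 1) ^ c'.depth ≤ (s.nat 0 [] + 1) ^ max c.depth c'.depth :=
      Nat.pow_le_pow_right (by omega) (le_max_right _ _)
    have e5 : 1 ≤ (s.nat 0 [] + 1) ^ max c.depth c'.depth := Nat.one_le_pow _ _ (by omega)
    simp only [Cmd.run, coef, depth]
    nlinarith [Nat.mul_le_mul_left c.coef e3, Nat.mul_le_mul_left c'.coef e4]
  | ite b c c' ih ih' =>
    simp only [capped, Bool.and_eq_true] at hc
    simp only [natW, List.mem_append, not_or] at h0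
    have e1 := ih hc.1 h0.1 s
    have e2 := ih' hc.2 h0.2 s
    have e3 : (s.nat 0 [] + 1) ^ c.depth ≤ (s.nat 0 [] + 1) ^ max c.depth c'.depth :=
      Nat.pow_le_pow_right (by omega) (le_max_left _ _)
    have e4 : (s.nat 0 [] + 1) ^ c'.depth ≤ (s.nat 0 [] + 1) ^ max c.depth c'.depth :=
      Nat.pow_le_pow_right (by omega) (le_max_right _ _)
    have e5 : 1 ≤ (s.nat 0 [] + 1) ^ max c.depth c'.depth := Nat.one_le_pow _ _ (by omega)
    have e6 := Nat.mul_le_mul_left c.coef e3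
    have e7 := Nat.mul_le_mul_left c'.coef e4
    have e8 := Nat.mul_le_mul_left b.steps e5
    simp only [Cmd.run, coef, depth]
    split_ifs <;> nlinarith
  | loop x lo hi c ih =>
    simp only [capped, Bool.and_eq_true] at hc
    simp only [natW, List.mem_cons, not_or] at h0
    set M := s.nat 0 [] + 1 with hM
    have hM1 : 1 ≤ M := by omega
    have key := run_loop_inv_pair (x := x) (lo := lo) (hi := hi) (c := c) (s := s)
      (fun n q => q.1.nat 0 = s.nat 0 ∧ lo.eval s ≤ n ∧
        q.2 ≤ 1 + lo.steps + hi.steps + (n - lo.eval s) * (1 + c.coef * M ^ c.depth))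
      ⟨rfl, le_rfl, by simp⟩ ?_
    · have hle := key.2.2
      rw [Nat.add_sub_cancel_left] at hle
      refine hle.trans ?_
      have hp : 1 ≤ M ^ c.depth := Nat.one_le_pow _ _ hM1
      have hcap := hc.1
      simp only [coef, depth]
      have hcc : 1 + c.coef * M ^ c.depth ≤ (1 + c.coef) * M ^ c.depth := by nlinarith
      rcases hcase : hi.cap with _ | _ | n
      · simp [hcase] at hcap
      · have hb := NExp.eval_le_of_cap_none (s := s) hcase
        rw [if_pos rfl, pow_succ]
        have h1 : (hi.eval s - lo.eval s) * (1 + c.coef * M ^ c.depth) ≤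
            M * ((1 + c.coef) * M ^ c.depth) := Nat.mul_le_mul (by omega) hcc
        have h2 : 1 ≤ M ^ c.depth * M := Nat.one_le_iff_ne_zero.mpr (by positivity)
        have h3 := Nat.mul_le_mul_left (1 + lo.steps + hi.steps) h2
        dsimp only
        nlinarith
      · have hb := NExp.eval_le_of_cap (s := s) hcase
        rw [if_neg (by simp)]
        have h1 : (hi.eval s - lo.eval s) * (1 + c.coef * M ^ c.depth) ≤
            n * ((1 + c.coef) * M ^ c.depth) := Nat.mul_le_mul (by omega) hcc
        have h3 := Nat.mul_le_mul_left (1 + lo.steps + hi.steps) hp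
        dsimp only
        nlinarith
    · rintro n q h1 h2 ⟨i1, i2, i3⟩
      have e0 : (q.1.setNat x [] n).nat 0 = s.nat 0 := by
        rw [State.nat_setNat_of_ne h0.1, i1]
      refine ⟨?_, by omega, ?_⟩
      · rw [(agree_run c _).nat 0 h0.2, e0]
      · have := ih hc.2 h0.2 (q.1.setNat x [] n)
        rw [e0, ← hM] at this
        dsimp only
        rw [show n + 1 - lo.eval s = (n - lo.eval s) + 1 by omega, Nat.add_mul]
        omega

/-! #### Table entries -/

/-- The index expressions are the given scalar variables. -/
def isVars : List ℕ → List NExp → Bool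
  | [], [] => true
  | v :: vs, NExp.cell a [] :: es => a == v && isVars vs es
  | _, _ => false

theorem map_eval_of_isVars {vs : List ℕ} {es : List NExp} (h : isVars vs es = true) (s : State) :
    es.map (NExp.eval s) = vs.map fun v => s.nat v [] := by
  induction vs generalizing es with
  | nil =>
    cases es with
    | nil => rfl
    | cons e es => simp [isVars] at h
  | cons v vs ih =>
    cases es with
    | nil => simp [isVars] at h
    | cons e es =>
      unfold isVars at h
      split at h
      · simp_all
      · rename_i h1 h2
        simp only [List.cons.injEq] at h1 h2
        obtain ⟨rfl, rfl⟩ := h1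
        obtain ⟨rfl, rfl⟩ := h2
        simp only [Bool.and_eq_true, beq_iff_eq] at h
        rw [List.map_cons, List.map_cons, ih h.2, NExp.eval, h.1]
        rfl
      · exact absurd h (by simp)

/-- Every write to the array `a` of naturals has the variables `vs` in its index, after `off`
positions. -/
def natAt (a off : ℕ) (vs : List ℕ) : Cmd → Bool
  | skip => true
  | setNat b ix _ => b != a || isVars vs ((ix.drop off).take vs.length)
  | setReal _ _ _ => true
  | seq c c' => c.natAt a off vs && c'.natAt a off vs
  | ite _ c c' => c.natAt a off vs && c'.natAt a off vs
  | loop x _ _ c => x != a && c.natAt a off vs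

/-- Every write to the array `a` of reals has the variables `vs` in its index, after `off`
positions. -/
def realAt (a off : ℕ) (vs : List ℕ) : Cmd → Bool
  | skip => true
  | setNat _ _ _ => true
  | setReal b ix _ => b != a || isVars vs ((ix.drop off).take vs.length)
  | seq c c' => c.realAt a off vs && c'.realAt a off vs
  | ite _ c c' => c.realAt a off vs && c'.realAt a off vs
  | loop _ _ _ c => c.realAt a off vs

/-- The variables `vs` are not written. -/
def keeps (vs : List ℕ) (c : Cmd) : Bool := vs.all fun v => decide (v ∉ c.natW)

theorem map_nat_run {vs : List ℕ} {c : Cmd} (h : c.keeps vs = true) (s : State) :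
    (vs.map fun v => (c.run s).1.nat v []) = vs.map fun v => s.nat v [] := by
  refine List.map_congr_left fun v hv => ?_
  simp only [keeps, List.all_eq_true, decide_eq_true_eq] at h
  rw [(agree_run c s).nat v (h v hv)]

/-- The variables `vs` keep their values throughout the run, so each write to `a` has these values
at the given positions of its index. The same argument applies to `run_real_at`. -/
theorem run_nat_at {c : Cmd} {a off : ℕ} {vs : List ℕ} (h : c.natAt a off vs = true)
    (hv : c.keeps vs = true) (s : State) {jx : List ℕ}
    (hj : (jx.drop off).take vs.length ≠ vs.map fun v => s.nat v []) :
    (c.run s).1.nat a jx = s.nat a jx := by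
  induction c generalizing s with
  | skip => rfl
  | setNat b ix e =>
    simp only [natAt, Bool.or_eq_true, bne_iff_ne] at h
    change (s.setNat b _ _).nat a jx = _
    rw [State.nat_setNat, if_neg]
    rintro ⟨rfl, rfl⟩
    rcases h with h | h
    · exact h rfl
    · apply hj
      rw [← map_eval_of_isVars h s, List.map_take, List.map_drop]
  | setReal b ix e => rfl
  | seq c c' ih ih' =>
    simp only [natAt, Bool.and_eq_true] at h
    have hv1 : c.keeps vs = true := by
      simp only [keeps, List.all_eq_true, decide_eq_true_eq, natW, List.mem_append, not_or] at hv ⊢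
      exact fun v hv' => (hv v hv').1
    have hv2 : c'.keeps vs = true := by
      simp only [keeps, List.all_eq_true, decide_eq_true_eq, natW, List.mem_append, not_or] at hv ⊢
      exact fun v hv' => (hv v hv').2
    change (c'.run (c.run s).1).1.nat a jx = _
    rw [ih' h.2 hv2 _ (by rwa [map_nat_run hv1]), ih h.1 hv1 s hj]
  | ite b c c' ih ih' =>
    simp only [natAt, Bool.and_eq_true] at h
    have hv1 : c.keeps vs = true := by
      simp only [keeps, List.all_eq_true, decide_eq_true_eq, natW, List.mem_append, not_or] at hv ⊢
      exact fun v hv' => (hv v hv').1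
    have hv2 : c'.keeps vs = true := by
      simp only [keeps, List.all_eq_true, decide_eq_true_eq, natW, List.mem_append, not_or] at hv ⊢
      exact fun v hv' => (hv v hv').2
    rw [Cmd.run]
    dsimp only
    split_ifs
    · exact ih h.1 hv1 s hj
    · exact ih' h.2 hv2 s hj
  | loop x lo hi c ih =>
    simp only [natAt, Bool.and_eq_true, bne_iff_ne] at h
    have hv1 : c.keeps vs = true := by
      simp only [keeps, List.all_eq_true, decide_eq_true_eq, natW, List.mem_cons, not_or] at hv ⊢
      exact fun v hv' => (hv v hv').2
    refine run_loop_agree (fun _ s' => s'.nat a jx = s.nat a jx) rfl fun n s' _ _ hag he => ?_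
    rw [ih h.2 hv1, State.nat_setNat_of_ne (Ne.symm h.1), he]
    convert hj using 1
    refine List.map_congr_left fun v hv' => ?_
    simp only [keeps, List.all_eq_true, decide_eq_true_eq] at hv
    have hvx : v ≠ x := fun e => hv v hv' (by simp [natW, e])
    rw [State.nat_setNat_of_ne hvx, hag.nat v (hv v hv')]

theorem run_real_at {c : Cmd} {a off : ℕ} {vs : List ℕ} (h : c.realAt a off vs = true)
    (hv : c.keeps vs = true) (s : State) {jx : List ℕ}
    (hj : (jx.drop off).take vs.length ≠ vs.map fun v => s.nat v []) :
    (c.run s).1.real a jx = s.real a jx := by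
  induction c generalizing s with
  | skip => rfl
  | setNat b ix e => rfl
  | setReal b ix e =>
    simp only [realAt, Bool.or_eq_true, bne_iff_ne] at h
    change (s.setReal b _ _).real a jx = _
    rw [State.real_setReal, if_neg]
    rintro ⟨rfl, rfl⟩
    rcases h with h | h
    · exact h rfl
    · apply hj
      rw [← map_eval_of_isVars h s, List.map_take, List.map_drop]
  | seq c c' ih ih' =>
    simp only [realAt, Bool.and_eq_true] at h
    have hv1 : c.keeps vs = true := by
      simp only [keeps, List.all_eq_true, decide_eq_true_eq, natW, List.mem_append, not_or] at hv ⊢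
      exact fun v hv' => (hv v hv').1
    have hv2 : c'.keeps vs = true := by
      simp only [keeps, List.all_eq_true, decide_eq_true_eq, natW, List.mem_append, not_or] at hv ⊢
      exact fun v hv' => (hv v hv').2
    change (c'.run (c.run s).1).1.real a jx = _
    rw [ih' h.2 hv2 _ (by rwa [map_nat_run hv1]), ih h.1 hv1 s hj]
  | ite b c c' ih ih' =>
    simp only [realAt, Bool.and_eq_true] at h
    have hv1 : c.keeps vs = true := by
      simp only [keeps, List.all_eq_true, decide_eq_true_eq, natW, List.mem_append, not_or] at hv ⊢
      exact fun v hv' => (hv v hv').1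
    have hv2 : c'.keeps vs = true := by
      simp only [keeps, List.all_eq_true, decide_eq_true_eq, natW, List.mem_append, not_or] at hv ⊢
      exact fun v hv' => (hv v hv').2
    rw [Cmd.run]
    dsimp only
    split_ifs
    · exact ih h.1 hv1 s hj
    · exact ih' h.2 hv2 s hj
  | loop x lo hi c ih =>
    simp only [realAt] at h
    have hv1 : c.keeps vs = true := by
      simp only [keeps, List.all_eq_true, decide_eq_true_eq, natW, List.mem_cons, not_or] at hv ⊢
      exact fun v hv' => (hv v hv').2
    refine run_loop_agree (fun _ s' => s'.real a jx = s.real a jx) rfl fun n s' _ _ hag he => ?_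
    rw [ih h hv1, State.real_setNat, he]
    convert hj using 1
    refine List.map_congr_left fun v hv' => ?_
    simp only [keeps, List.all_eq_true, decide_eq_true_eq] at hv
    have hvx : v ≠ x := fun e => hv v hv' (by simp [natW, e])
    rw [State.nat_setNat_of_ne hvx, hag.nat v (hv v hv')]

/-- Nested loops; a variable runs through `{0, 1}` or through `{0, …, T}`. -/
def nest : List (ℕ × Bool) → Cmd → Cmd
  | [], c => c
  | (x, b) :: r, c =>
      loop x (NExp.const 0) (cond b (NExp.const 2) (NExp.succ (NExp.cell 0 []))) (nest r c)

/-- The values of the loop variables are in their ranges. -/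
def InRange (T : ℕ) (vars : List (ℕ × Bool)) (env : ℕ → ℕ) : Prop :=
  ∀ x ∈ vars, env x.1 ≤ cond x.2 1 T

theorem nest_natW {vars : List (ℕ × Bool)} {c : Cmd} {a : ℕ} :
    a ∈ (nest vars c).natW ↔ a ∈ vars.map Prod.fst ∨ a ∈ c.natW := by
  induction vars with
  | nil => simp [nest]
  | cons x r ih => simp [nest, natW, ih, or_assoc]

theorem nest_inv {vars : List (ℕ × Bool)} {c : Cmd} {s : State} (Inv : State → Prop)
    (hscal : ∀ s', ∀ x ∈ vars, ∀ n, Inv s' → Inv (s'.setNat x.1 [] n))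
    (hrun : ∀ s', Inv s' → Inv (c.run s').1) (h : Inv s) : Inv ((nest vars c).run s).1 := by
  induction vars generalizing s with
  | nil => exact hrun s h
  | cons x r ih =>
    exact run_loop_inv (fun _ s' => Inv s') h fun n s' _ _ h' =>
      ih (fun s'' y hy => hscal s'' y (by simp [hy])) (hscal s' x (by simp) n h')

/-- A table entry that is computed by the body of nested loops, and does not change when the body
is run for other values of the loop variables, is correct after the loops. -/
theorem nest_fill {vars : List (ℕ × Bool)} {c : Cmd} {vs : List ℕ} {s : State} {T : ℕ}
    (P : List ℕ → State → Prop) (hT : s.nat 0 [] = T) (h0 : 0 ∉ (nest vars c).natW)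
    (hnd : (vars.map Prod.fst).Nodup) (hkeep : ∀ x ∈ vars, x.1 ∉ c.natW)
    (hsub : ∀ x ∈ vars, x.1 ∈ vs) (hvs : ∀ x ∈ vs, x ∉ c.natW)
    (hscal : ∀ s' ix, ∀ x ∈ vars, ∀ n, P ix s' → P ix (s'.setNat x.1 [] n))
    (hpres : ∀ s' ix, (ix ≠ vs.map fun v => s'.nat v []) → P ix s' → P ix (c.run s').1)
    (Inv : State → Prop) (hI : Inv s)
    (hIscal : ∀ s', ∀ x ∈ vars, ∀ n, Inv s' → Inv (s'.setNat x.1 [] n))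
    (hIrun : ∀ s', Inv s' → Inv (c.run s').1)
    (hbody : ∀ s', Agree (nest vars c) s s' → Inv s' → InRange T vars (fun v => s'.nat v []) →
      P (vs.map fun v => s'.nat v []) (c.run s').1)
    (env : ℕ → ℕ) (henv : InRange T vars env)
    (hfix : ∀ v ∈ vs, v ∉ vars.map Prod.fst → env v = s.nat v []) :
    P (vs.map env) ((nest vars c).run s).1 := by
  induction vars generalizing s with
  | nil =>
    have : vs.map env = vs.map fun v => s.nat v [] :=
      List.map_congr_left fun v hv => hfix v hv (by simp)
    rw [this]
    exact hbody s (Agree.refl _ _) hI (by simp [InRange])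
  | cons x r ih =>
    obtain ⟨x, b⟩ := x
    have hx0 : x ≠ 0 := by
      intro e
      apply h0
      simp [nest, natW, e]
    simp only [List.map_cons, List.nodup_cons] at hnd
    have hsubN : ∀ a ∈ (nest r c).natW, a ∈ (nest ((x, b) :: r) c).natW := by
      intro a ha
      simp [nest, natW, ha]
    have hsubR : ∀ a ∈ (nest r c).realW, a ∈ (nest ((x, b) :: r) c).realW := by
      intro a ha
      simpa [nest, realW] using ha
    have h0' : 0 ∉ (nest r c).natW := fun h => h0 (hsubN 0 h)
    have hxr : x ∉ (nest r c).natW := by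
      rw [nest_natW, not_or]
      exact ⟨hnd.1, hkeep (x, b) (by simp)⟩
    have hcap : ∀ n, n ≤ cond b 1 T →
        n < (cond b (NExp.const 2) (NExp.succ (NExp.cell 0 []))).eval s := by
      intro n hn
      cases b
      · simp only [cond_false, NExp.eval, List.map_nil] at hn ⊢
        omega
      · simp only [cond_true, NExp.eval] at hn ⊢
        omega
    have hcap' : ∀ n, n < (cond b (NExp.const 2) (NExp.succ (NExp.cell 0 []))).eval s →
        n ≤ cond b 1 T := by
      intro n hn
      cases b
      · simp only [cond_false, NExp.eval, List.map_nil] at hn ⊢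
        omega
      · simp only [cond_true, NExp.eval] at hn ⊢
        omega
    -- running the inner loops keeps the entries for other values of `x`
    have hpresr : ∀ r' : List (ℕ × Bool), (∀ y ∈ r', y ∈ r) → ∀ s' ix,
        (∀ e : ℕ → ℕ, e x = s'.nat x [] → ix ≠ vs.map e) →
        P ix s' → P ix ((nest r' c).run s').1 := by
      intro r'
      induction r' with
      | nil => exact fun _ s' ix hne hP => hpres s' ix (hne _ rfl) hP
      | cons y r' ihr =>
        obtain ⟨y, b'⟩ := y
        intro hr s' ix hne hP
        have hyr := hr (y, b') (by simp)
        have hxy : x ≠ y := fun e => hnd.1 (List.mem_map.mpr ⟨(y, b'), hyr, e.symm⟩)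
        refine run_loop_agree (fun _ s'' => P ix s'') hP fun n s'' _ _ hag hP' => ?_
        refine ihr (fun z hz => hr z (by simp [hz])) _ ix ?_
          (hscal s'' ix (y, b') (by simp [hyr]) n hP')
        intro e he
        refine hne e (he.trans ?_)
        rw [State.nat_setNat_of_ne hxy, hag.nat x]
        intro hmem
        have hmem' : x ∈ (nest ((y, b') :: r') c).natW := hmem
        rw [nest_natW] at hmem'
        rcases hmem' with hmem' | hmem'
        · obtain ⟨z, hz, e⟩ := List.mem_map.mp hmem'
          exact hnd.1 (List.mem_map.mpr ⟨z, hr z hz, e⟩)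
        · exact hkeep (x, b) (by simp) hmem'
    -- Once `x` has passed the value `env x` the entry is correct. It remains so, because `x` is
    -- part of the index and later rounds write elsewhere.
    have hfinal := run_loop_agree (x := x) (lo := NExp.const 0)
      (hi := cond b (NExp.const 2) (NExp.succ (NExp.cell 0 []))) (c := nest r c) (s := s)
      (fun n s' => Inv s' ∧ (env x < n → P (vs.map env) s'))
      ⟨hI, fun h => absurd h (by simp [NExp.eval])⟩ ?_
    · refine hfinal.2 ?_
      have := hcap _ (henv (x, b) (by simp))
      simp only [NExp.eval] at this ⊢
      omega
    · rintro n s' _ h2 hag ⟨hI', hP⟩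
      have hI'' := hIscal s' (x, b) (by simp) n hI'
      refine ⟨nest_inv Inv (fun s'' y hy => hIscal s'' y (by simp [hy])) hIrun hI'', fun hlt => ?_⟩
      have hag' : Agree (nest ((x, b) :: r) c) s (s'.setNat x [] n) :=
        hag.trans (Agree.setNat (by simp [natW]) [] n)
      by_cases hn : env x = n
      · refine ih (s := s'.setNat x [] n) ?_ h0' hnd.2 (fun y hy => hkeep y (by simp [hy]))
          (fun y hy => hsub y (by simp [hy])) (fun s'' ix y hy => hscal s'' ix y (by simp [hy]))
          hI'' (fun s'' y hy => hIscal s'' y (by simp [hy])) ?_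
          (fun y hy => henv y (by simp [hy])) ?_
        · rw [hag'.nat 0 h0, hT]
        · intro s'' hag'' hI3 hr
          refine hbody s'' (hag'.trans (hag''.mono hsubN hsubR)) hI3 ?_
          intro y hy
          rcases List.mem_cons.mp hy with rfl | hy
          · dsimp only
            rw [hag''.nat x hxr, State.nat_setNat, if_pos ⟨rfl, rfl⟩]
            exact hcap' n h2
          · exact hr y hy
        · intro v hv hvr
          by_cases hvx : v = x
          · subst hvx
            rw [State.nat_setNat, if_pos ⟨rfl, rfl⟩, hn]
          · rw [hag'.nat v, hfix v hv (by simp [hvx] at hvr ⊢; exact hvr)]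
            rw [nest_natW, List.map_cons, List.mem_cons, not_or, not_or]
            exact ⟨⟨hvx, hvr⟩, hvs v hv⟩
      · refine hpresr r (fun y hy => hy) _ _ ?_
          (hscal s' _ (x, b) (by simp) n (hP (by omega)))
        intro e he heq
        rw [State.nat_setNat, if_pos ⟨rfl, rfl⟩] at he
        have := List.map_inj_left.mp heq x (hsub (x, b) (by simp))
        omega

end Cmd

-- Memory updates and reading of table entries

namespace State

variable {s s' : State} {a : ℕ} {ix : List ℕ}

theorem setNat_setNat {x : ℕ} {m n : ℕ} : (s.setNat x ix m).setNat x ix n = s.setNat x ix n := by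
  unfold setNat
  congr 1
  funext b jx
  dsimp only
  split_ifs <;> rfl

theorem setReal_setReal {x : ℕ} {m n : ℝ} : (s.setReal x ix m).setReal x ix n = s.setReal x ix n := by
  unfold setReal
  congr 1
  funext b jx
  dsimp only
  split_ifs <;> rfl

theorem setReal_setNat {x y : ℕ} {jx : List ℕ} {m : ℝ} {n : ℕ} :
    (s.setReal x ix m).setNat y jx n = (s.setNat y jx n).setReal x ix m := rfl

theorem setNat_self : s.setNat a ix (s.nat a ix) = s := by
  unfold setNat
  congr 1
  funext b jx
  split_ifs with h
  · rw [h.1, h.2]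
  · rfl

theorem setReal_self : s.setReal a ix (s.real a ix) = s := by
  unfold setReal
  congr 1
  funext b jx
  split_ifs with h
  · rw [h.1, h.2]
  · rfl

theorem HoldsCost.congr {c : WithTop ℝ} (h : s.HoldsCost a ix c)
    (h0 : ∀ n, s'.nat a (n :: ix) = s.nat a (n :: ix)) (hr : s'.real a ix = s.real a ix) :
    s'.HoldsCost a ix c := by
  unfold HoldsCost at *
  rwa [h0, hr]

theorem HoldsStage.congr {g : Stage} (h : s.HoldsStage a ix g)
    (h0 : ∀ n < 2, s'.nat a (n :: ix) = s.nat a (n :: ix)) (hr : s'.real a ix = s.real a ix) :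
    s'.HoldsStage a ix g := by
  unfold HoldsStage at *
  rwa [h0 0 (by norm_num), h0 1 (by norm_num), hr]

theorem HoldsStage.holdsCost {g : Stage} (h : s.HoldsStage a ix g) : s.HoldsCost a ix g.cost := by
  rcases h with ⟨rfl, h⟩ | ⟨rfl, h⟩
  · exact Or.inl ⟨rfl, h⟩
  · exact Or.inr ⟨Stage.cost_mk _ _, h⟩

theorem HoldsCost.eq_top {c : WithTop ℝ} (h : s.HoldsCost a ix c)
    (h1 : ¬ 1 ≤ s.nat a (0 :: ix)) : c = ⊤ := by
  rcases h with ⟨rfl, h⟩ | ⟨rfl, h⟩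
  · rfl
  · omega

theorem HoldsCost.eq_coe {c : WithTop ℝ} (h : s.HoldsCost a ix c)
    (h1 : 1 ≤ s.nat a (0 :: ix)) : c = (s.real a ix : ℝ) := by
  rcases h with ⟨rfl, h⟩ | ⟨h', -⟩
  · omega
  · exact h'

theorem HoldsStage.eq_top {g : Stage} (h : s.HoldsStage a ix g)
    (h1 : ¬ 1 ≤ s.nat a (0 :: ix)) : g = ⊤ := by
  rcases h with ⟨rfl, h⟩ | ⟨rfl, h⟩
  · rfl
  · omega

theorem HoldsStage.eq_mk {g : Stage} (h : s.HoldsStage a ix g)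
    (h1 : 1 ≤ s.nat a (0 :: ix)) : g = Stage.mk (s.real a ix : ℝ) (s.nat a (1 :: ix)) := by
  rcases h with ⟨rfl, h⟩ | ⟨h', -⟩
  · omega
  · exact h'

end State

infixr:60 " ⨾ " => Cmd.seq

namespace Cmd

variable {c c' : Cmd} {s s' : State}

@[simp] theorem run_skip : (skip.run s).1 = s := rfl

@[simp] theorem run_seq : ((c ⨾ c').run s).1 = (c'.run (c.run s).1).1 := rfl

@[simp] theorem run_setNat {a : ℕ} {ix : List NExp} {e : NExp} :
    ((setNat a ix e).run s).1 = s.setNat a (ix.map (NExp.eval s)) (e.eval s) := rfl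

@[simp] theorem run_setReal {a : ℕ} {ix : List NExp} {e : RExp} :
    ((setReal a ix e).run s).1 = s.setReal a (ix.map (NExp.eval s)) (e.eval s) := rfl

theorem run_ite_pos {b : Test} (h : b.holds s) : ((ite b c c').run s).1 = (c.run s).1 := by
  rw [Cmd.run]; dsimp only; rw [if_pos h]

theorem run_ite_neg {b : Test} (h : ¬ b.holds s) : ((ite b c c').run s).1 = (c'.run s).1 := by
  rw [Cmd.run]; dsimp only; rw [if_neg h]

/-- The command does not write to the given arrays. -/
def leaves (A B : List ℕ) (c : Cmd) : Bool :=
  A.all (fun a => decide (a ∉ c.natW)) && B.all (fun b => decide (b ∉ c.realW))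

theorem Agree.nat_leaves {A B : List ℕ} (h : Agree c s s') (hc : c.leaves A B = true) {a : ℕ}
    (ha : a ∈ A) : s'.nat a = s.nat a := by
  simp only [leaves, Bool.and_eq_true, List.all_eq_true, decide_eq_true_eq] at hc
  exact h.nat a (hc.1 a ha)

theorem Agree.real_leaves {A B : List ℕ} (h : Agree c s s') (hc : c.leaves A B = true) {b : ℕ}
    (hb : b ∈ B) : s'.real b = s.real b := by
  simp only [leaves, Bool.and_eq_true, List.all_eq_true, decide_eq_true_eq] at hc
  exact h.real b (hc.2 b hb)

/-- Values of scalar variables. -/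
def Vals (l : List (ℕ × ℕ)) (s : State) : Prop := ∀ p ∈ l, s.nat p.1 [] = p.2

theorem Vals.of_agree {l : List (ℕ × ℕ)} (h : Vals l s) (hag : Agree c s s')
    (hc : c.leaves (l.map Prod.fst) [] = true) : Vals l s' := fun p hp => by
  rw [hag.nat_leaves hc (List.mem_map.mpr ⟨p, hp, rfl⟩), h p hp]

/-! #### Tables -/

/-- The entry of a table at `ix` consists of the cells at `ix` of the arrays `A` of naturals, with
a leading label, and of the cells of the arrays `B` of reals whose index begins with `ix`. -/
def Local (A B : List ℕ) (m : ℕ) (P : List ℕ → State → Prop) : Prop :=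
  ∀ ix s s', ix.length = m → (∀ a ∈ A, ∀ n, s'.nat a (n :: ix) = s.nat a (n :: ix)) →
    (∀ b ∈ B, ∀ jx, s'.real b (ix ++ jx) = s.real b (ix ++ jx)) → P ix s → P ix s'

/-- The body writes to the arrays `A` and `B` only at the entry given by the variables `vs`. -/
def tableOK (vars : List (ℕ × Bool)) (c : Cmd) (vs A B : List ℕ) : Bool :=
  decide (0 ∉ c.natW) && (vars.all fun x => x.1 != 0) && decide (vars.map Prod.fst).Nodup &&
  (vars.all fun x => decide (x.1 ∉ c.natW)) && (vars.all fun x => decide (x.1 ∈ vs)) &&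
  c.keeps vs && (A.all fun a => c.natAt a 1 vs && vars.all fun x => x.1 != a) &&
  (B.all fun b => c.realAt b 0 vs)

/-- All syntactic conditions of `nest_fill` are collected in the decidable `tableOK`; what remains
is the correctness of the body for one assignment of the variables. -/
theorem nest_table {vars : List (ℕ × Bool)} {c : Cmd} {vs A B : List ℕ} {T : ℕ}
    {P : List ℕ → State → Prop} (hT : s.nat 0 [] = T) (hok : tableOK vars c vs A B = true)
    (hloc : Local A B vs.length P) (Inv : State → Prop) (hI : Inv s)
    (hIscal : ∀ s', ∀ x ∈ vars, ∀ n, Inv s' → Inv (s'.setNat x.1 [] n))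
    (hIrun : ∀ s', Inv s' → Inv (c.run s').1)
    (hbody : ∀ s', Agree (nest vars c) s s' → Inv s' → InRange T vars (fun v => s'.nat v []) →
      P (vs.map fun v => s'.nat v []) (c.run s').1)
    (env : ℕ → ℕ) (henv : InRange T vars env)
    (hfix : ∀ v ∈ vs, v ∉ vars.map Prod.fst → env v = s.nat v []) :
    P (vs.map env) ((nest vars c).run s).1 := by
  simp only [tableOK, Bool.and_eq_true, List.all_eq_true, decide_eq_true_eq, bne_iff_ne] at hok
  obtain ⟨⟨⟨⟨⟨⟨⟨h0, h0'⟩, hnd⟩, hkeep⟩, hsub⟩, hkeeps⟩, hA⟩, hB⟩ := hok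
  refine nest_fill (fun ix s => ix.length = vs.length → P ix s) hT ?_ hnd hkeep hsub ?_ ?_ ?_ Inv
    hI hIscal hIrun (fun s' h1 h2 h3 _ => hbody s' h1 h2 h3) env henv hfix (by simp)
  · rw [nest_natW, not_or]
    refine ⟨fun h => ?_, h0⟩
    obtain ⟨x, hx, e⟩ := List.mem_map.mp h
    exact h0' x hx e
  · intro x hx
    simp only [keeps, List.all_eq_true, decide_eq_true_eq] at hkeeps
    exact hkeeps x hx
  · intro s' ix x hx n hP hlen
    refine hloc ix s' _ hlen (fun a ha m => ?_) (fun b hb jx => rfl) (hP hlen)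
    rw [State.nat_setNat_of_ne (fun e => (hA a ha).2 x hx e.symm)]
  · intro s' ix hne hP hlen
    refine hloc ix s' _ hlen (fun a ha m => ?_) (fun b hb jx => ?_) (hP hlen)
    · refine run_nat_at (hA a ha).1 hkeeps s' ?_
      rwa [List.drop_one, List.tail_cons, ← hlen, List.take_length]
    · refine run_real_at (hB b hb) hkeeps s' ?_
      rwa [List.drop_zero, ← hlen, List.take_left]

/-- The states agree on the arrays `A` and `B` at the indices with the entry at position `p`
different from the value of the variable `r`. -/
structure Keep (A B : List ℕ) (p r : ℕ) (s s' : State) : Prop where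
  reg : s'.nat r [] = s.nat r []
  nat : ∀ a ∈ A, ∀ m jx, (jx.drop p).take 1 ≠ [s.nat r []] → s'.nat a (m :: jx) = s.nat a (m :: jx)
  real : ∀ b ∈ B, ∀ jx, (jx.drop p).take 1 ≠ [s.nat r []] → s'.real b jx = s.real b jx

/-- The command writes to the arrays `A` and `B` only at indices with the variable `r` at position
`p`. -/
def keepOK (A B : List ℕ) (p r : ℕ) (c : Cmd) : Bool :=
  c.keeps [r] && (A.all fun a => c.natAt a (p + 1) [r]) && (B.all fun b => c.realAt b p [r]) &&
  decide (r ∉ A)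

variable {A B : List ℕ} {p r : ℕ}

theorem Keep.refl (s : State) : Keep A B p r s s :=
  ⟨rfl, fun _ _ _ _ _ => rfl, fun _ _ _ _ => rfl⟩

theorem Keep.trans {s'' : State} (h : Keep A B p r s s') (h' : Keep A B p r s' s'') :
    Keep A B p r s s'' := by
  refine ⟨h'.reg.trans h.reg, fun a ha m jx hj => ?_, fun b hb jx hj => ?_⟩
  · rw [h'.nat a ha m jx (by rwa [h.reg]), h.nat a ha m jx hj]
  · rw [h'.real b hb jx (by rwa [h.reg]), h.real b hb jx hj]

theorem Keep.run (hc : c.keepOK A B p r = true) (s : State) : Keep A B p r s (c.run s).1 := by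
  simp only [keepOK, Bool.and_eq_true, List.all_eq_true, decide_eq_true_eq] at hc
  obtain ⟨⟨⟨hk, hA⟩, hB⟩, -⟩ := hc
  refine ⟨?_, fun a ha m jx hj => ?_, fun b hb jx hj => ?_⟩
  · have := map_nat_run hk s
    simpa using this
  · exact run_nat_at (hA a ha) hk s (by simpa using hj)
  · exact run_real_at (hB b hb) hk s (by simpa using hj)

theorem Keep.setNat {x : ℕ} (hx : x ∉ A) (hr : x ≠ r) (n : ℕ) :
    Keep A B p r s (s.setNat x [] n) := by
  refine ⟨by rw [State.nat_setNat_of_ne hr.symm], fun a ha m jx hj => ?_, fun _ _ _ _ => rfl⟩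
  rw [State.nat_setNat_of_ne (ne_of_mem_of_not_mem ha hx)]

/-- Filling a table from entries filled before, which stay available. -/
theorem nest_table_keep {vars : List (ℕ × Bool)} {c : Cmd} {vs A B : List ℕ} {T p r : ℕ}
    {P : List ℕ → State → Prop} (hT : s.nat 0 [] = T) (hok : tableOK vars c vs A B = true)
    (hkeep : c.keepOK A B p r = true) (hr : ∀ x ∈ vars, x.1 ∉ A ∧ x.1 ≠ r)
    (hloc : Local A B vs.length P)
    (hbody : ∀ s', Agree (nest vars c) s s' → Keep A B p r s s' →
      InRange T vars (fun v => s'.nat v []) → P (vs.map fun v => s'.nat v []) (c.run s').1)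
    (env : ℕ → ℕ) (henv : InRange T vars env)
    (hfix : ∀ v ∈ vs, v ∉ vars.map Prod.fst → env v = s.nat v []) :
    P (vs.map env) ((nest vars c).run s).1 :=
  nest_table hT hok hloc (Keep A B p r s) (Keep.refl s)
    (fun _ x hx n h => h.trans (Keep.setNat (hr x hx).1 (hr x hx).2 n))
    (fun s' h => h.trans (Keep.run hkeep s')) hbody env henv hfix

/-- Running `c` for the values `T, …, 1` of the variable `r`, counted by `x`. -/
def desc (x r : ℕ) (c : Cmd) : Cmd :=
  loop x (.const 1) (.succ (.cell 0 []))
    (setNat r [] (.sub (.succ (.cell 0 [])) (.cell x [])) ⨾ c)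

/-- Backward recursion over `r`: the body for `i` may use the entries for all larger values, because
its own writes carry `i` at position `p` of the index. -/
theorem desc_fill {x T : ℕ} (hT : s.nat 0 [] = T) (hx : x ∉ A ∧ x ≠ r ∧ x ∉ c.natW)
    (h0 : 0 ∉ (desc x r c).natW) (hkeep : c.keepOK A B p r = true) (Q : ℕ → State → Prop)
    (hloc : ∀ i s s',
      (∀ a ∈ A, ∀ m jx, (jx.drop p).take 1 = [i] → s'.nat a (m :: jx) = s.nat a (m :: jx)) →
      (∀ b ∈ B, ∀ jx, (jx.drop p).take 1 = [i] → s'.real b jx = s.real b jx) → Q i s → Q i s')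
    (hbody : ∀ i s', 1 ≤ i → i ≤ T → Agree (desc x r c) s s' → s'.nat r [] = i →
      (∀ i', i < i' → i' ≤ T → Q i' s') → Q i (c.run s').1) :
    ∀ i, 1 ≤ i → i ≤ T → Q i ((desc x r c).run s).1 := by
  have hrA : r ∉ A := by
    simp only [keepOK, Bool.and_eq_true, decide_eq_true_eq] at hkeep
    exact hkeep.2
  -- When `x` reaches `n`, the entries for the values above `T + 1 - n` are filled; this round
  -- treats `T + 1 - n`.
  have key := run_loop_agree (x := x) (lo := .const 1) (hi := .succ (.cell 0 []))
    (c := setNat r [] (.sub (.succ (.cell 0 [])) (.cell x [])) ⨾ c) (s := s)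
    (fun n s' => 1 ≤ n ∧ ∀ i, T + 1 < n + i → i ≤ T → Q i s') ⟨by simp [NExp.eval], ?_⟩ ?_
  · intro i h1 h2
    refine key.2 i ?_ h2
    simp only [NExp.eval, List.map_nil, hT]
    omega
  · intro i h1 h2
    simp only [NExp.eval] at h1
    omega
  · rintro n s' h1 h2 hag ⟨h3, h4⟩
    refine ⟨by omega, fun i h5 h6 => ?_⟩
    simp only [NExp.eval, List.map_nil, hT] at h1 h2
    set s1 := s'.setNat x [] n with hs1
    have hT1 : s1.nat 0 [] = T := by
      rw [← hT, hs1, State.nat_setNat_of_ne, hag.nat 0 h0]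
      rintro rfl
      exact h0 (by simp [desc, natW])
    set s2 := s1.setNat r [] (T + 1 - n) with hs2
    have hrun : ((setNat r [] (.sub (.succ (.cell 0 [])) (.cell x [])) ⨾ c).run s1).1 =
        (c.run s2).1 := by
      rw [run_seq, run_setNat]
      simp only [List.map_nil, NExp.eval, hT1]
      rw [hs2, hs1, State.nat_setNat, if_pos ⟨rfl, rfl⟩]
    have hr2 : s2.nat r [] = T + 1 - n := by simp [hs2]
    have hold : ∀ i', T + 1 - n < i' → i' ≤ T → Q i' s2 := by
      intro i' h7 h8
      refine hloc i' s' s2 (fun a ha m jx _ => ?_) (fun b hb jx _ => rfl) (h4 i' (by omega) h8)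
      rw [hs2, State.nat_setNat_of_ne (ne_of_mem_of_not_mem ha hrA), hs1,
        State.nat_setNat_of_ne (ne_of_mem_of_not_mem ha hx.1)]
    rw [hrun]
    by_cases hi : i = T + 1 - n
    · subst hi
      refine hbody _ s2 (by omega) h6 ?_ hr2 hold
      exact hag.trans ((Agree.setNat (by simp [natW]) [] n).trans
        (Agree.setNat (by simp [natW]) [] _))
    · have hk := Keep.run hkeep s2
      refine hloc i s2 _ (fun a ha m jx hj => hk.nat a ha m jx ?_)
        (fun b hb jx hj => hk.real b hb jx ?_) (hold i (by omega) h6)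
      · rw [hj, hr2]; simpa using hi
      · rw [hj, hr2]; simpa using hi

/-! #### Loops over intervals -/

/-- The loop over `lo ≤ x < hi`, for `hi` at most one more than the number of periods. -/
def upto (x : ℕ) (lo hi : NExp) (c : Cmd) : Cmd :=
  loop x lo (.sub (.succ (.cell 0 [])) (.sub (.succ (.cell 0 [])) hi)) c

/-- `(T + 1) - ((T + 1) - hi)` equals `hi` as long as `hi ≤ T + 1`. The detour gives the loop bound
a form that `NExp.cap` recognizes. -/
theorem run_upto_agree {x : ℕ} {lo hi : NExp} (hT : hi.eval s ≤ s.nat 0 [] + 1)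
    (Inv : ℕ → State → Prop) (h0 : Inv (lo.eval s) s)
    (hstep : ∀ n s', lo.eval s ≤ n → n < hi.eval s → Agree (upto x lo hi c) s s' → Inv n s' →
      Inv (n + 1) (c.run (s'.setNat x [] n)).1) :
    Inv (lo.eval s + (hi.eval s - lo.eval s)) ((upto x lo hi c).run s).1 := by
  have e : (NExp.sub (.succ (.cell 0 [])) (.sub (.succ (.cell 0 [])) hi)).eval s = hi.eval s := by
    simp only [NExp.eval, List.map_nil]
    omega
  have := run_loop_agree (x := x) (lo := lo)
    (hi := .sub (.succ (.cell 0 [])) (.sub (.succ (.cell 0 [])) hi)) (c := c) (s := s) Inv h0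
    (by rw [e]; exact hstep)
  rwa [e] at this

/-- Add the values of `e` to the variable `r`. -/
def sumLoop (x : ℕ) (lo hi : NExp) (r : ℕ) (e : RExp) : Cmd :=
  upto x lo hi (setReal r [] (.add (.cell r []) e))

theorem run_sumLoop {x r : ℕ} {lo hi : NExp} {e : RExp} (f : ℕ → ℝ)
    (hT : hi.eval s ≤ s.nat 0 [] + 1)
    (hf : ∀ n z, lo.eval s ≤ n → n < hi.eval s →
      e.eval ((s.setNat x [] n).setReal r [] z) = f n) :
    ∃ m, ((sumLoop x lo hi r e).run s).1 = (s.setNat x [] m).setReal r []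
      (s.real r [] + ∑ n ∈ Finset.Ico (lo.eval s) (hi.eval s), f n) := by
  have key := run_upto_agree (x := x) (lo := lo) (hi := hi)
    (c := setReal r [] (.add (.cell r []) e)) (s := s) hT
    (fun n s' => lo.eval s ≤ n ∧ ∃ m, s' = (s.setNat x [] m).setReal r []
      (s.real r [] + ∑ n ∈ Finset.Ico (lo.eval s) n, f n))
    ⟨le_rfl, s.nat x [], by simp [State.setNat_self, State.setReal_self]⟩ ?_
  · obtain ⟨-, m, hm⟩ := key
    refine ⟨m, hm.trans ?_⟩
    congr 3
    rcases le_total (lo.eval s) (hi.eval s) with h | h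
    · rw [Nat.add_sub_cancel' h]
    · rw [Nat.sub_eq_zero_of_le h, Nat.add_zero, Finset.Ico_self, Finset.Ico_eq_empty_of_le h]
  · rintro n s' h1 h2 - ⟨-, m, rfl⟩
    refine ⟨by omega, n, ?_⟩
    rw [State.setReal_setNat, State.setNat_setNat, run_setReal, List.map_nil,
      State.setReal_setReal, RExp.eval, hf n _ h1 h2, Finset.sum_Ico_succ_top h1]
    simp [RExp.eval, add_assoc]

/-! #### Minimization -/

/-- The array `120` holds the best stage value found so far; if it is finite, the variables `121`,
`122`, `123` witness `W`. -/
def Best (W : Stage → ℕ → ℕ → ℕ → Prop) (s : State) (g : Stage) : Prop :=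
  s.HoldsStage 120 [] g ∧ (g ≠ ⊤ → W g (s.nat 121 []) (s.nat 122 []) (s.nat 123 []))

/-- Nothing found yet. -/
def clear : Cmd := setNat 120 [.const 0] (.const 0)

/-- Offer the value of `e` with last ordering period `r₀` and witnesses `r₁`, `r₂`, `r₃`, provided
that `b` holds. -/
def offer (b : Test) (e : RExp) (r₀ r₁ r₂ r₃ : ℕ) : Cmd :=
  -- The offer is taken if nothing finite is stored or if its pair of cost and period is
  -- lexicographically strictly smaller. The variables `100` and `101` hold `0` and `1`, because
  -- natural cells are indexed by variables only.
  ite (.and b (.not (.and (.natLe (.const 1) (.cell 120 [100])) (.and (.realLe (.cell 120 []) e)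
      (.not (.and (.realLe e (.cell 120 []))
        (.natLe (.succ (.cell r₀ [])) (.cell 120 [101]))))))))
    (setReal 120 [] e ⨾ setNat 120 [.const 1] (.cell r₀ []) ⨾ setNat 120 [.const 0] (.const 1) ⨾
      setNat 121 [] (.cell r₁ []) ⨾ setNat 122 [] (.cell r₂ []) ⨾ setNat 123 [] (.cell r₃ []))
    skip

variable {W : Stage → ℕ → ℕ → ℕ → Prop} {g : Stage}

theorem best_clear : Best W (clear.run s).1 ⊤ := by
  refine ⟨Or.inl ⟨rfl, ?_⟩, fun h => absurd rfl h⟩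
  simp [clear, NExp.eval]

theorem Best.congr (h : Best W s g) (hn : ∀ a, 120 ≤ a → a ≤ 123 → s'.nat a = s.nat a)
    (hr : s'.real 120 = s.real 120) : Best W s' g := by
  refine ⟨h.1.congr (fun n _ => ?_) (by rw [hr]), fun hg => ?_⟩
  · rw [hn 120 (by norm_num) (by norm_num)]
  · rw [hn 121 (by norm_num) (by norm_num), hn 122 (by norm_num) (by norm_num),
      hn 123 (by norm_num) (by norm_num)]
    exact h.2 hg

theorem Best.setNat (h : Best W s g) {x : ℕ} (hx : x < 120) (n : ℕ) :
    Best W (s.setNat x [] n) g :=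
  h.congr (fun a ha _ => State.nat_setNat_of_ne (by omega)) rfl

theorem mk_lt_mk {a b : ℝ} {k l : ℕ} :
    Stage.mk (a : WithTop ℝ) k < Stage.mk (b : WithTop ℝ) l ↔ a < b ∨ (a = b ∧ k < l) := by
  rw [Stage.mk_coe, Stage.mk_coe, WithTop.coe_lt_coe, Prod.Lex.toLex_lt_toLex]

/-- A candidate that fails the test `b` is read as `⊤`. This uniform treatment turns a whole loop of
offers into a minimum over an interval. -/
theorem Best.offer (hB : Best W s g) {b : Test} {e : RExp} {r₀ r₁ r₂ r₃ : ℕ}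
    (hr : r₀ < 120 ∧ r₁ < 120 ∧ r₂ < 120 ∧ r₃ < 120) (h100 : s.nat 100 [] = 0)
    (h101 : s.nat 101 [] = 1) (h : Stage)
    (hpos : b.holds s → h = Stage.mk (e.eval s : ℝ) (s.nat r₀ []) ∧
      W h (s.nat r₁ []) (s.nat r₂ []) (s.nat r₃ []))
    (hneg : ¬ b.holds s → h = ⊤) :
    Best W ((Cmd.offer b e r₀ r₁ r₂ r₃).run s).1 (min g h) := by
  obtain ⟨k0, k1, k2, k3⟩ := hr
  unfold Cmd.offer
  by_cases hb : b.holds s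
  swap
  · rw [run_ite_neg, run_skip, hneg hb, min_eq_left le_top]
    · exact hB
    · rintro ⟨h1, -⟩
      exact hb h1
  obtain ⟨hh, hW⟩ := hpos hb
  have better : h < g ↔ ¬ (1 ≤ s.nat 120 [0] ∧ s.real 120 [] ≤ e.eval s ∧
      ¬ (e.eval s ≤ s.real 120 [] ∧ s.nat r₀ [] + 1 ≤ s.nat 120 [1])) := by
    rcases hB.1 with ⟨h1, h2⟩ | ⟨h1, h2⟩
    · rw [h1, h2, hh]
      simp [Stage.mk_coe]
    · rw [h1, h2, hh, mk_lt_mk]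
      constructor
      · rintro h ⟨-, h4, h5⟩
        rcases h with h | ⟨h, h'⟩
        · linarith
        · exact h5 ⟨h.le, h'⟩
      · intro h3
        by_contra h4
        push Not at h4
        refine h3 ⟨le_rfl, h4.1, fun h5 => ?_⟩
        have := h4.2 (le_antisymm h5.1 h4.1)
        omega
  by_cases hlt : h < g
  · rw [run_ite_pos, min_eq_right hlt.le]
    · constructor
      · right
        rw [hh]
        refine ⟨?_, by simp [NExp.eval]⟩
        simp [NExp.eval]
      · intro _
        simp only [run_seq, run_setReal, run_setNat, NExp.eval, List.map_nil, State.nat_setNat,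
          State.nat_setReal]
        simpa [show r₁ ≠ 120 by omega, show r₂ ≠ 120 by omega, show r₃ ≠ 120 by omega,
          show r₁ ≠ 121 by omega, show r₂ ≠ 121 by omega, show r₃ ≠ 121 by omega,
          show r₂ ≠ 122 by omega, show r₃ ≠ 122 by omega] using hW
    · refine ⟨hb, ?_⟩
      simpa [Test.holds, RExp.eval, NExp.eval, h100, h101] using better.mp hlt
  · rw [run_ite_neg, run_skip, min_eq_left (not_lt.mp hlt)]
    · exact hB
    · rintro ⟨-, h3⟩
      apply hlt
      rw [better]
      simpa [Test.holds, RExp.eval, NExp.eval, h100, h101] using h3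

theorem Best.upto (hB : Best W s g) {x : ℕ} {lo hi : NExp} (hT : hi.eval s ≤ s.nat 0 [] + 1)
    (h : ℕ → Stage)
    (hbody : ∀ n s' g', lo.eval s ≤ n → n < hi.eval s → Agree (upto x lo hi c) s s' →
      Best W s' g' → Best W (c.run (s'.setNat x [] n)).1 (min g' (h n))) :
    Best W ((Cmd.upto x lo hi c).run s).1
      (min g ((Finset.Ico (lo.eval s) (hi.eval s)).inf h)) := by
  have key := run_upto_agree (x := x) (lo := lo) (hi := hi) (c := c) (s := s) hT
    (fun n s' => lo.eval s ≤ n ∧ Best W s' (min g ((Finset.Ico (lo.eval s) n).inf h)))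
    ⟨le_rfl, by simpa using hB⟩ ?_
  · have e : Finset.Ico (lo.eval s) (lo.eval s + (hi.eval s - lo.eval s)) =
        Finset.Ico (lo.eval s) (hi.eval s) := by
      ext n
      simp only [Finset.mem_Ico]
      omega
    rw [← e]
    exact key.2
  · rintro n s' h1 h2 hag ⟨-, h3⟩
    refine ⟨by omega, ?_⟩
    have := hbody n s' _ h1 h2 hag h3
    rwa [min_assoc, min_comm (Finset.inf _ _), ← Finset.inf_insert,
      Finset.insert_Ico_right_eq_Ico_add_one h1] at this

/-- The loop over the two labels. -/
def labels (x : ℕ) (c : Cmd) : Cmd := loop x (.const 0) (.const 2) c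

theorem inf_bool (h : Bool → Stage) :
    (Finset.univ : Finset Bool).inf h = min (h false) (h true) := by
  rw [show (Finset.univ : Finset Bool) = {false, true} by decide, Finset.inf_insert,
    Finset.inf_singleton]

theorem Best.labels (hB : Best W s g) {x : ℕ} (h : Bool → Stage)
    (hbody : ∀ γ s' g', Agree (labels x c) s s' →
      Best W s' g' → Best W (c.run (s'.setNat x [] γ.toNat)).1 (min g' (h γ))) :
    Best W ((Cmd.labels x c).run s).1 (min g ((Finset.univ : Finset Bool).inf h)) := by
  have e : ((Cmd.labels x c).run s).1 =
      (c.run ((c.run (s.setNat x [] 0)).1.setNat x [] 1)).1 := rfl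
  have h1 := hbody false s g (Agree.refl _ _) hB
  have hag : Agree (Cmd.labels x c) s (c.run (s.setNat x [] 0)).1 :=
    (Agree.setNat (by simp [Cmd.labels, natW]) [] 0).trans
      ((agree_run c _).mono (by simp +contextual [Cmd.labels, natW])
        (by simp [Cmd.labels, realW]))
  have h2 := hbody true _ _ hag h1
  rw [e, inf_bool, ← min_assoc]
  exact h2

/-- Copy the best value to the table `a` at the values of the variables `vs`. -/
def store (a : ℕ) (vs : List ℕ) : Cmd :=
  setReal a (vs.map fun v => .cell v []) (.cell 120 []) ⨾
  setNat a (.const 0 :: vs.map fun v => .cell v []) (.cell 120 [100]) ⨾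
  setNat a (.const 1 :: vs.map fun v => .cell v []) (.cell 120 [101])

theorem run_store {a : ℕ} {vs : List ℕ} (ha : a ≠ 120 ∧ a ≠ 100 ∧ a ≠ 101 ∧ a ∉ vs)
    (h100 : s.nat 100 [] = 0) (h101 : s.nat 101 [] = 1) (h : s.HoldsStage 120 [] g) :
    ((store a vs).run s).1.HoldsStage a (vs.map fun v => s.nat v []) g := by
  obtain ⟨a1, a2, a3, a4⟩ := ha
  have hv : ∀ (z : State) jx n, (vs.map fun v => (z.setNat a jx n).nat v []) =
      vs.map fun v => z.nat v [] := by
    intro z jx n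
    refine List.map_congr_left fun v hv => ?_
    rw [State.nat_setNat_of_ne (ne_of_mem_of_not_mem hv a4)]
  have hs : ((store a vs).run s).1 =
      (((s.setReal a (vs.map fun v => s.nat v []) (s.real 120 [])).setNat a
        (0 :: vs.map fun v => s.nat v []) (s.nat 120 [0])).setNat a
        (1 :: vs.map fun v => s.nat v []) (s.nat 120 [1])) := by
    simp only [store, run_seq, run_setReal, run_setNat, List.map_cons, NExp.eval, RExp.eval,
      List.map_nil, List.map_map, Function.comp_def, State.nat_setReal, h100, hv]
    simp [a3.symm, a1.symm, h101]
  rw [hs]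
  rcases h with ⟨rfl, h0⟩ | ⟨h1, h0⟩
  · exact Or.inl ⟨rfl, by simp [h0]⟩
  · exact Or.inr ⟨by simpa using h1, by simp [h0]⟩

end Cmd

namespace Data

variable {I J : Data}

/-! ### Tightening the inventory bounds -/

/-- The tightened bound `m` periods before the last one. -/
def tightBound (I : Data) : ℕ → ℝ
  | 0 => I.u I.T
  | m + 1 => min (I.u (I.T - (m + 1))) (I.tightBound m + I.d (I.T - m))

/-- The instance with tightened inventory bounds. -/
def tighten (I : Data) : Data :=
  { I with u := fun t => if 1 ≤ t ∧ t ≤ I.T then I.tightBound (I.T - t) else I.u t }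

theorem tighten_u_last (h : 1 ≤ I.T) : I.tighten.u I.T = I.u I.T := by
  simp [tighten, h, tightBound]

theorem tighten_u {t : ℕ} (h1 : 1 ≤ t) (h2 : t < I.T) :
    I.tighten.u t = min (I.u t) (I.tighten.u (t + 1) + I.d (t + 1)) := by
  obtain ⟨m, hm⟩ : ∃ m, I.T - t = m + 1 := ⟨I.T - t - 1, by omega⟩
  have hm' : I.T - (t + 1) = m := by omega
  simp only [tighten, h1, h2.le, and_self, if_true, hm, hm', tightBound,
    show 1 ≤ t + 1 ∧ t + 1 ≤ I.T from ⟨by omega, h2⟩, show I.T - (m + 1) = t by omega,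
    show I.T - m = t + 1 by omega]

theorem tighten_induction {P : ℕ → Prop} (h0 : P I.T)
    (hstep : ∀ t, 1 ≤ t → t < I.T → P (t + 1) → P t) {t : ℕ} (h1 : 1 ≤ t) (h2 : t ≤ I.T) : P t := by
  obtain ⟨m, hm⟩ : ∃ m, I.T = t + m := ⟨I.T - t, by omega⟩
  induction m generalizing t with
  | zero => rwa [show t = I.T by omega]
  | succ m ih => exact hstep t h1 (by omega) (ih (by omega) (by omega) (by omega))

theorem tighten_u_le (h : 1 ≤ I.T) {t : ℕ} (h1 : 1 ≤ t) (h2 : t ≤ I.T) : I.tighten.u t ≤ I.u t := by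
  rcases h2.lt_or_eq with h2 | rfl
  · rw [tighten_u h1 h2]
    exact min_le_left _ _
  · rw [tighten_u_last h]

theorem Valid.tighten (hV : I.Valid) : I.tighten.Valid := by
  refine ⟨hV.1, fun t h1 h2 => ?_⟩
  have hu : 0 ≤ I.tighten.u t := by
    refine tighten_induction (I := I) (P := fun t => 0 ≤ I.tighten.u t) ?_ ?_ h1 h2
    · rw [tighten_u_last hV.1]
      exact (hV.2 _ hV.1 le_rfl).2.2.2.2.2.2.2
    · intro t h1 h2 ih
      rw [tighten_u h1 h2]
      exact le_min (hV.2 t h1 h2.le).2.2.2.2.2.2.2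
        (add_nonneg ih (hV.2 (t + 1) (by omega) h2).1)
  obtain ⟨a1, a2, a3, a4, a5, a6, a7, -⟩ := hV.2 t h1 h2
  exact ⟨a1, a2, a3, a4, a5, a6, a7, hu⟩

theorem tight_tighten (I : Data) : I.tighten.Tight := by
  intro t h1 h2
  change t ≤ I.T at h2
  have := tighten_u (I := I) (t := t - 1) (by omega) (by omega)
  rw [Nat.sub_add_cancel (by omega)] at this
  rw [this]
  exact min_le_right _ _

theorem Tight.tighten_eq (hT : 1 ≤ I.T) (h : I.Tight) : I.tighten = I := by
  have key : ∀ t, 1 ≤ t → t ≤ I.T → I.tighten.u t = I.u t := by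
    intro t
    refine tighten_induction (I := I) (P := fun t => I.tighten.u t = I.u t) (tighten_u_last hT) ?_
    intro t h1 h2 ih
    rw [tighten_u h1 h2, ih, min_eq_left]
    simpa using h (t + 1) (by omega) h2
  have hu : I.tighten.u = I.u := by
    funext t
    by_cases ht : 1 ≤ t ∧ t ≤ I.T
    · exact key t ht.1 ht.2
    · simp [tighten, ht]
  calc I.tighten = { I with u := I.tighten.u } := rfl
    _ = I := by rw [hu]

/-- By the balance at `t + 1` and nonnegative orders, `s_t ≤ s_{t+1} + d_{t+1}`. So the tightened
bounds hold in every feasible plan, by induction backwards in time. -/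
theorem feasible_tighten (hV : I.Valid) {P : Plan} : I.tighten.Feasible P ↔ I.Feasible P := by
  constructor
  · rintro ⟨h1, h2, h3⟩
    refine ⟨h1, h2, fun t ht1 ht2 => ?_⟩
    obtain ⟨a1, a2, a3, a4, a5, a6, a7, a8, a9, a10, a11⟩ := h3 t ht1 ht2
    exact ⟨a1, a2, a3, a4, a5, a6, a7, a8, a9, a10, a11.trans (tighten_u_le hV.1 ht1 ht2)⟩
  · rintro ⟨h1, h2, h3⟩
    refine ⟨h1, h2, fun t ht1 ht2 => ?_⟩
    obtain ⟨a1, a2, a3, a4, a5, a6, a7, a8, a9, a10, a11⟩ := h3 t ht1 ht2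
    refine ⟨a1, a2, a3, a4, a5, a6, a7, a8, a9, a10, ?_⟩
    refine tighten_induction (I := I) (P := fun t => P.sR t ≤ I.tighten.u t) ?_ ?_ ht1 ht2
    · rw [tighten_u_last hV.1]
      exact (h3 I.T hV.1 le_rfl).2.2.2.2.2.2.2.2.2.2
    · intro t ht1 ht2 ih
      rw [tighten_u ht1 ht2]
      refine le_min (h3 t ht1 ht2.le).2.2.2.2.2.2.2.2.2.2 ?_
      obtain ⟨b1, -, -, -, b5, -⟩ := h3 (t + 1) (by omega) ht2
      rw [Nat.add_sub_cancel] at b1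
      linarith

theorem costs_tighten (hV : I.Valid) : I.tighten.costs = I.costs := by
  ext c
  simp only [costs, Set.mem_ofPred_eq, feasible_tighten hV]
  rfl

end Data

/-! ### The data in memory -/

/-- The memory contains the data of the instance, apart from the bounds, and some constants. -/
structure Loaded (J : Data) (s : State) : Prop where
  T : s.nat 0 [] = J.T
  zero : s.nat 100 [] = 0
  one : s.nat 101 [] = 1
  two : s.nat 115 [] = 2
  d : ∀ t, 1 ≤ t → t ≤ J.T → s.real 0 [t] = J.d t
  fR : ∀ t, 1 ≤ t → t ≤ J.T → s.real 1 [t] = J.fR t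
  pR : ∀ t, 1 ≤ t → t ≤ J.T → s.real 2 [t] = J.pR t
  hR : ∀ t, 1 ≤ t → t ≤ J.T → s.real 3 [t] = J.hR t
  fS : ∀ t, 1 ≤ t → t ≤ J.T → s.real 4 [t] = J.fS t
  pS : ∀ t, 1 ≤ t → t ≤ J.T → s.real 5 [t] = J.pS t
  hS : ∀ t, 1 ≤ t → t ≤ J.T → s.real 6 [t] = J.hS t

/-- The memory moreover contains tables of the inventory levels, of the cumulative demands and of
the unit holding costs at the supplier. -/
structure Ready (J : Data) (s : State) : Prop extends Loaded J s where
  lev : ∀ (b : Bool) t, t ≤ J.T → s.real 20 [b.toNat, t] = J.lev b t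
  D : ∀ m j, m ≤ J.T → j ≤ J.T → s.real 21 [m, j] = J.D (m + 1) j
  hold : ∀ t k, 1 ≤ t → t ≤ J.T → k ≤ J.T → s.real 22 [t, k] = J.unitHold t k

section

variable {J : Data} {s s' : State} {c : Cmd}

theorem Loaded.congr (h : Loaded J s) (hn : ∀ a ∈ [0, 100, 101, 115], s'.nat a = s.nat a)
    (hr : ∀ b ∈ [0, 1, 2, 3, 4, 5, 6], s'.real b = s.real b) : Loaded J s' := by
  constructor
  · rw [hn _ (by simp)]; exact h.T
  · rw [hn _ (by simp)]; exact h.zero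
  · rw [hn _ (by simp)]; exact h.one
  · rw [hn _ (by simp)]; exact h.two
  · rw [hr _ (by simp)]; exact h.d
  · rw [hr _ (by simp)]; exact h.fR
  · rw [hr _ (by simp)]; exact h.pR
  · rw [hr _ (by simp)]; exact h.hR
  · rw [hr _ (by simp)]; exact h.fS
  · rw [hr _ (by simp)]; exact h.pS
  · rw [hr _ (by simp)]; exact h.hS

theorem Loaded.of_agree (h : Loaded J s) (hag : Cmd.Agree c s s')
    (hc : c.leaves [0, 100, 101, 115] [0, 1, 2, 3, 4, 5, 6] = true) : Loaded J s' :=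
  h.congr (fun _ ha => hag.nat_leaves hc ha) fun _ hb => hag.real_leaves hc hb

theorem Ready.congr (h : Ready J s) (hn : ∀ a ∈ [0, 100, 101, 115], s'.nat a = s.nat a)
    (hr : ∀ b ∈ [0, 1, 2, 3, 4, 5, 6, 20, 21, 22], s'.real b = s.real b) : Ready J s' := by
  refine ⟨h.toLoaded.congr hn fun b hb => hr b (by revert b; decide), ?_, ?_, ?_⟩
  · rw [hr _ (by simp)]; exact h.lev
  · rw [hr _ (by simp)]; exact h.D
  · rw [hr _ (by simp)]; exact h.hold

theorem Ready.of_agree (h : Ready J s) (hag : Cmd.Agree c s s')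
    (hc : c.leaves [0, 100, 101, 115] [0, 1, 2, 3, 4, 5, 6, 20, 21, 22] = true) : Ready J s' :=
  h.congr (fun _ ha => hag.nat_leaves hc ha) fun _ hb => hag.real_leaves hc hb

theorem Ready.setNat (h : Ready J s) {x : ℕ} (hx : x ∉ [0, 100, 101, 115]) {ix : List ℕ} {n : ℕ} :
    Ready J (s.setNat x ix n) :=
  h.congr (fun _ ha => State.nat_setNat_of_ne (ne_of_mem_of_not_mem ha hx)) fun _ _ => rfl

theorem Ready.setReal (h : Ready J s) {x : ℕ} (hx : x ∉ [0, 1, 2, 3, 4, 5, 6, 20, 21, 22])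
    {ix : List ℕ} {r : ℝ} : Ready J (s.setReal x ix r) :=
  h.congr (fun _ _ => rfl) fun _ hb => State.real_setReal_of_ne (ne_of_mem_of_not_mem hb hx)

end

/-! ### The program: preparation -/

namespace Program

open Cmd

/-- Set the constants. -/
def constants : Cmd :=
  setNat 101 [] (.const 1) ⨾ setNat 115 [] (.const 2)

/-- Tabulate the inventory levels, with tightened bounds. -/
def levels : Cmd :=
  desc 111 105
    (ite (.natLe (.succ (.cell 105 [])) (.cell 0 []))
      (ite (.realLe (.cell 7 [.cell 105 []])
          (.add (.cell 20 [.cell 101 [], .succ (.cell 105 [])]) (.cell 0 [.succ (.cell 105 [])])))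
        (setReal 20 [.cell 101 [], .cell 105 []] (.cell 7 [.cell 105 []]))
        (setReal 20 [.cell 101 [], .cell 105 []] (.add (.cell 20 [.cell 101 [],
          .succ (.cell 105 [])]) (.cell 0 [.succ (.cell 105 [])]))))
      (setReal 20 [.cell 101 [], .cell 105 []] (.cell 7 [.cell 105 []]))) ⨾
  setReal 20 [.cell 101 [], .const 0] .zero

/-- Sum up the demands after period `111` until period `107`. -/
def demandsBody : Cmd :=
  setReal 130 [] .zero ⨾
  sumLoop 110 (.succ (.cell 111 [])) (.succ (.cell 107 [])) 130 (.cell 0 [.cell 110 []]) ⨾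
  setReal 21 [.cell 111 [], .cell 107 []] (.cell 130 [])

/-- Tabulate the cumulative demands. -/
def demands : Cmd := nest [(111, false), (107, false)] demandsBody

/-- Sum up the unit holding costs at the supplier from period `105` to period `108`. -/
def holdingBody : Cmd :=
  setReal 130 [] .zero ⨾
  sumLoop 110 (.cell 105 []) (.cell 108 []) 130 (.cell 6 [.cell 110 []]) ⨾
  setReal 22 [.cell 105 [], .cell 108 []] (.cell 130 [])

/-- Tabulate the unit holding costs at the supplier. -/
def holding : Cmd := nest [(105, false), (108, false)] holdingBody

theorem loaded_constants (I : Data) : Loaded I (constants.run I.initial).1 := by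
  constructor <;> simp +contextual [constants, Data.initial, NExp.eval, Data.input]

variable {I J : Data} {s : State}

theorem run_levels (hT : 1 ≤ I.T) (h : Loaded I s)
    (hu : ∀ t, 1 ≤ t → t ≤ I.T → s.real 7 [t] = I.u t) (h20 : ∀ t, s.real 20 [0, t] = 0) :
    ∀ (b : Bool) t, t ≤ I.T → ((levels.run s).1).real 20 [b.toNat, t] = I.tighten.lev b t := by
  unfold levels
  set c : Cmd := ite (.natLe (.succ (.cell 105 [])) (.cell 0 [])) _ _ with hc
  rw [run_seq]
  have hag := agree_run (desc 111 105 c) s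
  have h101 : ((desc 111 105 c).run s).1.nat 101 [] = 1 := by
    rw [hag.nat 101 (by decide), h.one]
  have key := desc_fill (A := []) (B := [20]) (p := 1) (r := 105) (c := c) (x := 111) (T := I.T)
    (s := s) h.T (by decide) (by decide) (by decide)
    (fun i s => s.real 20 [1, i] = I.tighten.u i)
    (fun i s s' _ hB hQ => (hB 20 (by simp) [1, i] (by simp)).trans hQ) ?_
  · intro b t ht
    rw [run_setReal]
    simp only [List.map_cons, List.map_nil, NExp.eval, h101, RExp.eval, State.real_setReal]
    cases b
    · rw [if_neg (by simp)]
      -- The loop writes to array `20` only with first index `1`, so the row of the label "0" keeps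
      -- its initial zeros.
      rw [run_real_at (off := 0) (vs := [101]) (by decide) (by decide) s (by simp [h.one]),
        Data.lev, if_neg (by simp)]
      exact h20 t
    · cases t with
      | zero => simp [Data.lev]
      | succ t => simpa [Data.lev] using key (t + 1) (by omega) ht
  · intro i s' h1 h2 hag' hr ih
    have e101 : s'.nat 101 [] = 1 := by rw [hag'.nat 101 (by decide), h.one]
    have e0 : s'.nat 0 [] = I.T := by rw [hag'.nat 0 (by decide), h.T]
    have e7 : s'.real 7 [i] = I.u i := by rw [hag'.real 7 (by decide), hu i h1 h2]
    rw [hc]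
    by_cases hi : i < I.T
    · have e20 := ih (i + 1) (by omega) hi
      have ed : s'.real 0 [i + 1] = I.d (i + 1) := by
        rw [hag'.real 0 (by decide), h.d (i + 1) (by omega) hi]
      rw [run_ite_pos (by simpa [Test.holds, NExp.eval, hr, e0] using hi)]
      by_cases hle : I.u i ≤ I.tighten.u (i + 1) + I.d (i + 1)
      · rw [run_ite_pos (by simpa [Test.holds, RExp.eval, NExp.eval, hr, e101, e7, e20, ed])]
        simp [NExp.eval, RExp.eval, hr, e101, e7, Data.tighten_u h1 hi, hle]
      · rw [run_ite_neg (by simpa [Test.holds, RExp.eval, NExp.eval, hr, e101, e7, e20, ed] using hle)]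
        simp [NExp.eval, RExp.eval, hr, e101, e20, ed, Data.tighten_u h1 hi, (not_le.mp hle).le]
    · rw [run_ite_neg (by simpa [Test.holds, NExp.eval, hr, e0] using hi)]
      obtain rfl : i = I.T := by omega
      simp [NExp.eval, RExp.eval, hr, e101, e7, Data.tighten_u_last hT]

/-- The first index is shifted by one: demands from `i` on are read at `i - 1`, and the empty sum `D
(T + 1) T` still lies within the range of the loops. -/
theorem run_demands (h : Loaded J s) :
    ∀ m j, m ≤ J.T → j ≤ J.T → ((demands.run s).1).real 21 [m, j] = J.D (m + 1) j := by
  intro m j hm hj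
  have := nest_table (vars := [(111, false), (107, false)]) (vs := [111, 107]) (A := [])
    (B := [21]) (s := s) (P := fun ix s => ∀ m j, ix = [m, j] → s.real 21 [m, j] = J.D (m + 1) j)
    (c := demandsBody) h.T (by decide) ?_ (fun _ => True) trivial (by simp) (by simp) ?_
    (fun v => if v = 111 then m else j) ?_ (by simp)
  · exact this m j (by simp)
  · rintro ix s s' - - hB hP m j rfl
    rw [← hP m j rfl]
    exact hB 21 (by simp) []
  · rintro s' hag - hr m j hmj
    simp only [List.map_cons, List.map_nil, List.cons.injEq, and_true] at hmj
    obtain ⟨rfl, rfl⟩ := hmj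
    have h1 := hr (111, false) (by simp)
    have h2 := hr (107, false) (by simp)
    have hT : s'.nat 0 [] = J.T := by rw [hag.nat 0 (by decide), h.T]
    simp only [cond_false] at h1 h2
    rw [demandsBody, run_seq, run_seq]
    obtain ⟨k, hk⟩ := run_sumLoop (s := ((setReal 130 [] .zero).run s').1) (x := 110) (r := 130)
      (lo := .succ (.cell 111 [])) (hi := .succ (.cell 107 [])) (e := .cell 0 [.cell 110 []]) J.d
      (by simpa [NExp.eval, hT] using h2) (fun n z hn1 hn2 => by
        simp only [NExp.eval, run_setReal, List.map_nil, State.nat_setReal] at hn1 hn2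
        simp [RExp.eval, NExp.eval, hag.real 0 (by decide), h.d n (by omega) (by omega)])
    rw [hk]
    simp [NExp.eval, RExp.eval, Data.D, Data.Icc_eq_Ico_succ]
  · simp [InRange, hm, hj]

theorem run_holding (h : Loaded J s) : ∀ t k, 1 ≤ t → t ≤ J.T → k ≤ J.T →
    ((holding.run s).1).real 22 [t, k] = J.unitHold t k := by
  intro t k ht htT hk
  have := nest_table (vars := [(105, false), (108, false)]) (vs := [105, 108]) (A := [])
    (B := [22]) (s := s)
    (P := fun ix s => ∀ t k, ix = [t, k] → 1 ≤ t → s.real 22 [t, k] = J.unitHold t k)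
    (c := holdingBody) h.T (by decide) ?_ (fun _ => True) trivial (by simp) (by simp) ?_
    (fun v => if v = 105 then t else k) ?_ (by simp)
  · exact this t k (by simp) ht
  · rintro ix s s' - - hB hP t k rfl ht
    rw [← hP t k rfl ht]
    exact hB 22 (by simp) []
  · rintro s' hag - hr t k htk ht
    simp only [List.map_cons, List.map_nil, List.cons.injEq, and_true] at htk
    obtain ⟨rfl, rfl⟩ := htk
    have h2 := hr (108, false) (by simp)
    have hT : s'.nat 0 [] = J.T := by rw [hag.nat 0 (by decide), h.T]
    simp only [cond_false] at h2
    rw [holdingBody, run_seq, run_seq]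
    obtain ⟨k, hk⟩ := run_sumLoop (s := ((setReal 130 [] .zero).run s').1) (x := 110) (r := 130)
      (lo := .cell 105 []) (hi := .cell 108 []) (e := .cell 6 [.cell 110 []]) J.hS
      (by simpa [NExp.eval, hT] using by omega) (fun n z hn1 hn2 => by
        simp only [NExp.eval, run_setReal, List.map_nil, State.nat_setReal] at hn1 hn2
        simp [RExp.eval, NExp.eval, hag.real 6 (by decide), h.hS n (by omega) (by omega)])
    rw [hk]
    simp [NExp.eval, RExp.eval, Data.unitHold]
  · simp [InRange, htT, hk]

/-- Set the constants and tabulate the data. -/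
def prepare : Cmd := constants ⨾ levels ⨾ demands ⨾ holding

theorem ready_prepare (I : Data) (hT : 1 ≤ I.T) : Ready I.tighten (prepare.run I.initial).1 := by
  rw [prepare, run_seq, run_seq, run_seq]
  have h1 := loaded_constants I
  have a1 := agree_run constants I.initial
  generalize (constants.run I.initial).1 = s1 at *
  have a2 := agree_run levels s1
  have h2 : Loaded I.tighten (levels.run s1).1 := by
    have := h1.of_agree a2 (by decide)
    -- Tightening changes the bounds only, which are not part of `Loaded`.
    exact ⟨this.T, this.zero, this.one, this.two, this.d, this.fR, this.pR, this.hR, this.fS,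
      this.pS, this.hS⟩
  have hlev := run_levels hT h1
    (fun t ht ht' => by rw [a1.real 7 (by decide)]; simp [Data.initial, Data.input, ht, ht'])
    (fun t => by rw [a1.real 20 (by decide)]; simp [Data.initial])
  generalize (levels.run s1).1 = s2 at *
  have a3 := agree_run demands s2
  have h3 := h2.of_agree a3 (by decide)
  have hD := run_demands h2
  generalize (demands.run s2).1 = s3 at *
  have a4 := agree_run holding s3
  have h4 := h3.of_agree a4 (by decide)
  refine ⟨h4, fun b t ht => ?_, fun m j hm hj => ?_, run_holding h3⟩
  · rw [a4.real 20 (by decide), a3.real 20 (by decide)]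
    exact hlev b t ht
  · rw [a4.real 21 (by decide)]
    exact hD m j hm hj

end Program

-- Derived tests

namespace Test

/-- The value is zero. -/
def isZero (e : RExp) : Test := .and (.realLe e .zero) (.realLe .zero e)

/-- Strict comparison. -/
def lt (e e' : RExp) : Test := .not (.realLe e' e)

/-- Equality of natural numbers. -/
def natEq (e e' : NExp) : Test := .and (.natLe e e') (.natLe e' e)

/-- Implication. -/
def imp (b b' : Test) : Test := .not (.and b (.not b'))

variable {s : State}

@[simp] theorem holds_natLe {e e' : NExp} : (natLe e e').holds s ↔ e.eval s ≤ e'.eval s := Iff.rfl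

@[simp] theorem holds_realLe {e e' : RExp} : (realLe e e').holds s ↔ e.eval s ≤ e'.eval s := Iff.rfl

@[simp] theorem holds_not {b : Test} : (not b).holds s ↔ ¬ b.holds s := Iff.rfl

@[simp] theorem holds_and {b b' : Test} : (and b b').holds s ↔ b.holds s ∧ b'.holds s := Iff.rfl

@[simp] theorem holds_isZero {e : RExp} : (isZero e).holds s ↔ e.eval s = 0 := by
  simp [isZero, RExp.eval, le_antisymm_iff]

@[simp] theorem holds_lt {e e' : RExp} : (lt e e').holds s ↔ e.eval s < e'.eval s := by
  simp [lt]

@[simp] theorem holds_natEq {e e' : NExp} : (natEq e e').holds s ↔ e.eval s = e'.eval s := by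
  simp [natEq, le_antisymm_iff]

@[simp] theorem holds_imp {b b' : Test} : (imp b b').holds s ↔ (b.holds s → b'.holds s) := by
  simp [imp]

end Test

-- Expressions for levels, demands and order quantities

namespace Program

open Cmd

/-- The scalar variable `x`. -/
def var (x : ℕ) : NExp := .cell x []

/-- The period before the one in the variable `i`. -/
def prev (i : ℕ) : NExp := .sub (.cell i []) (.const 1)

/-- Inventory level at period `e` for the label in the variable `a`. -/
def lev (a : ℕ) (e : NExp) : RExp := .cell 20 [var a, e]

/-- Demand after period `e` until period `e'`. -/
def dem (e e' : NExp) : RExp := .cell 21 [e, e']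

/-- Order quantity of a regular subplan. -/
def qty (a b i j : ℕ) : RExp :=
  .add (.sub (dem (prev i) (var j)) (lev a (prev i))) (lev b (var j))

variable {J : Data} {s : State}

@[simp] theorem eval_var {x : ℕ} : (var x).eval s = s.nat x [] := rfl

@[simp] theorem eval_prev {i : ℕ} : (prev i).eval s = s.nat i [] - 1 := rfl

theorem _root_.LotSizing.Ready.eval_lev (h : Ready J s) {a : ℕ} {α : Bool} {e : NExp}
    (ha : s.nat a [] = α.toNat) (he : e.eval s ≤ J.T) :
    (lev a e).eval s = J.lev α (e.eval s) := by
  simp [lev, RExp.eval, ha, h.lev α _ he]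

theorem _root_.LotSizing.Ready.eval_dem (h : Ready J s) {e e' : NExp} (he : e.eval s ≤ J.T)
    (he' : e'.eval s ≤ J.T) : (dem e e').eval s = J.D (e.eval s + 1) (e'.eval s) := by
  simp [dem, RExp.eval, h.D _ _ he he']

theorem _root_.LotSizing.Ready.eval_qty (h : Ready J s) {a b i j : ℕ} {α β : Bool}
    (ha : s.nat a [] = α.toNat) (hb : s.nat b [] = β.toNat) (hi : 1 ≤ s.nat i [])
    (hi' : s.nat i [] ≤ J.T) (hj : s.nat j [] ≤ J.T) :
    (qty a b i j).eval s = J.X α β (s.nat i []) (s.nat j []) := by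
  rw [qty, RExp.eval, RExp.eval, h.eval_lev ha (by simp; omega), h.eval_lev hb (by simpa),
    h.eval_dem (by simp; omega) (by simpa), Data.X]
  simp [Nat.sub_add_cancel hi]

end Program

-- One formula for all kinds of blocks

namespace Data

variable {I : Data}

/-- The conditions for an order at period `k` in a block, for all labels. -/
def PhiCond (I : Data) (α β : Bool) (i j k : ℕ) : Prop :=
  (α = false → k = i ∧ 0 < I.D i j + I.lev β j ∧ I.D (i + 1) j + I.lev β j ≤ I.lev true i) ∧
  (α = true ∧ β = true → k = j ∧ I.lev true (i - 1) < I.D i j + I.lev true j ∧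
    I.D i (j - 1) < I.lev true (i - 1)) ∧
  (α = true ∧ β = false → I.lev true (i - 1) < I.D i j ∧ I.D i (k - 1) < I.lev true (i - 1) ∧
    I.D (k + 1) j ≤ I.lev true k)

theorem phi_of_zero {α β : Bool} {i j k : ℕ} (h : I.X α β i j = 0) :
    I.phi α β i j k = ((∑ n ∈ Finset.Ico i (j + 1),
      I.hR n * (I.lev α (i - 1) - I.D i n) : ℝ) : WithTop ℝ) := by
  rw [phi, if_pos h, phiNone, if_pos h, Icc_eq_Ico_succ]

/-- The cases of `φ` share one formula: setup, units, inventory before the order and inventory after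
it. A start at level zero has no first sum, an end at `u_j` has a single term in the second, and an
end at zero contributes no cost at `j`. -/
theorem phi_of_order {α β : Bool} {i j k : ℕ} (hi : 1 ≤ i) (hik : i ≤ k) (hkj : k ≤ j)
    (h : I.X α β i j ≠ 0) (hc : I.PhiCond α β i j k) :
    I.phi α β i j k = ((I.fR k + I.pR k * I.X α β i j +
      (∑ n ∈ Finset.Ico i k, I.hR n * (I.lev α (i - 1) - I.D i n) +
       ∑ n ∈ Finset.Ico k (j + 1), I.hR n * (I.D (n + 1) j + I.lev β j)) : ℝ) : WithTop ℝ) := by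
  rw [phi, if_neg h]
  obtain ⟨c1, c2, c3⟩ := hc
  have hu : ∀ n, 1 ≤ n → I.lev true n = I.u n := fun n hn => by simp [lev, hn]
  cases α
  · obtain ⟨rfl, d2, d3⟩ := c1 rfl
    rw [hu _ hi] at d3
    rw [phiOrder, if_pos ⟨rfl, d2, d3⟩, Finset.Ico_self, Finset.sum_empty, zero_add,
      Icc_eq_Ico_succ]
  · cases β
    · have d := c3 ⟨rfl, rfl⟩
      rw [hu k (by omega)] at d
      rw [phiOrder, if_pos ⟨hik, hkj, d⟩, Finset.sum_Ico_succ_top hkj]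
      simp [D, lev, add_assoc]
    · obtain ⟨rfl, d2, d3⟩ := c2 ⟨rfl, rfl⟩
      rw [hu k (by omega)] at d2
      rw [phiOrder, if_pos ⟨rfl, d2, d3⟩, Finset.sum_Ico_succ_top le_rfl, Finset.Ico_self,
        Finset.sum_empty, zero_add, hu k (by omega)]
      simp [D, add_assoc]

theorem phi_of_not {α β : Bool} {i j k : ℕ} (hi : 1 ≤ i) (hik : i ≤ k) (hkj : k ≤ j)
    (h : I.X α β i j ≠ 0) (hc : ¬ I.PhiCond α β i j k) : I.phi α β i j k = ⊤ := by
  rw [phi, if_neg h]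
  have hu : ∀ n, 1 ≤ n → I.lev true n = I.u n := fun n hn => by simp [lev, hn]
  cases α
  · rw [phiOrder, if_neg]
    rintro ⟨rfl, d2, d3⟩
    exact hc ⟨fun _ => ⟨rfl, d2, by rwa [hu _ hi]⟩, by simp, by simp⟩
  · cases β
    · rw [phiOrder, if_neg]
      rintro ⟨-, -, d⟩
      exact hc ⟨by simp, by simp, fun _ => by rwa [hu k (by omega)]⟩
    · rw [phiOrder, if_neg]
      rintro ⟨rfl, d2, d3⟩
      exact hc ⟨by simp, fun _ => ⟨rfl, by rwa [hu k (by omega)], d3⟩, by simp⟩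

end Data

/-! ### The program: blocks -/

namespace Program

open Cmd

/-- The conditions for an order in a block. -/
def phiTest : Test :=
  .and (.imp (.natEq (var 102) (.const 0)) (.and (.natEq (var 108) (var 106))
      (.and (.lt .zero (.add (dem (prev 106) (var 107)) (lev 104 (var 107))))
        (.realLe (.add (dem (var 106) (var 107)) (lev 104 (var 107))) (lev 101 (var 106))))))
  (.and (.imp (.and (.natEq (var 102) (.const 1)) (.natEq (var 104) (.const 1)))
      (.and (.natEq (var 108) (var 107))
      (.and (.lt (lev 101 (prev 106)) (.add (dem (prev 106) (var 107)) (lev 101 (var 107))))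
        (.lt (dem (prev 106) (prev 107)) (lev 101 (prev 106))))))
  (.imp (.and (.natEq (var 102) (.const 1)) (.natEq (var 104) (.const 0)))
      (.and (.lt (lev 101 (prev 106)) (dem (prev 106) (var 107)))
      (.and (.lt (dem (prev 106) (prev 108)) (lev 101 (prev 106)))
        (.realLe (dem (var 108) (var 107)) (lev 101 (var 108)))))))

/-- Holding costs at the retailer before the order. -/
def holdBefore : RExp :=
  .mul (.cell 3 [var 110]) (.sub (lev 102 (prev 106)) (dem (prev 106) (var 110)))

/-- Holding costs at the retailer after the order. -/
def holdAfter : RExp :=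
  .mul (.cell 3 [var 110]) (.add (dem (var 110) (var 107)) (lev 104 (var 107)))

/-- The index of a block. -/
def phiIx : List NExp := [var 102, var 104, var 106, var 107, var 108]

/-- Compute the cost of a block. -/
def phiBody : Cmd :=
  setReal 130 [] .zero ⨾
  ite (.isZero (qty 102 104 106 107))
    (sumLoop 110 (var 106) (.succ (var 107)) 130 holdBefore ⨾
     setReal 15 phiIx (.cell 130 []) ⨾ setNat 15 (.const 0 :: phiIx) (.const 1))
    (ite phiTest
      (sumLoop 110 (var 106) (var 108) 130 holdBefore ⨾
       sumLoop 110 (var 108) (.succ (var 107)) 130 holdAfter ⨾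
       setReal 15 phiIx (.add (.add (.cell 1 [var 108])
        (.mul (.cell 2 [var 108]) (qty 102 104 106 107))) (.cell 130 [])) ⨾
       setNat 15 (.const 0 :: phiIx) (.const 1))
      (setNat 15 (.const 0 :: phiIx) (.const 0)))

/-- Tabulate the costs of the blocks. -/
def blocks : Cmd :=
  nest [(102, true), (104, true), (106, false), (107, false), (108, false)] phiBody

variable {J : Data} {s : State}

theorem holds_phiTest (h : Ready J s) {α β : Bool} {i j k : ℕ} (hα : s.nat 102 [] = α.toNat)
    (hβ : s.nat 104 [] = β.toNat) (hi : s.nat 106 [] = i) (hj : s.nat 107 [] = j)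
    (hk : s.nat 108 [] = k) (h1 : 1 ≤ i) (hik : i ≤ k) (hkj : k ≤ j) (hjT : j ≤ J.T) :
    phiTest.holds s ↔ J.PhiCond α β i j k := by
  have hone : s.nat 101 [] = true.toNat := h.one
  have l1 : (lev 104 (var 107)).eval s = J.lev β j := by
    rw [h.eval_lev hβ (by simp [hj, hjT])]; simp [hj]
  have l2 : (lev 101 (var 106)).eval s = J.lev true i := by
    rw [h.eval_lev hone (by simp [hi]; omega)]; simp [hi]
  have l3 : (lev 101 (prev 106)).eval s = J.lev true (i - 1) := by
    rw [h.eval_lev hone (by simp [hi]; omega)]; simp [hi]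
  have l4 : (lev 101 (var 107)).eval s = J.lev true j := by
    rw [h.eval_lev hone (by simp [hj, hjT])]; simp [hj]
  have l5 : (lev 101 (var 108)).eval s = J.lev true k := by
    rw [h.eval_lev hone (by simp [hk]; omega)]; simp [hk]
  have hii : i - 1 + 1 = i := by omega
  have d1 : (dem (prev 106) (var 107)).eval s = J.D i j := by
    rw [h.eval_dem (by simp [hi]; omega) (by simp [hj, hjT])]; simp [hi, hj, hii]
  have d2 : (dem (var 106) (var 107)).eval s = J.D (i + 1) j := by
    rw [h.eval_dem (by simp [hi]; omega) (by simp [hj, hjT])]; simp [hi, hj]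
  have d3 : (dem (prev 106) (prev 107)).eval s = J.D i (j - 1) := by
    rw [h.eval_dem (by simp [hi]; omega) (by simp [hj]; omega)]; simp [hi, hj, hii]
  have d4 : (dem (prev 106) (prev 108)).eval s = J.D i (k - 1) := by
    rw [h.eval_dem (by simp [hi]; omega) (by simp [hk]; omega)]; simp [hi, hk, hii]
  have d5 : (dem (var 108) (var 107)).eval s = J.D (k + 1) j := by
    rw [h.eval_dem (by simp [hk]; omega) (by simp [hj]; omega)]; simp [hk, hj]
  simp only [phiTest, Test.holds_and, Test.holds_imp, Test.holds_natEq, Test.holds_lt,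
    Test.holds_realLe, RExp.eval, NExp.eval, eval_var, l1, l2, l3, l4, l5, d1, d2, d3, d4, d5, hα,
    hβ, hi, hj, hk, Data.PhiCond]
  cases α <;> cases β <;> simp

theorem run_holdBefore (h : Ready J s) {α : Bool} {i m : ℕ} {hi : NExp}
    (hα : s.nat 102 [] = α.toNat) (hi' : s.nat 106 [] = i) (h1 : 1 ≤ i) (hm : hi.eval s = m)
    (hmT : m ≤ J.T + 1) :
    ∃ z, ((sumLoop 110 (var 106) hi 130 holdBefore).run s).1 = (s.setNat 110 [] z).setReal 130 []
      (s.real 130 [] + ∑ n ∈ Finset.Ico i m, J.hR n * (J.lev α (i - 1) - J.D i n)) := by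
  have := run_sumLoop (s := s) (x := 110) (r := 130) (lo := var 106) (hi := hi) (e := holdBefore)
    (fun n => J.hR n * (J.lev α (i - 1) - J.D i n)) (by rw [hm, h.T]; omega) ?_
  · simpa [hi', hm] using this
  · intro n z hn1 hn2
    simp only [eval_var, hi', hm] at hn1 hn2
    have h' : Ready J ((s.setNat 110 [] n).setReal 130 [] z) :=
      (h.setNat (by decide)).setReal (by decide)
    simp only [holdBefore, RExp.eval]
    rw [h'.eval_lev (α := α) (by simpa using hα)
      (by simp [hi']; omega), h'.eval_dem (by simp [hi']; omega) (by simp; omega)]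
    simp [hi', h.hR n (by omega) (by omega), show i - 1 + 1 = i by omega]

theorem run_holdAfter (h : Ready J s) {β : Bool} {j k : ℕ}
    (hβ : s.nat 104 [] = β.toNat) (hj : s.nat 107 [] = j) (hk : s.nat 108 [] = k) (h1 : 1 ≤ k)
    (hjT : j ≤ J.T) :
    ∃ z, ((sumLoop 110 (var 108) (.succ (var 107)) 130 holdAfter).run s).1 =
      (s.setNat 110 [] z).setReal 130 []
      (s.real 130 [] + ∑ n ∈ Finset.Ico k (j + 1), J.hR n * (J.D (n + 1) j + J.lev β j)) := by
  have := run_sumLoop (s := s) (x := 110) (r := 130) (lo := var 108) (hi := .succ (var 107))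
    (e := holdAfter) (fun n => J.hR n * (J.D (n + 1) j + J.lev β j))
    (by simp [NExp.eval, hj, h.T, hjT]) ?_
  · simpa [hj, hk, NExp.eval] using this
  · intro n z hn1 hn2
    simp only [eval_var, NExp.eval, hj, hk] at hn1 hn2
    have h' : Ready J ((s.setNat 110 [] n).setReal 130 [] z) :=
      (h.setNat (by decide)).setReal (by decide)
    simp only [holdAfter, RExp.eval]
    rw [h'.eval_lev (α := β) (by simpa using hβ)
      (by simp [hj, hjT]), h'.eval_dem (by simp; omega) (by simp [hj, hjT])]
    simp [hj, h.hR n (by omega) (by omega)]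

theorem run_phiBody (h : Ready J s) {α β : Bool} {i j k : ℕ} (hα : s.nat 102 [] = α.toNat)
    (hβ : s.nat 104 [] = β.toNat) (hi : s.nat 106 [] = i) (hj : s.nat 107 [] = j)
    (hk : s.nat 108 [] = k) (h1 : 1 ≤ i) (hik : i ≤ k) (hkj : k ≤ j) (hjT : j ≤ J.T) :
    (phiBody.run s).1.HoldsCost 15 [α.toNat, β.toNat, i, j, k] (J.phi α β i j k) := by
  rw [phiBody, run_seq, run_setReal]
  set s1 := s.setReal 130 ([].map (NExp.eval s)) (RExp.zero.eval s) with hs1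
  have r1 : Ready J s1 := h.setReal (by decide)
  have q1 : (qty 102 104 106 107).eval s1 = J.X α β i j := by
    rw [r1.eval_qty (α := α) (β := β) hα hβ (by simp [hs1, hi, h1]) (by simp [hs1, hi]; omega)
      (by simp [hs1, hj, hjT])]
    simp [hs1, hi, hj]
  by_cases hX : J.X α β i j = 0
  · rw [run_ite_pos (by simpa [q1] using hX), run_seq, run_seq]
    obtain ⟨z, hz⟩ := run_holdBefore r1 (hi := .succ (var 107)) (m := j + 1) hα hi h1
      (by simp [NExp.eval, hs1, hj]) (by omega)
    rw [hz, Data.phi_of_zero hX]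
    right
    simp [phiIx, NExp.eval, RExp.eval, hs1, hα, hβ, hi, hj, hk]
  · rw [run_ite_neg (by simpa [q1] using hX)]
    have ht := holds_phiTest r1 hα hβ hi hj hk h1 hik hkj hjT
    by_cases hc : J.PhiCond α β i j k
    · rw [run_ite_pos (ht.mpr hc), run_seq, run_seq, run_seq]
      obtain ⟨z, hz⟩ := run_holdBefore r1 (hi := var 108) (m := k) hα hi h1
        (by simp [hs1, hk]) (by omega)
      rw [hz]
      set s2 := (s1.setNat 110 [] z).setReal 130 [] _ with hs2
      have r2 : Ready J s2 := (r1.setNat (by decide)).setReal (by decide)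
      obtain ⟨z', hz'⟩ := run_holdAfter r2 (β := β) (j := j) (k := k) (by simpa [hs2, hs1] using hβ)
        (by simp [hs2, hs1, hj]) (by simp [hs2, hs1, hk]) (by omega) hjT
      rw [hz']
      set s3 := (s2.setNat 110 [] z').setReal 130 [] _ with hs3
      have r3 : Ready J s3 := (r2.setNat (by decide)).setReal (by decide)
      have q3 : (qty 102 104 106 107).eval s3 = J.X α β i j := by
        rw [r3.eval_qty (α := α) (β := β) (by simpa [hs3, hs2, hs1] using hα)
          (by simpa [hs3, hs2, hs1] using hβ) (by simp [hs3, hs2, hs1, hi, h1])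
          (by simp [hs3, hs2, hs1, hi]; omega) (by simp [hs3, hs2, hs1, hj, hjT])]
        simp [hs3, hs2, hs1, hi, hj]
      have f3 : s3.real 1 [k] = J.fR k := r3.fR k (by omega) (by omega)
      have p3 : s3.real 2 [k] = J.pR k := r3.pR k (by omega) (by omega)
      have k3 : s3.nat 108 [] = k := by simp [hs3, hs2, hs1, hk]
      rw [Data.phi_of_order h1 hik hkj hX hc]
      right
      constructor
      · rw [run_setNat, State.real_setNat, run_setReal]
        simp only [RExp.eval, q3, List.map_cons, List.map_nil, eval_var, k3, f3, p3]
        simp [phiIx, hs3, hs2, hs1, hα, hβ, hi, hj, hk, RExp.eval]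
      · simp [phiIx, NExp.eval, hs3, hs2, hs1, hα, hβ, hi, hj, hk]
    · rw [run_ite_neg (fun h => hc (ht.mp h)), Data.phi_of_not h1 hik hkj hX hc]
      left
      simp [phiIx, NExp.eval, hs1, hα, hβ, hi, hj, hk]

end Program

/-- The memory contains the table of the costs of the blocks. -/
def HoldsPhi (J : Data) (s : State) : Prop :=
  ∀ (α β : Bool) (i j k : ℕ), 1 ≤ i → i ≤ k → k ≤ j → j ≤ J.T →
    s.HoldsCost 15 [α.toNat, β.toNat, i, j, k] (J.phi α β i j k)

namespace Program

open Cmd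

variable {J : Data} {s : State}

theorem run_blocks (h : Ready J s) : HoldsPhi J (blocks.run s).1 := by
  intro α β i j k h1 hik hkj hjT
  have := nest_table
    (vars := [(102, true), (104, true), (106, false), (107, false), (108, false)])
    (vs := [102, 104, 106, 107, 108]) (A := [15]) (B := [15]) (s := s) (c := phiBody)
    (P := fun ix s => ∀ (α β : Bool) i j k, ix = [α.toNat, β.toNat, i, j, k] → 1 ≤ i → i ≤ k →
      k ≤ j → j ≤ J.T → s.HoldsCost 15 [α.toNat, β.toNat, i, j, k] (J.phi α β i j k))
    h.T (by decide) ?_ (fun _ => True) trivial (by simp) (by simp) ?_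
    (fun v => if v = 102 then α.toNat else if v = 104 then β.toNat else if v = 106 then i else
      if v = 107 then j else k) ?_ (by simp)
  · exact this α β i j k (by simp) h1 hik hkj hjT
  · rintro ix s s' - hA hB hP α β i j k rfl h1 hik hkj hjT
    exact (hP α β i j k rfl h1 hik hkj hjT).congr (hA 15 (by simp)) (hB 15 (by simp) [])
  · rintro s' hag - - α β i j k hix h1 hik hkj hjT
    simp only [List.map_cons, List.map_nil, List.cons.injEq, and_true] at hix
    obtain ⟨e1, e2, e3, e4, e5⟩ := hix
    exact run_phiBody (h.of_agree hag (by decide)) e1 e2 e3 e4 e5 h1 hik hkj hjT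
  · have hα := Bool.toNat_le α
    have hβ := Bool.toNat_le β
    simp [InRange, hα, hβ]
    omega

end Program

-- Best continuations without the availability period, and what the tables hold

namespace Data

variable {I : Data}

/-- Best continuation of a first block `[i,l]` with ordering period `k`, supplier holding costs
excluded. -/
def tail (I : Data) (α γ β : Bool) (i j k : ℕ) : Stage :=
  (Finset.Ico k j).inf fun l => Stage.addCost (I.phi α γ i l k) (I.G γ β k (l + 1) j)

/-- The supplier holds all `X_{ij}` units from `t` to `k`, whatever the end `l` of the first block.
This term leaves the minimum over `l`, which saves one nested loop and brings the total down to
fourth order. -/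
theorem w_eq_tail {α γ β : Bool} {t i j k : ℕ} (h : t ≤ k) (h' : i ≤ k) :
    I.w α γ β t i j k = Stage.addCost (I.carry t k (I.X α β i j) : ℝ) (I.tail α γ β i j k) := by
  rw [w_eq ⟨h, h'⟩, tail, Stage.addCost_inf]
  simp only [Stage.addCost_addCost]

/-- The form in which the program minimizes: first the plans with several blocks, then single blocks
for all `k` of `[i,j]`, where a test replaces the dependence of the range on `t`. -/
theorem G_pos' {α β : Bool} {t i j : ℕ} (hij : i ≤ j) (ht : t ≤ j) (hX : 0 < I.X α β i j) :
    I.G α β t i j = min (I.v α β t i j) ((Finset.Ico i (j + 1)).inf fun k =>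
      if t ≤ k then Stage.mk (I.phi α β i j k + (I.carry t k (I.X α β i j) : ℝ)) k else ⊤) := by
  rw [G_pos hij ht hX, min_comm]
  congr 1
  apply le_antisymm
  · refine Finset.le_inf fun k hk => ?_
    rw [Finset.mem_Ico] at hk
    split_ifs with h
    · exact Finset.inf_le (Finset.mem_Icc.mpr ⟨max_le hk.1 h, by omega⟩)
    · exact le_top
  · refine Finset.le_inf fun k hk => ?_
    rw [Finset.mem_Icc, max_le_iff] at hk
    refine (Finset.inf_le (Finset.mem_Ico.mpr ⟨hk.1.1, by omega⟩)).trans ?_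
    rw [if_pos hk.1.2]

theorem v_eq {α β : Bool} {t i j : ℕ} : I.v α β t i j = (Finset.Ico i j).inf fun k =>
    (Finset.univ : Finset Bool).inf fun γ => I.w α γ β t i j k := by
  rw [v]

/-- The entry of the table of continuations. -/
def HoldsTail (J : Data) (s : State) (α γ β : Bool) (i j k : ℕ) : Prop :=
  s.HoldsStage 24 [α.toNat, γ.toNat, β.toNat, i, j, k] (J.tail α γ β i j k) ∧
  (J.tail α γ β i j k ≠ ⊤ → ∃ l, l = s.nat 24 [2, α.toNat, γ.toNat, β.toNat, i, j, k] ∧ k ≤ l ∧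
    l < j ∧ J.tail α γ β i j k = Stage.addCost (J.phi α γ i l k) (J.G γ β k (l + 1) j))

/-- The entry of the table of regular subplans. -/
def HoldsG (J : Data) (s : State) (α β : Bool) (t i j : ℕ) : Prop :=
  s.HoldsStage 17 [α.toNat, β.toNat, t, i, j] (J.v α β t i j) ∧
  s.HoldsStage 18 [α.toNat, β.toNat, t, i, j] (J.G α β t i j)

/-- First block of an optimal regular subplan. -/
def HoldsGWit (J : Data) (s : State) (α β : Bool) (t i j : ℕ) : Prop :=
  ∃ k l m, k = s.nat 25 [0, α.toNat, β.toNat, t, i, j] ∧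
    l = s.nat 25 [1, α.toNat, β.toNat, t, i, j] ∧ m = s.nat 25 [2, α.toNat, β.toNat, t, i, j] ∧
    (0 < J.X α β i j → J.G α β t i j ≠ ⊤ →
      ∃ γ : Bool, m = γ.toNat ∧ J.GWit α β t i j (J.G α β t i j) k l γ) ∧
    (J.X α β i j = 0 → l = j ∧ m = β.toNat)

/-- The entry of the table of plans of regular subplans. -/
def HoldsGPlan (J : Data) (s : State) (α β : Bool) (t i j : ℕ) : Prop :=
  ∀ q : ℝ ×ₗ ℕ, J.G α β t i j = q →
    J.RealG α β t i j (fun n => s.real 26 [α.toNat, β.toNat, t, i, j, n]) (ofLex q).2 (ofLex q).1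

end Data

/-! ### The program: regular subplans -/

namespace Program

open Cmd Data

/-- Find the best continuation of a first block. -/
def tailBody : Cmd :=
  clear ⨾
  upto 109 (var 108) (var 107)
    (setNat 112 [] (.succ (var 109)) ⨾
     setNat 113 [] (.cell 18 [101, 103, 104, 108, 112, 107]) ⨾
     offer (.and (.natLe (.const 1) (.cell 15 [100, 102, 103, 106, 109, 108]))
        (.natLe (.const 1) (.cell 18 [100, 103, 104, 108, 112, 107])))
      (.add (.cell 15 [var 102, var 103, var 106, var 109, var 108])
        (.cell 18 [var 103, var 104, var 108, var 112, var 107])) 113 109 109 109) ⨾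
  store 24 [102, 103, 104, 106, 107, 108] ⨾
  setNat 24 [.const 2, var 102, var 103, var 104, var 106, var 107, var 108] (var 121)

/-- Cost of holding the order quantity at the supplier from period `105` to period `108`. -/
def carryE : RExp := .mul (.cell 22 [var 105, var 108]) (qty 102 104 106 107)

/-- Find the best regular subplan of at least two blocks. -/
def severalBody : Cmd :=
  upto 108 (var 106) (var 107) (labels 103
    (setNat 109 [] (.cell 24 [115, 102, 103, 104, 106, 107, 108]) ⨾
     setNat 113 [] (.cell 24 [101, 102, 103, 104, 106, 107, 108]) ⨾
     offer (.and (.natLe (var 105) (var 108))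
        (.natLe (.const 1) (.cell 24 [100, 102, 103, 104, 106, 107, 108])))
      (.add carryE (.cell 24 [var 102, var 103, var 104, var 106, var 107, var 108]))
      113 108 109 103))

/-- Find the best regular subplan of one block. -/
def singleBody : Cmd :=
  upto 108 (var 106) (.succ (var 107))
    (offer (.and (.natLe (var 105) (var 108))
        (.natLe (.const 1) (.cell 15 [100, 102, 104, 106, 107, 108])))
      (.add (.cell 15 [var 102, var 104, var 106, var 107, var 108]) carryE) 108 108 107 104)

/-- The regular subplan without orders. -/
def emptyBody : Cmd :=
  clear ⨾
  offer (.and (.isZero (qty 102 104 106 107))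
      (.natLe (.const 1) (.cell 15 [100, 102, 104, 106, 107, 107])))
    (.cell 15 [var 102, var 104, var 106, var 107, var 107]) 105 107 107 104

/-- Find the best regular subplan. -/
def regularBody : Cmd :=
  clear ⨾ severalBody ⨾ store 17 [102, 104, 105, 106, 107] ⨾
  ite (.lt .zero (qty 102 104 106 107)) singleBody emptyBody ⨾
  store 18 [102, 104, 105, 106, 107] ⨾
  setNat 25 [.const 0, var 102, var 104, var 105, var 106, var 107] (var 121) ⨾
  setNat 25 [.const 1, var 102, var 104, var 105, var 106, var 107] (var 122) ⨾
  setNat 25 [.const 2, var 102, var 104, var 105, var 106, var 107] (var 123)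

variable {J : Data} {s s' : State}

theorem _root_.LotSizing.HoldsPhi.of_agree (h : HoldsPhi J s) {c : Cmd} (hag : Agree c s s')
    (hc : c.leaves [15] [15] = true) : HoldsPhi J s' := by
  intro α β i j k h1 h2 h3 h4
  refine (h α β i j k h1 h2 h3 h4).congr (fun n => ?_) ?_
  · rw [hag.nat_leaves hc (by simp)]
  · rw [hag.real_leaves hc (by simp)]

/-- The needed values of `G` start at `l + 1 > i`, hence are present when `i` runs downwards. The
chosen `l` is stored next to the value, since `G` will need it as a witness for every `t`. -/
theorem run_tailBody (h : Ready J s) (hφ : HoldsPhi J s) {α γ β : Bool} {i j k : ℕ}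
    (hα : s.nat 102 [] = α.toNat) (hγ : s.nat 103 [] = γ.toNat) (hβ : s.nat 104 [] = β.toNat)
    (hi : s.nat 106 [] = i) (hj : s.nat 107 [] = j) (hk : s.nat 108 [] = k)
    (h1 : 1 ≤ i) (hik : i ≤ k) (hjT : j ≤ J.T)
    (hG : ∀ l, k ≤ l → l < j → J.HoldsG s γ β k (l + 1) j) :
    J.HoldsTail (tailBody.run s).1 α γ β i j k := by
  rw [tailBody, run_seq, run_seq, run_seq]
  set W : Stage → ℕ → ℕ → ℕ → Prop := fun g l _ _ => k ≤ l ∧ l < j ∧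
    g = Stage.addCost (J.phi α γ i l k) (J.G γ β k (l + 1) j) with hW
  have hcl := agree_run clear s
  have b1 : Best W (clear.run s).1 ⊤ := best_clear
  have e102 : (clear.run s).1.nat 102 [] = α.toNat := by rw [hcl.nat 102 (by decide), hα]
  have e103 : (clear.run s).1.nat 103 [] = γ.toNat := by rw [hcl.nat 103 (by decide), hγ]
  have e104 : (clear.run s).1.nat 104 [] = β.toNat := by rw [hcl.nat 104 (by decide), hβ]
  have e106 : (clear.run s).1.nat 106 [] = i := by rw [hcl.nat 106 (by decide), hi]
  have e107 : (clear.run s).1.nat 107 [] = j := by rw [hcl.nat 107 (by decide), hj]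
  have e108 : (clear.run s).1.nat 108 [] = k := by rw [hcl.nat 108 (by decide), hk]
  have r1 := h.of_agree hcl (by decide)
  have p1 := hφ.of_agree hcl (by decide)
  have e18 := hcl.nat 18 (by decide)
  have e18r := hcl.real 18 (by decide)
  generalize (clear.run s).1 = s1 at *
  set body := setNat 112 [] (.succ (var 109)) ⨾
     setNat 113 [] (.cell 18 [101, 103, 104, 108, 112, 107]) ⨾
     offer (.and (.natLe (.const 1) (.cell 15 [100, 102, 103, 106, 109, 108]))
        (.natLe (.const 1) (.cell 18 [100, 103, 104, 108, 112, 107])))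
      (.add (.cell 15 [var 102, var 103, var 106, var 109, var 108])
        (.cell 18 [var 103, var 104, var 108, var 112, var 107])) 113 109 109 109 with hbody
  have b2 := b1.upto (x := 109) (lo := var 108) (hi := var 107) (c := body)
    (by simp [e107, r1.T]; omega)
    (fun l => Stage.addCost (J.phi α γ i l k) (J.G γ β k (l + 1) j)) ?_
  swap
  · intro l s' g hl1 hl2 hag hB
    simp only [eval_var, e107, e108] at hl1 hl2
    have r2 := r1.of_agree hag (by decide)
    have hp := (p1.of_agree hag (by decide)) α γ i l k h1 hik hl1 (by omega)
    have hg := (hG l hl1 hl2).2.congr (s' := s')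
      (fun n _ => by rw [hag.nat 18 (by decide), e18])
      (by rw [hag.real 18 (by decide), e18r])
    have f102 : s'.nat 102 [] = α.toNat := by rw [hag.nat 102 (by decide), e102]
    have f103 : s'.nat 103 [] = γ.toNat := by rw [hag.nat 103 (by decide), e103]
    have f104 : s'.nat 104 [] = β.toNat := by rw [hag.nat 104 (by decide), e104]
    have f106 : s'.nat 106 [] = i := by rw [hag.nat 106 (by decide), e106]
    have f107 : s'.nat 107 [] = j := by rw [hag.nat 107 (by decide), e107]
    have f108 : s'.nat 108 [] = k := by rw [hag.nat 108 (by decide), e108]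
    have f100 := r2.zero
    have f101 := r2.one
    rw [hbody, run_seq, run_seq]
    refine Best.offer (((hB.setNat (by norm_num) _).setNat (by norm_num) _).setNat (by norm_num) _)
      (by norm_num) (by simp [f100]) (by simp [f101]) _ ?_ ?_
    · intro hpos
      simp only [Test.holds_and, Test.holds_natLe, NExp.eval, run_setNat, List.map_cons,
        List.map_nil, State.nat_setNat] at hpos
      simp [f102, f103, f104, f106, f107, f108, f100] at hpos
      have hp' := hp.eq_coe hpos.1
      have hg' := hg.eq_mk hpos.2
      refine ⟨?_, ?_⟩
      · rw [hp', hg', Stage.addCost_coe_mk]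
        simp [RExp.eval, NExp.eval, f102, f103, f104, f106, f107, f108, f101]
      · simp [hW, hl1, hl2]
    · intro hneg
      simp only [Test.holds_and, Test.holds_natLe, NExp.eval, run_setNat, List.map_cons,
        List.map_nil, State.nat_setNat] at hneg
      simp [f102, f103, f104, f106, f107, f108, f100] at hneg
      by_cases hf : 1 ≤ s'.nat 15 [0, α.toNat, γ.toNat, i, l, k]
      · rw [hg.eq_top (by have := hneg hf; omega), Stage.addCost_top]
      · rw [hp.eq_top hf, Stage.top_addCost]
  simp only [eval_var, e107, e108] at b2
  rw [min_eq_right le_top] at b2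
  change Best W _ (J.tail α γ β i j k) at b2
  have hag := agree_run (upto 109 (var 108) (var 107) body) s1
  have r2 := r1.of_agree hag (by decide)
  have f102 := congrFun (hag.nat 102 (by decide)) []
  have f103 := congrFun (hag.nat 103 (by decide)) []
  have f104 := congrFun (hag.nat 104 (by decide)) []
  have f106 := congrFun (hag.nat 106 (by decide)) []
  have f107 := congrFun (hag.nat 107 (by decide)) []
  have f108 := congrFun (hag.nat 108 (by decide)) []
  generalize ((upto 109 (var 108) (var 107) body).run s1).1 = s2 at *
  have hst := run_store (a := 24) (vs := [102, 103, 104, 106, 107, 108]) (by decide) r2.zero r2.one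
    b2.1
  have hag3 := agree_run (store 24 [102, 103, 104, 106, 107, 108]) s2
  have g102 := congrFun (hag3.nat 102 (by decide)) []
  have g103 := congrFun (hag3.nat 103 (by decide)) []
  have g104 := congrFun (hag3.nat 104 (by decide)) []
  have g106 := congrFun (hag3.nat 106 (by decide)) []
  have g107 := congrFun (hag3.nat 107 (by decide)) []
  have g108 := congrFun (hag3.nat 108 (by decide)) []
  have g121 := congrFun (hag3.nat 121 (by decide)) []
  generalize ((store 24 [102, 103, 104, 106, 107, 108]).run s2).1 = s3 at *
  simp only [List.map_cons, List.map_nil, f102, f103, f104, f106, f107, f108, e102, e103, e104,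
    e106, e107, e108] at hst g102 g103 g104 g106 g107 g108
  constructor
  · refine hst.congr (fun n hn => ?_) rfl
    rw [run_setNat, State.nat_setNat, if_neg]
    simp only [List.map_cons, NExp.eval, List.cons.injEq, not_and]
    omega
  · intro hne
    refine ⟨s2.nat 121 [], ?_, b2.2 hne⟩
    simp [NExp.eval, g102, g103, g104, g106, g107, g108, g121]

theorem eval_carryE (h : Ready J s) {α β : Bool} {t i j k : ℕ} (hα : s.nat 102 [] = α.toNat)
    (hβ : s.nat 104 [] = β.toNat) (ht : s.nat 105 [] = t) (hi : s.nat 106 [] = i)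
    (hj : s.nat 107 [] = j) (hk : s.nat 108 [] = k) (h1 : 1 ≤ i) (hij : i ≤ j) (hjT : j ≤ J.T)
    (ht1 : 1 ≤ t) (htj : t ≤ j) (hkj : k ≤ j) :
    carryE.eval s = J.carry t k (J.X α β i j) := by
  rw [carryE, RExp.eval, h.eval_qty hα hβ (by omega) (by omega) (by omega), carry_eq, hi, hj]
  simp [RExp.eval, ht, hk, h.hold t k ht1 (by omega) (by omega)]

/-- Witnesses of a value of `G`. -/
def GBest (J : Data) (α β : Bool) (t i j : ℕ) (g : Stage) (k l m : ℕ) : Prop :=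
  ∃ γ : Bool, m = γ.toNat ∧ J.GWit α β t i j g k l γ

theorem run_severalBody (h : Ready J s) {α β : Bool} {t i j : ℕ}
    (hv : Vals [(102, α.toNat), (104, β.toNat), (105, t), (106, i), (107, j)] s)
    (h1 : 1 ≤ i) (hij : i ≤ j) (hjT : j ≤ J.T) (ht1 : 1 ≤ t) (htj : t ≤ j)
    (htail : ∀ γ k, i ≤ k → k < j → J.HoldsTail s α γ β i j k)
    (hB : Best (GBest J α β t i j) s ⊤) :
    Best (GBest J α β t i j) (severalBody.run s).1 (J.v α β t i j) := by
  have e106 : s.nat 106 [] = i := hv (106, i) (by simp)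
  have e107 : s.nat 107 [] = j := hv (107, j) (by simp)
  have key := hB.upto (x := 108) (lo := var 106) (hi := var 107) (c := labels 103
    (setNat 109 [] (.cell 24 [115, 102, 103, 104, 106, 107, 108]) ⨾
     setNat 113 [] (.cell 24 [101, 102, 103, 104, 106, 107, 108]) ⨾
     offer (.and (.natLe (var 105) (var 108))
        (.natLe (.const 1) (.cell 24 [100, 102, 103, 104, 106, 107, 108])))
      (.add carryE (.cell 24 [var 102, var 103, var 104, var 106, var 107, var 108]))
      113 108 109 103)) (by simp [e107, h.T]; omega)
    (fun k => (Finset.univ : Finset Bool).inf fun γ => J.w α γ β t i j k) ?_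
  · rwa [min_eq_right le_top, eval_var, eval_var, e106, e107, ← v_eq] at key
  intro k s1 g hk1 hk2 hag1 hB1
  simp only [eval_var, e106, e107] at hk1 hk2
  have r1 : Ready J (s1.setNat 108 [] k) := (h.of_agree hag1 (by decide)).setNat (by decide)
  have v1 := hv.of_agree hag1 rfl
  have n24 := hag1.nat 24 (by decide)
  have q24 := hag1.real 24 (by decide)
  refine (hB1.setNat (by norm_num) k).labels _ fun γ s2 g' hag2 hB2 => ?_
  have r2 : Ready J (s2.setNat 103 [] γ.toNat) := (r1.of_agree hag2 (by decide)).setNat (by decide)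
  have v2 := Vals.of_agree (l := [(102, α.toNat), (104, β.toNat), (105, t), (106, i), (107, j),
    (108, k)]) (s := s1.setNat 108 [] k) (by simpa [Vals] using v1) hag2 rfl
  have n24' : s2.nat 24 = s.nat 24 := by
    rw [hag2.nat 24 (by decide), ← n24]; rfl
  have q24' : s2.real 24 = s.real 24 := by
    rw [hag2.real 24 (by decide), ← q24]; rfl
  simp only [Vals, List.forall_mem_cons, List.not_mem_nil, false_imp_iff, implies_true,
    and_true] at v2
  obtain ⟨f102, f104, f105, f106, f107, f108⟩ := v2
  obtain ⟨htl, htw⟩ := htail γ k hk1 hk2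
  have f100 : s2.nat 100 [] = 0 := by simpa using r2.zero
  have f101 : s2.nat 101 [] = 1 := by simpa using r2.one
  have f115 : s2.nat 115 [] = 2 := by simpa using r2.two
  have r3 : ∀ m n, Ready J (((s2.setNat 103 [] γ.toNat).setNat 109 [] m).setNat 113 [] n) :=
    fun m n => (r2.setNat (by decide)).setNat (by decide)
  rw [run_seq, run_seq]
  refine Best.offer (((hB2.setNat (by norm_num) _).setNat (by norm_num) _).setNat (by norm_num) _)
    (by norm_num) (r3 _ _).zero (r3 _ _).one _ ?_ ?_
  · intro hpos
    simp only [Test.holds_and, Test.holds_natLe, NExp.eval, run_setNat, List.map_cons, eval_var,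
      List.map_nil, State.nat_setNat] at hpos
    simp [f102, f104, f105, f106, f107, f108, f100, n24'] at hpos
    have hg := htl.eq_mk hpos.2
    rw [w_eq_tail hpos.1 hk1]
    -- The end of the first block is not searched again; it comes from the table of continuations.
    obtain ⟨l, hl, hkl, hlj, hw⟩ := htw (by rw [hg, Stage.mk_coe]; exact WithTop.coe_ne_top)
    constructor
    · rw [hg, Stage.addCost_coe_mk, RExp.eval,
        eval_carryE (α := α) (β := β) (t := t) (i := i) (j := j) (k := k) (r3 _ _) (by simp [f102])
          (by simp [f104]) (by simp [f105]) (by simp [f106]) (by simp [f107]) (by simp [f108]) h1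
          hij hjT ht1 htj hk2.le]
      simp [RExp.eval, NExp.eval, f102, f104, f106, f107, f108, f101, n24', q24']
    · refine ⟨γ, by simp, ?_⟩
      simp only [run_setNat, NExp.eval, List.map_cons, List.map_nil, State.nat_setNat]
      simp [f102, f104, f106, f107, f108, f115, n24', ← hl]
      refine ⟨hk1, hpos.1, hkl, hlj.le, Or.inr ⟨hlj, ?_⟩⟩
      rw [hw, Stage.addCost_addCost]
  · intro hneg
    simp only [Test.holds_and, Test.holds_natLe, NExp.eval, run_setNat, List.map_cons, eval_var,
      List.map_nil, State.nat_setNat] at hneg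
    simp [f102, f104, f105, f106, f107, f108, f100, n24'] at hneg
    by_cases htk : t ≤ k
    · rw [w_eq_tail htk hk1, htl.eq_top (by have := hneg htk; omega), Stage.addCost_top]
    · rw [w_top (by omega)]

/-- The minimization continues from the value of `v` already found, so its result is `G`. -/
theorem run_singleBody (h : Ready J s) (hφ : HoldsPhi J s) {α β : Bool} {t i j : ℕ}
    (hv : Vals [(102, α.toNat), (104, β.toNat), (105, t), (106, i), (107, j)] s)
    (h1 : 1 ≤ i) (hij : i ≤ j) (hjT : j ≤ J.T) (ht1 : 1 ≤ t) (htj : t ≤ j)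
    (hX : 0 < J.X α β i j) (hB : Best (GBest J α β t i j) s (J.v α β t i j)) :
    Best (GBest J α β t i j) (singleBody.run s).1 (J.G α β t i j) := by
  have e106 : s.nat 106 [] = i := hv (106, i) (by simp)
  have e107 : s.nat 107 [] = j := hv (107, j) (by simp)
  have key := hB.upto (x := 108) (lo := var 106) (hi := .succ (var 107)) (c :=
    offer (.and (.natLe (var 105) (var 108))
        (.natLe (.const 1) (.cell 15 [100, 102, 104, 106, 107, 108])))
      (.add (.cell 15 [var 102, var 104, var 106, var 107, var 108]) carryE) 108 108 107 104)
    (by simp [NExp.eval, e107, h.T]; omega)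
    (fun k => if t ≤ k then
      Stage.mk (J.phi α β i j k + (J.carry t k (J.X α β i j) : ℝ)) k else ⊤) ?_
  · rwa [NExp.eval, eval_var, eval_var, e106, e107, ← G_pos' hij htj hX] at key
  intro k s1 g hk1 hk2 hag1 hB1
  simp only [eval_var, NExp.eval, e106, e107] at hk1 hk2
  have r1 : Ready J (s1.setNat 108 [] k) := (h.of_agree hag1 (by decide)).setNat (by decide)
  have v1 := hv.of_agree hag1 rfl
  have hp := (hφ.of_agree hag1 (by decide)) α β i j k h1 hk1 (by omega) hjT
  simp only [Vals, List.forall_mem_cons, List.not_mem_nil, false_imp_iff, implies_true,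
    and_true] at v1
  obtain ⟨f102, f104, f105, f106, f107⟩ := v1
  have f100 : s1.nat 100 [] = 0 := by simpa using r1.zero
  refine Best.offer (hB1.setNat (by norm_num) _) (by norm_num) r1.zero r1.one _ ?_ ?_
  · intro hpos
    simp only [Test.holds_and, Test.holds_natLe, NExp.eval, List.map_cons, eval_var,
      List.map_nil, State.nat_setNat] at hpos
    simp [f102, f104, f105, f106, f107, f100] at hpos
    have hp' := hp.eq_coe hpos.2
    rw [if_pos hpos.1]
    constructor
    · rw [hp', RExp.eval, eval_carryE (α := α) (β := β) (t := t) (i := i) (j := j) (k := k) r1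
          (by simp [f102]) (by simp [f104]) (by simp [f105]) (by simp [f106]) (by simp [f107])
          (by simp) h1 hij hjT ht1 htj (by omega)]
      simp [RExp.eval, f102, f104, f106, f107]
    · refine ⟨β, by simp [f104], ?_⟩
      simp [f107]
      exact ⟨hk1, hpos.1, by omega, le_rfl, Or.inl ⟨rfl, rfl, rfl⟩⟩
  · intro hneg
    simp only [Test.holds_and, Test.holds_natLe, NExp.eval, List.map_cons, eval_var,
      List.map_nil, State.nat_setNat] at hneg
    simp [f102, f104, f105, f106, f107, f100] at hneg
    split_ifs with htk
    · rw [hp.eq_top (by have := hneg htk; omega)]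
      rfl
    · rfl

/-- With `X = 0` the block cost does not depend on the ordering period and is read at `k = j`. The
witnesses present the subplan as one block of quantity zero, so its plan is written like the others.
-/
theorem run_emptyBody (h : Ready J s) (hφ : HoldsPhi J s) {α β : Bool} {t i j : ℕ}
    (hv : Vals [(102, α.toNat), (104, β.toNat), (105, t), (106, i), (107, j)] s)
    (h1 : 1 ≤ i) (hij : i ≤ j) (hjT : j ≤ J.T) (htj : t ≤ j) (hX : ¬ 0 < J.X α β i j) :
    Best (fun _ _ l m => l = j ∧ m = β.toNat) (emptyBody.run s).1 (J.G α β t i j) := by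
  rw [emptyBody, run_seq]
  have hcl := agree_run clear s
  have b1 : Best (fun _ _ l m => l = j ∧ m = β.toNat) (clear.run s).1 ⊤ := best_clear
  have r1 := h.of_agree hcl (by decide)
  have v1 := hv.of_agree hcl rfl
  have hp := (hφ.of_agree hcl (by decide)) α β i j j h1 hij le_rfl hjT
  generalize (clear.run s).1 = s1 at *
  simp only [Vals, List.forall_mem_cons, List.not_mem_nil, false_imp_iff, implies_true,
    and_true] at v1
  obtain ⟨f102, f104, f105, f106, f107⟩ := v1
  have f100 := r1.zero
  have hq := r1.eval_qty (i := 106) (j := 107) f102 f104 (by omega) (by omega) (by omega)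
  rw [f106, f107] at hq
  rw [← min_eq_right (le_top : J.G α β t i j ≤ ⊤)]
  refine b1.offer (by norm_num) r1.zero r1.one _ ?_ ?_
  · intro hpos
    simp only [Test.holds_and, Test.holds_natLe, Test.holds_isZero, NExp.eval, List.map_cons, hq,
      List.map_nil, f102, f104, f106, f107, f100] at hpos
    refine ⟨?_, f107, f104⟩
    rw [G_none hij htj hpos.1]
    have hp' := hp.eq_coe hpos.2
    rw [phi_of_zero hpos.1] at hp'
    simp only [RExp.eval, List.map_cons, List.map_nil, eval_var, f102, f104, f105, f106, f107]
    rw [← hp', Icc_eq_Ico_succ]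
  · intro hneg
    simp only [Test.holds_and, Test.holds_natLe, Test.holds_isZero, NExp.eval, List.map_cons, hq,
      List.map_nil, f102, f104, f106, f107, f100] at hneg
    rcases (not_lt.mp hX).lt_or_eq with hX' | hX'
    · exact G_eq_top_of_neg hX'
    · exfalso
      refine hneg ⟨hX', ?_⟩
      by_contra h0
      have := hp.eq_top h0
      rw [phi_of_zero hX'] at this
      exact WithTop.coe_ne_top this

theorem run_regularBody (h : Ready J s) (hφ : HoldsPhi J s) {α β : Bool} {t i j : ℕ}
    (hv : Vals [(102, α.toNat), (104, β.toNat), (105, t), (106, i), (107, j)] s)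
    (h1 : 1 ≤ i) (hij : i ≤ j) (hjT : j ≤ J.T) (ht1 : 1 ≤ t) (htj : t ≤ j)
    (htail : ∀ γ k, i ≤ k → k < j → J.HoldsTail s α γ β i j k) :
    J.HoldsG (regularBody.run s).1 α β t i j ∧ J.HoldsGWit (regularBody.run s).1 α β t i j := by
  rw [regularBody, run_seq]
  have hcl := agree_run clear s
  have b1 : Best (GBest J α β t i j) (clear.run s).1 ⊤ := best_clear
  have r1 := h.of_agree hcl (by decide)
  have v1 := hv.of_agree hcl rfl
  have p1 := hφ.of_agree hcl (by decide)
  have t1 : ∀ γ k, i ≤ k → k < j → J.HoldsTail (clear.run s).1 α γ β i j k := by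
    intro γ k hk1 hk2
    unfold HoldsTail State.HoldsStage
    rw [hcl.nat 24 (by decide), hcl.real 24 (by decide)]
    exact htail γ k hk1 hk2
  generalize (clear.run s).1 = s1 at *
  rw [run_seq]
  have b2 := run_severalBody r1 v1 h1 hij hjT ht1 htj t1 b1
  have hag2 := agree_run severalBody s1
  have r2 := r1.of_agree hag2 (by decide)
  have v2 := v1.of_agree hag2 rfl
  have p2 := p1.of_agree hag2 (by decide)
  generalize (severalBody.run s1).1 = s2 at *
  rw [run_seq]
  have h17 := run_store (a := 17) (vs := [102, 104, 105, 106, 107]) (by decide) r2.zero r2.one b2.1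
  have hag3 := agree_run (store 17 [102, 104, 105, 106, 107]) s2
  have r3 := r2.of_agree hag3 (by decide)
  have v3 := v2.of_agree hag3 rfl
  have p3 := p2.of_agree hag3 (by decide)
  have b3 := b2.congr (s' := ((store 17 [102, 104, 105, 106, 107]).run s2).1)
    (fun a ha ha' => hag3.nat a (by simp [store, natW]; omega)) (hag3.real 120 (by decide))
  generalize ((store 17 [102, 104, 105, 106, 107]).run s2).1 = s3 at *
  simp only [Vals, List.forall_mem_cons, List.not_mem_nil, false_imp_iff, implies_true,
    and_true] at v2
  simp only [List.map_cons, List.map_nil, v2] at h17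
  have v3' := v3
  simp only [Vals, List.forall_mem_cons, List.not_mem_nil, false_imp_iff, implies_true,
    and_true] at v3'
  obtain ⟨f102, f104, f105, f106, f107⟩ := v3'
  have hq := r3.eval_qty (i := 106) (j := 107) f102 f104 (by omega) (by omega) (by omega)
  rw [f106, f107] at hq
  rw [run_seq]
  set c := ite (.lt .zero (qty 102 104 106 107)) singleBody emptyBody with hc
  have b4 : (c.run s3).1.HoldsStage 120 [] (J.G α β t i j) ∧
      (0 < J.X α β i j → J.G α β t i j ≠ ⊤ → GBest J α β t i j (J.G α β t i j)
        ((c.run s3).1.nat 121 []) ((c.run s3).1.nat 122 []) ((c.run s3).1.nat 123 [])) ∧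
      (J.X α β i j = 0 → (c.run s3).1.nat 122 [] = j ∧ (c.run s3).1.nat 123 [] = β.toNat) := by
    by_cases hX : 0 < J.X α β i j
    · rw [hc, run_ite_pos (by simpa [RExp.eval, hq] using hX)]
      have := run_singleBody r3 p3 v3 h1 hij hjT ht1 htj hX b3
      exact ⟨this.1, fun _ => this.2, fun h => absurd h hX.ne'⟩
    · rw [hc, run_ite_neg (by simpa [RExp.eval, hq] using hX)]
      have := run_emptyBody r3 p3 v3 h1 hij hjT htj hX
      refine ⟨this.1, fun h => absurd h hX, fun h => this.2 ?_⟩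
      rw [G_none hij htj h]
      exact WithTop.coe_ne_top
  have hag4 := agree_run c s3
  have r4 := r3.of_agree hag4 (by decide)
  have v4 := v3.of_agree hag4 rfl
  have h17' := h17.congr (s' := (c.run s3).1) (fun n _ => by rw [hag4.nat 17 (by decide)])
    (by rw [hag4.real 17 (by decide)])
  generalize (c.run s3).1 = s4 at *
  have h18 := run_store (a := 18) (vs := [102, 104, 105, 106, 107]) (by decide) r4.zero r4.one b4.1
  rw [run_seq]
  have hag5 := agree_run (store 18 [102, 104, 105, 106, 107]) s4
  have v5 := v4.of_agree hag5 rfl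
  have e121 := congrFun (hag5.nat 121 (by decide)) []
  have e122 := congrFun (hag5.nat 122 (by decide)) []
  have e123 := congrFun (hag5.nat 123 (by decide)) []
  have h17'' := h17'.congr (s' := ((store 18 [102, 104, 105, 106, 107]).run s4).1)
    (fun n _ => by rw [hag5.nat 17 (by decide)]) (by rw [hag5.real 17 (by decide)])
  generalize ((store 18 [102, 104, 105, 106, 107]).run s4).1 = s5 at *
  simp only [Vals, List.forall_mem_cons, List.not_mem_nil, false_imp_iff, implies_true,
    and_true] at v4 v5
  simp only [List.map_cons, List.map_nil, v4] at h18
  obtain ⟨g102, g104, g105, g106, g107⟩ := v5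
  refine ⟨⟨h17''.congr (fun n _ => ?_) ?_, h18.congr (fun n _ => ?_) ?_⟩, s4.nat 121 [],
    s4.nat 122 [], s4.nat 123 [], ?_, ?_, ?_, b4.2⟩ <;>
  simp [NExp.eval, g102, g104, g105, g106, g107, e121, e122, e123]

end Program

-- Writing a row of a table

namespace Cmd

variable {s : State}

/-- Write the values computed by `c` in the variable `130` to the row of the table `a` given by the
variables `vs`. -/
def fillRow (x a : ℕ) (vs : List ℕ) (c : Cmd) : Cmd :=
  loop x (.const 0) (.succ (.cell 0 []))
    (c ⨾ setReal a ((vs.map fun v => .cell v []) ++ [.cell x []]) (.cell 130 []))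

/-- While its row is being filled, `c` may read other rows of the same array, because they still
have their initial contents. Plans are copied from earlier plans in this way. -/
theorem run_fillRow {x a : ℕ} {vs : List ℕ} {c : Cmd} {T : ℕ} (f : ℕ → ℝ) (hT : s.nat 0 [] = T)
    (hk : c.keeps (x :: vs) = true) (hx : x ∉ vs) (ha : a ∉ c.realW)
    (hf : ∀ n ≤ T, ∀ s', Agree (fillRow x a vs c) s s' →
      (∀ jx, jx.take vs.length ≠ (vs.map fun v => s.nat v []) → s'.real a jx = s.real a jx) →
      (c.run (s'.setNat x [] n)).1.real 130 [] = f n) :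
    ∀ n ≤ T, ((fillRow x a vs c).run s).1.real a ((vs.map fun v => s.nat v []) ++ [n]) = f n := by
  have key := run_loop_agree (x := x) (lo := .const 0) (hi := .succ (.cell 0 []))
    (c := c ⨾ setReal a ((vs.map fun v => .cell v []) ++ [.cell x []]) (.cell 130 [])) (s := s)
    (fun n s' => (∀ m < n, s'.real a ((vs.map fun v => s.nat v []) ++ [m]) = f m) ∧
      ∀ jx, jx.take vs.length ≠ (vs.map fun v => s.nat v []) → s'.real a jx = s.real a jx)
    ⟨by simp [NExp.eval], fun _ _ => rfl⟩ ?_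
  · intro n hn
    refine key.1 n ?_
    simp only [NExp.eval, List.map_nil, hT]
    omega
  rintro n s' - h2 hag ⟨h3, h4⟩
  simp only [NExp.eval, List.map_nil, hT] at h2
  have hkr := agree_run c (s'.setNat x [] n)
  simp only [keeps, List.all_cons, Bool.and_eq_true, List.all_eq_true, decide_eq_true_eq] at hk
  have hvs : (vs.map fun v => (c.run (s'.setNat x [] n)).1.nat v []) =
      vs.map fun v => s.nat v [] := by
    refine List.map_congr_left fun v hv => ?_
    rw [hkr.nat v (hk.2 v hv), State.nat_setNat_of_ne (ne_of_mem_of_not_mem hv hx), hag.nat v]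
    simp only [natW, List.append_nil, List.mem_cons, not_or]
    exact ⟨ne_of_mem_of_not_mem hv hx, hk.2 v hv⟩
  have hxn : (c.run (s'.setNat x [] n)).1.nat x [] = n := by
    rw [hkr.nat x hk.1]
    simp
  have hix : ((vs.map fun v => NExp.cell v []) ++ [NExp.cell x []]).map
      (NExp.eval (c.run (s'.setNat x [] n)).1) = (vs.map fun v => s.nat v []) ++ [n] := by
    rw [← hvs]
    simp [NExp.eval, hxn]
  have hold : (c.run (s'.setNat x [] n)).1.real a = s'.real a := hkr.real a ha
  rw [run_seq, run_setReal, hix]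
  refine ⟨fun m hm => ?_, fun jx hj => ?_⟩
  · by_cases hmn : m = n
    · subst hmn
      rw [State.real_setReal, if_pos ⟨rfl, rfl⟩]
      exact hf m (by omega) s' hag h4
    · rw [State.real_setReal, if_neg (by simp [hmn]), hold]
      exact h3 m (by omega)
  · rw [State.real_setReal, if_neg, hold]
    · exact h4 jx hj
    · rintro ⟨-, rfl⟩
      exact hj (by simp)

end Cmd

/-! ### The program: plans of regular subplans -/

namespace Program

open Cmd Data

/-- Compute the plan of a regular subplan. -/
def planBody : Cmd :=
  setNat 108 [] (.cell 25 [100, 102, 104, 105, 106, 107]) ⨾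
  setNat 109 [] (.cell 25 [101, 102, 104, 105, 106, 107]) ⨾
  setNat 103 [] (.cell 25 [115, 102, 104, 105, 106, 107]) ⨾
  setNat 112 [] (.succ (var 109)) ⨾
  fillRow 110 26 [102, 104, 105, 106, 107]
    (ite (.natLe (var 110) (var 109))
      (ite (.natEq (var 110) (var 108)) (setReal 130 [] (qty 102 103 106 109))
        (setReal 130 [] .zero))
      (setReal 130 [] (.cell 26 [var 103, var 104, var 108, var 112, var 107, var 110])))

/-- Tabulate the regular subplans. -/
def regular : Cmd :=
  desc 111 106
    (nest [(107, false), (102, true), (103, true), (104, true), (108, false)] tailBody ⨾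
     nest [(107, false), (102, true), (104, true), (105, false)] regularBody ⨾
     nest [(107, false), (102, true), (104, true), (105, false)] planBody)

variable {J : Data} {s s' : State}

/-- The written row has exactly the shape required by `realG_of_wit`: one order for the first block,
then the stored plan of the remaining subplan. Every plan has its own row, at a cost of `T` steps
for each triple `t, i, j`. -/
theorem run_planBody (hV : J.Valid) (hI : J.Tight) (h : Ready J s) {α β : Bool} {t i j : ℕ}
    (hv : Vals [(102, α.toNat), (104, β.toNat), (105, t), (106, i), (107, j)] s)
    (h1 : 1 ≤ i) (hij : i ≤ j) (hjT : j ≤ J.T) (ht1 : 1 ≤ t) (htj : t ≤ j)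
    (hw : J.HoldsGWit s α β t i j)
    (hrec : ∀ γ k l, 1 ≤ k → k ≤ j → i ≤ l → l < j → J.HoldsGPlan s γ β k (l + 1) j) :
    J.HoldsGPlan (planBody.run s).1 α β t i j := by
  obtain ⟨k, l, m, hk, hl, hm, hpos, hzero⟩ := hw
  rw [planBody, run_seq, run_seq, run_seq, run_seq]
  have v0 := hv
  simp only [Vals, List.forall_mem_cons, List.not_mem_nil, false_imp_iff, implies_true,
    and_true] at v0
  obtain ⟨f102, f104, f105, f106, f107⟩ := v0
  set s1 := (((s.setNat 108 [] k).setNat 109 [] l).setNat 103 [] m).setNat 112 [] (l + 1) with hs1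
  have hs : ((setNat 112 [] (.succ (var 109))).run ((setNat 103 []
      (.cell 25 [115, 102, 104, 105, 106, 107])).run ((setNat 109 []
      (.cell 25 [101, 102, 104, 105, 106, 107])).run ((setNat 108 []
      (.cell 25 [100, 102, 104, 105, 106, 107])).run s).1).1).1).1 = s1 := by
    simp [hs1, hk, hl, hm, NExp.eval, f102, f104, f105, f106, f107, h.zero, h.one, h.two]
  rw [hs]
  have r1 : Ready J s1 := (((h.setNat (by decide)).setNat (by decide)).setNat (by decide)).setNat
    (by decide)
  have v1 : Vals [(102, α.toNat), (104, β.toNat), (105, t), (106, i), (107, j), (108, k), (109, l),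
      (103, m), (112, l + 1)] s1 := by
    simp [Vals, hs1, f102, f104, f105, f106, f107]
  set c : Cmd := ite (.natLe (var 110) (var 109))
      (ite (.natEq (var 110) (var 108)) (setReal 130 [] (qty 102 103 106 109))
        (setReal 130 [] .zero))
      (setReal 130 [] (.cell 26 [var 103, var 104, var 108, var 112, var 107, var 110])) with hc
  have fill : ∀ γ : Bool, m = γ.toNat → i ≤ l → l ≤ j → ∀ n ≤ J.T,
      ((fillRow 110 26 [102, 104, 105, 106, 107] c).run s1).1.real 26
        [α.toNat, β.toNat, t, i, j, n] = if n ≤ l then (if n = k then J.X α γ i l else 0) else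
          s.real 26 [γ.toNat, β.toNat, k, l + 1, j, n] := by
    intro γ hγ hil hlj n hn
    have := run_fillRow (s := s1) (x := 110) (a := 26) (vs := [102, 104, 105, 106, 107]) (c := c)
      (fun n => if n ≤ l then (if n = k then J.X α γ i l else 0) else
          s.real 26 [γ.toNat, β.toNat, k, l + 1, j, n])
      r1.T (by decide) (by decide) (by decide) ?_ n hn
    · simpa [hs1, f102, f104, f105, f106, f107] using this
    intro n hn s2 hag hold
    have r2 : Ready J (s2.setNat 110 [] n) := (r1.of_agree hag (by decide)).setNat (by decide)
    have v2 := v1.of_agree hag rfl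
    simp only [Vals, List.forall_mem_cons, List.not_mem_nil, false_imp_iff, implies_true,
      and_true] at v2
    obtain ⟨g102, g104, g105, g106, g107, g108, g109, g103, g112⟩ := v2
    rw [hc]
    by_cases hnl : n ≤ l
    · rw [run_ite_pos (by simpa [g109] using hnl), if_pos hnl]
      by_cases hnk : n = k
      · rw [run_ite_pos (by simpa [g108] using hnk), if_pos hnk, run_setReal,
          r2.eval_qty (α := α) (β := γ) (by simp [g102]) (by simp [g103, hγ]) (by simp [g106, h1])
          (by simp [g106]; omega) (by simp [g109]; omega)]
        simp [g106, g109]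
      · rw [run_ite_neg (by simpa [g108] using hnk), if_neg hnk]
        simp [RExp.eval]
    · rw [run_ite_neg (by simpa [g109] using hnl), if_neg hnl, run_setReal]
      -- The row that is read starts at `l + 1 > i`, so it differs from the row being written.
      have := hold [γ.toNat, β.toNat, k, l + 1, j, n] (by
        simp [hs1, f102, f104, f105, f106, f107]; omega)
      simp [RExp.eval, g103, g104, g107, g108, g112, ← hγ]
      simpa [hγ, hs1] using this
  intro q hq
  rcases lt_trichotomy (J.X α β i j) 0 with hX | hX | hX
  · rw [G_eq_top_of_neg hX] at hq
    exact absurd hq WithTop.top_ne_coe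
  -- The stored `k` plays no role here: the quantity is zero and the row vanishes on `[i,j]`.
  · obtain ⟨rfl, hmβ⟩ := hzero hX
    rw [G_none hij htj hX] at hq
    obtain ⟨e1, e2⟩ := Stage.mk_eq_coe hq
    have e1' := WithTop.coe_injective e1
    rw [← e1', ← e2]
    refine realG_none hV hI h1 hjT htj hX fun n hn1 hn2 => ?_
    rw [fill β hmβ hij le_rfl n (by omega), if_pos hn2, hX, ite_self]
  · obtain ⟨γ, hγ, hw⟩ := hpos hX (by rw [hq]; exact WithTop.coe_ne_top)
    obtain ⟨hik, htk, hkl, hlj, -⟩ := id hw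
    rw [hq] at hw
    exact realG_of_wit hV hI h1 hjT hw
      (fun hlj' q' hq' => hrec γ k l (by omega) (by omega) (by omega) hlj' q' hq')
      fun n hn1 hn2 => fill γ hγ (by omega) hlj n (by omega)

/-- The tables of regular subplans starting at period `i` are filled. -/
def RegularFilled (J : Data) (i : ℕ) (s : State) : Prop :=
  (∀ (α γ β : Bool) j k, i ≤ k → k < j → j ≤ J.T → J.HoldsTail s α γ β i j k) ∧
  ∀ (α β : Bool) t j, 1 ≤ t → t ≤ j → i ≤ j → j ≤ J.T →
    J.HoldsG s α β t i j ∧ J.HoldsGPlan s α β t i j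

theorem _root_.LotSizing.Data.HoldsG.congr {α β : Bool} {t i j : ℕ} (h : J.HoldsG s α β t i j)
    (hn : ∀ a ∈ [17, 18], ∀ n, s'.nat a [n, α.toNat, β.toNat, t, i, j] =
      s.nat a [n, α.toNat, β.toNat, t, i, j])
    (hr : ∀ b ∈ [17, 18], s'.real b [α.toNat, β.toNat, t, i, j] =
      s.real b [α.toNat, β.toNat, t, i, j]) : J.HoldsG s' α β t i j :=
  ⟨h.1.congr (fun n _ => hn 17 (by simp) n) (hr 17 (by simp)),
    h.2.congr (fun n _ => hn 18 (by simp) n) (hr 18 (by simp))⟩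

theorem _root_.LotSizing.Data.HoldsTail.congr {α γ β : Bool} {i j k : ℕ}
    (h : J.HoldsTail s α γ β i j k)
    (hn : ∀ n, s'.nat 24 [n, α.toNat, γ.toNat, β.toNat, i, j, k] =
      s.nat 24 [n, α.toNat, γ.toNat, β.toNat, i, j, k])
    (hr : s'.real 24 [α.toNat, γ.toNat, β.toNat, i, j, k] =
      s.real 24 [α.toNat, γ.toNat, β.toNat, i, j, k]) : J.HoldsTail s' α γ β i j k :=
  ⟨h.1.congr (fun n _ => hn n) hr, by rw [hn]; exact h.2⟩

theorem _root_.LotSizing.Data.HoldsGPlan.congr {α β : Bool} {t i j : ℕ}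
    (h : J.HoldsGPlan s α β t i j)
    (hr : ∀ n, s'.real 26 [α.toNat, β.toNat, t, i, j, n] =
      s.real 26 [α.toNat, β.toNat, t, i, j, n]) : J.HoldsGPlan s' α β t i j := by
  intro q hq
  simp only [hr]
  exact h q hq

/-- The start `i` runs downwards, since a continuation always starts later. For a fixed `i`,
continuations, values and plans each nest three more loops over periods. -/
theorem run_regular (hV : J.Valid) (hI : J.Tight) (h : Ready J s) (hφ : HoldsPhi J s) :
    ∀ i, 1 ≤ i → i ≤ J.T → RegularFilled J i (regular.run s).1 := by
  refine desc_fill (A := [17, 18, 24]) (B := [17, 18, 24, 26]) (p := 3) h.T (by decide) (by decide)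
    (by decide) (RegularFilled J) ?_ ?_
  · rintro i s s' hA hB ⟨hQ1, hQ2⟩
    refine ⟨fun α γ β j k h1 h2 h3 => (hQ1 α γ β j k h1 h2 h3).congr
        (fun n => hA 24 (by simp) n _ rfl) (hB 24 (by simp) _ rfl),
      fun α β t j h1 h2 h3 h4 => ⟨(hQ2 α β t j h1 h2 h3 h4).1.congr
        (fun a ha n => hA a (by revert a; decide) n _ rfl)
        (fun b hb => hB b (by revert b; decide) _ rfl),
        (hQ2 α β t j h1 h2 h3 h4).2.congr fun n => hB 26 (by simp) _ rfl⟩⟩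
  intro i s1 hi1 hiT hag hreg ih
  have r1 := h.of_agree hag (by decide)
  have p1 := hφ.of_agree hag (by decide)
  rw [run_seq, run_seq]
  -- continuations
  have t2 : ∀ (α γ β : Bool) j k, i ≤ k → k < j → j ≤ J.T → J.HoldsTail ((nest [(107, false),
      (102, true), (103, true), (104, true), (108, false)] tailBody).run s1).1 α γ β i j k := by
    intro α γ β j k hik hkj hjT
    have := nest_table (s := s1) (T := J.T)
      (vars := [(107, false), (102, true), (103, true), (104, true), (108, false)])
      (vs := [102, 103, 104, 106, 107, 108]) (A := [24]) (B := [24]) (c := tailBody)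
      (P := fun ix s => ∀ (α γ β : Bool) i j k, ix = [α.toNat, γ.toNat, β.toNat, i, j, k] →
        1 ≤ i → i ≤ k → k < j → j ≤ J.T → (∀ i', i < i' → i' ≤ J.T → RegularFilled J i' s1) →
        J.HoldsTail s α γ β i j k)
      r1.T (by decide) ?_ (fun _ => True) trivial (by simp) (by simp) ?_
      (fun v => if v = 102 then α.toNat else if v = 103 then γ.toNat else if v = 104 then β.toNat
        else if v = 106 then i else if v = 107 then j else k) ?_ (by simp [hreg])
    · exact this α γ β i j k (by simp) hi1 hik hkj hjT ih
    · rintro ix s s' - hA hB hP α γ β i j k rfl h1 h2 h3 h4 h5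
      exact (hP α γ β i j k rfl h1 h2 h3 h4 h5).congr (hA 24 (by simp)) (hB 24 (by simp) [])
    · rintro s' hag - - α γ β i j k hix h1 h2 h3 h4 h5
      simp only [List.map_cons, List.map_nil, List.cons.injEq, and_true] at hix
      obtain ⟨e1, e2, e3, e4, e5, e6⟩ := hix
      refine run_tailBody (r1.of_agree hag (by decide)) (p1.of_agree hag (by decide)) e1 e2 e3 e4
        e5 e6 h1 h2 h4 fun l hl1 hl2 => ?_
      refine (((h5 (l + 1) (by omega) (by omega)).2 γ β k j (by omega) (by omega) (by omega)
        h4).1).congr (fun a ha n => ?_) (fun b hb => ?_)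
      · rw [hag.nat a (by revert a; decide)]
      · rw [hag.real b (by revert b; decide)]
    · have hα := Bool.toNat_le α
      have hβ := Bool.toNat_le β
      have hγ := Bool.toNat_le γ
      simp [InRange, hα, hβ, hγ]
      omega
  have hag2 := agree_run (nest [(107, false), (102, true), (103, true), (104, true), (108, false)]
    tailBody) s1
  have r2 := r1.of_agree hag2 (by decide)
  have p2 := p1.of_agree hag2 (by decide)
  have reg2 := congrFun (hag2.nat 106 (by decide)) []
  have q2 := hag2.real 26 (by decide)
  generalize ((nest [(107, false), (102, true), (103, true), (104, true), (108, false)]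
    tailBody).run s1).1 = s2 at *
  -- values
  have t3 : ∀ (α β : Bool) t j, 1 ≤ t → t ≤ j → i ≤ j → j ≤ J.T → J.HoldsG ((nest [(107, false),
      (102, true), (104, true), (105, false)] regularBody).run s2).1 α β t i j ∧
      J.HoldsGWit ((nest [(107, false),
      (102, true), (104, true), (105, false)] regularBody).run s2).1 α β t i j := by
    intro α β t j ht1 htj hij hjT
    have := nest_table (s := s2) (T := J.T)
      (vars := [(107, false), (102, true), (104, true), (105, false)])
      (vs := [102, 104, 105, 106, 107]) (A := [17, 18, 25]) (B := [17, 18]) (c := regularBody)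
      (P := fun ix s => ∀ (α β : Bool) t i j, ix = [α.toNat, β.toNat, t, i, j] →
        1 ≤ t → t ≤ j → 1 ≤ i → i ≤ j → j ≤ J.T →
        (∀ γ k, i ≤ k → k < j → J.HoldsTail s2 α γ β i j k) →
        J.HoldsG s α β t i j ∧ J.HoldsGWit s α β t i j)
      r2.T (by decide) ?_ (fun _ => True) trivial (by simp) (by simp) ?_
      (fun v => if v = 102 then α.toNat else if v = 104 then β.toNat else if v = 105 then t
        else if v = 106 then i else j) ?_ (by simp [reg2, hreg])
    · exact this α β t i j (by simp) ht1 htj hi1 hij hjT fun γ k h1 h2 => t2 α γ β j k h1 h2 hjT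
    · rintro ix s s' - hA hB hP α β t i j rfl h1 h2 h3 h4 h5 h6
      obtain ⟨g1, g2⟩ := hP α β t i j rfl h1 h2 h3 h4 h5 h6
      refine ⟨g1.congr (fun a ha n => hA a (by revert a; decide) n)
        (fun b hb => hB b hb []), ?_⟩
      unfold HoldsGWit at *
      rwa [hA 25 (by simp), hA 25 (by simp), hA 25 (by simp)]
    · rintro s' hag - - α β t i j hix h1 h2 h3 h4 h5 h6
      simp only [List.map_cons, List.map_nil, List.cons.injEq, and_true] at hix
      obtain ⟨e1, e2, e3, e4, e5⟩ := hix
      refine run_regularBody (r2.of_agree hag (by decide)) (p2.of_agree hag (by decide))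
        (by simp [Vals, e1, e2, e3, e4, e5]) h3 h4 h5 h1 h2 fun γ k hk1 hk2 => ?_
      refine (h6 γ k hk1 hk2).congr (fun n => ?_) ?_
      · rw [hag.nat 24 (by decide)]
      · rw [hag.real 24 (by decide)]
    · have hα := Bool.toNat_le α
      have hβ := Bool.toNat_le β
      simp [InRange, hα, hβ]
      omega
  have hag3 := agree_run (nest [(107, false), (102, true), (104, true), (105, false)]
    regularBody) s2
  have r3 := r2.of_agree hag3 (by decide)
  have reg3 := congrFun (hag3.nat 106 (by decide)) []
  have q3 := hag3.real 26 (by decide)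
  have n24 := hag3.nat 24 (by decide)
  have q24 := hag3.real 24 (by decide)
  generalize ((nest [(107, false), (102, true), (104, true), (105, false)]
    regularBody).run s2).1 = s3 at *
  have hag4 := agree_run (nest [(107, false), (102, true), (104, true), (105, false)] planBody) s3
  refine ⟨fun α γ β j k h1 h2 h3 => (t2 α γ β j k h1 h2 h3).congr (fun n => ?_) ?_,
    fun α β t j ht1 htj hij hjT => ⟨(t3 α β t j ht1 htj hij hjT).1.congr (fun a ha n => ?_)
      (fun b hb => ?_), ?_⟩⟩
  · rw [hag4.nat 24 (by decide), n24]
  · rw [hag4.real 24 (by decide), q24]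
  · rw [hag4.nat a (by revert a; decide)]
  · rw [hag4.real b (by revert b; decide)]
  -- plans
  have := nest_table_keep (s := s3) (T := J.T) (p := 3) (r := 106)
    (vars := [(107, false), (102, true), (104, true), (105, false)])
    (vs := [102, 104, 105, 106, 107]) (A := []) (B := [26]) (c := planBody)
    (P := fun ix s => ∀ (α β : Bool) t j, ix = [α.toNat, β.toNat, t, i, j] →
      1 ≤ t → t ≤ j → i ≤ j → j ≤ J.T → J.HoldsGPlan s α β t i j)
    r3.T (by decide) (by decide) (by decide) ?_ ?_
    (fun v => if v = 102 then α.toNat else if v = 104 then β.toNat else if v = 105 then t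
      else if v = 106 then i else j) ?_ (by simp [reg3, reg2, hreg])
  · exact this α β t j (by simp) ht1 htj hij hjT
  · rintro ix s s' - - hB hP α β t j rfl h1 h2 h3 h4
    exact (hP α β t j rfl h1 h2 h3 h4).congr fun n => hB 26 (by simp) [n]
  · rintro s' hag hkeep - α β t j hix h1 h2 h3 h4
    simp only [List.map_cons, List.map_nil, List.cons.injEq, and_true] at hix
    obtain ⟨e1, e2, e3, e4, e5⟩ := hix
    refine run_planBody hV hI (r3.of_agree hag (by decide))
      (by simp [Vals, e1, e2, e3, e4, e5]) hi1 h3 h4 h1 h2 ?_ ?_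
    · have := (t3 α β t j h1 h2 h3 h4).2
      unfold HoldsGWit at *
      rwa [hag.nat 25 (by decide)]
    · intro γ k l hk1 hk2 hl1 hl2
      refine ((ih (l + 1) (by omega) (by omega)).2 γ β k j hk1 hk2 (by omega) h4).2.congr
        fun n => ?_
      -- Plans with start `l + 1` differ from the current ones at position `3` of the index and are
      -- not touched by this nest.
      rw [hkeep.real 26 (by simp) _ (by simp [reg3, reg2, hreg]; omega), q3, q2]
  · have hα := Bool.toNat_le α
    have hβ := Bool.toNat_le β
    simp [InRange, hα, hβ]
    omega

end Program

-- Plain costs as stage values with period zero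

namespace Stage

/-- With the constant period `0` the lexicographic order is that of the costs, so the minimization
commands for `G` also serve for `C`. -/
theorem mk_zero_mono : Monotone fun c : WithTop ℝ => mk c 0 := by
  intro a b hab
  cases b using WithTop.recTopCoe with
  | top => exact le_top
  | coe b =>
    cases a using WithTop.recTopCoe with
    | top => exact absurd hab (by simp)
    | coe a =>
      have : a ≤ b := WithTop.coe_le_coe.mp hab
      exact coe_le_coe.mpr (by rcases this.lt_or_eq with h | h <;> simp [h])

theorem mk_zero_min (a b : WithTop ℝ) : mk (min a b) 0 = min (mk a 0) (mk b 0) :=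
  mk_zero_mono.map_min

theorem mk_zero_inf {ι : Type*} (s : Finset ι) (f : ι → WithTop ℝ) :
    mk (s.inf f) 0 = s.inf fun i => mk (f i) 0 :=
  Finset.apply_inf_eq_inf_comp_of_linearOrder (fun c => mk c 0) mk_zero_mono rfl

end Stage

namespace Data

/-- The entry of the table of supply chain costs and plans. -/
def HoldsC (J : Data) (s : State) (α β : Bool) (t i j : ℕ) : Prop :=
  s.HoldsCost 19 [α.toNat, β.toNat, t, i, j] (J.C α β t i j) ∧
  ∀ c : ℝ, J.C α β t i j = (c : WithTop ℝ) →
    J.RealC α β t i j (fun n => s.real 27 [α.toNat, β.toNat, t, i, j, n])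
      (fun n => s.real 28 [α.toNat, β.toNat, t, i, j, n]) c

end Data

/-! ### The program: supply chain -/

namespace Program

open Cmd Data

/-- Cost of the supplier order serving the subplan from `i` to `l` with final label `b`. -/
def orderBody (b l : ℕ) : Cmd :=
  setReal 131 [] .zero ⨾
  ite (.lt .zero (qty 102 b 106 l))
    (setReal 131 [] (.add (.cell 4 [var 105]) (.mul (.cell 5 [var 105]) (qty 102 b 106 l)))) skip

/-- Offer to wait for the next period. -/
def waitBody : Cmd :=
  setNat 114 [] (.succ (var 105)) ⨾
  offer (.and (.natLe (.succ (var 105)) (var 107))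
      (.natLe (.const 1) (.cell 19 [100, 102, 104, 114, 106, 107])))
    (.cell 19 [var 102, var 104, var 114, var 106, var 107]) 100 100 100 100

/-- Offer to serve the periods until `l` now and the other periods later. -/
def splitBody : Cmd :=
  upto 109 (var 106) (var 107) (labels 103
    (setNat 112 [] (.succ (var 109)) ⨾
     setNat 113 [] (.succ (.cell 18 [101, 102, 103, 105, 106, 109])) ⨾
     orderBody 103 109 ⨾
     offer (.and (.natLe (var 105) (var 109))
        (.and (.natLe (.const 1) (.cell 18 [100, 102, 103, 105, 106, 109]))
          (.natLe (.const 1) (.cell 19 [100, 103, 104, 113, 112, 107]))))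
      (.add (.add (.cell 131 []) (.cell 18 [var 102, var 103, var 105, var 106, var 109]))
        (.cell 19 [var 103, var 104, var 113, var 112, var 107])) 100 101 109 103))

/-- Offer to serve all periods now. -/
def fullBody : Cmd :=
  orderBody 104 107 ⨾
  offer (.natLe (.const 1) (.cell 18 [100, 102, 104, 105, 106, 107]))
    (.add (.cell 131 []) (.cell 18 [var 102, var 104, var 105, var 106, var 107]))
    100 101 107 104

variable {J : Data} {s s' : State}

theorem RegularFilled.of_agree {i : ℕ} (h : RegularFilled J i s) {c : Cmd} (hag : Agree c s s')
    (hc : c.leaves [17, 18, 24] [17, 18, 24, 26] = true) : RegularFilled J i s' := by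
  refine ⟨fun α γ β j k h1 h2 h3 => (h.1 α γ β j k h1 h2 h3).congr
      (fun n => by rw [hag.nat_leaves hc (by simp)]) (by rw [hag.real_leaves hc (by simp)]),
    fun α β t j h1 h2 h3 h4 => ⟨(h.2 α β t j h1 h2 h3 h4).1.congr (fun a ha n => ?_)
      (fun b hb => ?_), (h.2 α β t j h1 h2 h3 h4).2.congr fun n => ?_⟩⟩
  · rw [hag.nat_leaves hc (by revert a; decide)]
  · rw [hag.real_leaves hc (by revert b; decide)]
  · rw [hag.real_leaves hc (by simp)]

theorem _root_.LotSizing.Data.HoldsC.congr {α β : Bool} {t i j : ℕ} (h : J.HoldsC s α β t i j)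
    (hn : ∀ n, s'.nat 19 [n, α.toNat, β.toNat, t, i, j] =
      s.nat 19 [n, α.toNat, β.toNat, t, i, j])
    (hr : ∀ b ∈ [19, 27, 28], ∀ jx, s'.real b ([α.toNat, β.toNat, t, i, j] ++ jx) =
      s.real b ([α.toNat, β.toNat, t, i, j] ++ jx)) : J.HoldsC s' α β t i j := by
  refine ⟨h.1.congr hn (hr 19 (by simp) []), fun c hc => ?_⟩
  have e27 := fun n => hr 27 (by simp) [n]
  have e28 := fun n => hr 28 (by simp) [n]
  simp only [List.cons_append, List.nil_append] at e27 e28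
  simp only [e27, e28]
  exact h.2 c hc

theorem _root_.LotSizing.Data.HoldsC.of_agree {α β : Bool} {t i j : ℕ} (h : J.HoldsC s α β t i j)
    {c : Cmd} (hag : Agree c s s') (hc : c.leaves [19] [19, 27, 28] = true) :
    J.HoldsC s' α β t i j :=
  h.congr (fun n => by rw [hag.nat_leaves hc (by simp)])
    fun b hb jx => by rw [hag.real_leaves hc hb]

theorem run_orderBody (h : Ready J s) {α γ : Bool} {b l t i : ℕ} (hα : s.nat 102 [] = α.toNat)
    (hγ : s.nat b [] = γ.toNat) (ht : s.nat 105 [] = t) (hi : s.nat 106 [] = i) (h1 : 1 ≤ i)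
    (hiT : i ≤ J.T) (hlT : s.nat l [] ≤ J.T) (ht1 : 1 ≤ t) (htT : t ≤ J.T) :
    ((orderBody b l).run s).1 = s.setReal 131 [] (J.orderCost t (J.X α γ i (s.nat l []))) := by
  rw [orderBody, run_seq, run_setReal]
  have r1 : Ready J (s.setReal 131 ([].map (NExp.eval s)) (RExp.zero.eval s)) :=
    h.setReal (by decide)
  have hq := r1.eval_qty (a := 102) (b := b) (i := 106) (j := l) (α := α) (β := γ) hα hγ
    (by rw [State.nat_setReal, hi]; exact h1) (by rw [State.nat_setReal, hi]; exact hiT) hlT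
  simp only [State.nat_setReal, hi, List.map_nil, RExp.eval] at hq
  unfold orderCost
  by_cases hX : 0 < J.X α γ i (s.nat l [])
  · rw [run_ite_pos (by simpa [RExp.eval, hq] using hX), if_pos hX, run_setReal]
    have e4 := h.fS t ht1 htT
    have e5 := h.pS t ht1 htT
    simp [RExp.eval, hq, ht, e4, e5, State.setReal_setReal]
  · rw [run_ite_neg (by simpa [RExp.eval, hq] using hX), if_neg hX]
    rfl

/-- Witnesses of a value of `C`. -/
def CBest (J : Data) (α β : Bool) (t i j : ℕ) (g : Stage) (m l b : ℕ) : Prop :=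
  ∀ c : ℝ, g = Stage.mk (c : WithTop ℝ) 0 → ∃ γ : Bool, b = γ.toNat ∧ J.CWit α β t i j c m l γ

theorem mk_zero_inj {a b : ℝ} (h : Stage.mk (a : WithTop ℝ) 0 = Stage.mk (b : WithTop ℝ) 0) :
    a = b := by
  have := congrArg Stage.cost h
  rw [Stage.cost_mk, Stage.cost_mk] at this
  exact WithTop.coe_injective this

/-- All witnesses are read from the variable `100`, which is zero; `m = 0` stands for waiting. -/
theorem run_waitBody (h : Ready J s) {α β : Bool} {t i j : ℕ}
    (hv : Vals [(102, α.toNat), (104, β.toNat), (105, t), (106, i), (107, j)] s)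
    (hC : t + 1 ≤ j → J.HoldsC s α β (t + 1) i j) (hB : Best (CBest J α β t i j) s ⊤) :
    Best (CBest J α β t i j) (waitBody.run s).1 (Stage.mk (J.C α β (t + 1) i j) 0) := by
  simp only [Vals, List.forall_mem_cons, List.not_mem_nil, false_imp_iff, implies_true,
    and_true] at hv
  obtain ⟨f102, f104, f105, f106, f107⟩ := hv
  have f100 := h.zero
  rw [waitBody, run_seq]
  have := (hB.setNat (x := 114) (by norm_num) (t + 1)).offer
    (b := .and (.natLe (.succ (var 105)) (var 107))
      (.natLe (.const 1) (.cell 19 [100, 102, 104, 114, 106, 107])))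
    (e := .cell 19 [var 102, var 104, var 114, var 106, var 107])
    (r₀ := 100) (r₁ := 100) (r₂ := 100) (r₃ := 100) (by norm_num) (by simp [f100])
    (by simp [h.one]) (Stage.mk (J.C α β (t + 1) i j) 0) ?_ ?_
  · simpa [NExp.eval, f105] using this
  · intro hpos
    simp [NExp.eval, f102, f104, f105, f106, f107, f100] at hpos
    have hc := (hC hpos.1).1.eq_coe hpos.2
    refine ⟨?_, fun c hc' => ⟨false, by simp [f100], ?_⟩⟩
    · rw [hc]
      simp [RExp.eval, f102, f104, f106, f107, f100]
    · rw [hc] at hc'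
      rw [CWit, if_pos (by simp [f100]), hc, mk_zero_inj hc']
      exact ⟨hpos.1, rfl⟩
  · intro hneg
    simp [NExp.eval, f102, f104, f105, f106, f107, f100] at hneg
    by_cases htj : t + 1 ≤ j
    · rw [(hC htj).1.eq_top (by have := hneg htj; omega)]
      rfl
    · rw [C_eq_top (by omega)]
      rfl

/-- The stored period `τ` of a finite `G` satisfies `t ≤ τ ≤ l` because it belongs to an actual
plan. So the entry of `C` at `τ + 1` lies in the part filled before, with `t` running downwards. -/
theorem run_splitBody (h : Ready J s) {α β : Bool} {t i j : ℕ}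
    (hv : Vals [(102, α.toNat), (104, β.toNat), (105, t), (106, i), (107, j)] s)
    (h1 : 1 ≤ i) (hij : i ≤ j) (hjT : j ≤ J.T) (ht1 : 1 ≤ t) (htj : t ≤ j)
    (hR : RegularFilled J i s)
    (hC : ∀ γ t' l, t < t' → t' ≤ j → i ≤ l → l < j → J.HoldsC s γ β t' (l + 1) j)
    {g : Stage} (hB : Best (CBest J α β t i j) s g) :
    Best (CBest J α β t i j) (splitBody.run s).1 (min g ((Finset.Ico i j).inf fun l =>
      (Finset.univ : Finset Bool).inf fun γ => Stage.mk (J.CSplit α γ β t i j l) 0)) := by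
  have e106 : s.nat 106 [] = i := hv (106, i) (by simp)
  have e107 : s.nat 107 [] = j := hv (107, j) (by simp)
  have key := hB.upto (x := 109) (lo := var 106) (hi := var 107) (c := labels 103
    (setNat 112 [] (.succ (var 109)) ⨾
     setNat 113 [] (.succ (.cell 18 [101, 102, 103, 105, 106, 109])) ⨾
     orderBody 103 109 ⨾
     offer (.and (.natLe (var 105) (var 109))
        (.and (.natLe (.const 1) (.cell 18 [100, 102, 103, 105, 106, 109]))
          (.natLe (.const 1) (.cell 19 [100, 103, 104, 113, 112, 107]))))
      (.add (.add (.cell 131 []) (.cell 18 [var 102, var 103, var 105, var 106, var 109]))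
        (.cell 19 [var 103, var 104, var 113, var 112, var 107])) 100 101 109 103))
    (by simp [e107, h.T]; omega)
    (fun l => (Finset.univ : Finset Bool).inf fun γ => Stage.mk (J.CSplit α γ β t i j l) 0) ?_
  · rwa [eval_var, eval_var, e106, e107] at key
  intro l s1 g1 hl1 hl2 hag1 hB1
  simp only [eval_var, e106, e107] at hl1 hl2
  have r1 : Ready J (s1.setNat 109 [] l) := (h.of_agree hag1 (by decide)).setNat (by decide)
  have v1 := hv.of_agree hag1 rfl
  refine (hB1.setNat (by norm_num) l).labels _ fun γ s2 g' hag2 hB2 => ?_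
  have r2 : Ready J s2 := r1.of_agree hag2 (by decide)
  have v2 := Vals.of_agree (l := [(102, α.toNat), (104, β.toNat), (105, t), (106, i), (107, j),
    (109, l)]) (s := s1.setNat 109 [] l) (by simpa [Vals] using v1) hag2 rfl
  have n18 : s2.nat 18 = s.nat 18 := by
    rw [hag2.nat 18 (by decide), ← hag1.nat 18 (by decide)]; rfl
  have q18 : s2.real 18 = s.real 18 := by
    rw [hag2.real 18 (by decide), ← hag1.real 18 (by decide)]; rfl
  have n19 : s2.nat 19 = s.nat 19 := by
    rw [hag2.nat 19 (by decide), ← hag1.nat 19 (by decide)]; rfl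
  have q19 : s2.real 19 = s.real 19 := by
    rw [hag2.real 19 (by decide), ← hag1.real 19 (by decide)]; rfl
  simp only [Vals, List.forall_mem_cons, List.not_mem_nil, false_imp_iff, implies_true,
    and_true] at v2
  obtain ⟨f102, f104, f105, f106, f107, f109⟩ := v2
  have f100 := r2.zero
  have f101 := r2.one
  set τ := s.nat 18 [1, α.toNat, γ.toNat, t, i, l] with hτ
  set s3 := ((s2.setNat 103 [] γ.toNat).setNat 112 [] (l + 1)).setNat 113 [] (τ + 1) with hs3
  have hs : ((setNat 113 [] (.succ (.cell 18 [101, 102, 103, 105, 106, 109]))).run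
      ((setNat 112 [] (.succ (var 109))).run (s2.setNat 103 [] γ.toNat)).1).1 = s3 := by
    simp [hs3, hτ, NExp.eval, f102, f105, f106, f101, f109, n18]
  have r3 : Ready J s3 := ((r2.setNat (by decide)).setNat (by decide)).setNat (by decide)
  have l3 : s3.nat 109 [] = l := by simp [hs3, f109]
  rw [run_seq, run_seq, run_seq, hs, run_orderBody r3 (α := α) (γ := γ) (t := t) (i := i)
    (by simp [hs3, f102]) (by simp [hs3]) (by simp [hs3, f105]) (by simp [hs3, f106]) h1 (by omega)
    (by rw [l3]; omega) ht1 (by omega), l3]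
  have b3 : Best (CBest J α β t i j)
      (s3.setReal 131 [] (J.orderCost t (J.X α γ i l))) g' :=
    ((((hB2.setNat (by norm_num) _).setNat (by norm_num) _).setNat (by norm_num) _)).congr
      (fun _ _ _ => rfl) rfl
  refine b3.offer (by norm_num) (by simp [hs3, f100]) (by simp [hs3, f101]) _ ?_ ?_
  · intro hpos
    simp [NExp.eval, hs3, f102, f104, f105, f106, f107, f109, f100, n18, n19] at hpos
    obtain ⟨p1, p2, p3⟩ := hpos
    obtain ⟨hG, hP⟩ := hR.2 α γ t l ht1 p1 hl1 (by omega)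
    have hg := hG.2.eq_mk p2
    rw [Stage.mk_coe] at hg
    have hreal := hP _ hg
    have ht' := hreal.t_le
    have hl' := hreal.last_le
    have hc := (hC γ (τ + 1) l (Nat.lt_succ_of_le ht')
      (by change τ ≤ l at hl'; omega) hl1 hl2).1.eq_coe p3
    rw [CSplit_coe hg]
    change Stage.mk (_ + J.C γ β (τ + 1) (l + 1) j) 0 = _ ∧ _
    constructor
    · rw [hc, ← WithTop.coe_add]
      simp [RExp.eval, hs3, f102, f104, f105, f106, f107, f109, f100, q18, q19]
    · intro c hc'
      change Stage.mk (_ + J.C γ β (τ + 1) (l + 1) j) 0 = _ at hc'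
      rw [hc, ← WithTop.coe_add] at hc'
      refine ⟨γ, by simp [hs3], ?_⟩
      simp [hs3, f101, f109]
      refine ⟨hl1, hl2.le, _, hg, Or.inr ⟨hl2, _, hc, (mk_zero_inj hc').symm⟩⟩
  · intro hneg
    simp [NExp.eval, hs3, f102, f104, f105, f106, f107, f109, f100, n18, n19] at hneg
    by_cases p1 : t ≤ l
    · obtain ⟨hG, hP⟩ := hR.2 α γ t l ht1 p1 hl1 (by omega)
      by_cases p2 : 1 ≤ s.nat 18 [0, α.toNat, γ.toNat, t, i, l]
      · have hg := hG.2.eq_mk p2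
        rw [Stage.mk_coe] at hg
        have hreal := hP _ hg
        have ht' := hreal.t_le
        have hl' := hreal.last_le
        have hc := (hC γ (τ + 1) l (Nat.lt_succ_of_le ht')
          (by change τ ≤ l at hl'; omega) hl1 hl2).1.eq_top
            (by have := hneg p1 p2; omega)
        rw [CSplit_coe hg]
        change Stage.mk (_ + J.C γ β (τ + 1) (l + 1) j) 0 = _
        rw [hc]
        rfl
      · rw [CSplit_top (hG.2.eq_top p2)]
        rfl
    · rw [CSplit_top (G_eq_top (by omega))]
      rfl

/-- This candidate is offered for every sign of `X`. For `X ≤ 0` its order cost is zero and it is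
the only one. -/
theorem run_fullBody (h : Ready J s) {α β : Bool} {t i j : ℕ}
    (hv : Vals [(102, α.toNat), (104, β.toNat), (105, t), (106, i), (107, j)] s)
    (h1 : 1 ≤ i) (hij : i ≤ j) (hjT : j ≤ J.T) (ht1 : 1 ≤ t) (htj : t ≤ j)
    (hR : RegularFilled J i s) {g : Stage} (hB : Best (CBest J α β t i j) s g) :
    Best (CBest J α β t i j) (fullBody.run s).1 (min g (Stage.mk
      ((J.orderCost t (J.X α β i j) : WithTop ℝ) + (J.G α β t i j).cost) 0)) := by
  simp only [Vals, List.forall_mem_cons, List.not_mem_nil, false_imp_iff, implies_true,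
    and_true] at hv
  obtain ⟨f102, f104, f105, f106, f107⟩ := hv
  have f100 := h.zero
  have f101 := h.one
  rw [fullBody, run_seq, run_orderBody h f102 f104 f105 f106 h1 (by omega) (by omega) ht1
    (by omega), f107]
  have b1 : Best (CBest J α β t i j) (s.setReal 131 [] (J.orderCost t (J.X α β i j))) g :=
    hB.congr (fun _ _ _ => rfl) rfl
  obtain ⟨hG, hP⟩ := hR.2 α β t j ht1 htj hij hjT
  refine b1.offer (by norm_num) (by simp [f100]) (by simp [f101]) _ ?_ ?_
  · intro hpos
    simp [NExp.eval, f102, f104, f105, f106, f107, f100] at hpos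
    have hg := hG.2.eq_mk hpos
    constructor
    · rw [hg, Stage.cost_mk, ← WithTop.coe_add]
      simp [RExp.eval, f102, f104, f105, f106, f107, f100]
    · intro c hc'
      rw [hg, Stage.cost_mk, ← WithTop.coe_add] at hc'
      rw [Stage.mk_coe] at hg
      refine ⟨β, by simp [f104], ?_⟩
      simp [f101, f107]
      exact ⟨hij, le_rfl, _, hg, Or.inl ⟨rfl, rfl, (mk_zero_inj hc').symm⟩⟩
  · intro hneg
    simp [NExp.eval, f102, f104, f105, f106, f107, f100] at hneg
    rw [hG.2.eq_top (by omega)]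
    rfl

end Program

-- Supply chain: values and plans

namespace Program

open Cmd Data

/-- Find the best supply chain plan of a regular subplan. -/
def chainValue : Cmd :=
  clear ⨾ ite (.lt .zero (qty 102 104 106 107)) (waitBody ⨾ splitBody) skip ⨾ fullBody ⨾
  store 19 [102, 104, 105, 106, 107]

/-- Fetch the first step of the best supply chain plan. -/
def chainArgs : Cmd :=
  setNat 109 [] (var 122) ⨾ setNat 103 [] (var 123) ⨾ setNat 112 [] (.succ (var 109)) ⨾
  setNat 114 [] (.succ (var 105)) ⨾
  ite (.natLe (var 112) (var 107))
    (setNat 113 [] (.succ (.cell 18 [101, 102, 103, 105, 106, 109])))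
    (setNat 113 [] (.succ (var 107)))

/-- Retailer orders if the supplier waits. -/
def waitRetailer : Cmd := fillRow 110 27 [102, 104, 105, 106, 107]
  (setReal 130 [] (.cell 27 [var 102, var 104, var 114, var 106, var 107, var 110]))

/-- Supplier orders if the supplier waits. -/
def waitSupplier : Cmd := fillRow 110 28 [102, 104, 105, 106, 107]
  (ite (.natEq (var 110) (var 105)) (setReal 130 [] .zero)
    (setReal 130 [] (.cell 28 [var 102, var 104, var 114, var 106, var 107, var 110])))

/-- Retailer orders if the supplier orders now. -/
def orderRetailer : Cmd := fillRow 110 27 [102, 104, 105, 106, 107]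
  (ite (.natLe (var 110) (var 109))
    (setReal 130 [] (.cell 26 [var 102, var 103, var 105, var 106, var 109, var 110]))
    (setReal 130 [] (.cell 27 [var 103, var 104, var 113, var 112, var 107, var 110])))

/-- Supplier orders if the supplier orders now. -/
def orderSupplier : Cmd := fillRow 110 28 [102, 104, 105, 106, 107]
  (ite (.natEq (var 110) (var 105)) (setReal 130 [] (qty 102 103 106 109))
    (ite (.natLe (.succ (var 110)) (var 113)) (setReal 130 [] .zero)
      (setReal 130 [] (.cell 28 [var 103, var 104, var 113, var 112, var 107, var 110]))))

/-- Compute the best supply chain plan of a regular subplan. -/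
def chainPlan : Cmd :=
  chainArgs ⨾
  ite (.natLe (var 121) (.const 0)) (waitRetailer ⨾ waitSupplier) (orderRetailer ⨾ orderSupplier)

/-- Cost and plan of a regular subplan with the supplier. -/
def chainBody : Cmd := chainValue ⨾ chainPlan

/-- Tabulate the supply chain costs and plans. -/
def chain : Cmd :=
  desc 111 105 (nest [(106, false), (107, false), (102, true), (104, true)] chainBody)

variable {J : Data} {s s' : State}

theorem run_chainValue (hV : J.Valid) (h : Ready J s) {α β : Bool} {t i j : ℕ}
    (hv : Vals [(102, α.toNat), (104, β.toNat), (105, t), (106, i), (107, j)] s)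
    (h1 : 1 ≤ i) (hij : i ≤ j) (hjT : j ≤ J.T) (ht1 : 1 ≤ t) (htj : t ≤ j)
    (hR : RegularFilled J i s)
    (hC : ∀ α t' i', t < t' → t' ≤ j → i ≤ i' → i' ≤ j → J.HoldsC s α β t' i' j) :
    (chainValue.run s).1.HoldsCost 19 [α.toNat, β.toNat, t, i, j] (J.C α β t i j) ∧
    ∀ c : ℝ, J.C α β t i j = (c : WithTop ℝ) → ∃ γ : Bool,
      (chainValue.run s).1.nat 123 [] = γ.toNat ∧
      J.CWit α β t i j c ((chainValue.run s).1.nat 121 []) ((chainValue.run s).1.nat 122 []) γ := by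
  rw [chainValue, run_seq]
  have hcl := agree_run clear s
  have b1 : Best (CBest J α β t i j) (clear.run s).1 ⊤ := best_clear
  have r1 := h.of_agree hcl (by decide)
  have v1 := hv.of_agree hcl rfl
  have R1 := hR.of_agree hcl (by decide)
  have C1 := fun α t' i' a b c d => (hC α t' i' a b c d).of_agree hcl (by decide)
  generalize (clear.run s).1 = s1 at *
  have v1' := v1
  simp only [Vals, List.forall_mem_cons, List.not_mem_nil, false_imp_iff, implies_true,
    and_true] at v1'
  obtain ⟨f102, f104, f105, f106, f107⟩ := v1'
  have hq := r1.eval_qty (i := 106) (j := 107) f102 f104 (by omega) (by omega) (by omega)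
  rw [f106, f107] at hq
  rw [run_seq]
  set c := ite (.lt .zero (qty 102 104 106 107)) (waitBody ⨾ splitBody) skip with hc
  have hag2 := agree_run c s1
  have r2 := r1.of_agree hag2 (by decide)
  have v2 := v1.of_agree hag2 rfl
  have R2 := R1.of_agree hag2 (by decide)
  -- For `X ≤ 0` nothing is offered before `fullBody`, in accordance with `C = G`.
  have b3 : ∃ g, Best (CBest J α β t i j) (c.run s1).1 g ∧ Stage.mk (J.C α β t i j) 0 = min g
      (Stage.mk ((J.orderCost t (J.X α β i j) : WithTop ℝ) + (J.G α β t i j).cost) 0) := by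
    by_cases hX : 0 < J.X α β i j
    · rw [hc, run_ite_pos (by simpa [RExp.eval, hq] using hX), run_seq]
      have bw := run_waitBody r1 v1 (fun htj => C1 α (t + 1) i (by omega) htj le_rfl hij) b1
      have hagw := agree_run waitBody s1
      have bs := run_splitBody (r1.of_agree hagw (by decide)) (v1.of_agree hagw rfl) h1 hij hjT ht1
        htj (R1.of_agree hagw (by decide)) (fun γ t' l a b c d =>
          (C1 γ t' (l + 1) a b (by omega) (by omega)).of_agree hagw (by decide)) bw
      refine ⟨_, bs, ?_⟩
      rw [C_pos hV ht1 hjT ⟨hij, htj⟩ hX, min_assoc, Stage.mk_zero_min, Stage.mk_zero_min,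
        Stage.mk_zero_inf]
      simp only [Stage.mk_zero_inf]
      congr 1
      exact min_comm _ _
    · rw [hc, run_ite_neg (by simpa [RExp.eval, hq] using hX), run_skip]
      refine ⟨_, b1, ?_⟩
      rw [C_nonpos hX, orderCost, if_neg hX, WithTop.coe_zero, zero_add, min_eq_right le_top]
  generalize (c.run s1).1 = s2 at *
  obtain ⟨g, b3, hg⟩ := b3
  have b4 := run_fullBody r2 v2 h1 hij hjT ht1 htj R2 b3
  rw [← hg] at b4
  have hag4 := agree_run fullBody s2
  have r4 := r2.of_agree hag4 (by decide)
  have v4 := v2.of_agree hag4 rfl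
  rw [run_seq]
  generalize (fullBody.run s2).1 = s4 at *
  have h19 := run_store (a := 19) (vs := [102, 104, 105, 106, 107]) (by decide) r4.zero r4.one b4.1
  have hag5 := agree_run (store 19 [102, 104, 105, 106, 107]) s4
  simp only [Vals, List.forall_mem_cons, List.not_mem_nil, false_imp_iff, implies_true,
    and_true] at v4
  simp only [List.map_cons, List.map_nil, v4] at h19
  constructor
  · have := h19.holdsCost
    rwa [Stage.cost_mk] at this
  · intro c hc
    rw [hag5.nat 121 (by decide), hag5.nat 122 (by decide), hag5.nat 123 (by decide)]
    exact b4.2 (by rw [hc, Stage.mk_coe]; exact WithTop.coe_ne_top) c (by rw [hc])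

/-- The rows are written in the forms asked for by `realC_of_wait` and `realC_of_order`, from rows
of `C` with a later first supplier period and from rows of `G`. -/
theorem run_chainPlan (h : Ready J s) {α β γ : Bool} {t i j m l : ℕ} {c : ℝ}
    (hv : Vals [(102, α.toNat), (104, β.toNat), (105, t), (106, i), (107, j), (121, m), (122, l),
      (123, γ.toNat)] s)
    (h1 : 1 ≤ i) (hij : i ≤ j) (hjT : j ≤ J.T) (ht1 : 1 ≤ t) (htj : t ≤ j)
    (hR : RegularFilled J i s)
    (hC : ∀ α t' i', t < t' → t' ≤ j → i ≤ i' → i' ≤ j → J.HoldsC s α β t' i' j)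
    (hw : J.CWit α β t i j c m l γ) :
    J.RealC α β t i j (fun n => (chainPlan.run s).1.real 27 [α.toNat, β.toNat, t, i, j, n])
      (fun n => (chainPlan.run s).1.real 28 [α.toNat, β.toNat, t, i, j, n]) c := by
  simp only [Vals, List.forall_mem_cons, List.not_mem_nil, false_imp_iff, implies_true,
    and_true] at hv
  obtain ⟨f102, f104, f105, f106, f107, f121, f122, f123⟩ := hv
  -- When `l = j` no later supplier order follows; `τ = j` then yields zeros after `t`.
  set τ := if l + 1 ≤ j then s.nat 18 [1, α.toNat, γ.toNat, t, i, l] else j with hτ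
  set s1 := ((((s.setNat 109 [] l).setNat 103 [] γ.toNat).setNat 112 [] (l + 1)).setNat 114 []
    (t + 1)).setNat 113 [] (τ + 1) with hs1
  have hs : (chainArgs.run s).1 = s1 := by
    simp only [chainArgs, run_seq]
    set s0 := (((s.setNat 109 [] l).setNat 103 [] γ.toNat).setNat 112 [] (l + 1)).setNat 114 []
      (t + 1) with hs0
    have e0 : ((setNat 114 [] (.succ (var 105))).run ((setNat 112 [] (.succ (var 109))).run
        ((setNat 103 [] (var 123)).run ((setNat 109 [] (var 122)).run s).1).1).1).1 = s0 := by
      simp [hs0, NExp.eval, f122, f123, f105]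
    rw [e0]
    by_cases hlj : l + 1 ≤ j
    · rw [run_ite_pos (by simpa [hs0, f107] using hlj), run_setNat, hs1, hτ, if_pos hlj]
      simp [hs0, NExp.eval, h.one, f102, f105, f106]
    · rw [run_ite_neg (by simpa [hs0, f107] using hlj), run_setNat, hs1, hτ, if_neg hlj]
      simp [hs0, NExp.eval, f107]
  rw [chainPlan, run_seq, hs]
  have r1 : Ready J s1 := ((((h.setNat (by decide)).setNat (by decide)).setNat (by decide)).setNat
    (by decide)).setNat (by decide)
  have v1 : Vals [(102, α.toNat), (104, β.toNat), (105, t), (106, i), (107, j), (109, l),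
      (103, γ.toNat), (112, l + 1), (114, t + 1), (113, τ + 1)] s1 := by
    simp [Vals, hs1, f102, f104, f105, f106, f107]
  have row : [102, 104, 105, 106, 107].map (fun v => s1.nat v []) =
      [α.toNat, β.toNat, t, i, j] := by
    simp [hs1, f102, f104, f105, f106, f107]
  have m1 : s1.nat 121 [] = m := by simp [hs1, f121]
  by_cases hm : m = 0
  · rw [run_ite_pos (by simp [m1, hm, NExp.eval]), run_seq]
    subst hm
    have htj' : t < j := by
      rw [CWit, if_pos rfl] at hw
      exact hw.1
    have fill1 : ∀ n ≤ J.T, (waitRetailer.run s1).1.real 27 [α.toNat, β.toNat, t, i, j, n] =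
        s.real 27 [α.toNat, β.toNat, t + 1, i, j, n] := by
      have := run_fillRow (s := s1) (x := 110) (a := 27) (vs := [102, 104, 105, 106, 107])
        (c := setReal 130 [] (.cell 27 [var 102, var 104, var 114, var 106, var 107, var 110]))
        (fun n => s.real 27 [α.toNat, β.toNat, t + 1, i, j, n])
        r1.T (by decide) (by decide) (by decide) ?_
      · rw [row] at this
        exact this
      · intro n hn s2 hag hold
        have v2 := v1.of_agree hag rfl
        simp only [Vals, List.forall_mem_cons, List.not_mem_nil, false_imp_iff, implies_true,
          and_true] at v2
        rw [row] at hold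
        have := hold [α.toNat, β.toNat, t + 1, i, j, n] (by simp)
        simp [RExp.eval, v2, this]
        rfl
    have hag2 := agree_run waitRetailer s1
    have v2 := v1.of_agree hag2 rfl
    have T2 : (waitRetailer.run s1).1.nat 0 [] = J.T := by rw [hag2.nat 0 (by decide), r1.T]
    have row2 : [102, 104, 105, 106, 107].map (fun v => (waitRetailer.run s1).1.nat v []) =
        [α.toNat, β.toNat, t, i, j] := by
      rw [← row]
      refine List.map_congr_left fun v hv => ?_
      rw [hag2.nat v (by revert v; decide)]
    have q28 := hag2.real 28 (by decide)
    have q27 := (agree_run waitSupplier (waitRetailer.run s1).1).real 27 (by decide)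
    rw [q27]
    generalize (waitRetailer.run s1).1 = s2 at *
    have fill2 : ∀ n ≤ J.T, (waitSupplier.run s2).1.real 28 [α.toNat, β.toNat, t, i, j, n] =
        if n = t then 0 else s.real 28 [α.toNat, β.toNat, t + 1, i, j, n] := by
      have := run_fillRow (s := s2) (x := 110) (a := 28) (vs := [102, 104, 105, 106, 107])
        (c := ite (.natEq (var 110) (var 105)) (setReal 130 [] .zero)
          (setReal 130 [] (.cell 28 [var 102, var 104, var 114, var 106, var 107, var 110])))
        (fun n => if n = t then 0 else s.real 28 [α.toNat, β.toNat, t + 1, i, j, n])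
        T2 (by decide) (by decide) (by decide) ?_
      · rw [row2] at this
        exact this
      · intro n hn s3 hag hold
        have v3 := v2.of_agree hag rfl
        simp only [Vals, List.forall_mem_cons, List.not_mem_nil, false_imp_iff, implies_true,
          and_true] at v3
        rw [row2] at hold
        have := hold [α.toNat, β.toNat, t + 1, i, j, n] (by simp)
        by_cases hnt : n = t
        · rw [run_ite_pos (by simpa [v3] using hnt), if_pos hnt]
          simp [RExp.eval]
        · rw [run_ite_neg (by simpa [v3] using hnt), if_neg hnt]
          simp [RExp.eval, v3, this, q28]
          rfl
    refine (realC_of_wait (x := fun n => s.real 27 [α.toNat, β.toNat, t + 1, i, j, n])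
      (y' := fun n => s.real 28 [α.toNat, β.toNat, t + 1, i, j, n]) hw
      ((hC α (t + 1) i (by omega) (by omega) le_rfl hij).2)
      (fun n hn1 hn2 => fill2 n (by omega))).congr (fun n hn1 hn2 => (fill1 n (by omega)).symm)
      fun n hn1 hn2 => rfl
  · rw [run_ite_neg (by simpa [m1, NExp.eval] using hm), run_seq]
    have hw' := hw
    rw [CWit, if_neg hm] at hw'
    obtain ⟨hil, hlj, q0, hq0, -⟩ := hw'
    have htl : t ≤ l := by
      by_contra hlt
      rw [G_eq_top (by omega)] at hq0
      exact WithTop.top_ne_coe hq0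
    obtain ⟨hG, hP⟩ := hR.2 α γ t l ht1 htl hil (by omega)
    have hτq : l < j → ∀ q : ℝ ×ₗ ℕ, J.G α γ t i l = q → τ = (ofLex q).2 := by
      intro hlj' q hq
      rw [hτ, if_pos (show l + 1 ≤ j from hlj')]
      rcases hG.2 with ⟨h', -⟩ | ⟨h', -⟩
      · rw [h'] at hq
        exact absurd hq WithTop.top_ne_coe
      · rw [h'] at hq
        exact (Stage.mk_eq_coe hq).2
    have hτt : t ≤ τ := by
      by_cases hlj' : l < j
      · rw [hτq hlj' q0 hq0]
        exact (hP q0 hq0).t_le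
      · rw [hτ, if_neg (show ¬ l + 1 ≤ j from hlj')]
        exact htj
    have hτj : l < j → τ < j := by
      intro hlj'
      rw [hτq hlj' q0 hq0]
      exact (hP q0 hq0).last_le.trans_lt hlj'
    have fill1 : ∀ n ≤ J.T, (orderRetailer.run s1).1.real 27 [α.toNat, β.toNat, t, i, j, n] =
        if n ≤ l then s.real 26 [α.toNat, γ.toNat, t, i, l, n] else
          s.real 27 [γ.toNat, β.toNat, τ + 1, l + 1, j, n] := by
      have := run_fillRow (s := s1) (x := 110) (a := 27) (vs := [102, 104, 105, 106, 107])
        (c := ite (.natLe (var 110) (var 109))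
          (setReal 130 [] (.cell 26 [var 102, var 103, var 105, var 106, var 109, var 110]))
          (setReal 130 [] (.cell 27 [var 103, var 104, var 113, var 112, var 107, var 110])))
        (fun n => if n ≤ l then s.real 26 [α.toNat, γ.toNat, t, i, l, n] else
          s.real 27 [γ.toNat, β.toNat, τ + 1, l + 1, j, n])
        r1.T (by decide) (by decide) (by decide) ?_
      · rw [row] at this
        exact this
      · intro n hn s2 hag hold
        have v2 := v1.of_agree hag rfl
        have q26 := hag.real 26 (by decide)
        simp only [Vals, List.forall_mem_cons, List.not_mem_nil, false_imp_iff, implies_true,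
          and_true] at v2
        rw [row] at hold
        -- Since `t ≤ τ`, the row at `τ + 1` is not the one being written.
        have := hold [γ.toNat, β.toNat, τ + 1, l + 1, j, n] (by simp; omega)
        by_cases hnl : n ≤ l
        · rw [run_ite_pos (by simpa [v2] using hnl), if_pos hnl]
          simp [RExp.eval, v2, q26]
          rfl
        · rw [run_ite_neg (by simpa [v2] using hnl), if_neg hnl]
          simp [RExp.eval, v2, this]
          rfl
    have hag2 := agree_run orderRetailer s1
    have v2 := v1.of_agree hag2 rfl
    have r2 := r1.of_agree hag2 (by decide)
    have row2 : [102, 104, 105, 106, 107].map (fun v => (orderRetailer.run s1).1.nat v []) =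
        [α.toNat, β.toNat, t, i, j] := by
      rw [← row]
      refine List.map_congr_left fun v hv => ?_
      rw [hag2.nat v (by revert v; decide)]
    have q28 := hag2.real 28 (by decide)
    have q27 := (agree_run orderSupplier (orderRetailer.run s1).1).real 27 (by decide)
    rw [q27]
    generalize (orderRetailer.run s1).1 = s2 at *
    have fill2 : ∀ n ≤ J.T, (orderSupplier.run s2).1.real 28 [α.toNat, β.toNat, t, i, j, n] =
        if n = t then J.X α γ i l else if n ≤ τ then 0 else
          s.real 28 [γ.toNat, β.toNat, τ + 1, l + 1, j, n] := by
      have := run_fillRow (s := s2) (x := 110) (a := 28) (vs := [102, 104, 105, 106, 107])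
        (c := ite (.natEq (var 110) (var 105)) (setReal 130 [] (qty 102 103 106 109))
          (ite (.natLe (.succ (var 110)) (var 113)) (setReal 130 [] .zero)
            (setReal 130 [] (.cell 28 [var 103, var 104, var 113, var 112, var 107, var 110]))))
        (fun n => if n = t then J.X α γ i l else if n ≤ τ then 0 else
          s.real 28 [γ.toNat, β.toNat, τ + 1, l + 1, j, n])
        r2.T (by decide) (by decide) (by decide) ?_
      · rw [row2] at this
        exact this
      · intro n hn s3 hag hold
        have v3 := v2.of_agree hag rfl
        have r3 : Ready J (s3.setNat 110 [] n) := (r2.of_agree hag (by decide)).setNat (by decide)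
        simp only [Vals, List.forall_mem_cons, List.not_mem_nil, false_imp_iff, implies_true,
          and_true] at v3
        rw [row2] at hold
        have := hold [γ.toNat, β.toNat, τ + 1, l + 1, j, n] (by simp; omega)
        by_cases hnt : n = t
        · rw [run_ite_pos (by simpa [v3] using hnt), if_pos hnt, run_setReal,
            r3.eval_qty (α := α) (β := γ) (by simp [v3]) (by simp [v3]) (by simp [v3, h1])
              (by simp [v3]; omega) (by simp [v3]; omega)]
          simp [v3]
        · rw [run_ite_neg (by simpa [v3] using hnt), if_neg hnt]
          by_cases hnτ : n ≤ τ
          · rw [run_ite_pos (by simpa [v3, NExp.eval] using hnτ), if_pos hnτ]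
            simp [RExp.eval]
          · rw [run_ite_neg (by simpa [v3, NExp.eval] using hnτ), if_neg hnτ]
            simp [RExp.eval, v3, this, q28]
            rfl
    refine realC_of_order hm hw hP hτq (fun hlj' => by rw [hτ, if_neg (show ¬ l + 1 ≤ j from hlj')])
      (fun hlj' => (hC γ (τ + 1) (l + 1) (by omega) (hτj hlj') (by omega) hlj').2)
      (fun n hn1 hn2 => fill1 n (by omega)) fun n hn1 hn2 => fill2 n (by omega)

/-- The tables of supply chain costs and plans from period `t` are filled. -/
def ChainFilled (J : Data) (t : ℕ) (s : State) : Prop :=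
  ∀ (α β : Bool) i j, t ≤ j → 1 ≤ i → i ≤ j → j ≤ J.T → J.HoldsC s α β t i j

/-- `C` at `t` refers only to later supplier periods, so `t` runs downwards. Inside, two loops over
`i, j` and one over `l`, or one along a row, give fourth order again. -/
theorem run_chain (hV : J.Valid) (h : Ready J s)
    (hR : ∀ i, 1 ≤ i → i ≤ J.T → RegularFilled J i s) :
    ∀ t, 1 ≤ t → t ≤ J.T → ChainFilled J t (chain.run s).1 := by
  refine desc_fill (A := [19]) (B := [19, 27, 28]) (p := 2) h.T (by decide) (by decide)
    (by decide) (ChainFilled J) ?_ ?_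
  · intro t s s' hA hB hQ α β i j h1 h2 h3 h4
    exact (hQ α β i j h1 h2 h3 h4).congr (fun n => hA 19 (by simp) n _ rfl)
      fun b hb jx => hB b hb _ rfl
  intro t s1 ht1 htT hag hreg ih α β i j htj h1 hij hjT
  have r1 := h.of_agree hag (by decide)
  have R1 := fun i a b => (hR i a b).of_agree hag (by decide)
  have := nest_table_keep (s := s1) (T := J.T) (p := 2) (r := 105)
    (vars := [(106, false), (107, false), (102, true), (104, true)])
    (vs := [102, 104, 105, 106, 107]) (A := [19]) (B := [19, 27, 28]) (c := chainBody)
    (P := fun ix s => ∀ (α β : Bool) i j, ix = [α.toNat, β.toNat, t, i, j] →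
      t ≤ j → 1 ≤ i → i ≤ j → j ≤ J.T → J.HoldsC s α β t i j)
    r1.T (by decide) (by decide) (by decide) ?_ ?_
    (fun v => if v = 102 then α.toNat else if v = 104 then β.toNat else if v = 105 then t
      else if v = 106 then i else j) ?_ (by simp [hreg])
  · exact this α β i j (by simp) htj h1 hij hjT
  · rintro ix s s' - hA hB hP α β i j rfl h1 h2 h3 h4
    exact (hP α β i j rfl h1 h2 h3 h4).congr (hA 19 (by simp)) hB
  · rintro s2 hag2 hkeep - α β i j hix h1 h2 h3 h4
    simp only [List.map_cons, List.map_nil, List.cons.injEq, and_true] at hix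
    obtain ⟨e1, e2, e3, e4, e5⟩ := hix
    have r2 := r1.of_agree hag2 (by decide)
    have R2 := (R1 i h2 (by omega)).of_agree hag2 (by decide)
    have C2 : ∀ α t' i', t < t' → t' ≤ j → i ≤ i' → i' ≤ j → J.HoldsC s2 α β t' i' j := by
      intro α t' i' k1 k2 k3 k4
      refine (ih t' k1 (by omega) α β i' j k2 (by omega) k4 h4).congr (fun n => ?_)
        fun b hb jx => ?_
      · exact hkeep.nat 19 (by simp) _ _ (by simp [hreg]; omega)
      · exact hkeep.real b hb _ (by simp [hreg]; omega)
    have v2 : Vals [(102, α.toNat), (104, β.toNat), (105, t), (106, i), (107, j)] s2 := by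
      simp [Vals, e1, e2, e3, e4, e5]
    rw [chainBody, run_seq]
    obtain ⟨hval, hwit⟩ := run_chainValue hV r2 v2 h2 h3 h4 ht1 h1 R2 C2
    have hag3 := agree_run chainValue s2
    have hk3 : Keep [19] [19, 27, 28] 2 105 s2 (chainValue.run s2).1 := Keep.run (by decide) s2
    have r3 := r2.of_agree hag3 (by decide)
    have v3 := v2.of_agree hag3 rfl
    have R3 := R2.of_agree hag3 (by decide)
    have C3 : ∀ α t' i', t < t' → t' ≤ j → i ≤ i' → i' ≤ j →
        J.HoldsC (chainValue.run s2).1 α β t' i' j := by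
      intro α t' i' k1 k2 k3 k4
      refine (C2 α t' i' k1 k2 k3 k4).congr (fun n => ?_) fun b hb jx => ?_
      · exact hk3.nat 19 (by simp) _ _ (by simp [e3]; omega)
      · exact hk3.real b hb _ (by simp [e3]; omega)
    generalize (chainValue.run s2).1 = s3 at *
    have hag4 := agree_run chainPlan s3
    refine ⟨hval.congr (fun n => by rw [hag4.nat 19 (by decide)])
      (by rw [hag4.real 19 (by decide)]), fun c hc => ?_⟩
    obtain ⟨γ, hγ, hw⟩ := hwit c hc
    exact run_chainPlan r3 (by simpa [Vals, hγ] using v3) h2 h3 h4 ht1 h1 R3 C3 hw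
  · have hα := Bool.toNat_le α
    have hβ := Bool.toNat_le β
    simp [InRange, hα, hβ]
    omega

end Program

/-! ### The program: output -/

namespace Program

open Cmd Data

/-- The index of an entry of the table of subplans with a given first ordering period. -/
def wIx : List NExp := [var 102, var 103, var 104, var 105, var 106, var 107, var 108]

/-- Compute the cost of a subplan with a given first ordering period. -/
def wBody : Cmd :=
  setReal 16 wIx
    (.add carryE (.cell 24 [var 102, var 103, var 104, var 106, var 107, var 108])) ⨾
  setNat 16 (.const 0 :: wIx) (.cell 24 [100, 102, 103, 104, 106, 107, 108]) ⨾
  setNat 16 (.const 1 :: wIx) (.cell 24 [101, 102, 103, 104, 106, 107, 108])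

/-- Tabulate the costs of the subplans with a given first ordering period. -/
def subplans : Cmd :=
  nest [(102, true), (103, true), (104, true), (105, false), (106, false), (107, false),
    (108, false)] wBody

variable {J : Data} {s s' : State}

theorem run_wBody (h : Ready J s) {α γ β : Bool} {t i j k : ℕ}
    (hv : Vals [(102, α.toNat), (103, γ.toNat), (104, β.toNat), (105, t), (106, i), (107, j),
      (108, k)] s) (ht : 1 ≤ t) (htk : t ≤ k) (hi : 1 ≤ i) (hik : i ≤ k) (hkj : k < j)
    (hjT : j ≤ J.T) (htail : J.HoldsTail s α γ β i j k) :
    (wBody.run s).1.HoldsStage 16 [α.toNat, γ.toNat, β.toNat, t, i, j, k]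
      (J.w α γ β t i j k) := by
  simp only [Vals, List.forall_mem_cons, List.not_mem_nil, false_imp_iff, implies_true,
    and_true] at hv
  obtain ⟨e102, e103, e104, e105, e106, e107, e108⟩ := hv
  have hc := eval_carryE h e102 e104 e105 e106 e107 e108 hi (by omega) hjT ht (by omega) hkj.le
  have e100 := h.zero
  have e101 := h.one
  rw [w_eq_tail htk hik]
  rcases htail.1 with ⟨h1, h2⟩ | ⟨h1, h2⟩
  · left
    rw [h1]
    exact ⟨Stage.addCost_top _, by
      simp [wBody, wIx, NExp.eval, e100, e102, e103, e104, e105, e106, e107, e108, h2]⟩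
  · right
    rw [h1, Stage.addCost_coe_mk]
    constructor
    · simp [wBody, wIx, NExp.eval, RExp.eval, e101, e102, e103, e104, e105, e106, e107, e108, hc]
    · simp [wBody, wIx, NExp.eval, e100, e102, e103, e104, e105, e106, e107, e108, h2]

/-- The table of `w` has four period indices, and each entry takes constant time from the
continuations. No later part of the program reads it. -/
theorem run_subplans (h : Ready J s) (hR : ∀ i, 1 ≤ i → i ≤ J.T → RegularFilled J i s)
    (α γ β : Bool) (t i j k : ℕ) (ht : 1 ≤ t) (htk : t ≤ k) (hi : 1 ≤ i) (hik : i ≤ k)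
    (hkj : k < j) (hjT : j ≤ J.T) :
    (subplans.run s).1.HoldsStage 16 [α.toNat, γ.toNat, β.toNat, t, i, j, k]
      (J.w α γ β t i j k) := by
  have := nest_table
    (vars := [(102, true), (103, true), (104, true), (105, false), (106, false), (107, false),
      (108, false)])
    (vs := [102, 103, 104, 105, 106, 107, 108]) (A := [16]) (B := [16]) (s := s) (c := wBody)
    (P := fun ix s => ∀ (α γ β : Bool) t i j k,
      ix = [α.toNat, γ.toNat, β.toNat, t, i, j, k] → 1 ≤ t → t ≤ k → 1 ≤ i → i ≤ k →
      k < j → j ≤ J.T → s.HoldsStage 16 [α.toNat, γ.toNat, β.toNat, t, i, j, k]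
        (J.w α γ β t i j k))
    h.T (by decide) ?_ (fun _ => True) trivial (by simp) (by simp) ?_
    (fun v => if v = 102 then α.toNat else if v = 103 then γ.toNat else if v = 104 then β.toNat
      else if v = 105 then t else if v = 106 then i else if v = 107 then j else k) ?_ (by simp)
  · exact this α γ β t i j k (by simp) ht htk hi hik hkj hjT
  · rintro ix s s' - hA hB hP α γ β t i j k rfl h1 h2 h3 h4 h5 h6
    exact (hP α γ β t i j k rfl h1 h2 h3 h4 h5 h6).congr (fun n _ => hA 16 (by simp) n)
      (hB 16 (by simp) [])
  · rintro s' hag - - α γ β t i j k hix h1 h2 h3 h4 h5 h6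
    simp only [List.map_cons, List.map_nil, List.cons.injEq, and_true] at hix
    obtain ⟨e1, e2, e3, e4, e5, e6, e7⟩ := hix
    refine run_wBody (h.of_agree hag (by decide)) (by simp [Vals, *]) h1 h2 h3 h4 h5 h6 ?_
    exact ((hR i h3 (by omega)).of_agree hag (by decide)).1 α γ β j k h4 h5 h6
  · have hα := Bool.toNat_le α
    have hβ := Bool.toNat_le β
    have hγ := Bool.toNat_le γ
    simp [InRange, hα, hβ, hγ]
    omega

/-- Set the setup indicator `a` at the period `110` for the order quantity `b`. -/
def setup (a b : ℕ) : Cmd :=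
  ite (.lt .zero (.cell b [var 110])) (setReal a [var 110] .one) (setReal a [var 110] .zero)

theorem run_setup {a b : ℕ} : ((setup a b).run s).1 =
    s.setReal a [s.nat 110 []] (if 0 < s.real b [s.nat 110 []] then 1 else 0) := by
  unfold setup
  split_ifs with h
  · rw [run_ite_pos (by simpa [RExp.eval] using h)]
    simp [RExp.eval]
  · rw [run_ite_neg (by simpa [RExp.eval] using h)]
    simp [RExp.eval]

/-- Write the period `110` of the optimal solution. -/
def solutionBody : Cmd :=
  setReal 9 [var 110] (.cell 27 [var 100, var 100, var 101, var 101, var 0, var 110]) ⨾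
  setReal 10 [var 110]
    (.sub (.add (.cell 10 [prev 110]) (.cell 9 [var 110])) (.cell 0 [var 110])) ⨾
  setup 11 9 ⨾
  setReal 12 [var 110] (.cell 28 [var 100, var 100, var 101, var 101, var 0, var 110]) ⨾
  setReal 13 [var 110]
    (.sub (.add (.cell 13 [prev 110]) (.cell 12 [var 110])) (.cell 9 [var 110])) ⨾
  setup 14 12

/-- Write the optimal cost and an optimal solution. -/
def solution : Cmd :=
  upto 110 (var 101) (.succ (var 0)) solutionBody ⨾
  setReal 8 [] (.cell 19 [var 100, var 100, var 101, var 101, var 0])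

theorem run_solution (h : Ready J s) (h0 : ∀ a ∈ [10, 13], s.real a [0] = 0) :
    J.IsPlanOf (fun n => s.real 27 [0, 0, 1, 1, J.T, n]) (fun n => s.real 28 [0, 0, 1, 1, J.T, n])
      (solution.run s).1.outPlan ∧
    (solution.run s).1.outCost = s.real 19 [0, 0, 1, 1, J.T] := by
  have h100 := h.zero
  have h101 := h.one
  have hT := h.T
  -- Invariant: before period `m` the output is the prescribed plan for the horizon `m - 1`.
  have key := run_upto_agree (x := 110) (lo := var 101) (hi := .succ (var 0)) (c := solutionBody)
    (s := s) (by simp [NExp.eval])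
    (fun m s' => 1 ≤ m ∧ IsPlanOf { J with T := m - 1 } (fun n => s.real 27 [0, 0, 1, 1, J.T, n])
      (fun n => s.real 28 [0, 0, 1, 1, J.T, n]) s'.outPlan) ?_ ?_
  · have hag := agree_run (upto 110 (var 101) (.succ (var 0)) solutionBody) s
    rw [solution, run_seq]
    generalize ((upto 110 (var 101) (.succ (var 0)) solutionBody).run s).1 = s1 at *
    simp only [eval_var, NExp.eval, h101, hT, Nat.add_sub_cancel, Nat.add_comm 1 J.T] at key
    refine ⟨?_, ?_⟩
    · have hk := key.2
      exact ⟨hk.sR_zero, hk.sS_zero, hk.xR, hk.xS, hk.sR, hk.sS, hk.yR, hk.yS⟩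
    · have e0 := congrFun (hag.nat 0 (by decide)) []
      have e100 := congrFun (hag.nat 100 (by decide)) []
      have e101 := congrFun (hag.nat 101 (by decide)) []
      have e19 := hag.real 19 (by decide)
      simp [State.outCost, RExp.eval, e0, e100, e101, e19, hT, h100, h101]
  · simp only [eval_var, h101, le_refl, true_and]
    refine ⟨h0 10 (by simp), h0 13 (by simp), ?_, ?_, ?_, ?_, ?_, ?_⟩ <;>
    · intro t h1 h2
      exact absurd (h1.trans h2) (by simp)
  · rintro n s' hn1 hn2 hag ⟨hn, hP⟩
    simp only [eval_var, NExp.eval, h101, hT] at hn1 hn2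
    have r1 := h.of_agree hag (by decide)
    have e0 := r1.T
    have e100 := r1.zero
    have e101 := r1.one
    have e27 := hag.real 27 (by decide)
    have e28 := hag.real 28 (by decide)
    have ed := r1.d n hn (by omega)
    refine ⟨by omega, ?_⟩
    have step : (solutionBody.run (s'.setNat 110 [] n)).1.outPlan =
        { xR := fun t => if t = n then s.real 27 [0, 0, 1, 1, J.T, n] else s'.outPlan.xR t
          sR := fun t => if t = n then s'.outPlan.sR (n - 1) + s.real 27 [0, 0, 1, 1, J.T, n] -
            J.d n else s'.outPlan.sR t
          yR := fun t => if t = n then if 0 < s.real 27 [0, 0, 1, 1, J.T, n] then 1 else 0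
            else s'.outPlan.yR t
          xS := fun t => if t = n then s.real 28 [0, 0, 1, 1, J.T, n] else s'.outPlan.xS t
          sS := fun t => if t = n then s'.outPlan.sS (n - 1) + s.real 28 [0, 0, 1, 1, J.T, n] -
            s.real 27 [0, 0, 1, 1, J.T, n] else s'.outPlan.sS t
          yS := fun t => if t = n then if 0 < s.real 28 [0, 0, 1, 1, J.T, n] then 1 else 0
            else s'.outPlan.yS t } := by
      simp [solutionBody, run_setup, State.outPlan, RExp.eval, e0, e100, e101, e27, e28, ed]
    have ht : ∀ t, 1 ≤ t → t ≤ n + 1 - 1 → t ≠ n → t ≤ n - 1 ∧ t - 1 ≠ n := fun t _ _ _ => by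
      omega
    rw [step]
    have hn0 : ¬ 0 = n := by omega
    have hnn : ¬ n - 1 = n := by omega
    refine ⟨by simpa [hn0] using hP.sR_zero, by simpa [hn0] using hP.sS_zero, ?_, ?_, ?_, ?_, ?_,
      ?_⟩ <;> intro t h1 h2 <;> dsimp only at h2 ⊢ <;> by_cases htn : t = n
    · simp [htn]
    · simpa [htn] using hP.xR t h1 (ht t h1 h2 htn).1
    · simp [htn]
    · simpa [htn] using hP.xS t h1 (ht t h1 h2 htn).1
    · simp [htn, hnn]
    · simpa [htn, (ht t h1 h2 htn).2] using hP.sR t h1 (ht t h1 h2 htn).1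
    · simp [htn, hnn]
    · simpa [htn, (ht t h1 h2 htn).2] using hP.sS t h1 (ht t h1 h2 htn).1
    · simp [htn]
    · simpa [htn] using hP.yR t h1 (ht t h1 h2 htn).1
    · simp [htn]
    · simpa [htn] using hP.yS t h1 (ht t h1 h2 htn).1

/-- Tabulate everything, then write an optimal solution. -/
def full : Cmd := prepare ⨾ blocks ⨾ regular ⨾ subplans ⨾ chain ⨾ solution

/-- The nesting depth is four, and `(T + 1) ^ 4 ≤ (2 * T) ^ 4 = 16 * T ^ 4` because `T ≥ 1`. -/
theorem steps_full (I : Data) (hT : 1 ≤ I.T) :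
    (full.run I.initial).2 ≤ full.coef * 16 * I.T ^ 4 := by
  refine (steps_le full (by decide) (by decide) _).trans ?_
  have e : I.initial.nat 0 [] = I.T := by simp [Data.initial]
  have hd : full.depth = 4 := by decide
  rw [e, hd, mul_assoc, show (16 : ℕ) = 2 ^ 4 by norm_num, ← mul_pow]
  gcongr
  omega

/-- The bounds are tightened in every run, so all tables and plans belong to the tightened instance.
-/
theorem run_full (I : Data) (hV : I.Valid) :
    ∃ c : ℝ, I.tighten.C false false 1 1 I.tighten.T = (c : WithTop ℝ) ∧
      (full.run I.initial).1.outCost = c ∧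
      I.tighten.Feasible (full.run I.initial).1.outPlan ∧
      I.tighten.cost (full.run I.initial).1.outPlan = c ∧
      I.tighten.ZeroInvOrdering (full.run I.initial).1.outPlan ∧
      I.tighten.OneOrderPerBlock (full.run I.initial).1.outPlan ∧
      (full.run I.initial).1.Tabulates I.tighten := by
  have hVJ := hV.tighten
  have hJ := tight_tighten I
  obtain ⟨c, hc, -⟩ := isLeast_costs_of_tight hVJ hJ
  refine ⟨c, hc, ?_⟩
  rw [full, run_seq, run_seq, run_seq, run_seq, run_seq]
  have a1 := agree_run prepare I.initial
  have r1 := ready_prepare I hV.1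
  have z1 : ∀ a ∈ [10, 13], (prepare.run I.initial).1.real a [0] = 0 := fun a ha => by
    rw [a1.real_leaves (A := []) (B := [10, 13]) (by decide) ha]
    simp [Data.initial]
  generalize (prepare.run I.initial).1 = s1 at *
  generalize I.tighten = J at *
  have hT := hVJ.1
  have a2 := agree_run blocks s1
  have r2 := r1.of_agree a2 (by decide)
  have p2 := run_blocks r1
  have z2 : ∀ a ∈ [10, 13], (blocks.run s1).1.real a [0] = 0 := fun a ha => by
    rw [a2.real_leaves (A := []) (B := [10, 13]) (by decide) ha, z1 a ha]
  generalize (blocks.run s1).1 = s2 at *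
  have a3 := agree_run regular s2
  have r3 := r2.of_agree a3 (by decide)
  have p3 := p2.of_agree a3 (by decide)
  have R3 := run_regular hVJ hJ r2 p2
  have z3 : ∀ a ∈ [10, 13], (regular.run s2).1.real a [0] = 0 := fun a ha => by
    rw [a3.real_leaves (A := []) (B := [10, 13]) (by decide) ha, z2 a ha]
  generalize (regular.run s2).1 = s3 at *
  have a4 := agree_run subplans s3
  have r4 := r3.of_agree a4 (by decide)
  have p4 := p3.of_agree a4 (by decide)
  have R4 := fun i h1 h2 => (R3 i h1 h2).of_agree a4 (by decide)
  have w4 := run_subplans r3 R3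
  have z4 : ∀ a ∈ [10, 13], (subplans.run s3).1.real a [0] = 0 := fun a ha => by
    rw [a4.real_leaves (A := []) (B := [10, 13]) (by decide) ha, z3 a ha]
  generalize (subplans.run s3).1 = s4 at *
  have a5 := agree_run chain s4
  have r5 := r4.of_agree a5 (by decide)
  have p5 := p4.of_agree a5 (by decide)
  have R5 := fun i h1 h2 => (R4 i h1 h2).of_agree a5 (by decide)
  have C5 := run_chain hVJ r4 R4
  have n5 := a5.nat 16 (by decide)
  have q5 := a5.real 16 (by decide)
  have z5 : ∀ a ∈ [10, 13], (chain.run s4).1.real a [0] = 0 := fun a ha => by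
    rw [a5.real_leaves (A := []) (B := [10, 13]) (by decide) ha, z4 a ha]
  generalize (chain.run s4).1 = s5 at *
  have a6 := agree_run solution s5
  have p6 := p5.of_agree a6 (by decide)
  have R6 := fun i h1 h2 => (R5 i h1 h2).of_agree a6 (by decide)
  have n6 := a6.nat 16 (by decide)
  have q6 := a6.real 16 (by decide)
  obtain ⟨hplan, hcost⟩ := run_solution r5 z5
  obtain ⟨hC, hreal⟩ := C5 1 le_rfl hT false false 1 J.T hT le_rfl hT le_rfl
  obtain ⟨hf, hco, hz, ho⟩ := (hreal c hc).plan hVJ hplan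
  refine ⟨?_, hf, hco, hz, ho, p6, ?_, ?_⟩
  · rw [hcost]
    rcases hC with ⟨h, -⟩ | ⟨h, -⟩
    · rw [hc] at h
      exact absurd h WithTop.coe_ne_top
    · rw [hc] at h
      exact (WithTop.coe_injective h).symm
  · intro α γ β t i j k h1 h2 h3 h4 h5 h6
    exact (w4 α γ β t i j k h1 h2 h3 h4 h5 h6).congr (fun n _ => by rw [n6, n5]) (by rw [q6, q5])
  · intro α β t i j h1 h2 h3 h4 h5
    have hG := ((R6 i h3 (by omega)).2 α β t j h1 h2 h4 h5).1
    exact ⟨hG.1, hG.2,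
      ((C5 t h1 (by omega) α β i j h2 h3 h4 h5).of_agree a6 (by decide)).1⟩

end Program

end LotSizing

end

-- The main theorem

theorem mainTheorem1 :
    (∀ I : LotSizing.Data, I.Valid → I.Tight →
      ∃ c : ℝ, I.C false false 1 1 I.T = (c : WithTop ℝ) ∧ IsLeast I.costs c) ∧
    ∃ (P : LotSizing.Cmd) (K : ℕ), ∀ I : LotSizing.Data, I.Valid →
      (P.run I.initial).2 ≤ K * I.T ^ 4 ∧
      IsLeast I.costs (P.run I.initial).1.outCost ∧
      I.Feasible (P.run I.initial).1.outPlan ∧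
      I.cost (P.run I.initial).1.outPlan = (P.run I.initial).1.outCost ∧
      I.ZeroInvOrdering (P.run I.initial).1.outPlan ∧
      (I.Tight →
        I.OneOrderPerBlock (P.run I.initial).1.outPlan ∧
        (P.run I.initial).1.Tabulates I) := by
  refine ⟨fun I hV hT => LotSizing.Data.isLeast_costs_of_tight hV hT, LotSizing.Program.full,
    LotSizing.Program.full.coef * 16, fun I hV => ?_⟩
  -- Tightening keeps feasible plans and their costs, so the output is optimal for the given
  -- instance too. Blocks and tables refer to the bounds; they are transferred only when the bounds
  -- are already tight, for then the tightened instance is the given one.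
  obtain ⟨c, hc, hout, hf, hco, hz, ho, htab⟩ := LotSizing.Program.run_full I hV
  obtain ⟨c', hc', hleast⟩ := LotSizing.Data.isLeast_costs_of_tight hV.tighten
    (LotSizing.Data.tight_tighten I)
  rw [hc, WithTop.coe_inj] at hc'
  refine ⟨LotSizing.Program.steps_full I hV.1, ?_, (LotSizing.Data.feasible_tighten hV).mp hf,
    hco.trans hout.symm, hz, fun hI => ?_⟩
  · rwa [hout, hc', ← LotSizing.Data.costs_tighten hV]
  · rw [hI.tighten_eq hV.1] at ho htab
    exact ⟨ho, htab⟩
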